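/- Let $G$ be a group, $\{H_\lambda\}_{\lambda\in\Lambda}$ a family of subgroups and $N_\lambda\lhd H_\lambda$ normal subgroups. Let $\langle\!\langle\mathcal N\rangle\!\rangle$ be the normal closure of $\bigcup_\lambda N_\lambda$ in $G$, and put $\overline G=G/\langle\!\langle\mathcal N\rangle\!\rangle$, $\overline H_\lambda=H_\lambda/N_\lambda$. Suppose that $(G,\{H_\lambda\},\{N_\lambda\})$ is a Cohen–Lyndon triple: there are left transversals $T_\lambda$ of $H_\lambda\langle\!\langle\mathcal N\rangle\!\rangle$ in $G$ such that $\langle\!\langle\mathcal N\rangle\!\rangle$ is the free product of its subgroups $tN_\lambda t^{-1}$, $\lambda\in\Lambda$, $t\in T_\lambda$. Let $k$ be a commutative ring (for instance $\mathbb Z$) and $A$ a $kG$-module. The groups $\overline G$ and $\overline H_\lambda$ act on the (co)homology of $\langle\!\langle\mathcal N\rangle\!\rangle$ and of $N_\lambda$ with coefficients in $A$ by conjugation; $\mathrm{Ind}$ and $\mathrm{CoInd}$ are taken along the natural homomorphisms $\overline H_\lambda\to\overline G$. (1) For every $q>1$, and also for $q=1$ if $\langle\!\langle\mathcal N\rangle\!\rangle$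 acts trivially on $A$, the inclusions $N_\lambda\hookrightarrow\langle\!\langle\mathcal N\rangle\!\rangle$ induce isomorphisms of $k\overline G$-modules $$\bigoplus_{\lambda}\mathrm{Ind}_{\overline H_\lambda}^{\overline G}H_q(N_\lambda;A)\xrightarrow{\ \cong\ }H_q(\langle\!\langle\mathcal N\rangle\!\rangle;A),\qquad H^q(\langle\!\langle\mathcal N\rangle\!\rangle;A)\xrightarrow{\ \cong\ }\prod_{\lambda}\mathrm{CoInd}_{\overline H_\lambda}^{\overline G}H^q(N_\lambda;A).$$ (2) Let $E$ be the direct sum over $\lambda$ of the homological Lyndon–Hochschild–Serre spectral sequences of $(H_\lambda,N_\lambda,A)$ and $F$ that of $(G,\langle\!\langle\mathcal N\rangle\!\rangle,A)$. Then $$E^2_{p,q}\cong\bigoplus_\lambda H_p(\overline H_\lambda;H_q(N_\lambda;A))\Rightarrow\bigoplus_\lambda H_{p+q}(H_\lambda;A),\qquad F^2_{p,q}\cong H_p(\overline G;H_q(\langle\!\langle\mathcal N\rangle\!\rangle;A))\Rightarrow H_{p+q}(G;A),$$ and the inclusions $H_\lambda\hookrightarrow G$ induce a morphism of spectral sequences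 $\phi:E\to F$, natural in $A$. On the second pages $\phi$ is the map induced by the homomorphisms $\overline H_\lambda\to\overline G$ and the inclusions $N_\lambda\hookrightarrow\langle\!\langle\mathcal N\rangle\!\rangle$, and $\phi$ is compatible with the map $\bigoplus_\lambda H_n(H_\lambda;A)\to H_n(G;A)$ induced by the inclusions on the limits. The map $\phi:E^2_{p,q}\to F^2_{p,q}$ is an isomorphism for all $p$ and all $q>1$, and also for $q=1$ if $\langle\!\langle\mathcal N\rangle\!\rangle$ acts trivially on $A$. (3) The analogous statement holds in cohomology. Let $F$ be the cohomological Lyndon–Hochschild–Serre spectral sequence of $(G,\langle\!\langle\mathcal N\rangle\!\rangle,A)$ and $E$ the product over $\lambda$ of those of $(H_\lambda,N_\lambda,A)$. Then $$F_2^{p,q}\cong H^p(\overline G;H^q(\langle\!\langle\mathcal N\rangle\!\rangle;A))\Rightarrow H^{p+q}(G;A),\qquad E_2^{p,q}\cong\prod_\lambda H^p(\overline H_\lambda;H^q(N_\lambda;A))\Rightarrow\prod_\lambda H^{p+q}(H_\lambda;A),$$ and there is a morphism $\phi:F\to E$, natural in $A$, induced by the inclusions on the second pages and compatible with the restriction maps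 $H^n(G;A)\to\prod_\lambda H^n(H_\lambda;A)$ on the limits. The map $\phi:F_2^{p,q}\to E_2^{p,q}$ is an isomorphism for all $p$ and all $q>1$, and also for $q=1$ if $\langle\!\langle\mathcal N\rangle\!\rangle$ acts trivially on $A$. -/

import Mathlib

open CategoryTheory Limits
open scoped DirectSum

universe u

noncomputable section

section
variable {k : Type u} [CommRing k] {ι : Type*} {c : ComplexShape ι}
  (K : HomologicalComplex (ModuleCat.{u} k) c)

lemma exists_cycles_of_d_eq_zero (i : ι) (x : K.X i) (hx : ∀ j, (K.d i j).hom x = 0) :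
    ∃ y : K.cycles i, (K.iCycles i).hom y = x := by
  refine ⟨((K.sc i).moduleCatCyclesIso.inv).hom ⟨x, hx _⟩, ?_⟩
  exact congr($((K.sc i).moduleCatCyclesIso_inv_iCycles).hom ⟨x, hx _⟩)

lemma homologyπ_eq_zero_iff (i : ι) (y : K.cycles i) :
    (K.homologyπ i).hom y = 0 ↔ ∃ j z, (K.d j i).hom z = (K.iCycles i).hom y := by
  constructor
  · intro hy
    have h := ShortComplex.exact_of_g_is_cokernel
      (ShortComplex.mk (K.toCycles (c.prev i) i) (K.homologyπ i) (by simp))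
      (K.homologyIsCokernel _ i rfl)
    rw [ShortComplex.moduleCat_exact_iff] at h
    obtain ⟨z, hz⟩ := h y hy
    refine ⟨_, z, ?_⟩
    have := congr($(K.toCycles_i (c.prev i) i).hom z)
    rw [← this]
    exact congr((K.iCycles i).hom $hz)
  · rintro ⟨j, z, hz⟩
    have : (K.toCycles j i).hom z = y := by
      apply (ModuleCat.mono_iff_injective (K.iCycles i)).1 inferInstance
      rw [← hz]
      exact congr($(K.toCycles_i j i).hom z)
    rw [← this]
    exact congr($(K.toCycles_comp_homologyπ j i).hom z)

lemma liftCycles_congr {i : ι} {X : ModuleCat.{u} k} {f g : X ⟶ K.X i} (h : f = g) (j : ι)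
    (hj : c.next i = j) (hj' : c.next i = j) (hf : f ≫ K.d i j = 0) (hg : g ≫ K.d i j = 0) :
    K.liftCycles f j hj hf = K.liftCycles g j hj' hg := by
  subst h
  rfl

end

/-- A filtered complex of `k`-modules. The differential has degree `σ` and the filtration satisfies
`F (p + σ) ≤ F p`: for `σ = -1` this is an increasing filtration of a chain complex, for `σ = 1` a
decreasing filtration of a cochain complex. -/
structure FilteredComplex (k : Type u) [CommRing k] (σ : ℤ) where
  K : HomologicalComplex (ModuleCat.{u} k) (ComplexShape.up' σ)
  F : ℤ → (n : ℤ) → Submodule k (K.X n)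
  F_le (p n : ℤ) : F (p + σ) n ≤ F p n
  d_mem (p i j : ℤ) (x : K.X i) (hx : x ∈ F p i) : (K.d i j).hom x ∈ F p j

namespace FilteredComplex

variable {k : Type u} [CommRing k] {σ : ℤ}

/-- Morphisms of filtered complexes: chain maps that respect the filtrations. -/
@[ext]
structure Hom (C D : FilteredComplex k σ) where
  f : C.K ⟶ D.K
  mem (p n : ℤ) (x : C.K.X n) (hx : x ∈ C.F p n) : (f.f n).hom x ∈ D.F p n

variable (C D : FilteredComplex k σ)

lemma d_d (i j l : ℤ) (x : C.K.X i) : (C.K.d j l).hom ((C.K.d i j).hom x) = 0 := by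
  exact congr($(C.K.d_comp_d i j l).hom x)

/-- `Z^r_p = {x ∈ F_p | d x ∈ F_{p + σ r}}` in degree `n`. -/
def Z (r p n : ℤ) : Submodule k (C.K.X n) :=
  C.F p n ⊓ ⨅ j, (C.F (p + σ * r) j).comap (C.K.d n j).hom

/-- `B^r_p = Z^{r-1}_{p + σ} + d Z^{r-1}_{p - σ (r-1)}` in degree `n`. -/
def B (r p n : ℤ) : Submodule k (C.K.X n) :=
  C.Z (r - 1) (p + σ) n ⊔ ⨆ i, (C.Z (r - 1) (p - σ * (r - 1)) i).map (C.K.d i n).hom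

variable {C D}

lemma mem_Z {r p n : ℤ} {x : C.K.X n} :
    x ∈ C.Z r p n ↔ x ∈ C.F p n ∧ ∀ j, (C.K.d n j).hom x ∈ C.F (p + σ * r) j := by
  simp [Z]

lemma iSup_map_d {r p n i : ℤ} (hi : i + σ = n) :
    ⨆ i, (C.Z r p i).map (C.K.d i n).hom = (C.Z r p i).map (C.K.d i n).hom := by
  refine le_antisymm (iSup_le fun i' => ?_) (le_iSup (fun i => (C.Z r p i).map (C.K.d i n).hom) i)
  by_cases h : i' = i
  · subst h; rfl
  · rw [C.K.shape i' n (by simp [ComplexShape.up']; omega)]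
    simp

lemma mem_B {r p n : ℤ} {x : C.K.X n} :
    x ∈ C.B r p n ↔ ∃ b ∈ C.Z (r - 1) (p + σ) n, ∃ z ∈ C.Z (r - 1) (p - σ * (r - 1)) (n - σ),
      b + (C.K.d (n - σ) n).hom z = x := by
  rw [B, iSup_map_d (sub_add_cancel n σ), Submodule.mem_sup]
  simp

lemma d_mem_B {r p n i : ℤ} {z : C.K.X i} (hz : z ∈ C.Z (r - 1) (p - σ * (r - 1)) i) :
    (C.K.d i n).hom z ∈ C.B r p n :=
  (le_sup_right : _ ≤ C.B r p n) (Submodule.mem_iSup_of_mem i ⟨z, hz, rfl⟩)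

lemma Z_le_B {r p n : ℤ} : C.Z (r - 1) (p + σ) n ≤ C.B r p n := le_sup_left

lemma d_mem_Z {r r' p p' n n' : ℤ} {x : C.K.X n} (hx : x ∈ C.Z r p n) (hp : p' = p + σ * r) :
    (C.K.d n n').hom x ∈ C.Z r' p' n' := by
  subst hp
  rw [mem_Z]
  refine ⟨(mem_Z.1 hx).2 n', fun j => ?_⟩
  rw [d_d]
  exact zero_mem _

lemma d_B_mem {r p p' n n' : ℤ} {x : C.K.X n} (hx : x ∈ C.B r p n) (hp : p' = p + σ * r) :
    (C.K.d n n').hom x ∈ C.B r p' n' := by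
  obtain ⟨b, hb, z, hz, rfl⟩ := mem_B.1 hx
  rw [map_add, d_d, add_zero]
  apply d_mem_B
  rwa [show p' - σ * (r - 1) = p + σ by rw [hp]; ring]

lemma Z_succ_le (r p n : ℤ) : C.Z (r + 1) p n ≤ C.Z r p n := by
  intro x hx
  rw [mem_Z] at hx ⊢
  refine ⟨hx.1, fun j => C.F_le _ _ ?_⟩
  convert hx.2 j using 2
  ring

variable (C)

/-- The module `E^r_p = Z^r_p / B^r_p` in degree `n`. -/
abbrev E (r p n : ℤ) : Type u := C.Z r p n ⧸ (C.B r p n).submoduleOf (C.Z r p n)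

/-- The differential of `E^r`, induced by the differential of the complex. -/
def dE (r p p' n n' : ℤ) (hp : p' = p + σ * r) : C.E r p n →ₗ[k] C.E r p' n' :=
  Submodule.mapQ _ _ ((C.K.d n n').hom.restrict fun _ hx => d_mem_Z hx hp)
    fun _ hx => d_B_mem (C := C) hx hp

variable {C}

lemma dE_mk (r p p' n n' : ℤ) (hp : p' = p + σ * r) (x : C.Z r p n) :
    C.dE r p p' n n' hp (Submodule.Quotient.mk x) =
      Submodule.Quotient.mk ⟨(C.K.d n n').hom x.1, d_mem_Z x.2 hp⟩ := rfl

lemma mk_eq_zero_iff {r p n : ℤ} (x : C.Z r p n) :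
    (Submodule.Quotient.mk x : C.E r p n) = 0 ↔ x.1 ∈ C.B r p n := by
  rw [Submodule.Quotient.mk_eq_zero]
  rfl

lemma dE_comp_dE (r p p' p'' n n' n'' : ℤ) (hp : p' = p + σ * r) (hp' : p'' = p' + σ * r) :
    C.dE r p' p'' n' n'' hp' ∘ₗ C.dE r p p' n n' hp = 0 := by
  refine LinearMap.ext fun x => ?_
  obtain ⟨x, rfl⟩ := Submodule.Quotient.mk_surjective _ x
  rw [LinearMap.comp_apply, dE_mk, dE_mk, LinearMap.zero_apply, mk_eq_zero_iff]
  simp only [d_d, zero_mem]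

/-- The shape of the pages: `d^r` has bidegree `(σ r, σ (1 - r))`, i.e. `(-r, r - 1)` in the
homological case `σ = -1` and `(r, 1 - r)` in the cohomological case `σ = 1`. -/
abbrev pageShape (σ : ℤ) (r : ℤ) : ComplexShape (ℤ × ℤ) :=
  ComplexShape.up' ((σ * r, σ * (1 - r)) : ℤ × ℤ)

lemma fst_of_rel {r : ℤ} {pq pq' : ℤ × ℤ} (h : (pageShape σ r).Rel pq pq') :
    pq'.1 = pq.1 + σ * r := by
  have h : pq + (σ * r, σ * (1 - r)) = pq' := h
  simp [← h]

lemma add_of_rel {r : ℤ} {pq pq' : ℤ × ℤ} (h : (pageShape σ r).Rel pq pq') :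
    pq.1 + pq.2 + σ = pq'.1 + pq'.2 := by
  have h : pq + (σ * r, σ * (1 - r)) = pq' := h
  simp [← h]
  ring

variable (C)

open Classical in
/-- The `r`th page: `E^r_{p,q}` sits in total degree `p + q`. -/
def page (r : ℤ) : HomologicalComplex (ModuleCat.{u} k) (pageShape σ r) where
  X pq := ModuleCat.of k (C.E r pq.1 (pq.1 + pq.2))
  d pq pq' := if h : (pageShape σ r).Rel pq pq' then
    ModuleCat.ofHom (C.dE r pq.1 pq'.1 _ _ (fst_of_rel h)) else 0
  shape _ _ h := dif_neg h
  d_comp_d' a b c hab hbc := by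
    rw [dif_pos hab, dif_pos hbc]
    rw [← ModuleCat.ofHom_comp, dE_comp_dE]
    rfl

lemma page_d {r : ℤ} {pq pq' : ℤ × ℤ} (h : (pageShape σ r).Rel pq pq') :
    (C.page r).d pq pq' = ModuleCat.ofHom (C.dE r pq.1 pq'.1 _ _ (fst_of_rel h)) := dif_pos h

variable {C} in
lemma dE_mk_eq_zero_iff {r p p' n n' : ℤ} (hp : p' = p + σ * r) (y : C.Z r p n) (w : C.K.X n)
    (hw : y.1 = w) :
    C.dE r p p' n n' hp (Submodule.Quotient.mk y) = 0 ↔ (C.K.d n n').hom w ∈ C.B r p' n' := by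
  subst hw
  rw [dE_mk, mk_eq_zero_iff]

variable {C} in
lemma mk_inclusion_dE {r r' p p' n n' : ℤ} (h : r + 1 = r') (hp : p' = p + σ * r)
    (hle : C.Z r' p n ≤ C.Z r p n) :
    C.dE r p p' n n' hp ∘ₗ Submodule.mkQ _ ∘ₗ Submodule.inclusion hle = 0 := by
  refine LinearMap.ext fun x => ?_
  exact (dE_mk_eq_zero_iff hp (Submodule.inclusion hle x) x.1 (Submodule.coe_inclusion hle x)).2
    (Z_le_B (d_mem_Z x.2 (by subst h hp; ring)))

/-- The class in `E^r` of an element of `Z^{r+1}`. -/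
def fromZ (r r' : ℤ) (h : r + 1 = r') (pq : ℤ × ℤ) :
    ModuleCat.of k (C.Z r' pq.1 (pq.1 + pq.2)) ⟶ (C.page r).X pq :=
  ModuleCat.ofHom (Submodule.mkQ _ ∘ₗ
    Submodule.inclusion (by subst h; exact Z_succ_le r pq.1 (pq.1 + pq.2)))

lemma fromZ_d (r r' : ℤ) (h : r + 1 = r') (pq pq' : ℤ × ℤ) :
    C.fromZ r r' h pq ≫ (C.page r).d pq pq' = 0 := by
  by_cases hr : (pageShape σ r).Rel pq pq'
  · rw [page_d _ hr]
    exact congr_arg ModuleCat.ofHom (mk_inclusion_dE (n' := pq'.1 + pq'.2) h (fst_of_rel hr) _)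
  · rw [(C.page r).shape _ _ hr, comp_zero]

/-- The homology class on the `r`th page of an element of `Z^{r+1}`. -/
def toHomology (r r' : ℤ) (h : r + 1 = r') (pq : ℤ × ℤ) :
    ModuleCat.of k (C.Z r' pq.1 (pq.1 + pq.2)) ⟶ (C.page r).homology pq :=
  (C.page r).liftCycles (C.fromZ r r' h pq) _ rfl (C.fromZ_d r r' h pq _) ≫
    (C.page r).homologyπ pq

lemma iCycles_liftCycles_fromZ (r r' : ℤ) (h : r + 1 = r') (pq : ℤ × ℤ)
    (x : C.Z r' pq.1 (pq.1 + pq.2)) :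
    ((C.page r).iCycles pq).hom (((C.page r).liftCycles (C.fromZ r r' h pq) _ rfl
      (C.fromZ_d r r' h pq _)).hom x) = (C.fromZ r r' h pq).hom x :=
  congr($((C.page r).liftCycles_i (C.fromZ r r' h pq) _ rfl (C.fromZ_d r r' h pq _)).hom x)

variable {C} in
/-- A cycle of `E^r` is represented by an element of `Z^{r+1}`. -/
lemma exists_of_dE_eq_zero {r r' p p' n n' : ℤ} (h : r + 1 = r') (hp : p' = p + σ * r)
    (hn : n + σ = n') (x : C.Z r p n)
    (hx : C.dE r p p' n n' hp (Submodule.Quotient.mk x) = 0) :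
    ∃ y ∈ C.Z r' p n, x.1 - y ∈ C.B r p n := by
  subst h hp hn
  rw [dE_mk, mk_eq_zero_iff, B, iSup_map_d rfl, Submodule.mem_sup] at hx
  obtain ⟨b, hb, _, ⟨z, hz, rfl⟩, hbz⟩ := hx
  rw [SetLike.mem_coe, show p + σ * r - σ * (r - 1) = p + σ by ring] at hz
  refine ⟨x.1 - z, mem_Z.2 ⟨sub_mem (mem_Z.1 x.2).1 (C.F_le _ _ (mem_Z.1 hz).1), fun j => ?_⟩, ?_⟩
  · by_cases hj : j = n + σ
    · subst hj
      dsimp only at hbz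
      rw [map_sub, ← hbz, add_sub_cancel_right, show p + σ * (r + 1) = p + σ * r + σ by ring]
      exact (mem_Z.1 hb).1
    · rw [C.K.shape n j (fun h' => hj h'.symm)]
      exact zero_mem _
  · rw [sub_sub_cancel]
    exact Z_le_B hz

variable {C} in
/-- An element of `Z^{r+1}` represents a boundary of `E^r` iff it lies in `B^{r+1}`. -/
lemma mem_B_succ_iff {r r' p p' n n' : ℤ} (h : r + 1 = r') (hp : p = p' + σ * r)
    (hn : n' + σ = n) (x : C.K.X n) (hx : x ∈ C.Z r' p n) :
    x ∈ C.B r' p n ↔ ∃ z ∈ C.Z r p' n', x - (C.K.d n' n).hom z ∈ C.B r p n := by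
  subst h hp hn
  rw [B, iSup_map_d rfl, Submodule.mem_sup, B, iSup_map_d rfl,
    show p' + σ * r - σ * (r + 1 - 1) = p' by ring, show r + 1 - 1 = r by ring]
  constructor
  · rintro ⟨b, hb, _, ⟨z, hz, rfl⟩, rfl⟩
    refine ⟨z, hz, ?_⟩
    rw [add_sub_cancel_right]
    apply Submodule.mem_sup_left
    have := Z_succ_le (C := C) (r - 1) (p' + σ * r + σ) (n' + σ)
    rw [sub_add_cancel] at this
    exact this hb
  · rintro ⟨z, hz, hxz⟩
    obtain ⟨b, hb, _, ⟨w, hw, rfl⟩, hbz⟩ := Submodule.mem_sup.1 hxz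
    rw [SetLike.mem_coe, show p' + σ * r - σ * (r - 1) = p' + σ by ring, mem_Z] at hw
    have e : b = x - (C.K.d n' (n' + σ)).hom (z + w) := by
      rw [map_add, ← sub_sub, ← hbz, add_sub_cancel_right]
    refine ⟨b, mem_Z.2 ⟨(mem_Z.1 hb).1, fun j => ?_⟩, _, ⟨z + w, ?_, rfl⟩, ?_⟩
    · rw [e, map_sub, d_d, sub_zero, add_assoc (p' + σ * r), ← show σ * (r + 1) = σ + σ * r by ring]
      exact (mem_Z.1 hx).2 j
    · refine add_mem hz (mem_Z.2 ⟨C.F_le _ _ hw.1, fun j => ?_⟩)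
      rw [show p' + σ * r = p' + σ + σ * (r - 1) by ring]
      exact hw.2 j
    · rw [e, sub_add_cancel]

variable {C} in
lemma mk_eq_mk_iff {r p n : ℤ} (x y : C.Z r p n) :
    (Submodule.Quotient.mk x : C.E r p n) = Submodule.Quotient.mk y ↔ x.1 - y.1 ∈ C.B r p n := by
  rw [← sub_eq_zero, ← Submodule.Quotient.mk_sub, mk_eq_zero_iff]
  rfl

lemma fromZ_eq (r r' : ℤ) (h : r + 1 = r') (pq : ℤ × ℤ) (x : C.Z r' pq.1 (pq.1 + pq.2))
    (hx : x.1 ∈ C.Z r pq.1 (pq.1 + pq.2)) :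
    (C.fromZ r r' h pq).hom x = (Submodule.Quotient.mk ⟨x.1, hx⟩ : C.E r _ _) := by
  rfl

lemma toHomology_surjective (r r' : ℤ) (h : r + 1 = r') (pq : ℤ × ℤ) :
    Function.Surjective (C.toHomology r r' h pq).hom := by
  intro y
  obtain ⟨c, rfl⟩ := (ModuleCat.epi_iff_surjective ((C.page r).homologyπ pq)).1 inferInstance y
  obtain ⟨x, hx⟩ := Submodule.Quotient.mk_surjective _ (((C.page r).iCycles pq).hom c)
  have hrel : (pageShape σ r).Rel pq (pq + (σ * r, σ * (1 - r))) := rfl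
  have hdx : (C.dE r pq.1 _ (pq.1 + pq.2) ((pq + (σ * r, σ * (1 - r))).1 +
      (pq + (σ * r, σ * (1 - r))).2) (fst_of_rel hrel)) (Submodule.Quotient.mk x) = 0 := by
    have := congr($((C.page r).iCycles_d pq (pq + (σ * r, σ * (1 - r)))).hom c)
    rw [page_d _ hrel] at this
    rw [hx]
    exact this
  obtain ⟨y, hy, hxy⟩ := exists_of_dE_eq_zero h _ (add_of_rel hrel) x hdx
  have hy' : y ∈ C.Z r pq.1 (pq.1 + pq.2) := by subst h; exact Z_succ_le _ _ _ hy
  refine ⟨⟨y, hy⟩, congr_arg ((C.page r).homologyπ pq).hom ?_⟩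
  apply (ModuleCat.mono_iff_injective ((C.page r).iCycles pq)).1 inferInstance
  refine (C.iCycles_liftCycles_fromZ r r' h pq ⟨y, hy⟩).trans (Eq.trans ?_ hx)
  exact (mk_eq_mk_iff ⟨y, hy'⟩ x).2 (by rw [← neg_sub]; exact neg_mem hxy)

lemma toHomology_eq_zero_iff (r r' : ℤ) (h : r + 1 = r') (pq : ℤ × ℤ)
    (x : C.Z r' pq.1 (pq.1 + pq.2)) :
    (C.toHomology r r' h pq).hom x = 0 ↔ x.1 ∈ C.B r' pq.1 (pq.1 + pq.2) := by
  have hx' : x.1 ∈ C.Z r pq.1 (pq.1 + pq.2) := by subst h; exact Z_succ_le _ _ _ x.2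
  have hrel : (pageShape σ r).Rel (pq - (σ * r, σ * (1 - r))) pq := sub_add_cancel _ _
  refine (homologyπ_eq_zero_iff (C.page r) pq (((C.page r).liftCycles (C.fromZ r r' h pq) _ rfl
    (C.fromZ_d r r' h pq _)).hom x)).trans ?_
  rw [iCycles_liftCycles_fromZ, fromZ_eq C r r' h pq x hx',
    mem_B_succ_iff h (fst_of_rel hrel) (add_of_rel hrel) x.1 x.2]
  constructor
  · rintro ⟨j, z, hz⟩
    by_cases hj : (pageShape σ r).Rel j pq
    · obtain rfl : j = pq - (σ * r, σ * (1 - r)) := eq_sub_of_add_eq hj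
      obtain ⟨z, rfl⟩ := Submodule.Quotient.mk_surjective _ z
      rw [page_d _ hj] at hz
      refine ⟨z.1, z.2, ?_⟩
      have := (mk_eq_mk_iff _ _).1 hz.symm
      exact this
    · rw [(C.page r).shape _ _ hj] at hz
      refine ⟨0, zero_mem _, ?_⟩
      rw [map_zero, sub_zero]
      exact (mk_eq_zero_iff _).1 hz.symm
  · rintro ⟨z, hz, hxz⟩
    refine ⟨_, Submodule.Quotient.mk ⟨z, hz⟩, ?_⟩
    rw [page_d _ hrel]
    exact (mk_eq_mk_iff _ _).2 (by rw [← neg_sub]; exact neg_mem hxz)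

lemma toHomology_ker (r r' : ℤ) (h : r + 1 = r') (pq : ℤ × ℤ) :
    (C.B r' pq.1 (pq.1 + pq.2)).submoduleOf (C.Z r' pq.1 (pq.1 + pq.2)) =
      (C.toHomology r r' h pq).hom.ker := by
  ext x
  rw [LinearMap.mem_ker, toHomology_eq_zero_iff]
  rfl

/-- The homology of the `r`th page is the next page. -/
def pageIso (r r' : ℤ) (h : r + 1 = r') (pq : ℤ × ℤ) :
    (C.page r').X pq ≅ (C.page r).homology pq :=
  ((Submodule.quotEquivOfEq _ _ (C.toHomology_ker r r' h pq)).trans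
    ((C.toHomology r r' h pq).hom.quotKerEquivOfSurjective
      (C.toHomology_surjective r r' h pq))).toModuleIso

/-- The spectral sequence of a filtered complex. -/
def spectralSequence : SpectralSequence (ModuleCat.{u} k) (pageShape σ) 2 where
  page r _ := C.page r
  iso r r' pq h _ := (C.pageIso r r' h pq).symm

namespace Hom

variable {C} (φ : Hom C D)

lemma d_f (i j : ℤ) (x : C.K.X i) :
    (φ.f.f j).hom ((C.K.d i j).hom x) = (D.K.d i j).hom ((φ.f.f i).hom x) :=
  congr($(φ.f.comm i j).hom x).symm

lemma mem_Z_of_mem {r p n : ℤ} {x : C.K.X n} (hx : x ∈ C.Z r p n) :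
    (φ.f.f n).hom x ∈ D.Z r p n := by
  rw [FilteredComplex.mem_Z] at hx ⊢
  refine ⟨φ.mem _ _ _ hx.1, fun j => ?_⟩
  rw [← d_f]
  exact φ.mem _ _ _ (hx.2 j)

lemma mem_B_of_mem {r p n : ℤ} {x : C.K.X n} (hx : x ∈ C.B r p n) :
    (φ.f.f n).hom x ∈ D.B r p n := by
  rw [FilteredComplex.mem_B] at hx ⊢
  obtain ⟨b, hb, z, hz, rfl⟩ := hx
  exact ⟨_, φ.mem_Z_of_mem hb, _, φ.mem_Z_of_mem hz, by rw [← d_f, map_add]⟩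

/-- The map induced on `E^r`. -/
def mapE (r p n : ℤ) : C.E r p n →ₗ[k] D.E r p n :=
  Submodule.mapQ _ _ ((φ.f.f n).hom.restrict fun _ hx => φ.mem_Z_of_mem hx)
    fun _ hx => φ.mem_B_of_mem hx

lemma mapE_mk {r p n : ℤ} (x : C.Z r p n) :
    φ.mapE r p n (Submodule.Quotient.mk x) =
      Submodule.Quotient.mk ⟨(φ.f.f n).hom x.1, φ.mem_Z_of_mem x.2⟩ := rfl

lemma mapE_dE (r p p' n n' : ℤ) (hp : p' = p + σ * r) :
    D.dE r p p' n n' hp ∘ₗ φ.mapE r p n = φ.mapE r p' n' ∘ₗ C.dE r p p' n n' hp := by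
  refine LinearMap.ext fun x => ?_
  obtain ⟨x, rfl⟩ := Submodule.Quotient.mk_surjective _ x
  rw [LinearMap.comp_apply, LinearMap.comp_apply, mapE_mk, dE_mk, dE_mk, mapE_mk]
  simp only [d_f]

/-- The map induced on the `r`th page. -/
def mapPage (r : ℤ) : C.page r ⟶ D.page r where
  f pq := ModuleCat.ofHom (φ.mapE r pq.1 (pq.1 + pq.2))
  comm' i j hij := by
    rw [page_d _ hij, page_d _ hij]
    exact congr_arg ModuleCat.ofHom (φ.mapE_dE r i.1 j.1 _ (j.1 + j.2) (fst_of_rel hij))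

/-- The map induced on `Z^r`. -/
def mapZ (r p n : ℤ) : ModuleCat.of k (C.Z r p n) ⟶ ModuleCat.of k (D.Z r p n) :=
  ModuleCat.ofHom ((φ.f.f n).hom.restrict fun _ hx => φ.mem_Z_of_mem hx)

lemma fromZ_mapPage (r r' : ℤ) (h : r + 1 = r') (pq : ℤ × ℤ) :
    C.fromZ r r' h pq ≫ (φ.mapPage r).f pq = φ.mapZ r' _ _ ≫ D.fromZ r r' h pq := by
  apply ModuleCat.hom_ext
  refine LinearMap.ext fun x => ?_
  have hx : x.1 ∈ C.Z r pq.1 (pq.1 + pq.2) := by subst h; exact Z_succ_le _ _ _ x.2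
  have e1 := congr_arg (φ.mapE r pq.1 (pq.1 + pq.2)) (C.fromZ_eq r r' h pq x hx)
  rw [mapE_mk] at e1
  exact e1.trans (D.fromZ_eq r r' h pq ((φ.mapZ r' _ _).hom x) (φ.mem_Z_of_mem hx)).symm

lemma toHomology_map (r r' : ℤ) (h : r + 1 = r') (pq : ℤ × ℤ) :
    C.toHomology r r' h pq ≫ HomologicalComplex.homologyMap (φ.mapPage r) pq =
      φ.mapZ r' _ _ ≫ D.toHomology r r' h pq := by
  rw [toHomology, toHomology, Category.assoc, HomologicalComplex.homologyπ_naturality,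
    HomologicalComplex.liftCycles_comp_cyclesMap_assoc, ← Category.assoc,
    HomologicalComplex.comp_liftCycles]
  exact congr_arg (· ≫ (D.page r).homologyπ pq)
    (liftCycles_congr _ (φ.fromZ_mapPage r r' h pq) _ _ _ _ _)

end Hom

lemma mk_pageIso_hom (r r' : ℤ) (h : r + 1 = r') (pq : ℤ × ℤ) (x : C.Z r' pq.1 (pq.1 + pq.2)) :
    (C.pageIso r r' h pq).hom.hom (Submodule.Quotient.mk x) = (C.toHomology r r' h pq).hom x := by
  rfl

variable {C} in
lemma Hom.pageIso_map (φ : Hom C D) (r r' : ℤ) (h : r + 1 = r') (pq : ℤ × ℤ) :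
    (C.pageIso r r' h pq).hom ≫ HomologicalComplex.homologyMap (φ.mapPage r) pq =
      (φ.mapPage r').f pq ≫ (D.pageIso r r' h pq).hom := by
  apply ModuleCat.hom_ext
  refine LinearMap.ext fun x => ?_
  obtain ⟨x, rfl⟩ := Submodule.Quotient.mk_surjective _ x
  have e := congr($(φ.toHomology_map r r' h pq).hom x)
  have e1 : (HomologicalComplex.homologyMap (φ.mapPage r) pq).hom
      ((C.toHomology r r' h pq).hom x) =
      (D.toHomology r r' h pq).hom ((φ.mapZ r' pq.1 (pq.1 + pq.2)).hom x) := e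
  have e2 := D.mk_pageIso_hom r r' h pq ((φ.mapZ r' pq.1 (pq.1 + pq.2)).hom x)
  have e3 := congr_arg (HomologicalComplex.homologyMap (φ.mapPage r) pq).hom
    (C.mk_pageIso_hom r r' h pq x)
  exact (e3.trans e1).trans e2.symm

variable {C} in
lemma Hom.map_pageIso_inv (φ : Hom C D) (r r' : ℤ) (h : r + 1 = r') (pq : ℤ × ℤ) :
    HomologicalComplex.homologyMap (φ.mapPage r) pq ≫ (D.pageIso r r' h pq).inv =
      (C.pageIso r r' h pq).inv ≫ (φ.mapPage r').f pq := by
  rw [Iso.comp_inv_eq, Category.assoc, ← φ.pageIso_map, Iso.inv_hom_id_assoc]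


variable {C} in
/-- The morphism of spectral sequences induced by a morphism of filtered complexes. -/
def mapSpectralSequence (φ : Hom C D) : C.spectralSequence ⟶ D.spectralSequence where
  hom r _ := φ.mapPage r
  comm r r' pq h _ := φ.map_pageIso_inv r r' h pq

end FilteredComplex

/-- Total degree `i + j`, with the sign `(-1) ^ i` on the inner differential. -/
instance downTotalShape :
    TotalComplexShape (ComplexShape.down ℕ) (ComplexShape.down ℕ) (ComplexShape.up' (-1 : ℤ)) where
  π i := (i.1 : ℤ) + i.2
  ε₁ _ := 1
  ε₂ i := (-1) ^ i.1
  rel₁ {i i'} h j := by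
    have h : i' + 1 = i := h
    change (i : ℤ) + j + -1 = i' + j
    omega
  rel₂ i j j' h := by
    have h : j' + 1 = j := h
    change (i : ℤ) + j + -1 = i + j'
    omega
  ε₂_ε₁ {i i' j j'} h _ := by
    have h : i' + 1 = i := h
    subst h
    simp [pow_succ]

/-- Total degree `i + j`, with the sign `(-1) ^ i` on the inner differential. -/
instance upTotalShape :
    TotalComplexShape (ComplexShape.up ℕ) (ComplexShape.up ℕ) (ComplexShape.up' (1 : ℤ)) where
  π i := (i.1 : ℤ) + i.2
  ε₁ _ := 1
  ε₂ i := (-1) ^ i.1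
  rel₁ {i i'} h j := by
    have h : i + 1 = i' := h
    change (i : ℤ) + j + 1 = i' + j
    omega
  rel₂ i j j' h := by
    have h : j + 1 = j' := h
    change (i : ℤ) + j + 1 = i + j'
    omega
  ε₂_ε₁ {i i' j j'} h _ := by
    have h : i + 1 = i' := h
    subst h
    simp [pow_succ]

section
variable {k : Type u} [CommRing k] {σ : ℤ} {c : ComplexShape ℕ}
  [TotalComplexShape c c (ComplexShape.up' σ)]
  (K L : HomologicalComplex₂ (ModuleCat.{u} k) c c)

/-- The filtration of the total complex of a double complex `K` by the inner degree. -/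
def innerFiltration (p n : ℤ) : Submodule k ((K.total (ComplexShape.up' σ)).X n) :=
  ⨆ (i : ℕ) (j : ℕ) (h : ComplexShape.π c c (ComplexShape.up' σ) (i, j) = n)
    (_ : σ * p ≤ σ * j), (K.ιTotal (ComplexShape.up' σ) i j n h).hom.range

variable {K L} in
lemma innerFiltration_le {p n : ℤ} {S : Submodule k ((K.total (ComplexShape.up' σ)).X n)}
    (h : ∀ (i j : ℕ) (h : ComplexShape.π c c (ComplexShape.up' σ) (i, j) = n)
      (_ : σ * p ≤ σ * j) (x : (K.X i).X j),
      (K.ιTotal (ComplexShape.up' σ) i j n h).hom x ∈ S) : innerFiltration K p n ≤ S := by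
  refine iSup_le fun i => iSup_le fun j => iSup_le fun hi => iSup_le fun hj => ?_
  rintro _ ⟨x, rfl⟩
  exact h i j hi hj x

lemma ι_mem_innerFiltration {p n : ℤ} {i j : ℕ}
    (h : ComplexShape.π c c (ComplexShape.up' σ) (i, j) = n) (hj : σ * p ≤ σ * j)
    (x : (K.X i).X j) :
    (K.ιTotal (ComplexShape.up' σ) i j n h).hom x ∈ innerFiltration K p n :=
  Submodule.mem_iSup_of_mem i <| Submodule.mem_iSup_of_mem j <| Submodule.mem_iSup_of_mem h <|
    Submodule.mem_iSup_of_mem hj ⟨x, rfl⟩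

lemma ιOrZero_mem_innerFiltration {p n : ℤ} {i j : ℕ} (hj : σ * p ≤ σ * j)
    (x : (K.X i).X j) :
    (K.ιTotalOrZero (ComplexShape.up' σ) i j n).hom x ∈ innerFiltration K p n := by
  by_cases h : ComplexShape.π c c (ComplexShape.up' σ) (i, j) = n
  · rw [K.ιTotalOrZero_eq _ _ _ _ h]
    exact ι_mem_innerFiltration K h hj x
  · rw [K.ιTotalOrZero_eq_zero _ _ _ _ h]
    exact zero_mem _

lemma d₁_mem_innerFiltration {p n : ℤ} {i j : ℕ} (hj : σ * p ≤ σ * j) (x : (K.X i).X j) :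
    (K.d₁ (ComplexShape.up' σ) i j n).hom x ∈ innerFiltration K p n := by
  by_cases h : c.Rel i (c.next i)
  · rw [K.d₁_eq' _ h]
    rcases Int.units_eq_one_or (ComplexShape.ε₁ c c (ComplexShape.up' σ) (i, j)) with e | e
    · rw [e, one_smul]
      exact ιOrZero_mem_innerFiltration K hj _
    · rw [e, Units.neg_smul, one_smul]
      exact neg_mem (ιOrZero_mem_innerFiltration K hj _)
  · rw [K.d₁_eq_zero _ _ _ _ h]
    exact zero_mem _

lemma d₂_mem_innerFiltration (hc : ∀ i j, c.Rel i j → (i : ℤ) + σ = j) {p n : ℤ} {i j : ℕ}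
    (hj : σ * p ≤ σ * j) (x : (K.X i).X j) :
    (K.d₂ (ComplexShape.up' σ) i j n).hom x ∈ innerFiltration K p n := by
  by_cases h : c.Rel j (c.next j)
  · rw [K.d₂_eq' _ _ h]
    have hj' : σ * p ≤ σ * (c.next j : ℕ) := by
      rw [← hc _ _ h]
      nlinarith [mul_self_nonneg σ]
    rcases Int.units_eq_one_or (ComplexShape.ε₂ c c (ComplexShape.up' σ) (i, j)) with e | e
    · rw [e, one_smul]
      exact ιOrZero_mem_innerFiltration K hj' _
    · rw [e, Units.neg_smul, one_smul]
      exact neg_mem (ιOrZero_mem_innerFiltration K hj' _)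
  · rw [K.d₂_eq_zero _ _ _ _ h]
    exact zero_mem _

/-- The total complex of a double complex, filtered by the inner degree. -/
def totalFiltered (hc : ∀ i j, c.Rel i j → (i : ℤ) + σ = j) : FilteredComplex k σ where
  K := K.total (ComplexShape.up' σ)
  F := innerFiltration K
  F_le p n := innerFiltration_le fun i j h hj x =>
    ι_mem_innerFiltration K h (by nlinarith [mul_self_nonneg σ]) x
  d_mem p n n' x hx := by
    revert x
    change innerFiltration K p n ≤
      (innerFiltration K p n').comap ((K.total (ComplexShape.up' σ)).d n n').hom
    refine innerFiltration_le fun i j h hj x => ?_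
    have h1 := congr($(K.ι_D₁ (ComplexShape.up' σ) n n' i j h).hom x)
    have h2 := congr($(K.ι_D₂ (ComplexShape.up' σ) n n' i j h).hom x)
    rw [Submodule.mem_comap, HomologicalComplex₂.total_d, ModuleCat.hom_add, LinearMap.add_apply]
    refine add_mem ?_ ?_
    · rw [ModuleCat.hom_comp, LinearMap.comp_apply] at h1
      rw [h1]
      exact d₁_mem_innerFiltration K hj x
    · rw [ModuleCat.hom_comp, LinearMap.comp_apply] at h2
      rw [h2]
      exact d₂_mem_innerFiltration K hc hj x

variable {K L} in
/-- The filtered morphism of total complexes induced by a morphism of double complexes. -/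
def totalFilteredMap (hc : ∀ i j, c.Rel i j → (i : ℤ) + σ = j) (f : K ⟶ L) :
    FilteredComplex.Hom (totalFiltered K hc) (totalFiltered L hc) where
  f := HomologicalComplex₂.total.map f (ComplexShape.up' σ)
  mem p n x hx := by
    revert x
    change innerFiltration K p n ≤ (innerFiltration L p n).comap
      ((HomologicalComplex₂.total.map f (ComplexShape.up' σ)).f n).hom
    refine innerFiltration_le fun i j h hj x => ?_
    have h1 := congr($(HomologicalComplex₂.ιTotal_map K L f (ComplexShape.up' σ) i j n h).hom x)
    rw [ModuleCat.hom_comp, LinearMap.comp_apply] at h1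
    rw [Submodule.mem_comap, h1]
    exact ι_mem_innerFiltration L h hj _

end

section
variable {k : Type u} [CommRing k] {G G' G'' : Type u} [Group G] [Group G'] [Group G'']

/-- The diagonal action of `G` on `k[X] ⊗ A`, realized as `X →₀ A`. -/
def finsuppAction (X : Type u) [MulAction G X] (A : Rep.{u} k G) : Representation k G (X →₀ A) where
  toFun := fun g => Finsupp.mapRange.linearMap (A.ρ g) ∘ₗ Finsupp.lmapDomain A k (g • ·)
  map_one' := Finsupp.lhom_ext fun x a => by simp
  map_mul' := fun g h => Finsupp.lhom_ext fun x a => by simp [mul_smul]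

/-- The action of `G` on `Hom(k[X], A)`, realized as `X → A`, by `(g F) x = g F (g⁻¹ x)`. -/
def funAction (X : Type u) [MulAction G X] (A : Rep.{u} k G) : Representation k G (X → A) where
  toFun := fun g => (A.ρ g).compLeft X ∘ₗ LinearMap.funLeft k A (g⁻¹ • ·)
  map_one' := LinearMap.ext fun F => funext fun x => by simp [LinearMap.funLeft]
  map_mul' := fun g h => LinearMap.ext fun F => funext fun x => by
    simp [LinearMap.funLeft, mul_smul]

/-- The `G`-module `k[X] ⊗ A`. -/
abbrev finsuppRep (X : Type u) [MulAction G X] (A : Rep.{u} k G) : Rep.{u} k G :=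
  Rep.of (finsuppAction X A)

/-- The `G`-module `Hom(k[X], A)`. -/
abbrev funRep (X : Type u) [MulAction G X] (A : Rep.{u} k G) : Rep.{u} k G :=
  Rep.of (funAction X A)

variable {A B : Rep.{u} k G} {A' B' : Rep.{u} k G'} {X X' : Type u} [MulAction G X]
  [MulAction G' X']

/-- Functoriality of `k[X] ⊗ A`. -/
def finsuppRepMap (f : G →* G') (e : X → X') (he : ∀ g x, e (g • x) = f g • e x)
    (φ : A ⟶ Rep.res f A') : finsuppRep X A ⟶ Rep.res f (finsuppRep X' A') :=
  Rep.ofHom (σ := (finsuppAction X' A').comp f)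
    { toLinearMap := Finsupp.mapRange.linearMap φ.hom.toLinearMap ∘ₗ Finsupp.lmapDomain A k e
      isIntertwining' := fun g => by
        refine Finsupp.lhom_ext fun x a => ?_
        have := Rep.hom_comm_apply φ g a
        simp [finsuppAction, he, this] }

/-- Functoriality of `Hom(k[X], A)`. -/
def funRepMap (f : G →* G') (e : X → X') (he : ∀ g x, e (g • x) = f g • e x)
    (φ : Rep.res f A' ⟶ A) : Rep.res f (funRep X' A') ⟶ funRep X A :=
  Rep.ofHom (ρ := (funAction X' A').comp f)
    { toLinearMap := φ.hom.toLinearMap.compLeft X ∘ₗ LinearMap.funLeft k A' e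
      isIntertwining' := fun g => by
        refine LinearMap.ext fun F => funext fun x => ?_
        have := Rep.hom_comm_apply φ g (F (f g⁻¹ • e x))
        simpa [funAction, he] using! this }

variable (N : Subgroup G) [N.Normal] (N' : Subgroup G') [N'.Normal]

/-- The map induced on the coinvariants of normal subgroups. -/
def coinvariantsMap (f : G →* G') (hN : N ≤ N'.comap f) (ψ : B ⟶ Rep.res f B') :
    B.quotientToCoinvariants N ⟶
      Rep.res (QuotientGroup.map N N' f hN) (B'.quotientToCoinvariants N') :=
  Rep.ofHom (σ := (B'.quotientToCoinvariants N').ρ.comp (QuotientGroup.map N N' f hN))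
    { toLinearMap := Representation.Coinvariants.lift _
        (Representation.Coinvariants.mk (B'.ρ.comp N'.subtype) ∘ₗ ψ.hom.toLinearMap) fun n => by
          refine LinearMap.ext fun x => (Representation.Coinvariants.mk_eq_iff _).2 ?_
          exact Representation.Coinvariants.mem_ker_of_eq (ρ := B'.ρ.comp N'.subtype)
            ⟨f n, hN n.2⟩ (ψ.hom x) _ (congr($(Rep.hom_comm_apply ψ n.1 x) - _).symm)
      isIntertwining' := fun g => by
        induction g using QuotientGroup.induction_on with | H g => ?_
        refine Representation.Coinvariants.hom_ext (LinearMap.ext fun x => ?_)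
        exact congr_arg (Representation.Coinvariants.mk (B'.ρ.comp N'.subtype))
          (Rep.hom_comm_apply ψ g x) }

/-- The map induced on the invariants of normal subgroups. -/
def invariantsMap (f : G →* G') (hN : N ≤ N'.comap f) (ψ : Rep.res f B' ⟶ B) :
    Rep.res (QuotientGroup.map N N' f hN) (B'.quotientToInvariants N') ⟶
      B.quotientToInvariants N :=
  Rep.ofHom (ρ := (B'.quotientToInvariants N').ρ.comp (QuotientGroup.map N N' f hN))
    { toLinearMap := ψ.hom.toLinearMap.restrict fun x hx n =>
        (Rep.hom_comm_apply ψ n.1 x).symm.trans (congr_arg ψ.hom (hx ⟨f n, hN n.2⟩))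
      isIntertwining' := fun g => by
        induction g using QuotientGroup.induction_on with | H g => ?_
        refine LinearMap.ext fun x => Subtype.ext ?_
        exact Rep.hom_comm_apply ψ g x.1 }


variable {N N'}

/-- The map on inhomogeneous `G ⧸ N`-chains with coefficients in `(k[X] ⊗ A)_N`. -/
def lhsChainsMap (f : G →* G') (hN : N ≤ N'.comap f) (e : X → X')
    (he : ∀ g x, e (g • x) = f g • e x) (φ : A ⟶ Rep.res f A') :
    groupHomology.inhomogeneousChains ((finsuppRep X A).quotientToCoinvariants N) ⟶
      groupHomology.inhomogeneousChains ((finsuppRep X' A').quotientToCoinvariants N') :=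
  groupHomology.chainsMap (QuotientGroup.map N N' f hN)
    (coinvariantsMap N N' f hN (finsuppRepMap f e he φ))

/-- The map on inhomogeneous `G ⧸ N`-cochains with coefficients in `Hom(k[X], A)^N`. -/
def lhsCochainsMap (f : G →* G') (hN : N ≤ N'.comap f) (e : X → X')
    (he : ∀ g x, e (g • x) = f g • e x) (φ : Rep.res f A' ⟶ A) :
    groupCohomology.inhomogeneousCochains ((funRep X' A').quotientToInvariants N') ⟶
      groupCohomology.inhomogeneousCochains ((funRep X A).quotientToInvariants N) :=
  groupCohomology.cochainsMap (QuotientGroup.map N N' f hN)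
    (invariantsMap N N' f hN (funRepMap f e he φ))

lemma lhsChainsMap_single (f : G →* G') (hN : N ≤ N'.comap f) (e : X → X')
    (he : ∀ g x, e (g • x) = f g • e x) (φ : A ⟶ Rep.res f A') (n : ℕ) (g : Fin n → G ⧸ N)
    (x : X) (a : A) :
    ((lhsChainsMap f hN e he φ).f n).hom
        (Finsupp.single g (Representation.Coinvariants.mk _ (Finsupp.single x a))) =
      Finsupp.single (QuotientGroup.map N N' f hN ∘ g)
        (Representation.Coinvariants.mk _ (Finsupp.single (e x) (φ.hom a))) := by
  refine (groupHomology.chainsMap_f_single (QuotientGroup.map N N' f hN)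
    (coinvariantsMap N N' f hN (finsuppRepMap f e he φ)) n g _).trans ?_
  refine congr_arg (Finsupp.single _) ?_
  refine congr_arg (Representation.Coinvariants.mk _) ?_
  change Finsupp.mapRange.linearMap φ.hom.toLinearMap (Finsupp.lmapDomain A k e _) = _
  simp

lemma lhsChains_hom_ext {C : ChainComplex (ModuleCat.{u} k) ℕ}
    {α β : groupHomology.inhomogeneousChains ((finsuppRep X A).quotientToCoinvariants N) ⟶ C}
    (h : ∀ (n : ℕ) (g : Fin n → G ⧸ N) (x : X) (a : A),
      (α.f n).hom (Finsupp.single g (Representation.Coinvariants.mk _ (Finsupp.single x a))) =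
      (β.f n).hom (Finsupp.single g (Representation.Coinvariants.mk _ (Finsupp.single x a)))) :
    α = β := by
  refine HomologicalComplex.hom_ext _ _ fun n => ModuleCat.hom_ext ?_
  refine Finsupp.lhom_ext' fun g => ?_
  refine Representation.Coinvariants.hom_ext ?_
  refine Finsupp.lhom_ext fun x a => ?_
  exact h n g x a

lemma lhsChainsMap_comp {N'' : Subgroup G''} [N''.Normal] {A'' : Rep.{u} k G''} {X'' : Type u}
    [MulAction G'' X'']
    (f : G →* G') (hN : N ≤ N'.comap f) (e : X → X') (he : ∀ g x, e (g • x) = f g • e x)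
    (φ : A ⟶ Rep.res f A')
    (f' : G' →* G'') (hN' : N' ≤ N''.comap f') (e' : X' → X'')
    (he' : ∀ g x, e' (g • x) = f' g • e' x) (φ' : A' ⟶ Rep.res f' A'')
    (f'' : G →* G'') (hN'' : N ≤ N''.comap f'') (e'' : X → X'')
    (he'' : ∀ g x, e'' (g • x) = f'' g • e'' x) (φ'' : A ⟶ Rep.res f'' A'')
    (hf : f'.comp f = f'') (hee : e' ∘ e = e'') (hφ : ∀ a, φ'.hom (φ.hom a) = φ''.hom a) :
    lhsChainsMap f hN e he φ ≫ lhsChainsMap f' hN' e' he' φ' =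
      lhsChainsMap f'' hN'' e'' he'' φ'' := by
  subst hf hee
  refine lhsChains_hom_ext fun n g x a => ?_
  rw [lhsChainsMap_single, HomologicalComplex.comp_f, ModuleCat.hom_comp, LinearMap.comp_apply,
    lhsChainsMap_single]
  refine (lhsChainsMap_single f' hN' e' he' φ' n _ _ _).trans ?_
  rw [hφ]
  congr 1
  funext i
  exact QuotientGroup.map_map N N' N'' f f' hN hN' hN'' (g i)

lemma lhsChainsMap_id (hN : N ≤ N.comap (MonoidHom.id G)) (e : X → X)
    (he : ∀ (g : G) x, e (g • x) = g • e x) (hee : e = id) :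
    lhsChainsMap (MonoidHom.id G) hN e he (𝟙 A) = 𝟙 _ := by
  subst hee
  refine lhsChains_hom_ext fun n g x a => ?_
  rw [lhsChainsMap_single, HomologicalComplex.id_f]
  have : ⇑(QuotientGroup.map N N (MonoidHom.id G) hN) ∘ g = g :=
    funext fun i => congr($(QuotientGroup.map_id N hN) (g i))
  rw [this]
  rfl

lemma lhsCochainsMap_comp {N'' : Subgroup G''} [N''.Normal] {A'' : Rep.{u} k G''} {X'' : Type u}
    [MulAction G'' X'']
    (f : G →* G') (hN : N ≤ N'.comap f) (e : X → X') (he : ∀ g x, e (g • x) = f g • e x)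
    (φ : Rep.res f A' ⟶ A)
    (f' : G' →* G'') (hN' : N' ≤ N''.comap f') (e' : X' → X'')
    (he' : ∀ g x, e' (g • x) = f' g • e' x) (φ' : Rep.res f' A'' ⟶ A')
    (f'' : G →* G'') (hN'' : N ≤ N''.comap f'') (e'' : X → X'')
    (he'' : ∀ g x, e'' (g • x) = f'' g • e'' x) (φ'' : Rep.res f'' A'' ⟶ A)
    (hf : f'.comp f = f'') (hee : e' ∘ e = e'') (hφ : ∀ a, φ.hom (φ'.hom a) = φ''.hom a) :
    lhsCochainsMap f' hN' e' he' φ' ≫ lhsCochainsMap f hN e he φ =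
      lhsCochainsMap f'' hN'' e'' he'' φ'' := by
  subst hf hee
  refine HomologicalComplex.hom_ext _ _ fun n => ModuleCat.hom_ext (LinearMap.ext fun F => ?_)
  refine funext fun g => Subtype.ext (funext fun x => ?_)
  refine (hφ _).trans ?_
  have : ⇑(QuotientGroup.map N' N'' f' hN') ∘ ⇑(QuotientGroup.map N N' f hN) ∘ g =
      ⇑(QuotientGroup.map N N'' (f'.comp f) hN'') ∘ g :=
    funext fun i => QuotientGroup.map_map N N' N'' f f' hN hN' hN'' (g i)
  exact congr_arg (fun g => φ''.hom ((F g).1 (e' (e x)))) this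

lemma lhsCochainsMap_id (hN : N ≤ N.comap (MonoidHom.id G)) (e : X → X)
    (he : ∀ (g : G) x, e (g • x) = g • e x) (hee : e = id) :
    lhsCochainsMap (MonoidHom.id G) hN e he (𝟙 A) = 𝟙 _ := by
  subst hee
  refine HomologicalComplex.hom_ext _ _ fun n => ModuleCat.hom_ext (LinearMap.ext fun F => ?_)
  refine funext fun g => Subtype.ext (funext fun x => ?_)
  have : ⇑(QuotientGroup.map N N (MonoidHom.id G) hN) ∘ g = g :=
    funext fun i => congr($(QuotientGroup.map_id N hN) (g i))
  exact congr_arg (fun g => (F g).1 x) this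

variable (N N')

/-- The simplicial chain complex with `n`-simplices the inhomogeneous chains of `G ⧸ N` with
coefficients in `(k[G^{n+1}] ⊗ A)_N`. -/
def lhsSimplicial (A : Rep.{u} k G) : SimplicialObject (ChainComplex (ModuleCat.{u} k) ℕ) where
  obj Δ := groupHomology.inhomogeneousChains
    ((finsuppRep (Fin (Δ.unop.len + 1) → G) A).quotientToCoinvariants N)
  map α := lhsChainsMap (MonoidHom.id G) le_rfl (fun x => x ∘ α.unop.toOrderHom)
    (fun _ _ => rfl) (𝟙 A)
  map_id _ := lhsChainsMap_id _ _ _ rfl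
  map_comp α β := (lhsChainsMap_comp (MonoidHom.id G) le_rfl (fun x => x ∘ α.unop.toOrderHom)
    (fun _ _ => rfl) (𝟙 A) (MonoidHom.id G) le_rfl (fun x => x ∘ β.unop.toOrderHom)
    (fun _ _ => rfl) (𝟙 A) (MonoidHom.id G) le_rfl (fun x => x ∘ (α ≫ β).unop.toOrderHom)
    (fun _ _ => rfl) (𝟙 A) rfl rfl fun _ => rfl).symm

/-- The cosimplicial cochain complex with `n`-cosimplices the inhomogeneous cochains of `G ⧸ N` with
coefficients in `Hom(k[G^{n+1}], A)^N`. -/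
def lhsCosimplicial (A : Rep.{u} k G) :
    CosimplicialObject (CochainComplex (ModuleCat.{u} k) ℕ) where
  obj Δ := groupCohomology.inhomogeneousCochains
    ((funRep (Fin (Δ.len + 1) → G) A).quotientToInvariants N)
  map α := lhsCochainsMap (MonoidHom.id G) le_rfl (fun x => x ∘ α.toOrderHom)
    (fun _ _ => rfl) (𝟙 A)
  map_id _ := lhsCochainsMap_id _ _ _ rfl
  map_comp α β := (lhsCochainsMap_comp (MonoidHom.id G) le_rfl (fun x => x ∘ β.toOrderHom)
    (fun _ _ => rfl) (𝟙 A) (MonoidHom.id G) le_rfl (fun x => x ∘ α.toOrderHom)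
    (fun _ _ => rfl) (𝟙 A) (MonoidHom.id G) le_rfl (fun x => x ∘ (α ≫ β).toOrderHom)
    (fun _ _ => rfl) (𝟙 A) rfl rfl fun _ => rfl).symm

variable {N N'}

/-- Functoriality of `lhsSimplicial`. -/
def lhsSimplicialMap (f : G →* G') (hN : N ≤ N'.comap f) (φ : A ⟶ Rep.res f A') :
    lhsSimplicial N A ⟶ lhsSimplicial N' A' where
  app _ := lhsChainsMap f hN (f ∘ ·) (fun _ _ => funext fun _ => map_mul f _ _) φ
  naturality _ _ α :=
    (lhsChainsMap_comp _ _ _ _ _ _ _ _ _ _ _ hN (fun x => f ∘ x ∘ α.unop.toOrderHom)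
      (fun _ _ => funext fun _ => map_mul f _ _) φ rfl rfl fun _ => rfl).trans
    (lhsChainsMap_comp _ _ _ _ _ _ _ _ _ _ _ hN (fun x => f ∘ x ∘ α.unop.toOrderHom)
      (fun _ _ => funext fun _ => map_mul f _ _) φ rfl rfl fun _ => rfl).symm

/-- Functoriality of `lhsCosimplicial`. -/
def lhsCosimplicialMap (f : G →* G') (hN : N ≤ N'.comap f) (φ : Rep.res f A' ⟶ A) :
    lhsCosimplicial N' A' ⟶ lhsCosimplicial N A where
  app _ := lhsCochainsMap f hN (f ∘ ·) (fun _ _ => funext fun _ => map_mul f _ _) φ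
  naturality _ _ α :=
    (lhsCochainsMap_comp _ _ _ _ _ _ _ _ _ _ _ hN (fun x => f ∘ x ∘ α.toOrderHom)
      (fun _ _ => funext fun _ => map_mul f _ _) φ rfl rfl fun _ => rfl).trans
    (lhsCochainsMap_comp _ _ _ _ _ _ _ _ _ _ _ hN (fun x => f ∘ x ∘ α.toOrderHom)
      (fun _ _ => funext fun _ => map_mul f _ _) φ rfl rfl fun _ => rfl).symm

variable (N) in
/-- The double complex of the homological spectral sequence of the extension
`1 → N → G → G ⧸ N → 1`: outer degree `q`, inner degree `p`. -/
def lhsDoubleComplex (A : Rep.{u} k G) :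
    HomologicalComplex₂ (ModuleCat.{u} k) (ComplexShape.down ℕ) (ComplexShape.down ℕ) :=
  (AlgebraicTopology.alternatingFaceMapComplex _).obj (lhsSimplicial N A)

variable (N) in
/-- The double complex of the cohomological spectral sequence of the extension
`1 → N → G → G ⧸ N → 1`: outer degree `q`, inner degree `p`. -/
def lhsCoDoubleComplex (A : Rep.{u} k G) :
    HomologicalComplex₂ (ModuleCat.{u} k) (ComplexShape.up ℕ) (ComplexShape.up ℕ) :=
  (AlgebraicTopology.alternatingCofaceMapComplex _).obj (lhsCosimplicial N A)

variable (N) in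
/-- The homological Lyndon–Hochschild–Serre spectral sequence. -/
def lhsSS (A : Rep.{u} k G) :
    SpectralSequence (ModuleCat.{u} k) (FilteredComplex.pageShape (-1)) 2 :=
  (totalFiltered (lhsDoubleComplex N A) fun i j (h : j + 1 = i) => by omega).spectralSequence

variable (N) in
/-- The cohomological Lyndon–Hochschild–Serre spectral sequence. -/
def lhsCoSS (A : Rep.{u} k G) :
    SpectralSequence (ModuleCat.{u} k) (FilteredComplex.pageShape 1) 2 :=
  (totalFiltered (lhsCoDoubleComplex N A) fun i j (h : i + 1 = j) => by omega).spectralSequence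

/-- Functoriality of the homological Lyndon–Hochschild–Serre spectral sequence. -/
def lhsSSMap (f : G →* G') (hN : N ≤ N'.comap f) (φ : A ⟶ Rep.res f A') :
    lhsSS N A ⟶ lhsSS N' A' :=
  FilteredComplex.mapSpectralSequence (totalFilteredMap _
    ((AlgebraicTopology.alternatingFaceMapComplex _).map (lhsSimplicialMap f hN φ)))

/-- Functoriality of the cohomological Lyndon–Hochschild–Serre spectral sequence. -/
def lhsCoSSMap (f : G →* G') (hN : N ≤ N'.comap f) (φ : Rep.res f A' ⟶ A) :
    lhsCoSS N' A' ⟶ lhsCoSS N A :=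
  FilteredComplex.mapSpectralSequence (totalFilteredMap _
    ((AlgebraicTopology.alternatingCofaceMapComplex _).map (lhsCosimplicialMap f hN φ)))

variable (N) in
/-- Functoriality of the homological spectral sequence in the coefficients. -/
def lhsSSCoeffMap {A B : Rep.{u} k G} (v : A ⟶ B) : lhsSS N A ⟶ lhsSS N B :=
  lhsSSMap (A := A) (A' := B) (MonoidHom.id G) le_rfl v

variable (N) in
/-- Functoriality of the cohomological spectral sequence in the coefficients. -/
def lhsCoSSCoeffMap {A B : Rep.{u} k G} (v : A ⟶ B) : lhsCoSS N A ⟶ lhsCoSS N B :=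
  lhsCoSSMap (A := B) (A' := A) (MonoidHom.id G) le_rfl v

end

section
variable {k : Type u} [CommRing k] {Λ : Type u}

open DirectSum

open Classical in
/-- The inclusion of a summand in a direct sum of modules. -/
def dsι (M : Λ → ModuleCat.{u} k) (l : Λ) : M l ⟶ ModuleCat.of k (⨁ l, M l) :=
  ModuleCat.ofHom (DirectSum.lof k Λ (fun l => M l) l)

open Classical in
/-- The morphism from a direct sum of modules with given components. -/
def dsDesc {M : Λ → ModuleCat.{u} k} {P : ModuleCat.{u} k} (f : ∀ l, M l ⟶ P) :
    ModuleCat.of k (⨁ l, M l) ⟶ P :=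
  ModuleCat.ofHom (DirectSum.toModule k Λ P fun l => (f l).hom)

lemma dsι_desc {M : Λ → ModuleCat.{u} k} {P : ModuleCat.{u} k} (f : ∀ l, M l ⟶ P) (l : Λ) :
    dsι M l ≫ dsDesc f = f l := by
  classical
  refine ModuleCat.hom_ext (LinearMap.ext fun x => ?_)
  exact DirectSum.toModule_lof k (φ := fun l => (f l).hom) l x

lemma ds_hom_ext {M : Λ → ModuleCat.{u} k} {P : ModuleCat.{u} k}
    {f g : ModuleCat.of k (⨁ l, M l) ⟶ P} (h : ∀ l, dsι M l ≫ f = dsι M l ≫ g) : f = g := by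
  classical
  refine ModuleCat.hom_ext (DirectSum.linearMap_ext k fun l => LinearMap.ext fun x => ?_)
  exact congr($(h l).hom x)

/-- The direct sum of morphisms of modules. -/
def dsMap {M M' : Λ → ModuleCat.{u} k} (f : ∀ l, M l ⟶ M' l) :
    ModuleCat.of k (⨁ l, M l) ⟶ ModuleCat.of k (⨁ l, M' l) :=
  dsDesc fun l => f l ≫ dsι M' l

lemma dsι_map {M M' : Λ → ModuleCat.{u} k} (f : ∀ l, M l ⟶ M' l) (l : Λ) :
    dsι M l ≫ dsMap f = f l ≫ dsι M' l := dsι_desc _ _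

lemma dsMap_desc {M M' : Λ → ModuleCat.{u} k} {P : ModuleCat.{u} k} (f : ∀ l, M l ⟶ M' l)
    (g : ∀ l, M' l ⟶ P) : dsMap f ≫ dsDesc g = dsDesc fun l => f l ≫ g l :=
  ds_hom_ext fun l => by
    rw [← Category.assoc, dsι_map, Category.assoc, dsι_desc, dsι_desc]

lemma dsDesc_comm {M M' : Λ → ModuleCat.{u} k} {P P' : ModuleCat.{u} k} (f : ∀ l, M l ⟶ P)
    (d : P ⟶ P') (e : ∀ l, M l ⟶ M' l) (f' : ∀ l, M' l ⟶ P') (h : ∀ l, f l ≫ d = e l ≫ f' l) :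
    dsDesc f ≫ d = dsMap e ≫ dsDesc f' :=
  ds_hom_ext fun l => by rw [← Category.assoc, dsι_desc, dsMap_desc, dsι_desc, h]

/-- The direct sum of isomorphisms of modules. -/
def dsMapIso {M M' : Λ → ModuleCat.{u} k} (e : ∀ l, M l ≅ M' l) :
    ModuleCat.of k (⨁ l, M l) ≅ ModuleCat.of k (⨁ l, M' l) where
  hom := dsMap fun l => (e l).hom
  inv := dsMap fun l => (e l).inv
  hom_inv_id := ds_hom_ext fun l => by
    rw [← Category.assoc, dsι_map, Category.assoc, dsι_map, Iso.hom_inv_id_assoc, Category.comp_id]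
  inv_hom_id := ds_hom_ext fun l => by
    rw [← Category.assoc, dsι_map, Category.assoc, dsι_map, Iso.inv_hom_id_assoc, Category.comp_id]

/-- The projection to a summand of a direct sum of modules. -/
def dsπ (M : Λ → ModuleCat.{u} k) (l : Λ) : ModuleCat.of k (⨁ l, M l) ⟶ M l :=
  ModuleCat.ofHom (DirectSum.component k Λ (fun l => M l) l)

lemma dsι_π_self (M : Λ → ModuleCat.{u} k) (l : Λ) : dsι M l ≫ dsπ M l = 𝟙 _ := by
  classical
  exact ModuleCat.hom_ext (LinearMap.ext fun x =>
    DirectSum.component.lof_self k (M := fun l => M l) l x)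

lemma dsι_π_ne (M : Λ → ModuleCat.{u} k) (l l' : Λ) (h : l ≠ l') :
    dsι M l ≫ dsπ M l' = 0 := by
  classical
  refine ModuleCat.hom_ext (LinearMap.ext fun x => ?_)
  refine (DirectSum.component.of k (M := fun l => M l) l' l x).trans ?_
  rw [dif_neg h]
  rfl

lemma dsMap_π {M M' : Λ → ModuleCat.{u} k} (f : ∀ l, M l ⟶ M' l) (l : Λ) :
    dsMap f ≫ dsπ M' l = dsπ M l ≫ f l := by
  refine ds_hom_ext fun l' => ?_
  rw [← Category.assoc, dsι_map, Category.assoc, ← Category.assoc (dsι M l')]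
  by_cases h : l' = l
  · subst h
    rw [dsι_π_self, dsι_π_self, Category.comp_id, Category.id_comp]
  · rw [dsι_π_ne _ _ _ h, dsι_π_ne _ _ _ h, comp_zero, zero_comp]

lemma ds_ext {M : Λ → ModuleCat.{u} k} {x y : ⨁ l, M l}
    (h : ∀ l, (dsπ M l).hom x = (dsπ M l).hom y) : x = y :=
  DirectSum.ext_component k h

lemma ds_eq_sum (M : Λ → ModuleCat.{u} k) (x : ⨁ l, M l) :
    ∃ s : Finset Λ, x = ∑ l ∈ s, (dsι M l).hom ((dsπ M l).hom x) := by
  classical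
  exact ⟨_, (DirectSum.sum_support_of x).symm⟩

variable {ι : Type*} {c : ComplexShape ι} (K : Λ → HomologicalComplex (ModuleCat.{u} k) c)

/-- The direct sum of a family of complexes of modules. -/
def dsComplex : HomologicalComplex (ModuleCat.{u} k) c where
  X i := ModuleCat.of k (⨁ l, (K l).X i)
  d i j := dsMap fun l => (K l).d i j
  shape i j h := ds_hom_ext fun l => by rw [dsι_map, (K l).shape i j h, zero_comp, comp_zero]
  d_comp_d' i j m _ _ := ds_hom_ext fun l => by
    rw [← Category.assoc, dsι_map, Category.assoc, dsι_map, ← Category.assoc, (K l).d_comp_d,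
      zero_comp, comp_zero]

/-- The inclusion of a summand in a direct sum of complexes. -/
def dsComplexι (l : Λ) : K l ⟶ dsComplex K where
  f i := dsι (fun l => (K l).X i) l
  comm' i j _ := dsι_map (fun l => (K l).d i j) l

/-- The projection to a summand of a direct sum of complexes. -/
def dsComplexπ (l : Λ) : dsComplex K ⟶ K l where
  f i := dsπ (fun l => (K l).X i) l
  comm' i j _ := (dsMap_π (fun l => (K l).d i j) l).symm

variable {K} in
/-- The morphism from a direct sum of complexes with given components. -/
def dsComplexDesc {L : HomologicalComplex (ModuleCat.{u} k) c} (f : ∀ l, K l ⟶ L) :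
    dsComplex K ⟶ L where
  f i := dsDesc fun l => (f l).f i
  comm' i j _ := dsDesc_comm _ _ _ _ fun l => (f l).comm i j

lemma dsComplexι_desc {L : HomologicalComplex (ModuleCat.{u} k) c} (f : ∀ l, K l ⟶ L) (l : Λ) :
    dsComplexι K l ≫ dsComplexDesc f = f l :=
  HomologicalComplex.hom_ext _ _ fun i => dsι_desc (fun l => (f l).f i) l

/-- The canonical map from the direct sum of the homology modules. -/
def dsHomologyMap (i : ι) :
    ModuleCat.of k (⨁ l, (K l).homology i) ⟶ (dsComplex K).homology i :=
  dsDesc fun l => HomologicalComplex.homologyMap (dsComplexι K l) i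

lemma dsHomologyMap_π (i : ι) (l : Λ) :
    dsHomologyMap K i ≫ HomologicalComplex.homologyMap (dsComplexπ K l) i = dsπ _ l := by
  refine ds_hom_ext fun l' => ?_
  rw [dsHomologyMap, ← Category.assoc, dsι_desc, ← HomologicalComplex.homologyMap_comp]
  by_cases h : l' = l
  · subst h
    rw [dsι_π_self, ← HomologicalComplex.homologyMap_id]
    congr 1
    exact HomologicalComplex.hom_ext _ _ fun i => dsι_π_self (fun l => (K l).X i) l'
  · rw [dsι_π_ne _ _ _ h, ← HomologicalComplex.homologyMap_zero]
    congr 1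
    exact HomologicalComplex.hom_ext _ _ fun i => dsι_π_ne (fun l => (K l).X i) l' l h

lemma dsHomologyMap_injective (i : ι) : Function.Injective (dsHomologyMap K i).hom := by
  intro x y h
  refine ds_ext fun l => ?_
  rw [← dsHomologyMap_π]
  exact congr_arg (HomologicalComplex.homologyMap (dsComplexπ K l) i).hom h

lemma dsHomologyMap_surjective (i : ι) : Function.Surjective (dsHomologyMap K i).hom := by
  intro y
  obtain ⟨z, rfl⟩ :=
    (ModuleCat.epi_iff_surjective ((dsComplex K).homologyπ i)).1 inferInstance y
  obtain ⟨s, hs⟩ := ds_eq_sum (fun l => (K l).X i) (((dsComplex K).iCycles i).hom z)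
  refine ⟨∑ l ∈ s, (dsι _ l).hom (((K l).homologyπ i).hom
    ((HomologicalComplex.cyclesMap (dsComplexπ K l) i).hom z)), ?_⟩
  have h1 (l : Λ) (w : (K l).cycles i) :
      (dsHomologyMap K i).hom ((dsι _ l).hom (((K l).homologyπ i).hom w)) =
      ((dsComplex K).homologyπ i).hom
        ((HomologicalComplex.cyclesMap (dsComplexι K l) i).hom w) := by
    have e1 := congr($(dsι_desc (fun l => HomologicalComplex.homologyMap (dsComplexι K l) i)
      l).hom (((K l).homologyπ i).hom w))
    have e2 := congr($(HomologicalComplex.homologyπ_naturality (dsComplexι K l) i).hom w)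
    exact e1.trans e2
  rw [map_sum, Finset.sum_congr rfl fun l _ => h1 l _, ← map_sum]
  refine congr_arg ((dsComplex K).homologyπ i).hom ?_
  apply (ModuleCat.mono_iff_injective ((dsComplex K).iCycles i)).1 inferInstance
  refine Eq.trans ?_ hs.symm
  refine (map_sum ((dsComplex K).iCycles i).hom _ _).trans (Finset.sum_congr rfl fun l _ => ?_)
  have e1 := congr($(HomologicalComplex.cyclesMap_i (dsComplexι K l) i).hom
    ((HomologicalComplex.cyclesMap (dsComplexπ K l) i).hom z))
  have e2 := congr($(HomologicalComplex.cyclesMap_i (dsComplexπ K l) i).hom z)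
  exact e1.trans (congr_arg (dsι (fun l => (K l).X i) l).hom e2)

instance (i : ι) : IsIso (dsHomologyMap K i) :=
  (ConcreteCategory.isIso_iff_bijective _).2
    ⟨dsHomologyMap_injective K i, dsHomologyMap_surjective K i⟩

variable {K} in
lemma dsSS_comm {L : HomologicalComplex (ModuleCat.{u} k) c} (i : ι) {M : Λ → ModuleCat.{u} k}
    {P : ModuleCat.{u} k} (f : ∀ l, K l ⟶ L) (e : ∀ l, (K l).homology i ⟶ M l)
    {e' : L.homology i ⟶ P} (g : ∀ l, M l ⟶ P)
    (h : ∀ l, HomologicalComplex.homologyMap (f l) i ≫ e' = e l ≫ g l) :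
    HomologicalComplex.homologyMap (dsComplexDesc f) i ≫ e' =
      (inv (dsHomologyMap K i) ≫ dsMap e) ≫ dsDesc g := by
  rw [Category.assoc, IsIso.eq_inv_comp, dsMap_desc]
  refine ds_hom_ext fun l => ?_
  rw [dsHomologyMap, ← Category.assoc, ← Category.assoc, dsι_desc,
    ← HomologicalComplex.homologyMap_comp, dsComplexι_desc, dsι_desc, h]

variable {κ : Type*} {c' : ℤ → ComplexShape κ} {r₀ : ℤ}
  (E : Λ → SpectralSequence (ModuleCat.{u} k) c' r₀)

/-- The direct sum of a family of spectral sequences. -/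
def dsSS : SpectralSequence (ModuleCat.{u} k) c' r₀ where
  page r hr := dsComplex fun l => (E l).page r hr
  iso r r' pq h hr := (asIso (dsHomologyMap (fun l => (E l).page r hr) pq)).symm ≪≫
    dsMapIso fun l => (E l).iso r r' pq h hr

variable {E} in
/-- The morphism from a direct sum of spectral sequences with given components. -/
def dsSSDesc {F : SpectralSequence (ModuleCat.{u} k) c' r₀} (f : ∀ l, E l ⟶ F) :
    dsSS E ⟶ F where
  hom r hr := dsComplexDesc fun l => (f l).hom r hr
  comm r r' pq h hr := by
    exact dsSS_comm pq _ _ _ fun l => (f l).comm r r' pq h hr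

end

section
variable {k : Type u} [CommRing k] {Λ : Type u}

/-- The projection to a factor of a product of modules. -/
def prπ (M : Λ → ModuleCat.{u} k) (l : Λ) : ModuleCat.of k (∀ l, M l) ⟶ M l :=
  ModuleCat.ofHom (LinearMap.proj l)

/-- The morphism to a product of modules with given components. -/
def prLift {M : Λ → ModuleCat.{u} k} {P : ModuleCat.{u} k} (f : ∀ l, P ⟶ M l) :
    P ⟶ ModuleCat.of k (∀ l, M l) :=
  ModuleCat.ofHom (LinearMap.pi fun l => (f l).hom)

lemma prLift_π {M : Λ → ModuleCat.{u} k} {P : ModuleCat.{u} k} (f : ∀ l, P ⟶ M l) (l : Λ) :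
    prLift f ≫ prπ M l = f l := rfl

lemma pr_hom_ext {M : Λ → ModuleCat.{u} k} {P : ModuleCat.{u} k}
    {f g : P ⟶ ModuleCat.of k (∀ l, M l)} (h : ∀ l, f ≫ prπ M l = g ≫ prπ M l) : f = g :=
  ModuleCat.hom_ext (LinearMap.ext fun x => funext fun l => congr($(h l).hom x))

/-- The product of morphisms of modules. -/
def prMap {M M' : Λ → ModuleCat.{u} k} (f : ∀ l, M l ⟶ M' l) :
    ModuleCat.of k (∀ l, M l) ⟶ ModuleCat.of k (∀ l, M' l) :=
  prLift fun l => prπ M l ≫ f l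

lemma prMap_π {M M' : Λ → ModuleCat.{u} k} (f : ∀ l, M l ⟶ M' l) (l : Λ) :
    prMap f ≫ prπ M' l = prπ M l ≫ f l := rfl

/-- The product of isomorphisms of modules. -/
def prMapIso {M M' : Λ → ModuleCat.{u} k} (e : ∀ l, M l ≅ M' l) :
    ModuleCat.of k (∀ l, M l) ≅ ModuleCat.of k (∀ l, M' l) where
  hom := prMap fun l => (e l).hom
  inv := prMap fun l => (e l).inv
  hom_inv_id := pr_hom_ext fun l => by
    rw [Category.assoc, prMap_π, ← Category.assoc, prMap_π, Category.assoc, Iso.hom_inv_id,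
      Category.comp_id, Category.id_comp]
  inv_hom_id := pr_hom_ext fun l => by
    rw [Category.assoc, prMap_π, ← Category.assoc, prMap_π, Category.assoc, Iso.inv_hom_id,
      Category.comp_id, Category.id_comp]

lemma prLift_comm {M M' : Λ → ModuleCat.{u} k} {P P' : ModuleCat.{u} k} (f : ∀ l, P ⟶ M l)
    (d : P ⟶ P') (e : ∀ l, M l ⟶ M' l) (f' : ∀ l, P' ⟶ M' l) (h : ∀ l, f l ≫ e l = d ≫ f' l) :
    prLift f ≫ prMap e = d ≫ prLift f' :=
  pr_hom_ext fun l => by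
    rw [Category.assoc, prMap_π, ← Category.assoc, prLift_π, Category.assoc, prLift_π, h]

variable {ι : Type*} {c : ComplexShape ι} (K : Λ → HomologicalComplex (ModuleCat.{u} k) c)

/-- The product of a family of complexes of modules. -/
def prComplex : HomologicalComplex (ModuleCat.{u} k) c where
  X i := ModuleCat.of k (∀ l, (K l).X i)
  d i j := prMap fun l => (K l).d i j
  shape i j h := pr_hom_ext fun l => by rw [prMap_π, (K l).shape i j h, zero_comp, comp_zero]
  d_comp_d' i j m _ _ := pr_hom_ext fun l => by
    rw [Category.assoc, prMap_π, ← Category.assoc, prMap_π, Category.assoc, (K l).d_comp_d,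
      zero_comp, comp_zero]

/-- The projection to a factor of a product of complexes. -/
def prComplexπ (l : Λ) : prComplex K ⟶ K l where
  f i := prπ (fun l => (K l).X i) l
  comm' i j _ := (prMap_π (fun l => (K l).d i j) l).symm

variable {K} in
/-- The morphism to a product of complexes with given components. -/
def prComplexLift {L : HomologicalComplex (ModuleCat.{u} k) c} (f : ∀ l, L ⟶ K l) :
    L ⟶ prComplex K where
  f i := prLift fun l => (f l).f i
  comm' i j _ := prLift_comm _ _ _ _ fun l => (f l).comm i j

lemma prComplexLift_π {L : HomologicalComplex (ModuleCat.{u} k) c} (f : ∀ l, L ⟶ K l) (l : Λ) :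
    prComplexLift f ≫ prComplexπ K l = f l := rfl

/-- The canonical map to the product of the homology modules. -/
def prHomologyMap (i : ι) :
    (prComplex K).homology i ⟶ ModuleCat.of k (∀ l, (K l).homology i) :=
  prLift fun l => HomologicalComplex.homologyMap (prComplexπ K l) i

lemma prHomologyMap_mk (i : ι) (z : (prComplex K).cycles i) (l : Λ) :
    (prHomologyMap K i).hom (((prComplex K).homologyπ i).hom z) l =
      ((K l).homologyπ i).hom ((HomologicalComplex.cyclesMap (prComplexπ K l) i).hom z) :=
  congr($(HomologicalComplex.homologyπ_naturality (prComplexπ K l) i).hom z)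

lemma iCycles_cyclesMap_prComplexπ (i : ι) (z : (prComplex K).cycles i) (l : Λ) :
    ((K l).iCycles i).hom ((HomologicalComplex.cyclesMap (prComplexπ K l) i).hom z) =
      (((prComplex K).iCycles i).hom z : ∀ l, (K l).X i) l :=
  congr($(HomologicalComplex.cyclesMap_i (prComplexπ K l) i).hom z)

lemma prHomologyMap_injective (i : ι) : Function.Injective (prHomologyMap K i).hom := by
  rw [injective_iff_map_eq_zero]
  intro x hx
  obtain ⟨z, rfl⟩ :=
    (ModuleCat.epi_iff_surjective ((prComplex K).homologyπ i)).1 inferInstance x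
  have h (l : Λ) : ∃ w, ((K l).d (c.prev i) i).hom w =
      (((prComplex K).iCycles i).hom z : ∀ l, (K l).X i) l := by
    have e := congr_fun hx l
    rw [prHomologyMap_mk] at e
    obtain ⟨j, w, hw⟩ := (homologyπ_eq_zero_iff (K l) i _).1 e
    rw [iCycles_cyclesMap_prComplexπ] at hw
    by_cases hj : c.Rel j i
    · obtain rfl := c.prev_eq' hj
      exact ⟨w, hw⟩
    · rw [(K l).shape _ _ hj] at hw
      exact ⟨0, (map_zero _).trans hw⟩
  choose w hw using h
  exact (homologyπ_eq_zero_iff (prComplex K) i z).2 ⟨c.prev i, w, funext hw⟩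

lemma prHomologyMap_surjective (i : ι) : Function.Surjective (prHomologyMap K i).hom := by
  intro y
  have h (l : Λ) : ∃ z, ((K l).homologyπ i).hom z = (y : ∀ l, (K l).homology i) l :=
    (ModuleCat.epi_iff_surjective ((K l).homologyπ i)).1 inferInstance _
  choose z hz using h
  obtain ⟨w, hw⟩ := exists_cycles_of_d_eq_zero (prComplex K) i (fun l => ((K l).iCycles i).hom (z l))
    fun j => funext fun l => congr($((K l).iCycles_d i j).hom (z l))
  refine ⟨((prComplex K).homologyπ i).hom w, funext fun l => ?_⟩
  rw [prHomologyMap_mk, ← hz]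
  refine congr_arg ((K l).homologyπ i).hom ?_
  apply (ModuleCat.mono_iff_injective ((K l).iCycles i)).1 inferInstance
  exact (iCycles_cyclesMap_prComplexπ K i w l).trans (congr_fun hw l)

instance (i : ι) : IsIso (prHomologyMap K i) :=
  (ConcreteCategory.isIso_iff_bijective _).2
    ⟨prHomologyMap_injective K i, prHomologyMap_surjective K i⟩

variable {K} in
lemma prSS_comm {L : HomologicalComplex (ModuleCat.{u} k) c} (i : ι) {M : Λ → ModuleCat.{u} k}
    {P : ModuleCat.{u} k} (f : ∀ l, L ⟶ K l) (e : ∀ l, (K l).homology i ⟶ M l)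
    (e' : L.homology i ⟶ P) (g : ∀ l, P ⟶ M l)
    (h : ∀ l, HomologicalComplex.homologyMap (f l) i ≫ e l = e' ≫ g l) :
    HomologicalComplex.homologyMap (prComplexLift f) i ≫ prHomologyMap K i ≫ prMap e =
      e' ≫ prLift g := by
  refine pr_hom_ext fun l => ?_
  rw [Category.assoc, Category.assoc, Category.assoc, prMap_π, prLift_π, ← h, prHomologyMap,
    ← Category.assoc (prLift _), prLift_π, ← Category.assoc,
    ← HomologicalComplex.homologyMap_comp, prComplexLift_π]

variable {κ : Type*} {c' : ℤ → ComplexShape κ} {r₀ : ℤ}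
  (E : Λ → SpectralSequence (ModuleCat.{u} k) c' r₀)

/-- The product of a family of spectral sequences. -/
def prSS : SpectralSequence (ModuleCat.{u} k) c' r₀ where
  page r hr := prComplex fun l => (E l).page r hr
  iso r r' pq h hr := asIso (prHomologyMap (fun l => (E l).page r hr) pq) ≪≫
    prMapIso fun l => (E l).iso r r' pq h hr

variable {E} in
/-- The morphism to a product of spectral sequences with given components. -/
def prSSLift {F : SpectralSequence (ModuleCat.{u} k) c' r₀} (f : ∀ l, F ⟶ E l) :
    F ⟶ prSS E where
  hom r hr := prComplexLift fun l => (f l).hom r hr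
  comm r r' pq h hr := prSS_comm pq _ _ _ _ fun l => (f l).comm r r' pq h hr

end

section
variable {k : Type u} [CommRing k] {G : Type u} [Group G]

/-- The action of `g` as a morphism from `A` to its restriction along conjugation by `g`. -/
def innerHom (g : G) (A : Rep.{u} k G) : A ⟶ Rep.res (MulAut.conj g).toMonoidHom A :=
  Rep.ofHom (σ := A.ρ.comp (MulAut.conj g).toMonoidHom)
    { toLinearMap := A.ρ g
      isIntertwining' := fun x => LinearMap.ext fun a => by
        change (A.ρ g * A.ρ x) a = (A.ρ (g * x * g⁻¹) * A.ρ g) a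
        rw [← map_mul, ← map_mul, inv_mul_cancel_right] }

lemma innerHom_chainsMap_comm (g : G) {A B : Rep.{u} k G} (u : A ⟶ B) :
    groupHomology.chainsMap (MulAut.conj g).toMonoidHom (innerHom g A) ≫
      groupHomology.chainsMap (MonoidHom.id G) u =
    groupHomology.chainsMap (MonoidHom.id G) u ≫
      groupHomology.chainsMap (MulAut.conj g).toMonoidHom (innerHom g B) := by
  rw [← groupHomology.chainsMap_comp, ← groupHomology.chainsMap_comp]
  refine groupHomology.chainsMap_congr rfl (LinearMap.ext fun a => ?_)
  exact Rep.hom_comm_apply u g a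

/-- Inner automorphisms act trivially on group homology. -/
lemma groupHomology_map_innerHom (g : G) (n : ℕ) : ∀ A : Rep.{u} k G,
    groupHomology.map (MulAut.conj g).toMonoidHom (innerHom g A) n = 𝟙 _ := by
  induction n with
  | zero =>
    intro A
    rw [← cancel_epi (groupHomology.H0π A), groupHomology.H0π_comp_map, Category.comp_id,
      ← cancel_mono (groupHomology.H0Iso A).hom, Category.assoc, groupHomology.H0π_comp_H0Iso_hom]
    refine ModuleCat.hom_ext (LinearMap.ext fun a => ?_)
    exact Representation.Coinvariants.mk_self_apply A.ρ g a
  | succ n ih =>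
    intro A
    classical
    let adj := Rep.indResAdjunction.{u} k (⊥ : Subgroup G).subtype
    let e := adj.counit.app A
    let X : ShortComplex (Rep.{u} k G) := ShortComplex.mk (kernel.ι e) e (kernel.condition e)
    have hX : X.ShortExact :=
      { exact := ShortComplex.exact_of_f_is_kernel _ (kernelIsKernel e)
        mono_f := inferInstanceAs (Mono (kernel.ι e))
        epi_g := inferInstanceAs (Epi e) }
    have hz : IsZero (groupHomology X.X₂ (n + 1)) :=
      (isZero_groupHomology_succ_of_subsingleton _ n).of_iso
        (groupHomology.indIso (⊥ : Subgroup G) (Rep.res (⊥ : Subgroup G).subtype A) (n + 1))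
    have := groupHomology.mono_δ_of_isZero hX n hz
    let φ : X.map (groupHomology.chainsFunctor k G) ⟶ X.map (groupHomology.chainsFunctor k G) :=
      { τ₁ := groupHomology.chainsMap (MulAut.conj g).toMonoidHom (innerHom g X.X₁)
        τ₂ := groupHomology.chainsMap (MulAut.conj g).toMonoidHom (innerHom g X.X₂)
        τ₃ := groupHomology.chainsMap (MulAut.conj g).toMonoidHom (innerHom g X.X₃)
        comm₁₂ := innerHom_chainsMap_comm g X.f
        comm₂₃ := innerHom_chainsMap_comm g X.g }
    have hn := HomologicalComplex.HomologySequence.δ_naturality φ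
      (groupHomology.map_chainsFunctor_shortExact hX)
      (groupHomology.map_chainsFunctor_shortExact hX) (n + 1) n rfl
    have h1 : HomologicalComplex.homologyMap φ.τ₁ n = 𝟙 _ := ih X.X₁
    rw [h1] at hn
    rw [← cancel_mono (groupHomology.δ hX (n + 1) n rfl)]
    exact hn.symm.trans ((Category.comp_id _).trans (Category.id_comp _).symm)

/-- The action of `g⁻¹`, as a morphism to `A` from its restriction along conjugation by `g⁻¹`,
is inverse to `innerHom`; this is the version for cohomology. -/
def innerCoHom (g : G) (A : Rep.{u} k G) : Rep.res (MulAut.conj g⁻¹).toMonoidHom A ⟶ A :=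
  Rep.ofHom (ρ := A.ρ.comp (MulAut.conj g⁻¹).toMonoidHom)
    { toLinearMap := A.ρ g
      isIntertwining' := fun x => LinearMap.ext fun a => by
        change (A.ρ g * A.ρ (g⁻¹ * x * g⁻¹⁻¹)) a = (A.ρ x * A.ρ g) a
        rw [← map_mul, ← map_mul, inv_inv, ← mul_assoc, mul_inv_cancel_left] }

lemma innerCoHom_cochainsMap_comm (g : G) {A B : Rep.{u} k G} (u : A ⟶ B) :
    groupCohomology.cochainsMap (MulAut.conj g⁻¹).toMonoidHom (innerCoHom g A) ≫
      groupCohomology.cochainsMap (MonoidHom.id G) u =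
    groupCohomology.cochainsMap (MonoidHom.id G) u ≫
      groupCohomology.cochainsMap (MulAut.conj g⁻¹).toMonoidHom (innerCoHom g B) := by
  refine HomologicalComplex.hom_ext _ _ fun n => ModuleCat.hom_ext (LinearMap.ext fun F => ?_)
  refine funext fun x => ?_
  exact Rep.hom_comm_apply u g _

/-- Inner automorphisms act trivially on group cohomology. -/
lemma groupCohomology_map_innerCoHom (g : G) (n : ℕ) : ∀ A : Rep.{u} k G,
    groupCohomology.map (MulAut.conj g⁻¹).toMonoidHom (innerCoHom g A) n = 𝟙 _ := by
  induction n with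
  | zero =>
    intro A
    rw [← cancel_mono (groupCohomology.H0Iso A).hom, Category.id_comp]
    refine ModuleCat.hom_ext (LinearMap.ext fun a => Subtype.ext ?_)
    exact congr($(groupCohomology.map_H0Iso_hom_f (MulAut.conj g⁻¹).toMonoidHom
      (innerCoHom g A)).hom a).trans (((groupCohomology.H0Iso A).hom.hom a).2 g)
  | succ n ih =>
    intro A
    let adj := Rep.resCoindAdjunction.{u, u, u, u} k (⊥ : Subgroup G).subtype
    let e := adj.unit.app A
    let X : ShortComplex (Rep.{u} k G) := ShortComplex.mk e (cokernel.π e) (cokernel.condition e)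
    have hX : X.ShortExact :=
      { exact := ShortComplex.exact_of_g_is_cokernel _ (cokernelIsCokernel e)
        mono_f := inferInstanceAs (Mono e)
        epi_g := inferInstanceAs (Epi (cokernel.π e)) }
    have hz : IsZero (groupCohomology X.X₂ (n + 1)) :=
      (isZero_groupCohomology_succ_of_subsingleton _ n).of_iso
        (groupCohomology.coindIso (S := (⊥ : Subgroup G))
          (Rep.res (⊥ : Subgroup G).subtype A) (n + 1))
    have := groupCohomology.epi_δ_of_isZero hX n hz
    let φ : X.map (groupCohomology.cochainsFunctor k G) ⟶
        X.map (groupCohomology.cochainsFunctor k G) :=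
      { τ₁ := groupCohomology.cochainsMap (MulAut.conj g⁻¹).toMonoidHom (innerCoHom g X.X₁)
        τ₂ := groupCohomology.cochainsMap (MulAut.conj g⁻¹).toMonoidHom (innerCoHom g X.X₂)
        τ₃ := groupCohomology.cochainsMap (MulAut.conj g⁻¹).toMonoidHom (innerCoHom g X.X₃)
        comm₁₂ := innerCoHom_cochainsMap_comm g X.f
        comm₂₃ := innerCoHom_cochainsMap_comm g X.g }
    have hn := HomologicalComplex.HomologySequence.δ_naturality φ
      (groupCohomology.map_cochainsFunctor_shortExact hX)
      (groupCohomology.map_cochainsFunctor_shortExact hX) n (n + 1) rfl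
    have h1 : HomologicalComplex.homologyMap φ.τ₃ n = 𝟙 _ := ih X.X₃
    rw [h1] at hn
    rw [← cancel_epi (groupCohomology.δ hX n (n + 1) rfl)]
    exact hn.trans ((Category.id_comp _).trans (Category.comp_id _).symm)

end

section
variable {k : Type u} [CommRing k] {G G' : Type u} [Group G] [Group G']
variable (N : Subgroup G) [N.Normal] (N' : Subgroup G') [N'.Normal]
variable (A : Rep.{u} k G) {A' : Rep.{u} k G'}

lemma homologyMap_sq {ι : Type*} {c : ComplexShape ι}
    {K₁ K₂ K₃ K₄ : HomologicalComplex (ModuleCat.{u} k) c} {a : K₁ ⟶ K₂} {b : K₂ ⟶ K₄}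
    {a' : K₁ ⟶ K₃} {b' : K₃ ⟶ K₄} (q : ι) (h : a ≫ b = a' ≫ b') :
    HomologicalComplex.homologyMap a q ≫ HomologicalComplex.homologyMap b q =
      HomologicalComplex.homologyMap a' q ≫ HomologicalComplex.homologyMap b' q := by
  rw [← HomologicalComplex.homologyMap_comp, ← HomologicalComplex.homologyMap_comp, h]

/-- The action of `g` as a morphism from `A` to its restriction along conjugation by `g`, as
modules over a normal subgroup `N`. -/
def conjHom (g : G) : Rep.res N.subtype A ⟶
    Rep.res (MulAut.conjNormal (H := N) g).toMonoidHom (Rep.res N.subtype A) :=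
  Rep.ofHom (ρ := A.ρ.comp N.subtype)
    (σ := (A.ρ.comp N.subtype).comp (MulAut.conjNormal (H := N) g).toMonoidHom)
    { toLinearMap := A.ρ g
      isIntertwining' := fun x => LinearMap.ext fun a => by
        change (A.ρ g * A.ρ x) a = (A.ρ (g * x * g⁻¹) * A.ρ g) a
        rw [← map_mul, ← map_mul, inv_mul_cancel_right] }

/-- The action of `g` as a morphism to `A` from its restriction along conjugation by `g⁻¹`, as
modules over a normal subgroup `N`. -/
def conjCoHom (g : G) : Rep.res (MulAut.conjNormal (H := N) g⁻¹).toMonoidHom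
    (Rep.res N.subtype A) ⟶ Rep.res N.subtype A :=
  Rep.ofHom (ρ := (A.ρ.comp N.subtype).comp (MulAut.conjNormal (H := N) g⁻¹).toMonoidHom)
    (σ := A.ρ.comp N.subtype)
    { toLinearMap := A.ρ g
      isIntertwining' := fun x => LinearMap.ext fun a => by
        change (A.ρ g * A.ρ (g⁻¹ * x * g⁻¹⁻¹)) a = (A.ρ x * A.ρ g) a
        rw [← map_mul, ← map_mul, inv_inv, ← mul_assoc, mul_inv_cancel_left] }

/-- The conjugation action of `G` on `H_q(N; A)`: `g` acts by the map induced by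
`n ↦ g n g⁻¹`, `a ↦ g a`. -/
def homologyAction (q : ℕ) :
    Representation k G (groupHomology (Rep.res N.subtype A) q) where
  toFun g := (groupHomology.map (MulAut.conjNormal (H := N) g).toMonoidHom (conjHom N A g) q).hom
  map_one' := by
    have : groupHomology.chainsMap (MulAut.conjNormal (H := N) (1 : G)).toMonoidHom
        (conjHom N A 1) =
        groupHomology.chainsMap (MonoidHom.id N) (𝟙 (Rep.res N.subtype A)) :=
      groupHomology.chainsMap_congr (MonoidHom.ext fun n => Subtype.ext
        (by change (1 : G) * n * (1 : G)⁻¹ = n; group)) A.ρ.map_one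
    rw [groupHomology.map, this, groupHomology.chainsMap_id, HomologicalComplex.homologyMap_id]
    rfl
  map_mul' g h := by
    have : groupHomology.chainsMap (MulAut.conjNormal (H := N) (g * h)).toMonoidHom
        (conjHom N A (g * h)) =
        groupHomology.chainsMap (MulAut.conjNormal (H := N) h).toMonoidHom (conjHom N A h) ≫
        groupHomology.chainsMap (MulAut.conjNormal (H := N) g).toMonoidHom (conjHom N A g) := by
      rw [← groupHomology.chainsMap_comp]
      exact groupHomology.chainsMap_congr (by rw [map_mul]; rfl) (A.ρ.map_mul g h)
    rw [groupHomology.map, this, HomologicalComplex.homologyMap_comp]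
    rfl

/-- The conjugation action of `G` on `H^q(N; A)`: `g` acts by the map induced by
`n ↦ g⁻¹ n g`, `a ↦ g a`. -/
def cohomologyAction (q : ℕ) :
    Representation k G (groupCohomology (Rep.res N.subtype A) q) where
  toFun g :=
    (groupCohomology.map (MulAut.conjNormal (H := N) g⁻¹).toMonoidHom (conjCoHom N A g) q).hom
  map_one' := by
    have : groupCohomology.cochainsMap (MulAut.conjNormal (H := N) (1 : G)⁻¹).toMonoidHom
        (conjCoHom N A 1) = 𝟙 _ := by
      refine HomologicalComplex.hom_ext _ _ fun n => ModuleCat.hom_ext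
        (LinearMap.ext fun F => funext fun x => ?_)
      change A.ρ 1 (F (fun i => MulAut.conjNormal (H := N) (1 : G)⁻¹ (x i))) = F x
      rw [map_one, inv_one, map_one]
      rfl
    rw [groupCohomology.map, this, HomologicalComplex.homologyMap_id]
    rfl
  map_mul' g h := by
    have : groupCohomology.cochainsMap (MulAut.conjNormal (H := N) (g * h)⁻¹).toMonoidHom
        (conjCoHom N A (g * h)) =
        groupCohomology.cochainsMap (MulAut.conjNormal (H := N) h⁻¹).toMonoidHom
          (conjCoHom N A h) ≫
        groupCohomology.cochainsMap (MulAut.conjNormal (H := N) g⁻¹).toMonoidHom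
          (conjCoHom N A g) := by
      refine HomologicalComplex.hom_ext _ _ fun n => ModuleCat.hom_ext
        (LinearMap.ext fun F => funext fun x => ?_)
      change A.ρ (g * h) (F (fun i => MulAut.conjNormal (H := N) (g * h)⁻¹ (x i))) =
        A.ρ g (A.ρ h (F (fun i => MulAut.conjNormal (H := N) h⁻¹
          (MulAut.conjNormal (H := N) g⁻¹ (x i)))))
      rw [map_mul, mul_inv_rev, map_mul]
      rfl
    rw [groupCohomology.map, this, HomologicalComplex.homologyMap_comp]
    rfl

instance (q : ℕ) : Representation.IsTrivial ((homologyAction N A q).comp N.subtype) where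
  out n := by
    have : groupHomology.chainsMap (MulAut.conjNormal (H := N) (n : G)).toMonoidHom
        (conjHom N A n) =
        groupHomology.chainsMap (MulAut.conj n).toMonoidHom (innerHom n (Rep.res N.subtype A)) :=
      groupHomology.chainsMap_congr (MonoidHom.ext fun x => Subtype.ext rfl) rfl
    have h := groupHomology_map_innerHom n q (Rep.res N.subtype A)
    rw [groupHomology.map, ← this] at h
    exact congr_arg ModuleCat.Hom.hom h

instance (q : ℕ) : Representation.IsTrivial ((cohomologyAction N A q).comp N.subtype) where
  out n := by
    have : groupCohomology.cochainsMap (MulAut.conjNormal (H := N) (n : G)⁻¹).toMonoidHom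
        (conjCoHom N A n) = groupCohomology.cochainsMap (MulAut.conj n⁻¹).toMonoidHom
          (innerCoHom n (Rep.res N.subtype A)) := by
      rfl
    have h := groupCohomology_map_innerCoHom n q (Rep.res N.subtype A)
    rw [groupCohomology.map, ← this] at h
    exact congr_arg ModuleCat.Hom.hom h

/-- `H_q(N; A)` as a `G ⧸ N`-module. -/
abbrev homologyRep (q : ℕ) : Rep.{u} k (G ⧸ N) :=
  Rep.of ((homologyAction N A q).ofQuotient N)

/-- `H^q(N; A)` as a `G ⧸ N`-module. -/
abbrev cohomologyRep (q : ℕ) : Rep.{u} k (G ⧸ N) :=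
  Rep.of ((cohomologyAction N A q).ofQuotient N)

variable {N N' A}

/-- The restriction of a group homomorphism to subgroups. -/
def subgroupHom (f : G →* G') (hN : N ≤ N'.comap f) : N →* N' :=
  (f.comp N.subtype).codRestrict N' fun n => hN n.2

/-- Restriction of a morphism of modules to normal subgroups. -/
def resHom (f : G →* G') (hN : N ≤ N'.comap f) (φ : A ⟶ Rep.res f A') :
    Rep.res N.subtype A ⟶ Rep.res (subgroupHom f hN) (Rep.res N'.subtype A') :=
  Rep.ofHom (ρ := A.ρ.comp N.subtype) (σ := (A'.ρ.comp N'.subtype).comp (subgroupHom f hN))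
    { toLinearMap := φ.hom.toLinearMap
      isIntertwining' := fun n => LinearMap.ext fun a => Rep.hom_comm_apply φ n.1 a }

/-- Restriction of a morphism of modules to normal subgroups. -/
def resCoHom (f : G →* G') (hN : N ≤ N'.comap f) (φ : Rep.res f A' ⟶ A) :
    Rep.res (subgroupHom f hN) (Rep.res N'.subtype A') ⟶ Rep.res N.subtype A :=
  Rep.ofHom (ρ := (A'.ρ.comp N'.subtype).comp (subgroupHom f hN)) (σ := A.ρ.comp N.subtype)
    { toLinearMap := φ.hom.toLinearMap
      isIntertwining' := fun n => LinearMap.ext fun a => Rep.hom_comm_apply φ n.1 a }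

/-- Functoriality of the `G ⧸ N`-module `H_q(N; A)`. -/
def homologyRepMap (f : G →* G') (hN : N ≤ N'.comap f) (φ : A ⟶ Rep.res f A') (q : ℕ) :
    homologyRep N A q ⟶ Rep.res (QuotientGroup.map N N' f hN) (homologyRep N' A' q) :=
  Rep.ofHom (σ := ((homologyAction N' A' q).ofQuotient N').comp (QuotientGroup.map N N' f hN))
    { toLinearMap := (groupHomology.map (subgroupHom f hN) (resHom f hN φ) q).hom
      isIntertwining' := fun g => by
        induction g using QuotientGroup.induction_on with | H g => ?_
        change (groupHomology.map _ (conjHom N A g) q ≫ groupHomology.map _ _ q).hom =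
          (groupHomology.map _ _ q ≫ groupHomology.map _ (conjHom N' A' (f g)) q).hom
        refine congr_arg ModuleCat.Hom.hom (homologyMap_sq q ?_)
        rw [← groupHomology.chainsMap_comp, ← groupHomology.chainsMap_comp]
        refine (groupHomology.chainsMap_congr (MonoidHom.ext fun n => Subtype.ext ?_)
            (LinearMap.ext fun a => Rep.hom_comm_apply φ g a))
        change f (g * n * g⁻¹) = f g * f n * (f g)⁻¹
        rw [map_mul, map_mul, map_inv] }

/-- Functoriality of the `G ⧸ N`-module `H^q(N; A)`. -/
def cohomologyRepMap (f : G →* G') (hN : N ≤ N'.comap f) (φ : Rep.res f A' ⟶ A) (q : ℕ) :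
    Rep.res (QuotientGroup.map N N' f hN) (cohomologyRep N' A' q) ⟶ cohomologyRep N A q :=
  Rep.ofHom (ρ := ((cohomologyAction N' A' q).ofQuotient N').comp (QuotientGroup.map N N' f hN))
    { toLinearMap := (groupCohomology.map (subgroupHom f hN) (resCoHom f hN φ) q).hom
      isIntertwining' := fun g => by
        induction g using QuotientGroup.induction_on with | H g => ?_
        change (groupCohomology.map _ (conjCoHom N' A' (f g)) q ≫ groupCohomology.map _ _ q).hom =
          (groupCohomology.map _ _ q ≫ groupCohomology.map _ (conjCoHom N A g) q).hom
        refine congr_arg ModuleCat.Hom.hom (homologyMap_sq q ?_)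
        refine HomologicalComplex.hom_ext _ _ fun n => ModuleCat.hom_ext
          (LinearMap.ext fun F => funext fun x => ?_)
        have e : (fun i => MulAut.conjNormal (H := N') (f g)⁻¹ (subgroupHom f hN (x i))) =
            fun i => subgroupHom f hN (MulAut.conjNormal (H := N) g⁻¹ (x i)) := by
          funext i
          refine Subtype.ext ?_
          change (f g)⁻¹ * f (x i) * (f g)⁻¹⁻¹ = f (g⁻¹ * x i * g⁻¹⁻¹)
          rw [map_mul, map_mul, map_inv, map_inv, map_inv]
        refine Eq.trans ?_ (Rep.hom_comm_apply φ g _)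
        exact congr_arg (fun y => φ.hom (A'.ρ (f g) (F y))) e }

end

section
variable {k : Type u} [CommRing k] {Λ : Type u} {κ : Type*} {c' : ℤ → ComplexShape κ} {r₀ : ℤ}

lemma homologyMap_dsComplexι_comp {c : ComplexShape κ}
    (X : Λ → HomologicalComplex (ModuleCat.{u} k) c) (pq : κ) (l : Λ) (W : Λ → ModuleCat.{u} k)
    (w : ∀ l, (X l).homology pq ⟶ W l) :
    HomologicalComplex.homologyMap (dsComplexι X l) pq ≫ inv (dsHomologyMap X pq) ≫ dsMap w =
      w l ≫ dsι W l := by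
  have e := dsι_desc (fun l => HomologicalComplex.homologyMap (dsComplexι X l) pq) l
  change dsι (fun l => (X l).homology pq) l ≫ dsHomologyMap X pq = _ at e
  rw [← e, Category.assoc, IsIso.hom_inv_id_assoc]
  exact dsι_map _ _

/-- The inclusion of a summand in a direct sum of spectral sequences. -/
def dsSSι (E : Λ → SpectralSequence (ModuleCat.{u} k) c' r₀) (l : Λ) : E l ⟶ dsSS E where
  hom r hr := dsComplexι (fun l => (E l).page r hr) l
  comm r r' pq h hr := by
    exact homologyMap_dsComplexι_comp (fun l => (E l).page r hr) pq l
      (fun l => (E l).page r' (by lia)|>.X pq) fun l => ((E l).iso r r' pq h hr).hom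

/-- The direct sum of morphisms of spectral sequences. -/
def dsSSMap {E E' : Λ → SpectralSequence (ModuleCat.{u} k) c' r₀} (f : ∀ l, E l ⟶ E' l) :
    dsSS E ⟶ dsSS E' :=
  dsSSDesc fun l => f l ≫ dsSSι E' l

/-- The projection to a factor of a product of spectral sequences. -/
def prSSπ (E : Λ → SpectralSequence (ModuleCat.{u} k) c' r₀) (l : Λ) : prSS E ⟶ E l where
  hom r hr := prComplexπ (fun l => (E l).page r hr) l
  comm _ _ _ _ _ := rfl

/-- The product of morphisms of spectral sequences. -/
def prSSMap {E E' : Λ → SpectralSequence (ModuleCat.{u} k) c' r₀} (f : ∀ l, E l ⟶ E' l) :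
    prSS E ⟶ prSS E' :=
  prSSLift fun l => prSSπ E l ≫ f l
end

section
variable {k : Type u} [CommRing k] {σ : ℤ}

/-- Convergence `E_{p,q} ⇒ H_{p+q}` of a first quadrant spectral sequence: `E` vanishes outside the
first quadrant, and for a finite filtration of each `H n`, the graded piece of index `p` in degree
`p + q` is the stable value of `E^r_{p,q}`, attained for `r ≥ p + q + 2`. For `σ = -1` the
filtration is increasing with `fil (-1) n = ⊥` and `fil n n = ⊤`; for `σ = 1` it is decreasing with
`fil 0 n = ⊤` and `fil (n + 1) n = ⊥`. -/
structure Convergence (E : SpectralSequence (ModuleCat.{u} k) (FilteredComplex.pageShape σ) 2)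
    (H : ℕ → ModuleCat.{u} k) where
  isZero (r : ℤ) (hr : 2 ≤ r) (p q : ℤ) (hpq : p < 0 ∨ q < 0) : IsZero ((E.page r hr).X (p, q))
  fil (p : ℤ) (n : ℕ) : Submodule k (H n)
  fil_le (p : ℤ) (n : ℕ) : fil (p + σ) n ≤ fil p n
  fil_top (p : ℤ) (n : ℕ) (h : σ * p ≤ 0) (h' : σ * p ≤ σ * n) : fil p n = ⊤
  fil_bot (p : ℤ) (n : ℕ) (h : 0 < σ * p) (h' : σ * n < σ * p) : fil p n = ⊥
  toPage (p q : ℕ) (r : ℤ) (hr : (p : ℤ) + q + 2 ≤ r) :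
    fil p (p + q) →ₗ[k] (E.page r (by omega)).X ((p : ℤ), (q : ℤ))
  toPage_surjective (p q : ℕ) (r : ℤ) (hr : (p : ℤ) + q + 2 ≤ r) :
    Function.Surjective (toPage p q r hr)
  toPage_eq_zero_iff (p q : ℕ) (r : ℤ) (hr : (p : ℤ) + q + 2 ≤ r) (x : fil p (p + q)) :
    toPage p q r hr x = 0 ↔ (x : H (p + q)) ∈ fil (p + σ) (p + q)
  toPage_succ (p q : ℕ) (r : ℤ) (hr : (p : ℤ) + q + 2 ≤ r) (x : fil p (p + q)) :
    ∃ z : (E.page r (by omega)).cycles ((p : ℤ), (q : ℤ)),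
      ((E.page r (by omega)).iCycles _).hom z = toPage p q r hr x ∧
      (E.iso r (r + 1) ((p : ℤ), (q : ℤ)) rfl (by omega)).hom.hom
        (((E.page r (by omega)).homologyπ _).hom z) = toPage p q (r + 1) (by omega) x

/-- A morphism of convergent spectral sequences `φ` is compatible with maps `f` of the limits. -/
structure Convergence.Compatible
    {E E' : SpectralSequence (ModuleCat.{u} k) (FilteredComplex.pageShape σ) 2}
    {H H' : ℕ → ModuleCat.{u} k} (c : Convergence E H) (c' : Convergence E' H')
    (φ : E ⟶ E') (f : ∀ n, H n ⟶ H' n) : Prop where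
  mem (p : ℤ) (n : ℕ) (x : H n) (hx : x ∈ c.fil p n) : (f n).hom x ∈ c'.fil p n
  toPage (p q : ℕ) (r : ℤ) (hr : (p : ℤ) + q + 2 ≤ r) (x : c.fil p (p + q)) :
    ((φ.hom r (by omega)).f ((p : ℤ), (q : ℤ))).hom (c.toPage p q r hr x) =
      c'.toPage p q r hr ⟨(f (p + q)).hom x.1, mem p (p + q) x.1 x.2⟩
end

section
variable {G Λ : Type u} [Group G] (H : Λ → Subgroup G) (N : ∀ l, Subgroup (H l))

/-- The subgroup `N l` of `H l`, as a subgroup of `G`. -/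
abbrev subgroupOfG (l : Λ) : Subgroup G := (N l).map (H l).subtype

/-- The normal closure in `G` of the union of the subgroups `N l`. -/
abbrev tripleKernel : Subgroup G :=
  Subgroup.normalClosure (⋃ l, (subgroupOfG H N l : Set G))

/-- A group triple `(G, H, N)` with `N l ◁ H l` is a Cohen–Lyndon triple if there are left
transversals `T l` of `H l ⬝ ⟪N⟫` in `G` such that `⟪N⟫` is the free product of the conjugates
`t (N l) t⁻¹` with `l : Λ` and `t ∈ T l`. -/
def IsCohenLyndonTriple : Prop :=
  ∃ T : Λ → Set G,
    (∀ l, Subgroup.IsComplement (T l) ((H l ⊔ tripleKernel H N : Subgroup G) : Set G)) ∧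
    let conj : (Σ l, T l) → Subgroup G := fun i =>
      (subgroupOfG H N i.1).map (MulAut.conj (i.2 : G)).toMonoidHom
    let toG : Monoid.CoprodI (fun i => conj i) →* G :=
      Monoid.CoprodI.lift fun i => (conj i).subtype
    Function.Injective toG ∧ toG.range = tripleKernel H N

lemma le_comap_tripleKernel (l : Λ) : N l ≤ (tripleKernel H N).comap (H l).subtype := fun n hn =>
  Subgroup.subset_normalClosure (Set.mem_iUnion.2 ⟨l, ⟨n, hn, rfl⟩⟩)

variable [∀ l, (N l).Normal]

/-- The homomorphism `H l ⧸ N l → G ⧸ ⟪N⟫` induced by the inclusion. -/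
abbrev tripleQuotientMap (l : Λ) : H l ⧸ N l →* G ⧸ tripleKernel H N :=
  QuotientGroup.map (N l) (tripleKernel H N) (H l).subtype (le_comap_tripleKernel H N l)

variable {k : Type u} [CommRing k] (A : Rep.{u} k G)

/-- The map `H_q(N l; A) → H_q(⟪N⟫; A)` induced by the inclusion. -/
def tripleHomologyMap (l : Λ) (q : ℕ) :
    homologyRep (N l) (Rep.res (H l).subtype A) q ⟶
      Rep.res (tripleQuotientMap H N l) (homologyRep (tripleKernel H N) A q) :=
  homologyRepMap (H l).subtype (le_comap_tripleKernel H N l) (𝟙 _) q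

/-- The map `H^q(⟪N⟫; A) → H^q(N l; A)` induced by the inclusion. -/
def tripleCohomologyMap (l : Λ) (q : ℕ) :
    Rep.res (tripleQuotientMap H N l) (cohomologyRep (tripleKernel H N) A q) ⟶
      cohomologyRep (N l) (Rep.res (H l).subtype A) q :=
  cohomologyRepMap (H l).subtype (le_comap_tripleKernel H N l) (𝟙 _) q

/-- The map `⨁ Ind H_q(N l; A) → H_q(⟪N⟫; A)` of `G ⧸ ⟪N⟫`-modules induced by the inclusions. -/
def tripleIndMap (q : ℕ) :
    (∐ fun l => Rep.ind (tripleQuotientMap H N l)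
      (homologyRep (N l) (Rep.res (H l).subtype A) q)) ⟶
    homologyRep (tripleKernel H N) A q :=
  Sigma.desc fun l => (Rep.indResHomEquiv.{u} (tripleQuotientMap H N l)
    (homologyRep (N l) (Rep.res (H l).subtype A) q)
    (homologyRep (tripleKernel H N) A q)).symm (tripleHomologyMap H N A l q)

/-- The map `H^q(⟪N⟫; A) → ∏ CoInd H^q(N l; A)` of `G ⧸ ⟪N⟫`-modules induced by the inclusions. -/
def tripleCoindMap (q : ℕ) :
    cohomologyRep (tripleKernel H N) A q ⟶
    (∏ᶜ fun l => Rep.coind (tripleQuotientMap H N l)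
      (cohomologyRep (N l) (Rep.res (H l).subtype A) q)) :=
  Pi.lift fun l => Rep.resCoindHomEquiv.{u} (tripleQuotientMap H N l)
    (cohomologyRep (tripleKernel H N) A q)
    (cohomologyRep (N l) (Rep.res (H l).subtype A) q) (tripleCohomologyMap H N A l q)

/-- The direct sum of the homological spectral sequences of the pairs `(H l, N l)`. -/
abbrev sumSS := dsSS fun l => lhsSS (N l) (Rep.res (H l).subtype A)

/-- The product of the cohomological spectral sequences of the pairs `(H l, N l)`. -/
abbrev prodSS := prSS fun l => lhsCoSS (N l) (Rep.res (H l).subtype A)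

/-- The morphism from the direct sum of the homological spectral sequences of the pairs
`(H l, N l)` to that of `(G, ⟪N⟫)` induced by the inclusions. -/
def tripleSSMap : sumSS H N A ⟶ lhsSS (tripleKernel H N) A :=
  dsSSDesc fun l => lhsSSMap (H l).subtype (le_comap_tripleKernel H N l) (𝟙 _)

/-- The morphism from the cohomological spectral sequence of `(G, ⟪N⟫)` to the product of those of
the pairs `(H l, N l)` induced by the inclusions. -/
def tripleCoSSMap : lhsCoSS (tripleKernel H N) A ⟶ prodSS H N A :=
  prSSLift fun l => lhsCoSSMap (H l).subtype (le_comap_tripleKernel H N l) (𝟙 _)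

/-- Functoriality of `sumSS` in the coefficients. -/
def sumSSMap {A B : Rep.{u} k G} (v : A ⟶ B) : sumSS H N A ⟶ sumSS H N B :=
  dsSSMap fun l => lhsSSCoeffMap (N l) ((Rep.resFunctor (H l).subtype).map v)

/-- Functoriality of `prodSS` in the coefficients. -/
def prodSSMap {A B : Rep.{u} k G} (v : A ⟶ B) : prodSS H N A ⟶ prodSS H N B :=
  prSSMap fun l => lhsCoSSCoeffMap (N l) ((Rep.resFunctor (H l).subtype).map v)

end

end

/-!
The homology of a group `Γ` is computed here by simplices on a `Γ`-set. Let `Γ` act on `X` and on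
`A` through a homomorphism `ι : Γ → G`, and suppose that there is a `Γ`-equivariant map `X → Γ`; in
other words, `X` is a free `Γ`-set. The complex of the modules `k[X^{q+1}] ⊗ A` is exact for
nonempty `X`, and its coinvariants compute `H_q(Γ; A)` (`barClass_surjective`,
`barClass_eq_zero_iff`); dually, the invariants of `Hom(k[X^{q+1}], A)` compute `H^q(Γ; A)`
(`cobarClass_surjective`, `cobarClass_eq_zero_iff`). Since `X` need not be `Γ` itself, one and the
same complex, for `X = G`, serves `G` and all its subgroups, and induced maps can be read off from
maps of vertices (`map_barClass`, `map_cobarClass`); two choices of such a map are homotopic by the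
prism operator.

*Spectral sequences.* The double complex of `(G, M, A)` has, in bidegree `(q, p)`, the inhomogeneous
`p`-chains of `G ⧸ M` with coefficients in `(k[G^{q+1}] ⊗ A)_M`. Chains are exact in the
coefficients, so the homology in the direction of `q` consists of chains of `G ⧸ M` with
coefficients in `H_q(M; A)`, which gives the second page (`RowHomology.pageTwoIso`,
`lhsPageTwoIso`). The coefficients are induced modules, so in the direction of `p` the double
complex is a resolution of `(k[G^{q+1}] ⊗ A)_G`, and the total complex computes `H_n(G; A)`
(`lhsLimit`); convergence is that of a first quadrant filtration (`FilteredComplex.convergence`,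
`lhsConvergence`). All of this is functorial in `(G, M, A)` and compatible with direct sums, and the
dual statements hold in cohomology with products. This yields the morphisms `φ`, their description
on the second pages and on the limits, and their naturality.

*Free products.* Let `G` be the free product of the groups `Γ i`. Derivations given on the factors
extend to `G` (`exists_derivation`). It follows that the relations `g z - z` by which the
coinvariants of `k[G^m] ⊗ A` are formed are, for `m > 0`, the *direct* sum of the relations coming
from the factors (`coinvKer_id_le_iSup`, `exists_coinvKer_projection`); for `m = 0` there are no
relations at all if the action on `A` is trivial. A chain whose boundary is a relation therefore
splits, up to boundaries, into chains with the same property for one factor each. This shows that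
`H_q(G; A)` is the direct sum of the modules `H_q(Γ i; A)` for `q > 1`, and for `q = 1` if the
action is trivial (`isInternalSum_homology_freeProduct`); dually for cohomology
(`isInternalProd_cohomology_freeProduct`).

*Cohen–Lyndon triples.* Now `⟪N⟫` is the free product of the conjugates of the groups `N l` by the
elements of the transversals. So `H_q(⟪N⟫; A)` is the direct sum of the translates of the images of
the modules `H_q(N l; A)`, one for each coset of the image of `H l ⧸ N l` in `G ⧸ ⟪N⟫`. This
property, `IsInducedSum`, gives the universal property of a direct sum of induced modules
(`IsInducedSum.isIso_desc`), and likewise `IsInducedProd.isIso_lift` for cohomology, which is the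
first assertion. On the second pages, the claim becomes Shapiro's lemma for the homomorphisms
`H l ⧸ N l → G ⧸ ⟪N⟫` (`IsInducedSum.isInternalSum_groupHomology`,
`IsInducedProd.isInternalProd_groupCohomology`), which requires them to be injective. They are,
because free factors are malnormal (`coprodI_exists_eq_of`), except possibly when `N l` is trivial;
but then `H_q(N l; A)` vanishes for `q > 0` and there is nothing to prove
(`IsCohenLyndonTriple.injective_or_subsingleton`).
-/


noncomputable section

/-! ### Chains and cochains with coefficients -/

section Transport
variable {k : Type u} [CommRing k] {A B : Type u} [AddCommGroup A] [Module k A] [AddCommGroup B]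
  [Module k B] {Y Y' Y'' : Type u}

/-- The linear map `k[Y] → k[Y] ⊗ A`, `y ↦ y ⊗ a`. -/
def finsuppTmul (a : A) : (Y →₀ k) →ₗ[k] (Y →₀ A) :=
  Finsupp.linearCombination k fun y => Finsupp.single y a

@[simp]
lemma finsuppTmul_single (a : A) (y : Y) (r : k) :
    finsuppTmul a (Finsupp.single y r) = Finsupp.single y (r • a) := by
  simp [finsuppTmul]

lemma finsuppTmul_eq (a : A) (z : Y →₀ k) :
    finsuppTmul a z = Finsupp.mapRange.linearMap (LinearMap.toSpanSingleton k A a) z := by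
  induction z using Finsupp.induction_linear with
  | zero => simp
  | add x y hx hy => rw [map_add, map_add, hx, hy]
  | single y r => simp

/-- The map `k[Y] ⊗ A → k[Y'] ⊗ A` induced by the linear map `k[Y] → k[Y']` with values `f y`. -/
def transport (A : Type u) [AddCommGroup A] [Module k A] (f : Y → Y' →₀ k) :
    (Y →₀ A) →ₗ[k] (Y' →₀ A) :=
  Finsupp.lsum k fun y =>
    { toFun := fun a => finsuppTmul a (f y)
      map_add' := fun a b => by
        ext; simp [finsuppTmul_eq]
      map_smul' := fun r a => by
        ext; simp [finsuppTmul_eq, smul_smul, mul_comm] }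

@[simp]
lemma transport_single (f : Y → Y' →₀ k) (y : Y) (a : A) :
    transport A f (Finsupp.single y a) = finsuppTmul a (f y) := by
  rw [transport, Finsupp.lsum_single]
  rfl

lemma transport_tmul (f : Y → Y' →₀ k) (z : Y →₀ k) (a : A) :
    transport A f (finsuppTmul a z) = finsuppTmul a (Finsupp.linearCombination k f z) := by
  induction z using Finsupp.induction_linear with
  | zero => simp
  | add x y hx hy => simp only [map_add, hx, hy]
  | single y r =>
    rw [finsuppTmul_single, transport_single, Finsupp.linearCombination_single, map_smul]
    ext; simp [finsuppTmul_eq, smul_smul, mul_comm]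

lemma transport_transport (f : Y → Y' →₀ k) (g : Y' → Y'' →₀ k) (x : Y →₀ A) :
    transport A g (transport A f x) =
      transport A (fun y => Finsupp.linearCombination k g (f y)) x := by
  induction x using Finsupp.induction_linear with
  | zero => simp
  | add x y hx hy => simp only [map_add, hx, hy]
  | single y r => rw [transport_single, transport_tmul, transport_single]

/-- The map `Hom(k[Y'], A) → Hom(k[Y], A)` induced by the linear map `k[Y] → k[Y']` with
values `f y`. -/
def cotransport (A : Type u) [AddCommGroup A] [Module k A] (f : Y → Y' →₀ k) :
    (Y' → A) →ₗ[k] (Y → A) where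
  toFun F y := Finsupp.linearCombination k F (f y)
  map_add' F F' := by
    funext y
    simp [Finsupp.linearCombination_apply, Finsupp.sum_add]
  map_smul' r F := by
    funext y
    simp [Finsupp.linearCombination_apply, Finsupp.smul_sum, smul_smul, mul_comm]

lemma cotransport_apply (f : Y → Y' →₀ k) (F : Y' → A) (y : Y) :
    cotransport A f F y = Finsupp.linearCombination k F (f y) := rfl

lemma linearCombination_cotransport (f : Y → Y' →₀ k) (F : Y' → A) (z : Y →₀ k) :
    Finsupp.linearCombination k (cotransport A f F) z =
      Finsupp.linearCombination k F (Finsupp.linearCombination k f z) := by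
  induction z using Finsupp.induction_linear with
  | zero => simp
  | add x y hx hy => simp only [map_add, hx, hy]
  | single y r => simp [cotransport_apply]

lemma cotransport_cotransport (f : Y → Y' →₀ k) (g : Y' → Y'' →₀ k) (F : Y'' → A) :
    cotransport A f (cotransport A g F) =
      cotransport A (fun y => Finsupp.linearCombination k g (f y)) F :=
  funext fun y => linearCombination_cotransport g F (f y)

lemma linearCombination_map (φ : A →ₗ[k] B) (F : Y → A) (z : Y →₀ k) :
    Finsupp.linearCombination k (fun y => φ (F y)) z = φ (Finsupp.linearCombination k F z) := by
  rw [Finsupp.apply_linearCombination]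
  rfl

end Transport

/-! ### Simplices with vertices in a set -/

section Chains
variable (k : Type u) [CommRing k] {X X' : Type u}

/-- The boundary of a simplex with `m + 1` vertices; this includes the augmentation, for `m = 0`. -/
def simplexBd {m : ℕ} (x : Fin (m + 1) → X) : (Fin m → X) →₀ k :=
  ∑ i : Fin (m + 1), (-1 : k) ^ (i : ℕ) • Finsupp.single (x ∘ i.succAbove) 1

/-- The boundary on `k[X^{m+1}]`. -/
abbrev chainBd (m : ℕ) : ((Fin (m + 1) → X) →₀ k) →ₗ[k] ((Fin m → X) →₀ k) :=
  Finsupp.linearCombination k (simplexBd k)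

/-- The cone operator with vertex `v`. -/
def cone (v : X) (m : ℕ) : ((Fin m → X) →₀ k) →ₗ[k] ((Fin (m + 1) → X) →₀ k) :=
  Finsupp.lmapDomain k k fun x => (Fin.cons v x : Fin (m + 1) → X)

variable {k}

@[simp]
lemma cone_single (v : X) {m : ℕ} (x : Fin m → X) (r : k) :
    cone k v m (Finsupp.single x r) = Finsupp.single (Fin.cons v x : Fin (m + 1) → X) r := by
  simp [cone]

lemma chainBd_single {m : ℕ} (x : Fin (m + 1) → X) :
    chainBd k m (Finsupp.single x 1) = simplexBd k x := by simp

lemma cons_comp_succAbove_succ (v : X) {m : ℕ} (x : Fin (m + 1) → X) (i : Fin (m + 1)) :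
    (Fin.cons v x : Fin (m + 2) → X) ∘ i.succ.succAbove = Fin.cons v (x ∘ i.succAbove) := by
  funext j
  refine Fin.cases ?_ (fun j => ?_) j
  · simp
  · simp [Fin.succ_succAbove_succ]

lemma cons_comp_succAbove_zero (v : X) {m : ℕ} (x : Fin m → X) :
    (Fin.cons v x : Fin (m + 1) → X) ∘ (0 : Fin (m + 1)).succAbove = x := by
  funext j
  simp

/-- The cone operator is a contracting homotopy of the augmented complex of simplices. -/
lemma bd_cone (v : X) {m : ℕ} (z : (Fin (m + 1) → X) →₀ k) :
    chainBd k (m + 1) (cone k v (m + 1) z) = z - cone k v m (chainBd k m z) := by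
  induction z using Finsupp.induction_linear with
  | zero => simp
  | add x y hx hy => simp only [map_add, hx, hy]; abel
  | single x r =>
    rw [cone_single, Finsupp.linearCombination_single, Finsupp.linearCombination_single, simplexBd,
      Fin.sum_univ_succ, map_smul, simplexBd, map_sum]
    simp only [cons_comp_succAbove_zero, cons_comp_succAbove_succ, map_smul, cone_single,
      Fin.val_zero, pow_zero, one_smul, Fin.val_succ, pow_succ, mul_neg, mul_one, neg_smul,
      Finset.sum_neg_distrib, smul_add, smul_neg, sub_eq_add_neg]
    simp

lemma bd_cone_zero (v : X) (z : (Fin 0 → X) →₀ k) :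
    chainBd k 0 (cone k v 0 z) = z := by
  induction z using Finsupp.induction_linear with
  | zero => simp
  | add x y hx hy => simp only [map_add, hx, hy]
  | single x r =>
    rw [cone_single, Finsupp.linearCombination_single, simplexBd]
    simp [Subsingleton.elim _ x]

/-- Every simplex is a cone, so that `bd_cone` gives the claim by induction on the dimension. -/
lemma bd_bd {m : ℕ} (z : (Fin (m + 2) → X) →₀ k) : chainBd k m (chainBd k (m + 1) z) = 0 := by
  induction m with
  | zero =>
    induction z using Finsupp.induction_linear with
    | zero => simp
    | add x y hx hy => simp only [map_add, hx, hy, add_zero]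
    | single x r =>
      have hx : Finsupp.single x r = cone k (x 0) 1 (Finsupp.single (Fin.tail x) r) := by
        rw [cone_single, Fin.cons_self_tail]
      rw [hx, bd_cone, map_sub, bd_cone_zero, sub_self]
  | succ m ih =>
    induction z using Finsupp.induction_linear with
    | zero => simp
    | add x y hx hy => simp only [map_add, hx, hy, add_zero]
    | single x r =>
      have hx : Finsupp.single x r = cone k (x 0) _ (Finsupp.single (Fin.tail x) r) := by
        rw [cone_single, Fin.cons_self_tail]
      rw [hx, bd_cone, map_sub, bd_cone, ih, map_zero, sub_zero, sub_self]

lemma bd_mapDomain (e : X → X') {m : ℕ} (z : (Fin (m + 1) → X) →₀ k) :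
    chainBd k m (Finsupp.lmapDomain k k (e ∘ ·) z) =
      Finsupp.lmapDomain k k (e ∘ ·) (chainBd k m z) := by
  induction z using Finsupp.induction_linear with
  | zero => simp
  | add x y hx hy => simp only [map_add, hx, hy]
  | single x r =>
    rw [Finsupp.lmapDomain_apply, Finsupp.mapDomain_single]
    simp [simplexBd, map_sum, Finsupp.mapDomain_single, Function.comp_assoc]

/-- The prism operator of two maps of vertices, as a cone over the difference of the two images and
of the prism over the boundary. -/
def prism (e e' : X → X') : ∀ {m : ℕ}, (Fin m → X) → (Fin (m + 1) → X') →₀ k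
  | 0, _ => 0
  | m + 1, x => cone k (e (x 0)) (m + 1) (Finsupp.single (e' ∘ x) 1 - Finsupp.single (e ∘ x) 1 -
      Finsupp.linearCombination k (prism e e') (simplexBd k x))

lemma bd_prism_lin {e e' : X → X'} {m : ℕ}
    (h : ∀ x : Fin (m + 1) → X, chainBd k (m + 1) (prism e e' x) =
      Finsupp.single (e' ∘ x) 1 - Finsupp.single (e ∘ x) 1 -
        Finsupp.linearCombination k (prism e e') (simplexBd k x)) (z : (Fin (m + 1) → X) →₀ k) :
    chainBd k (m + 1) (Finsupp.linearCombination k (prism e e') z) =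
      Finsupp.lmapDomain k k (e' ∘ ·) z - Finsupp.lmapDomain k k (e ∘ ·) z -
      Finsupp.linearCombination k (prism e e') (chainBd k m z) := by
  induction z using Finsupp.induction_linear with
  | zero => simp
  | add x y hx hy => simp only [map_add, hx, hy]; abel
  | single x r =>
    rw [Finsupp.linearCombination_single, map_smul, h, Finsupp.linearCombination_single, map_smul,
      smul_sub, smul_sub]
    simp

/-- The prism operator is a homotopy between the maps on chains induced by `e` and `e'`. In the
lowest degree, `simplexBd` is the augmentation, where both maps agree. -/
lemma bd_prism (e e' : X → X') {m : ℕ} : ∀ x : Fin (m + 1) → X,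
    chainBd k (m + 1) (prism e e' x) =
      Finsupp.single (e' ∘ x) 1 - Finsupp.single (e ∘ x) 1 -
        Finsupp.linearCombination k (prism e e') (simplexBd k x) := by
  induction m with
  | zero =>
    intro x
    rw [prism, bd_cone]
    have h1 : Finsupp.linearCombination k (prism (k := k) e e') (simplexBd k x) = 0 := by
      simp [simplexBd, prism]
    have h2 (y : Fin 1 → X') : simplexBd k y = Finsupp.single default 1 := by
      simp [simplexBd, Subsingleton.elim _ (default : Fin 0 → X')]
    rw [h1, sub_zero, map_sub, chainBd_single, chainBd_single, h2, h2, sub_self, map_zero, sub_zero]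
  | succ m ih =>
    intro x
    have h (e : X → X') : Finsupp.single (e ∘ x) (1 : k) =
        Finsupp.lmapDomain k k (e ∘ ·) (Finsupp.single x 1) := by simp
    have h0 : chainBd k (m + 1) (Finsupp.single (e' ∘ x) 1 - Finsupp.single (e ∘ x) 1 -
        Finsupp.linearCombination k (prism e e') (simplexBd k x)) = 0 := by
      rw [map_sub, map_sub, bd_prism_lin ih, h, h, bd_mapDomain, bd_mapDomain, chainBd_single,
        ← chainBd_single x, bd_bd, map_zero, sub_zero, sub_self]
    rw [prism, bd_cone, h0, map_zero, sub_zero]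

lemma cone_lmapDomain (s : X → X') (v : X) {m : ℕ} (z : (Fin m → X) →₀ k) :
    Finsupp.lmapDomain k k (s ∘ ·) (cone k v m z) =
      cone k (s v) m (Finsupp.lmapDomain k k (s ∘ ·) z) := by
  induction z using Finsupp.induction_linear with
  | zero => simp
  | add x y hx hy => simp only [map_add, hx, hy]
  | single x r =>
    simp only [Finsupp.lmapDomain_apply, Finsupp.mapDomain_single, cone_single]
    congr 1
    funext j
    refine Fin.cases ?_ (fun j => ?_) j <;> simp

/-- The prism operator is equivariant. -/
lemma prism_equivariant {e e' : X → X'} (s : X → X) (s' : X' → X') (h : ∀ x, e (s x) = s' (e x))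
    (h' : ∀ x, e' (s x) = s' (e' x)) {m : ℕ} : ∀ x : Fin m → X,
    prism e e' (s ∘ x) = Finsupp.lmapDomain k k (s' ∘ ·) (prism e e' x) := by
  induction m with
  | zero => intro x; simp [prism]
  | succ m ih =>
    intro x
    have h1 (e : X → X') (h : ∀ x, e (s x) = s' (e x)) : Finsupp.single (e ∘ s ∘ x) (1 : k) =
        Finsupp.lmapDomain k k (s' ∘ ·) (Finsupp.single (e ∘ x) 1) := by
      rw [Finsupp.lmapDomain_apply, Finsupp.mapDomain_single]
      congr 1
      exact funext fun i => h _
    have h2 : Finsupp.linearCombination k (prism e e') (simplexBd k (s ∘ x)) =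
        Finsupp.lmapDomain k k (s' ∘ ·)
          (Finsupp.linearCombination k (prism e e') (simplexBd k x)) := by
      simp only [simplexBd, map_sum, map_smul, Finsupp.linearCombination_single, one_smul]
      exact Finset.sum_congr rfl fun i _ => congr_arg _ (ih (x ∘ i.succAbove))
    rw [prism, prism, cone_lmapDomain, map_sub (Finsupp.lmapDomain k k _),
      map_sub (Finsupp.lmapDomain k k _), ← h1 e h, ← h1 e' h', ← h2, Function.comp_apply, h]

end Chains

/-! ### Homology classes of cycles -/

section HomologyClass
variable {k : Type u} [CommRing k] {κ : Type*} {c : ComplexShape κ}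
  (K : HomologicalComplex (ModuleCat.{u} k) c)

/-- The submodule of cycles in degree `i`. -/
def cycleSubmodule (i : κ) : Submodule k (K.X i) := ⨅ j, LinearMap.ker (K.d i j).hom

variable {K} in
lemma mem_cycleSubmodule {i : κ} {x : K.X i} :
    x ∈ cycleSubmodule K i ↔ ∀ j, (K.d i j).hom x = 0 := by
  simp [cycleSubmodule]

lemma d_mem_cycleSubmodule (i j : κ) (x : K.X i) : (K.d i j).hom x ∈ cycleSubmodule K j :=
  mem_cycleSubmodule.2 fun l => congr($(K.d_comp_d i j l).hom x)

lemma cycleSubmodule_subtype_d (i : κ) :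
    ModuleCat.ofHom (cycleSubmodule K i).subtype ≫ K.d i (c.next i) = 0 :=
  ModuleCat.hom_ext (LinearMap.ext fun x => mem_cycleSubmodule.1 x.2 _)

/-- The homology class of a cycle. -/
def homologyClass (i : κ) : cycleSubmodule K i →ₗ[k] K.homology i :=
  (K.liftCycles (ModuleCat.ofHom (cycleSubmodule K i).subtype) _ rfl
    (cycleSubmodule_subtype_d K i) ≫ K.homologyπ i).hom

lemma iCycles_liftCycles_subtype (i : κ) (x : cycleSubmodule K i) :
    (K.iCycles i).hom ((K.liftCycles (ModuleCat.ofHom (cycleSubmodule K i).subtype) _ rfl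
      (cycleSubmodule_subtype_d K i)).hom x) = x :=
  congr($(K.liftCycles_i (ModuleCat.ofHom (cycleSubmodule K i).subtype) _ rfl
      (cycleSubmodule_subtype_d K i)).hom x)

variable {K}

lemma homologyClass_surjective (i : κ) : Function.Surjective (homologyClass K i) := by
  intro y
  obtain ⟨z, rfl⟩ := (ModuleCat.epi_iff_surjective (K.homologyπ i)).1 inferInstance y
  refine ⟨⟨(K.iCycles i).hom z, mem_cycleSubmodule.2 fun j => congr($(K.iCycles_d i j).hom z)⟩, ?_⟩
  refine congr_arg (K.homologyπ i).hom ?_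
  apply (ModuleCat.mono_iff_injective (K.iCycles i)).1 inferInstance
  exact iCycles_liftCycles_subtype K i _

lemma homologyClass_eq_zero_iff (i : κ) (x : cycleSubmodule K i) :
    homologyClass K i x = 0 ↔ ∃ j z, (K.d j i).hom z = x := by
  have h := iCycles_liftCycles_subtype K i x
  exact (homologyπ_eq_zero_iff K i _).trans
    ⟨fun ⟨j, z, hz⟩ => ⟨j, z, hz.trans h⟩, fun ⟨j, z, hz⟩ => ⟨j, z, hz.trans h.symm⟩⟩

lemma homologyClass_eq_iff (i : κ) (x y : cycleSubmodule K i) :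
    homologyClass K i x = homologyClass K i y ↔ ∃ j z, (K.d j i).hom z = x.1 - y.1 := by
  rw [← sub_eq_zero, ← map_sub, homologyClass_eq_zero_iff]
  rfl

lemma map_mem_cycleSubmodule {L : HomologicalComplex (ModuleCat.{u} k) c} (f : K ⟶ L) {i : κ}
    {x : K.X i} (hx : x ∈ cycleSubmodule K i) : (f.f i).hom x ∈ cycleSubmodule L i := by
  rw [mem_cycleSubmodule] at hx ⊢
  intro j
  have h := congr($(f.comm i j).hom x)
  refine h.trans ?_
  rw [ModuleCat.hom_comp, LinearMap.comp_apply, hx, map_zero]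

lemma homologyMap_homologyClass {L : HomologicalComplex (ModuleCat.{u} k) c} (f : K ⟶ L) (i : κ)
    (x : cycleSubmodule K i) :
    (HomologicalComplex.homologyMap f i).hom (homologyClass K i x) =
      homologyClass L i ⟨(f.f i).hom x, map_mem_cycleSubmodule f x.2⟩ := by
  have h := congr($(HomologicalComplex.homologyπ_naturality f i).hom
    ((K.liftCycles (ModuleCat.ofHom (cycleSubmodule K i).subtype) _ rfl
      (cycleSubmodule_subtype_d K i)).hom x))
  refine h.trans ?_
  refine congr_arg (L.homologyπ i).hom ?_
  apply (ModuleCat.mono_iff_injective (L.iCycles i)).1 inferInstance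
  have h2 := congr($(HomologicalComplex.cyclesMap_i f i).hom
    ((K.liftCycles (ModuleCat.ofHom (cycleSubmodule K i).subtype) _ rfl
      (cycleSubmodule_subtype_d K i)).hom x))
  exact (h2.trans (congr_arg (f.f i).hom (iCycles_liftCycles_subtype K i x))).trans
    (iCycles_liftCycles_subtype L i ⟨_, map_mem_cycleSubmodule f x.2⟩).symm

end HomologyClass

/-! ### Coinvariants of chains of simplices -/

section SimplexChains
variable {k : Type u} [CommRing k] {Γ Γ' G G' : Type u} [Group Γ] [Group Γ'] [Group G] [Group G']
  {A : Rep.{u} k G} {A' : Rep.{u} k G'} {X X' : Type u}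

lemma finsuppAction_single [MulAction G X] (g : G) (x : X) (a : A) :
    finsuppAction X A g (Finsupp.single x a) = Finsupp.single (g • x) (A.ρ g a) := by
  simp [finsuppAction]

/-- The map on chains of simplices induced by a map of vertices and a map of coefficients. -/
def simplexMap (e : X → X') (φ : A →ₗ[k] A') (m : ℕ) :
    ((Fin m → X) →₀ A) →ₗ[k] ((Fin m → X') →₀ A') :=
  Finsupp.mapRange.linearMap φ ∘ₗ Finsupp.lmapDomain A k (e ∘ ·)

@[simp]
lemma simplexMap_single (e : X → X') (φ : A →ₗ[k] A') {m : ℕ} (x : Fin m → X) (a : A) :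
    simplexMap e φ m (Finsupp.single x a) = Finsupp.single (e ∘ x) (φ a) := by
  simp [simplexMap]

/-- The boundary on `k[X^{m+1}] ⊗ A`. -/
def simplexD (X : Type u) (A : Type u) [AddCommGroup A] [Module k A] (m : ℕ) :
    ((Fin (m + 1) → X) →₀ A) →ₗ[k] ((Fin m → X) →₀ A) :=
  transport A (simplexBd k)

lemma simplexD_single {A : Type u} [AddCommGroup A] [Module k A] {m : ℕ} (x : Fin (m + 1) → X)
    (a : A) :
    simplexD (k := k) X A m (Finsupp.single x a) =
      ∑ i : Fin (m + 1), (-1 : k) ^ (i : ℕ) • Finsupp.single (x ∘ i.succAbove) a := by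
  rw [simplexD, transport_single, simplexBd, map_sum]
  simp

lemma simplexD_simplexD {A : Type u} [AddCommGroup A] [Module k A] {m : ℕ}
    (z : (Fin (m + 2) → X) →₀ A) :
    simplexD (k := k) X A m (simplexD (k := k) X A (m + 1) z) = 0 := by
  rw [simplexD, simplexD, transport_transport]
  induction z using Finsupp.induction_linear with
  | zero => simp
  | add x y hx hy => rw [map_add, hx, hy, add_zero]
  | single x a => rw [transport_single, ← chainBd_single x, bd_bd, map_zero]

/-- The augmented complex of simplices is exact. -/
lemma exists_simplexD_eq [Nonempty X] {A : Type u} [AddCommGroup A] [Module k A] {m : ℕ}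
    (z : (Fin (m + 1) → X) →₀ A) (hz : simplexD (k := k) X A m z = 0) :
    ∃ w, simplexD (k := k) X A (m + 1) w = z := by
  let v : X := Classical.arbitrary X
  let c (m : ℕ) := transport (k := k) A (fun x : Fin m → X => cone k v m (Finsupp.single x 1))
  refine ⟨c _ z, ?_⟩
  have key (z : (Fin (m + 1) → X) →₀ A) : simplexD (k := k) X A (m + 1) (c _ z) =
      z - c _ (simplexD (k := k) X A m z) := by
    induction z using Finsupp.induction_linear with
    | zero => simp
    | add x y hx hy => simp only [map_add, hx, hy]; abel
    | single x a =>
      have h (m : ℕ) : Finsupp.linearCombination k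
          (fun x : Fin m → X => cone k v m (Finsupp.single x 1)) = cone k v m := by
        ext; simp
      rw [simplexD, simplexD]
      simp only [c]
      rw [transport_transport, transport_transport, transport_single, transport_single, bd_cone,
        h, chainBd_single, map_sub]
      simp
  rw [key, hz, map_zero, sub_zero]

lemma simplexD_simplexMap (e : X → X') (φ : A →ₗ[k] A') {m : ℕ} (z : (Fin (m + 1) → X) →₀ A) :
    simplexD (k := k) X' A' m (simplexMap e φ (m + 1) z) =
      simplexMap e φ m (simplexD (k := k) X A m z) := by
  induction z using Finsupp.induction_linear with
  | zero => simp
  | add x y hx hy => simp only [map_add, hx, hy]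
  | single x a =>
    rw [simplexMap_single, simplexD_single, simplexD_single, map_sum]
    exact Finset.sum_congr rfl fun i _ => by rw [map_smul, simplexMap_single]; rfl

/-- The homotopy between the maps on chains of simplices induced by two maps of vertices. -/
def prismMap (e e' : X → X') (φ : A →ₗ[k] A') (m : ℕ) :
    ((Fin m → X) →₀ A) →ₗ[k] ((Fin (m + 1) → X') →₀ A') :=
  transport A' (prism e e') ∘ₗ Finsupp.mapRange.linearMap φ

lemma prismMap_single (e e' : X → X') (φ : A →ₗ[k] A') {m : ℕ} (x : Fin m → X) (a : A) :
    prismMap e e' φ m (Finsupp.single x a) = finsuppTmul (φ a) (prism (k := k) e e' x) := by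
  simp [prismMap]

lemma prismMap_zero (e e' : X → X') (φ : A →ₗ[k] A') (z : (Fin 0 → X) →₀ A) :
    prismMap e e' φ 0 z = 0 := by
  induction z using Finsupp.induction_linear with
  | zero => simp
  | add x y hx hy => rw [map_add, hx, hy, add_zero]
  | single x a => rw [prismMap_single, prism, map_zero]

/-- `prismMap e e'` is a homotopy from `simplexMap e` to `simplexMap e'`. -/
lemma simplexD_prismMap (e e' : X → X') (φ : A →ₗ[k] A') {m : ℕ} (z : (Fin (m + 1) → X) →₀ A) :
    simplexD (k := k) X' A' (m + 1) (prismMap e e' φ (m + 1) z) =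
      simplexMap e' φ (m + 1) z - simplexMap e φ (m + 1) z -
        prismMap e e' φ m (simplexD (k := k) X A m z) := by
  induction z using Finsupp.induction_linear with
  | zero => simp
  | add x y hx hy => simp only [map_add, hx, hy]; abel
  | single x a =>
    have h : prismMap e e' φ m (simplexD (k := k) X A m (Finsupp.single x a)) =
        finsuppTmul (φ a) (Finsupp.linearCombination k (prism (k := k) e e') (simplexBd k x)) := by
      rw [simplexD_single, simplexBd, map_sum, map_sum, map_sum]
      refine Finset.sum_congr rfl fun i _ => ?_
      rw [map_smul, prismMap_single, map_smul, map_smul, Finsupp.linearCombination_single, one_smul]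
    rw [h, prismMap_single, simplexD, transport_tmul, bd_prism, map_sub, map_sub,
      simplexMap_single, simplexMap_single, finsuppTmul_single, finsuppTmul_single, one_smul]

variable [MulAction G X] [MulAction G' X']

/-- The submodule of `k[X^m] ⊗ A` spanned by the elements `γ z - z`, where `Γ` acts through a
homomorphism `ι : Γ → G`. -/
abbrev coinvKer (ι : Γ →* G) (X : Type u) [MulAction G X] (A : Rep.{u} k G) (m : ℕ) :
    Submodule k ((Fin m → X) →₀ A) :=
  Representation.Coinvariants.ker ((finsuppAction (Fin m → X) A).comp ι)

lemma single_sub_single_mem_coinvKer (ι : Γ →* G) {m : ℕ} (γ : Γ) (x : Fin m → X) (a : A) :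
    Finsupp.single (ι γ • x) (A.ρ (ι γ) a) - Finsupp.single x a ∈ coinvKer ι X A m := by
  have := Representation.Coinvariants.sub_mem_ker (ρ := (finsuppAction (Fin m → X) A).comp ι) γ
    (Finsupp.single x a)
  rwa [MonoidHom.comp_apply, finsuppAction_single] at this

/-- The relations of the coinvariants are spanned by those for single simplices. -/
lemma coinvKer_le {ι : Γ →* G} {m : ℕ} {S : Submodule k ((Fin m → X) →₀ A)}
    (h : ∀ γ x a, Finsupp.single (ι γ • x) (A.ρ (ι γ) a) - Finsupp.single x a ∈ S) :
    coinvKer ι X A m ≤ S := by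
  refine Submodule.span_le.2 ?_
  rintro _ ⟨⟨γ, z⟩, rfl⟩
  change finsuppAction (Fin m → X) A (ι γ) z - z ∈ S
  induction z using Finsupp.induction_linear with
  | zero => simp
  | add x y hx hy => rw [map_add, add_sub_add_comm]; exact add_mem hx hy
  | single x a => rw [finsuppAction_single]; exact h γ x a

lemma coinvKer_le_ker {ι : Γ →* G} {m : ℕ} {V : Type*} [AddCommGroup V] [Module k V]
    {T : ((Fin m → X) →₀ A) →ₗ[k] V}
    (h : ∀ γ x a, T (Finsupp.single (ι γ • x) (A.ρ (ι γ) a)) = T (Finsupp.single x a)) :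
    coinvKer ι X A m ≤ LinearMap.ker T :=
  coinvKer_le fun γ x a => by rw [LinearMap.mem_ker, map_sub, h, sub_self]

lemma simplexD_mem_coinvKer {ι : Γ →* G} {m : ℕ} {z : (Fin (m + 1) → X) →₀ A}
    (hz : z ∈ coinvKer ι X A (m + 1)) : simplexD (k := k) X A m z ∈ coinvKer ι X A m := by
  refine coinvKer_le (S := (coinvKer ι X A m).comap (simplexD (k := k) X A m)) (fun γ x a => ?_) hz
  rw [Submodule.mem_comap, map_sub, simplexD_single, simplexD_single, ← Finset.sum_sub_distrib]
  refine sum_mem fun i _ => ?_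
  rw [← smul_sub]
  exact Submodule.smul_mem _ _ (single_sub_single_mem_coinvKer ι γ (x ∘ i.succAbove) a)

lemma simplexMap_mem_coinvKer {ι : Γ →* G} {ι' : Γ' →* G'} {f : Γ →* Γ'} {e : X → X'}
    {φ : A →ₗ[k] A'} (he : ∀ γ x, e (ι γ • x) = ι' (f γ) • e x)
    (hφ : ∀ γ a, φ (A.ρ (ι γ) a) = A'.ρ (ι' (f γ)) (φ a)) {m : ℕ} {z : (Fin m → X) →₀ A}
    (hz : z ∈ coinvKer ι X A m) : simplexMap e φ m z ∈ coinvKer ι' X' A' m := by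
  refine coinvKer_le (S := (coinvKer ι' X' A' m).comap (simplexMap e φ m)) (fun γ x a => ?_) hz
  rw [Submodule.mem_comap, map_sub, simplexMap_single, simplexMap_single, hφ]
  convert single_sub_single_mem_coinvKer ι' (f γ) (e ∘ x) (φ a) using 3
  exact funext fun i => he γ (x i)

lemma tmul_lmapDomain_sub_mem (ι : Γ →* G) {m : ℕ} (γ : Γ) (a : A) (w : (Fin m → X) →₀ k) :
    finsuppTmul (A.ρ (ι γ) a) (Finsupp.lmapDomain k k (ι γ • ·) w) - finsuppTmul a w ∈
      coinvKer ι X A m := by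
  induction w using Finsupp.induction_linear with
  | zero => simp
  | add x y hx hy =>
    simp only [map_add, add_sub_add_comm]
    exact add_mem hx hy
  | single x r =>
    rw [Finsupp.lmapDomain_apply, Finsupp.mapDomain_single, finsuppTmul_single, finsuppTmul_single,
      ← map_smul]
    exact single_sub_single_mem_coinvKer ι γ x (r • a)

/-- The prism operator of two equivariant maps of vertices descends to coinvariants. -/
lemma prismMap_mem_coinvKer {ι : Γ →* G} {ι' : Γ' →* G'} {f : Γ →* Γ'} {e e' : X → X'}
    {φ : A →ₗ[k] A'} (he : ∀ γ x, e (ι γ • x) = ι' (f γ) • e x)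
    (he' : ∀ γ x, e' (ι γ • x) = ι' (f γ) • e' x)
    (hφ : ∀ γ a, φ (A.ρ (ι γ) a) = A'.ρ (ι' (f γ)) (φ a)) {m : ℕ} {z : (Fin m → X) →₀ A}
    (hz : z ∈ coinvKer ι X A m) : prismMap e e' φ m z ∈ coinvKer ι' X' A' (m + 1) := by
  refine coinvKer_le (S := (coinvKer ι' X' A' (m + 1)).comap (prismMap e e' φ m)) (fun γ x a => ?_) hz
  rw [Submodule.mem_comap, map_sub, prismMap_single, prismMap_single, hφ]
  have h : prism (k := k) e e' (ι γ • x) =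
      Finsupp.lmapDomain k k (ι' (f γ) • ·) (prism (k := k) e e' x) :=
    prism_equivariant (ι γ • ·) (ι' (f γ) • ·) (he γ) (he' γ) x
  rw [h]
  exact tmul_lmapDomain_sub_mem ι' (f γ) (φ a) _

end SimplexChains

/-! ### Homogeneous and inhomogeneous chains -/

section Bar
variable {k : Type u} [CommRing k] {Γ : Type u} [Group Γ] (B : Rep.{u} k Γ)

/-- The successive quotients `xᵢ⁻¹ xᵢ₊₁` of a sequence. -/
def quotients {n : ℕ} (x : Fin (n + 1) → Γ) : Fin n → Γ :=
  fun i => (x i.castSucc)⁻¹ * x i.succ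

lemma quotients_smul {n : ℕ} (γ : Γ) (x : Fin (n + 1) → Γ) : quotients (γ • x) = quotients x := by
  funext i
  simp [quotients, mul_assoc]

lemma quotients_comp_succAbove {n : ℕ} (x : Fin (n + 2) → Γ) (j : Fin (n + 1)) :
    quotients (x ∘ j.succ.succAbove) = Fin.contractNth j (· * ·) (quotients x) := by
  funext i
  have hx : x = x 0 • Fin.partialProd (quotients x) := (Fin.partialProd_left_inv x).symm
  rw [← Fin.inv_partialProd_mul_eq_contractNth]
  conv_lhs => rw [hx]
  simp [quotients, mul_assoc, Fin.succ_succAbove_succ]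

lemma partialProd_quotients {n : ℕ} (x : Fin (n + 1) → Γ) (i : Fin (n + 1)) :
    x 0 * Fin.partialProd (quotients x) i = x i :=
  congr_fun (Fin.partialProd_left_inv x) i

lemma quotients_partialProd {n : ℕ} (g : Fin n → Γ) : quotients (Fin.partialProd g) = g :=
  funext fun i => Fin.partialProd_right_inv g i

/-- The map from homogeneous to inhomogeneous chains. -/
def toBar (n : ℕ) : ((Fin (n + 1) → Γ) →₀ B) →ₗ[k] ((Fin n → Γ) →₀ B) :=
  Finsupp.lsum k fun x => Finsupp.lsingle (quotients x) ∘ₗ B.ρ (x 0)⁻¹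

variable {B}

lemma toBar_single {n : ℕ} (x : Fin (n + 1) → Γ) (b : B) :
    toBar B n (Finsupp.single x b) = Finsupp.single (quotients x) (B.ρ (x 0)⁻¹ b) := by
  rw [toBar, Finsupp.lsum_single]
  rfl

/-- The passage to inhomogeneous chains is a chain map. -/
lemma toBar_simplexD {n : ℕ} (z : (Fin (n + 2) → Γ) →₀ B) :
    toBar B n (simplexD (k := k) Γ B (n + 1) z) =
      (groupHomology.inhomogeneousChains.d B n).hom (toBar B (n + 1) z) := by
  induction z using Finsupp.induction_linear with
  | zero => simp
  | add x y hx hy => simp only [map_add, hx, hy]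
  | single x b =>
    rw [simplexD_single, toBar_single, map_sum, Fin.sum_univ_succ]
    refine Eq.trans ?_ (groupHomology.inhomogeneousChains.d_single n _ _).symm
    congr 1
    · rw [Fin.val_zero, pow_zero, one_smul, toBar_single]
      congr 1
      · rw [← Module.End.mul_apply, ← map_mul]
        simp [quotients]
    · refine Finset.sum_congr rfl fun j _ => ?_
      rw [map_smul, toBar_single, quotients_comp_succAbove]
      simp

/-- The passage to inhomogeneous chains factors through the coinvariants. -/
lemma toBar_eq_zero {n : ℕ} {z : (Fin (n + 1) → Γ) →₀ B}
    (hz : z ∈ coinvKer (MonoidHom.id Γ) Γ B (n + 1)) : toBar B n z = 0 := by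
  refine coinvKer_le_ker (fun γ x b => ?_) hz
  rw [MonoidHom.id_apply, toBar_single, toBar_single, quotients_smul, ← Module.End.mul_apply,
    ← map_mul]
  simp

end Bar

/-! ### Group homology by simplices on a free set -/

section BarComparison
variable {k : Type u} [CommRing k] {Γ Γ' G G' : Type u} [Group Γ] [Group Γ'] [Group G] [Group G']
  {A : Rep.{u} k G} {A' : Rep.{u} k G'} {X X' : Type u} [MulAction G X] [MulAction G' X']

/-- The coinvariants of `k[X^m] ⊗ A` under a group `Γ` acting through `ι : Γ → G`. -/
abbrev coinvChains (ι : Γ →* G) (X : Type u) [MulAction G X] (A : Rep.{u} k G) (m : ℕ) : Type u :=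
  Representation.Coinvariants ((finsuppAction (Fin m → X) A).comp ι)

variable (ι : Γ →* G) {ι' : Γ' →* G'}

/-- The class of a chain in the coinvariants. -/
abbrev coinvMk (X : Type u) [MulAction G X] (A : Rep.{u} k G) (m : ℕ) :
    ((Fin m → X) →₀ A) →ₗ[k] coinvChains ι X A m :=
  Representation.Coinvariants.mk _

variable {ι} in
lemma coinvMk_surjective (m : ℕ) : Function.Surjective (coinvMk ι X A m) :=
  Representation.Coinvariants.mk_surjective _

variable {ι} in
lemma coinvMk_eq_zero_iff {m : ℕ} {z : (Fin m → X) →₀ A} :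
    coinvMk ι X A m z = 0 ↔ z ∈ coinvKer ι X A m :=
  Representation.Coinvariants.mk_eq_zero _

variable {ι} in
lemma coinvMk_eq_iff {m : ℕ} {z w : (Fin m → X) →₀ A} :
    coinvMk ι X A m z = coinvMk ι X A m w ↔ z - w ∈ coinvKer ι X A m :=
  Representation.Coinvariants.mk_eq_iff _

/-- A linear map on chains which is invariant under `Γ`, as a map on coinvariants. -/
def coinvLift {m : ℕ} {V : Type u} [AddCommGroup V] [Module k V]
    (T : ((Fin m → X) →₀ A) →ₗ[k] V) (h : coinvKer ι X A m ≤ LinearMap.ker T) :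
    coinvChains ι X A m →ₗ[k] V :=
  (coinvKer ι X A m).liftQ T h

variable {ι} in
@[simp]
lemma coinvLift_mk {m : ℕ} {V : Type u} [AddCommGroup V] [Module k V]
    (T : ((Fin m → X) →₀ A) →ₗ[k] V) (h : coinvKer ι X A m ≤ LinearMap.ker T)
    (z : (Fin m → X) →₀ A) : coinvLift ι T h (coinvMk ι X A m z) = T z := rfl

/-- The boundary on the coinvariants. -/
def coinvD (X : Type u) [MulAction G X] (A : Rep.{u} k G) (m : ℕ) :
    coinvChains ι X A (m + 1) →ₗ[k] coinvChains ι X A m :=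
  coinvLift ι (coinvMk ι X A m ∘ₗ simplexD (k := k) X A m) fun _ hz =>
    coinvMk_eq_zero_iff.2 (simplexD_mem_coinvKer hz)

variable {ι} in
@[simp]
lemma coinvD_mk {m : ℕ} (z : (Fin (m + 1) → X) →₀ A) :
    coinvD ι X A m (coinvMk ι X A (m + 1) z) = coinvMk ι X A m (simplexD (k := k) X A m z) := rfl

/-- The `q`-cycles of the unaugmented complex of coinvariants. -/
def coinvCycles (X : Type u) [MulAction G X] (A : Rep.{u} k G) :
    ∀ q : ℕ, Submodule k (coinvChains ι X A (q + 1))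
  | 0 => ⊤
  | q + 1 => LinearMap.ker (coinvD ι X A (q + 1))

variable {ι}

lemma coinvMk_mem_coinvCycles_succ {q : ℕ} {z : (Fin (q + 2) → X) →₀ A} :
    coinvMk ι X A (q + 2) z ∈ coinvCycles ι X A (q + 1) ↔
      simplexD (k := k) X A (q + 1) z ∈ coinvKer ι X A (q + 1) :=
  coinvMk_eq_zero_iff

lemma coinvD_mem_coinvCycles (q : ℕ) (b : coinvChains ι X A (q + 2)) :
    coinvD ι X A (q + 1) b ∈ coinvCycles ι X A q := by
  cases q with
  | zero => trivial
  | succ q =>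
    obtain ⟨z, rfl⟩ := coinvMk_surjective _ b
    rw [coinvD_mk, coinvMk_mem_coinvCycles_succ, simplexD_simplexD]
    exact zero_mem _

/-- The map of coinvariants induced by equivariant maps of vertices and of coefficients. -/
def coinvMap {f : Γ →* Γ'} (e : X → X') (φ : A →ₗ[k] A')
    (he : ∀ γ x, e (ι γ • x) = ι' (f γ) • e x)
    (hφ : ∀ γ a, φ (A.ρ (ι γ) a) = A'.ρ (ι' (f γ)) (φ a)) (m : ℕ) :
    coinvChains ι X A m →ₗ[k] coinvChains ι' X' A' m :=
  coinvLift ι (coinvMk ι' X' A' m ∘ₗ simplexMap e φ m) fun _ hz =>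
    coinvMk_eq_zero_iff.2 (simplexMap_mem_coinvKer he hφ hz)

lemma coinvMap_mk {f : Γ →* Γ'} {e : X → X'} {φ : A →ₗ[k] A'}
    (he : ∀ γ x, e (ι γ • x) = ι' (f γ) • e x)
    (hφ : ∀ γ a, φ (A.ρ (ι γ) a) = A'.ρ (ι' (f γ)) (φ a)) {m : ℕ} (z : (Fin m → X) →₀ A) :
    coinvMap e φ he hφ m (coinvMk ι X A m z) = coinvMk ι' X' A' m (simplexMap e φ m z) := rfl

lemma coinvMap_coinvD {f : Γ →* Γ'} {e : X → X'} {φ : A →ₗ[k] A'}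
    (he : ∀ γ x, e (ι γ • x) = ι' (f γ) • e x)
    (hφ : ∀ γ a, φ (A.ρ (ι γ) a) = A'.ρ (ι' (f γ)) (φ a)) {m : ℕ}
    (b : coinvChains ι X A (m + 1)) :
    coinvMap e φ he hφ m (coinvD ι X A m b) = coinvD ι' X' A' m (coinvMap e φ he hφ (m + 1) b) := by
  obtain ⟨z, rfl⟩ := coinvMk_surjective _ b
  rw [coinvD_mk, coinvMap_mk, coinvMap_mk, coinvD_mk, simplexD_simplexMap]

lemma coinvMap_mem_coinvCycles {f : Γ →* Γ'} {e : X → X'} {φ : A →ₗ[k] A'}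
    (he : ∀ γ x, e (ι γ • x) = ι' (f γ) • e x)
    (hφ : ∀ γ a, φ (A.ρ (ι γ) a) = A'.ρ (ι' (f γ)) (φ a)) {q : ℕ}
    {b : coinvChains ι X A (q + 1)} (hb : b ∈ coinvCycles ι X A q) :
    coinvMap e φ he hφ (q + 1) b ∈ coinvCycles ι' X' A' q := by
  cases q with
  | zero => trivial
  | succ q =>
    change coinvD ι' X' A' (q + 1) _ = 0
    rw [← coinvMap_coinvD, show coinvD ι X A (q + 1) b = 0 from hb, map_zero]

/-- The map from chains of simplices on `X` to inhomogeneous chains of `Γ` induced by a map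
`X → Γ`. -/
def simplexToBar (ι : Γ →* G) (A : Rep.{u} k G) (ρ : X → Γ) (n : ℕ) :
    ((Fin (n + 1) → X) →₀ A) →ₗ[k] (groupHomology.inhomogeneousChains (Rep.res ι A)).X n :=
  toBar (Rep.res ι A) n ∘ₗ simplexMap (A' := Rep.res ι A) ρ LinearMap.id (n + 1)

omit [MulAction G X] in
lemma simplexToBar_apply (ρ : X → Γ) (n : ℕ) (z : (Fin (n + 1) → X) →₀ A) :
    simplexToBar ι A ρ n z =
      toBar (Rep.res ι A) n (simplexMap (A' := Rep.res ι A) ρ LinearMap.id (n + 1) z) := rfl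

omit [MulAction G X] in
lemma simplexToBar_single (ρ : X → Γ) (n : ℕ) (x : Fin (n + 1) → X) (a : A) :
    simplexToBar ι A ρ n (Finsupp.single x a) =
      Finsupp.single (quotients (ρ ∘ x)) (A.ρ (ι (ρ (x 0))⁻¹) a) := by
  rw [simplexToBar_apply, simplexMap_single, toBar_single]
  rfl

omit [MulAction G X] in
lemma simplexToBar_simplexD (ρ : X → Γ) (n : ℕ) (z : (Fin (n + 2) → X) →₀ A) :
    simplexToBar ι A ρ n (simplexD (k := k) X A (n + 1) z) =
      ((groupHomology.inhomogeneousChains (Rep.res ι A)).d (n + 1) n).hom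
        (simplexToBar ι A ρ (n + 1) z) := by
  rw [simplexToBar_apply, groupHomology.inhomogeneousChains.d_def]
  refine (congr_arg _ (simplexD_simplexMap (A' := Rep.res ι A) ρ LinearMap.id z).symm).trans ?_
  exact toBar_simplexD _

variable {ρ : X → Γ} (hρ : ∀ γ x, ρ (ι γ • x) = γ * ρ x)

include hρ in
lemma simplexToBar_eq_zero {n : ℕ} {z : (Fin (n + 1) → X) →₀ A}
    (hz : z ∈ coinvKer ι X A (n + 1)) : simplexToBar ι A ρ n z = 0 := by
  have h : simplexMap (A' := Rep.res ι A) ρ LinearMap.id (n + 1) z ∈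
      coinvKer (MonoidHom.id Γ) Γ (Rep.res ι A) (n + 1) :=
    simplexMap_mem_coinvKer (f := MonoidHom.id Γ) (ι := ι) hρ (fun _ _ => rfl) hz
  exact toBar_eq_zero h

/-- The map from coinvariants of chains of simplices on `X` to inhomogeneous chains of `Γ` induced
by an equivariant map `X → Γ`. -/
def coinvToBar (n : ℕ) : coinvChains ι X A (n + 1) →ₗ[k]
    (groupHomology.inhomogeneousChains (Rep.res ι A)).X n :=
  coinvLift ι (simplexToBar ι A ρ n) fun _ hz => simplexToBar_eq_zero hρ hz

lemma coinvToBar_mk {n : ℕ} (z : (Fin (n + 1) → X) →₀ A) :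
    coinvToBar hρ n (coinvMk ι X A (n + 1) z) = simplexToBar ι A ρ n z := rfl

lemma coinvToBar_coinvD {n : ℕ} (b : coinvChains ι X A (n + 2)) :
    coinvToBar hρ n (coinvD ι X A (n + 1) b) =
      ((groupHomology.inhomogeneousChains (Rep.res ι A)).d (n + 1) n).hom
        (coinvToBar hρ (n + 1) b) := by
  obtain ⟨z, rfl⟩ := coinvMk_surjective _ b
  rw [coinvD_mk, coinvToBar_mk, coinvToBar_mk, simplexToBar_simplexD]

lemma mem_cycleSubmodule_zero {B : Rep.{u} k Γ}
    (x : (groupHomology.inhomogeneousChains B).X 0) :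
    x ∈ cycleSubmodule (groupHomology.inhomogeneousChains B) 0 :=
  mem_cycleSubmodule.2 fun j => by
    rw [HomologicalComplex.shape _ _ _ (by simp)]
    rfl

lemma mem_cycleSubmodule_succ {B : Rep.{u} k Γ} {n : ℕ}
    {x : (groupHomology.inhomogeneousChains B).X (n + 1)} :
    x ∈ cycleSubmodule (groupHomology.inhomogeneousChains B) (n + 1) ↔
      ((groupHomology.inhomogeneousChains B).d (n + 1) n).hom x = 0 := by
  rw [mem_cycleSubmodule]
  refine ⟨fun h => h n, fun h j => ?_⟩
  by_cases hj : j = n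
  · subst hj; exact h
  · rw [HomologicalComplex.shape _ _ _ (by simpa using hj)]
    rfl

lemma coinvToBar_mem {q : ℕ} {b : coinvChains ι X A (q + 1)} (hb : b ∈ coinvCycles ι X A q) :
    coinvToBar hρ q b ∈ cycleSubmodule (groupHomology.inhomogeneousChains (Rep.res ι A)) q := by
  cases q with
  | zero => exact mem_cycleSubmodule_zero _
  | succ q =>
    rw [mem_cycleSubmodule_succ, ← coinvToBar_coinvD, show coinvD ι X A (q + 1) b = 0 from hb,
      map_zero]

/-- The class in `H_q(Γ; A)` of a cycle in the coinvariants of chains of simplices on a free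
`Γ`-set `X`. -/
def barClass (q : ℕ) : coinvCycles ι X A q →ₗ[k] groupHomology (Rep.res ι A) q :=
  homologyClass _ q ∘ₗ ((coinvToBar hρ q).restrict fun _ hb => coinvToBar_mem hρ hb)

lemma barClass_apply {q : ℕ} (b : coinvCycles ι X A q) :
    barClass hρ q b = homologyClass _ q ⟨coinvToBar hρ q b.1, coinvToBar_mem hρ b.2⟩ := rfl

/-- The map from inhomogeneous chains of `Γ` to chains of simplices on `X`, for a base point of
`X`. -/
def ofBar (ι : Γ →* G) (A : Rep.{u} k G) (x₀ : X) (n : ℕ) : (groupHomology.inhomogeneousChains (Rep.res ι A)).X n →ₗ[k]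
    ((Fin (n + 1) → X) →₀ A) :=
  Finsupp.lmapDomain A k fun g i => ι (Fin.partialProd g i) • x₀

lemma ofBar_single (x₀ : X) {n : ℕ} (g : Fin n → Γ) (a : A) :
    ofBar ι A x₀ n (Finsupp.single g a) =
      Finsupp.single (fun i => ι (Fin.partialProd g i) • x₀) a :=
  Finsupp.mapDomain_single

/-- `ofBar` is a chain map modulo the relations of the coinvariants: the faces of a simplex agree
with those of the bar construction, except for the face opposite to the first vertex, which has to
be translated by the first group element. -/
lemma simplexD_ofBar_sub_mem (x₀ : X) {n : ℕ}
    (c : (groupHomology.inhomogeneousChains (Rep.res ι A)).X (n + 1)) :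
    simplexD (k := k) X A (n + 1) (ofBar ι A x₀ (n + 1) c) -
      ofBar ι A x₀ n (((groupHomology.inhomogeneousChains (Rep.res ι A)).d (n + 1) n).hom c) ∈
      coinvKer ι X A (n + 1) := by
  rw [groupHomology.inhomogeneousChains.d_def]
  refine Finsupp.induction_linear (motive := fun c => simplexD (k := k) X A (n + 1)
    (ofBar ι A x₀ (n + 1) c) - ofBar ι A x₀ n
      ((groupHomology.inhomogeneousChains.d (Rep.res ι A) n).hom c) ∈ coinvKer ι X A (n + 1))
    c ?_ (fun c c' h h' => ?_) (fun g a => ?_)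
  · rw [map_zero, map_zero, map_zero, map_zero, sub_zero]
    exact zero_mem _
  · rw [map_add, map_add, map_add, map_add, add_sub_add_comm]
    exact add_mem h h'
  · have e : (groupHomology.inhomogeneousChains.d (Rep.res ι A) n).hom (Finsupp.single g a) = _ :=
      groupHomology.inhomogeneousChains.d_single n g a
    have e2 : ofBar ι A x₀ n ((groupHomology.inhomogeneousChains.d (Rep.res ι A) n).hom
        (Finsupp.single g a)) = Finsupp.single
          (fun i => ι (Fin.partialProd (fun i => g i.succ) i) • x₀) (A.ρ (ι (g 0)⁻¹) a) +
        ∑ j : Fin (n + 1), (-1 : k) ^ ((j : ℕ) + 1) • Finsupp.single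
          (fun i => ι (Fin.partialProd (Fin.contractNth j (· * ·) g) i) • x₀) a := by
      refine (congr_arg (ofBar ι A x₀ n) e).trans ?_
      refine (map_add (ofBar ι A x₀ n) _ _).trans ?_
      refine congr_arg₂ (· + ·) (ofBar_single x₀ _ _) ?_
      refine (map_sum (ofBar ι A x₀ n) _ _).trans ?_
      exact Finset.sum_congr rfl fun j _ =>
        (map_smul (ofBar ι A x₀ n) _ _).trans (congr_arg _ (ofBar_single x₀ _ _))
    rw [e2, ofBar_single, simplexD_single, Fin.sum_univ_succ]
    have e3 (j : Fin (n + 1)) : (fun i => ι (Fin.partialProd (Fin.contractNth j (· * ·) g) i) • x₀) =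
        (fun i => ι (Fin.partialProd g i) • x₀) ∘ j.succ.succAbove := by
      rw [Fin.partialProd_contractNth]
      rfl
    simp only [e3, Fin.val_succ]
    rw [add_sub_add_right_eq_sub, Fin.val_zero, pow_zero, one_smul]
    have := single_sub_single_mem_coinvKer (A := A) ι (g 0)
      (fun i => ι (Fin.partialProd (fun i => g i.succ) i) • x₀) (A.ρ (ι (g 0)⁻¹) a)
    convert this using 3
    · funext i
      simp [Fin.partialProd_succ', mul_smul]
      rfl
    · rw [← Module.End.mul_apply, ← map_mul]
      simp

lemma simplexToBar_ofBar {x₀ : X} (h₀ : ρ x₀ = 1) (hρ : ∀ γ x, ρ (ι γ • x) = γ * ρ x) {n : ℕ}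
    (c : (groupHomology.inhomogeneousChains (Rep.res ι A)).X n) :
    simplexToBar ι A ρ n (ofBar ι A x₀ n c) = c := by
  refine Finsupp.induction_linear (motive := fun c => simplexToBar ι A ρ n (ofBar ι A x₀ n c) = c)
    c ?_ (fun c c' h h' => ?_) (fun g a => ?_)
  · rw [map_zero, map_zero]
  · rw [map_add, map_add, h, h']
  · rw [ofBar_single, simplexToBar_single]
    have h : ρ ∘ (fun i => ι (Fin.partialProd g i) • x₀) = Fin.partialProd g :=
      funext fun i => by rw [Function.comp_apply, hρ, h₀, mul_one]
    rw [h, quotients_partialProd, Fin.partialProd_zero, hρ, h₀]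
    simp

/-- Modulo the relations of the coinvariants, the composite of the two comparison maps on chains of
simplices is induced by the map `x ↦ ι (ρ x) • x₀` of vertices. -/
lemma ofBar_simplexToBar_sub_mem (x₀ : X) {n : ℕ} (z : (Fin (n + 1) → X) →₀ A) :
    simplexMap (fun x => ι (ρ x) • x₀) LinearMap.id (n + 1) z -
      ofBar ι A x₀ n (simplexToBar ι A ρ n z) ∈ coinvKer ι X A (n + 1) := by
  induction z using Finsupp.induction_linear with
  | zero => simp
  | add x y hx hy => simp only [map_add, add_sub_add_comm]; exact add_mem hx hy
  | single x a =>
    rw [simplexToBar_single, ofBar_single, simplexMap_single]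
    have := single_sub_single_mem_coinvKer (A := A) ι (ρ (x 0))
      (fun i => ι (Fin.partialProd (quotients (ρ ∘ x)) i) • x₀) (A.ρ (ι (ρ (x 0))⁻¹) a)
    convert this using 3
    · funext i
      rw [Pi.smul_apply, ← mul_smul, ← map_mul]
      exact congr_arg (fun g => ι g • x₀) (partialProd_quotients (ρ ∘ x) i).symm
    · rw [← Module.End.mul_apply, ← map_mul]
      simp

/-- An equivariant self-map of `X` acts on cycles by adding a boundary. -/
lemma exists_sub_simplexMap_eq {e : X → X} (he : ∀ γ x, e (ι γ • x) = ι γ • e x) {q : ℕ}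
    {z : (Fin (q + 1) → X) →₀ A} (hz : coinvMk ι X A (q + 1) z ∈ coinvCycles ι X A q) :
    ∃ w, simplexMap e LinearMap.id (q + 1) z - z - simplexD (k := k) X A (q + 1) w ∈
      coinvKer ι X A (q + 1) := by
  refine ⟨prismMap id e LinearMap.id (q + 1) z, ?_⟩
  have hid : simplexMap id LinearMap.id (q + 1) z = z := by
    clear hz
    induction z using Finsupp.induction_linear with
    | zero => simp
    | add x y hx hy => rw [map_add, hx, hy]
    | single x a => rw [simplexMap_single]; rfl
  rw [simplexD_prismMap, hid, sub_sub_cancel]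
  cases q with
  | zero =>
    rw [prismMap_zero]
    exact zero_mem _
  | succ q =>
    exact prismMap_mem_coinvKer (f := MonoidHom.id Γ) (ι' := ι) (fun _ _ => rfl) he
      (fun _ _ => rfl) (coinvMk_mem_coinvCycles_succ.1 hz)

include hρ in
/-- After a translation, any point has image `1` under an equivariant map to the group. -/
lemma exists_base_point [Nonempty X] : ∃ x₀ : X, ρ x₀ = 1 :=
  ⟨ι (ρ (Classical.arbitrary X))⁻¹ • Classical.arbitrary X, by rw [hρ, inv_mul_cancel]⟩

/-- With `barClass_eq_zero_iff`, this identifies the homology of the coinvariants of chains of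
simplices on `X` with `H_q(Γ; A)`. The equivariant map `ρ : X → Γ` says that `X` is a free `Γ`-set.
-/
lemma barClass_surjective [Nonempty X] (q : ℕ) :
    Function.Surjective (barClass (A := A) hρ q) := by
  intro y
  obtain ⟨⟨c, hc⟩, rfl⟩ := homologyClass_surjective q y
  obtain ⟨x₀, h₀⟩ := exists_base_point hρ
  have hz : coinvMk ι X A (q + 1) (ofBar ι A x₀ q c) ∈ coinvCycles ι X A q := by
    cases q with
    | zero => trivial
    | succ q =>
      rw [coinvMk_mem_coinvCycles_succ]
      have h := simplexD_ofBar_sub_mem x₀ c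
      rwa [mem_cycleSubmodule_succ.1 hc, map_zero, sub_zero] at h
  refine ⟨⟨_, hz⟩, ?_⟩
  rw [barClass_apply]
  congr 2
  exact simplexToBar_ofBar h₀ hρ c

lemma barClass_eq_zero_iff [Nonempty X] {q : ℕ} (b : coinvCycles ι X A q) :
    barClass hρ q b = 0 ↔ ∃ w, coinvD ι X A (q + 1) w = b := by
  refine (homologyClass_eq_zero_iff _ _).trans ?_
  constructor
  · rintro ⟨j, c, hc⟩
    obtain ⟨c, hc⟩ : ∃ c, ((groupHomology.inhomogeneousChains (Rep.res ι A)).d (q + 1) q).hom c =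
        coinvToBar hρ q b.1 := by
      by_cases hj : j = q + 1
      · subst hj; exact ⟨c, hc⟩
      · rw [HomologicalComplex.shape _ _ _ (by simpa using Ne.symm hj)] at hc
        exact ⟨0, (map_zero _).trans hc⟩
    obtain ⟨b, hb⟩ := b
    obtain ⟨z, rfl⟩ := coinvMk_surjective _ b
    obtain ⟨x₀, h₀⟩ := exists_base_point hρ
    -- The composite `x ↦ ι (ρ x) • x₀` is equivariant, so it is homotopic to the identity.
    obtain ⟨w, hw⟩ := exists_sub_simplexMap_eq (e := fun x => ι (ρ x) • x₀)
      (fun γ x => by rw [hρ, map_mul, mul_smul]) hb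
    refine ⟨coinvMk ι X A (q + 2) (ofBar ι A x₀ (q + 1) c - w), ?_⟩
    rw [coinvD_mk, coinvMk_eq_iff, map_sub]
    have h1 := simplexD_ofBar_sub_mem x₀ c
    rw [hc, coinvToBar_mk] at h1
    have h2 := ofBar_simplexToBar_sub_mem (ι := ι) (ρ := ρ) x₀ z
    convert add_mem (sub_mem h1 h2) hw using 1
    abel
  · rintro ⟨w, hw⟩
    exact ⟨q + 1, coinvToBar hρ (q + 1) w, by rw [← coinvToBar_coinvD, hw]; rfl⟩

/-- Naturality of the class in `H_q(Γ; A)`. The map of vertices need not respect the chosen maps to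
the groups: any two choices are homotopic. -/
lemma map_barClass {ρ' : X' → Γ'} (hρ' : ∀ γ x, ρ' (ι' γ • x) = γ * ρ' x) (f : Γ →* Γ')
    (e : X → X') (he : ∀ γ x, e (ι γ • x) = ι' (f γ) • e x) (φ : A →ₗ[k] A')
    (hφ : ∀ γ a, φ (A.ρ (ι γ) a) = A'.ρ (ι' (f γ)) (φ a))
    (ψ : Rep.res ι A ⟶ Rep.res f (Rep.res ι' A')) (hψ : ∀ a : A, ψ.hom a = φ a) {q : ℕ}
    (b : coinvCycles ι X A q) :
    (groupHomology.map f ψ q).hom (barClass hρ q b) =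
      barClass hρ' q ⟨coinvMap e φ he hφ (q + 1) b.1, coinvMap_mem_coinvCycles he hφ b.2⟩ := by
  obtain ⟨b, hb⟩ := b
  obtain ⟨z, rfl⟩ := coinvMk_surjective _ b
  rw [barClass_apply, barClass_apply]
  refine (homologyMap_homologyClass _ _ _).trans ?_
  rw [homologyClass_eq_iff]
  have h1 : ((groupHomology.chainsMap f ψ).f q).hom (coinvToBar hρ q (coinvMk ι X A (q + 1) z)) =
      toBar (Rep.res ι' A') q (simplexMap (A' := Rep.res ι' A') (f ∘ ρ) φ (q + 1) z) := by
    rw [coinvToBar_mk]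
    clear hb
    induction z using Finsupp.induction_linear with
    | zero => simp only [map_zero]
    | add x y hx hy => simp only [map_add, hx, hy]
    | single x a =>
      rw [simplexToBar_single, simplexMap_single, toBar_single]
      refine (groupHomology.chainsMap_f_single f ψ q _ _).trans ?_
      congr 1
      · funext i
        simp [quotients]
      · rw [hψ, hφ]
        simp
  have h2 : coinvToBar hρ' q (coinvMap e φ he hφ (q + 1) (coinvMk ι X A (q + 1) z)) =
      toBar (Rep.res ι' A') q (simplexMap (A' := Rep.res ι' A') (ρ' ∘ e) φ (q + 1) z) := by
    rw [coinvMap_mk, coinvToBar_mk, simplexToBar_apply]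
    congr 1
    clear hb h1
    induction z using Finsupp.induction_linear with
    | zero => simp only [map_zero]
    | add x y hx hy => simp only [map_add, hx, hy]
    | single x a => simp only [simplexMap_single]; rfl
  -- The two maps of vertices `ρ' ∘ e` and `f ∘ ρ` to `Γ'` are homotopic by the prism operator.
  refine ⟨q + 1, toBar (Rep.res ι' A') (q + 1)
    (prismMap (A' := Rep.res ι' A') (ρ' ∘ e) (f ∘ ρ) φ (q + 1) z), ?_⟩
  refine Eq.trans ?_ (congr_arg₂ (· - ·) h1 h2).symm
  refine Eq.trans (congr($(groupHomology.inhomogeneousChains.d_def (Rep.res ι' A') q).hom _)) ?_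
  refine (toBar_simplexD _).symm.trans ?_
  rw [simplexD_prismMap, map_sub, map_sub]
  refine sub_eq_self.2 ?_
  cases q with
  | zero => rw [prismMap_zero, map_zero]
  | succ q =>
    have h : prismMap (A' := Rep.res ι' A') (ρ' ∘ e) (f ∘ ρ) φ (q + 1)
        (simplexD (k := k) X A (q + 1) z) ∈
          coinvKer (MonoidHom.id Γ') Γ' (Rep.res ι' A') (q + 2) :=
      prismMap_mem_coinvKer (ι := ι) (ι' := MonoidHom.id Γ') (f := f)
        (fun γ x => by simp [he, hρ']) (fun γ x => by simp [hρ]) (fun γ a => hφ γ a)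
        (coinvMk_mem_coinvCycles_succ.1 hb)
    exact toBar_eq_zero h

end BarComparison

/-! ### Invariant cochains of simplices -/

section SimplexCochains
variable {k : Type u} [CommRing k] {Γ Γ' G G' : Type u} [Group Γ] [Group Γ'] [Group G] [Group G']
  {A : Rep.{u} k G} {A' : Rep.{u} k G'} {X X' : Type u}

/-- The coboundary on `Hom(k[X^m], A)`. -/
def simplexDelta (X : Type u) (A : Type u) [AddCommGroup A] [Module k A] (m : ℕ) :
    ((Fin m → X) → A) →ₗ[k] ((Fin (m + 1) → X) → A) :=
  cotransport A (simplexBd k)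

lemma simplexDelta_apply {A : Type u} [AddCommGroup A] [Module k A] {m : ℕ} (F : (Fin m → X) → A)
    (x : Fin (m + 1) → X) :
    simplexDelta (k := k) X A m F x =
      ∑ i : Fin (m + 1), (-1 : k) ^ (i : ℕ) • F (x ∘ i.succAbove) := by
  rw [simplexDelta, cotransport_apply, simplexBd, map_sum]
  simp

lemma linearCombination_single_eq {Y A : Type u} [AddCommGroup A] [Module k A] (F : Y → A) (y : Y) :
    Finsupp.linearCombination k F (Finsupp.single y 1) = F y := by
  simp

lemma simplexDelta_simplexDelta {A : Type u} [AddCommGroup A] [Module k A] {m : ℕ}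
    (F : (Fin m → X) → A) :
    simplexDelta (k := k) X A (m + 1) (simplexDelta (k := k) X A m F) = 0 := by
  rw [simplexDelta, simplexDelta, cotransport_cotransport]
  funext x
  rw [cotransport_apply, ← chainBd_single x, bd_bd, map_zero]
  rfl

/-- The augmented complex of cochains of simplices is exact. -/
lemma exists_simplexDelta_eq [Nonempty X] {A : Type u} [AddCommGroup A] [Module k A] {m : ℕ}
    (F : (Fin (m + 1) → X) → A) (hF : simplexDelta (k := k) X A (m + 1) F = 0) :
    ∃ E, simplexDelta (k := k) X A m E = F := by
  let v : X := Classical.arbitrary X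
  refine ⟨fun x => F (Fin.cons v x), funext fun x => ?_⟩
  have h1 : simplexDelta (k := k) X A m (fun x => F (Fin.cons v x)) x =
      Finsupp.linearCombination k F (cone k v m (simplexBd k x)) := by
    rw [simplexDelta, cotransport_apply, cone, Finsupp.lmapDomain_apply,
      Finsupp.linearCombination_mapDomain]
    rfl
  have h2 : Finsupp.linearCombination k F (chainBd k (m + 1)
      (cone k v (m + 1) (Finsupp.single x 1))) = 0 := by
    rw [← linearCombination_cotransport]
    change Finsupp.linearCombination k (simplexDelta (k := k) X A (m + 1) F) _ = 0
    rw [hF]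
    simp
  rw [bd_cone, map_sub, chainBd_single, sub_eq_zero, linearCombination_single_eq] at h2
  rw [h1, h2]

/-- The map on cochains of simplices induced by a map of vertices and a map of coefficients. -/
def cosimplexMap (e : X → X') (φ : A' →ₗ[k] A) (m : ℕ) :
    ((Fin m → X') → A') →ₗ[k] ((Fin m → X) → A) :=
  φ.compLeft _ ∘ₗ LinearMap.funLeft k A' (e ∘ ·)

@[simp]
lemma cosimplexMap_apply (e : X → X') (φ : A' →ₗ[k] A) {m : ℕ} (F : (Fin m → X') → A')
    (x : Fin m → X) : cosimplexMap e φ m F x = φ (F (e ∘ x)) := rfl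

lemma simplexDelta_cosimplexMap (e : X → X') (φ : A' →ₗ[k] A) {m : ℕ} (F : (Fin m → X') → A') :
    simplexDelta (k := k) X A m (cosimplexMap e φ m F) =
      cosimplexMap e φ (m + 1) (simplexDelta (k := k) X' A' m F) := by
  funext x
  rw [cosimplexMap_apply, simplexDelta_apply, simplexDelta_apply, map_sum]
  exact Finset.sum_congr rfl fun i _ => by rw [map_smul]; rfl

/-- The homotopy between the maps on cochains of simplices induced by two maps of vertices. -/
def coprismMap (e e' : X → X') (φ : A' →ₗ[k] A) (m : ℕ) :
    ((Fin (m + 1) → X') → A') →ₗ[k] ((Fin m → X) → A) :=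
  φ.compLeft _ ∘ₗ cotransport A' (prism e e')

lemma coprismMap_apply (e e' : X → X') (φ : A' →ₗ[k] A) {m : ℕ} (F : (Fin (m + 1) → X') → A')
    (x : Fin m → X) :
    coprismMap e e' φ m F x = φ (Finsupp.linearCombination k F (prism e e' x)) := rfl

lemma coprismMap_zero (e e' : X → X') (φ : A' →ₗ[k] A) (F : (Fin 1 → X') → A') :
    coprismMap e e' φ 0 F = 0 :=
  funext fun x => by rw [coprismMap_apply, prism, map_zero, map_zero]; rfl

/-- `coprismMap e e'` is a homotopy between the maps on cochains induced by `e` and `e'`. -/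
lemma coprismMap_simplexDelta (e e' : X → X') (φ : A' →ₗ[k] A) {m : ℕ}
    (F : (Fin (m + 1) → X') → A') :
    coprismMap e e' φ (m + 1) (simplexDelta (k := k) X' A' (m + 1) F) =
      cosimplexMap e' φ (m + 1) F - cosimplexMap e φ (m + 1) F -
        simplexDelta (k := k) X A m (coprismMap e e' φ m F) := by
  funext x
  have h : simplexDelta (k := k) X A m (coprismMap e e' φ m F) x =
      φ (Finsupp.linearCombination k F
        (Finsupp.linearCombination k (prism e e') (simplexBd k x))) := by
    rw [← linearCombination_cotransport]
    exact linearCombination_map φ _ _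
  rw [Pi.sub_apply, Pi.sub_apply, h, coprismMap_apply, simplexDelta, linearCombination_cotransport,
    bd_prism, map_sub, map_sub, map_sub, map_sub, linearCombination_single_eq,
    linearCombination_single_eq, cosimplexMap_apply, cosimplexMap_apply]

variable [MulAction G X] [MulAction G' X']

/-- The cochains of simplices that are invariant under a group `Γ` acting through `ι : Γ → G`. -/
abbrev invCochains (ι : Γ →* G) (X : Type u) [MulAction G X] (A : Rep.{u} k G) (m : ℕ) :
    Submodule k ((Fin m → X) → A) :=
  Representation.invariants ((funAction (Fin m → X) A).comp ι)

lemma mem_invCochains {ι : Γ →* G} {m : ℕ} {F : (Fin m → X) → A} :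
    F ∈ invCochains ι X A m ↔ ∀ γ x, F (ι γ • x) = A.ρ (ι γ) (F x) := by
  constructor
  · intro h γ x
    have := congr_fun (h γ) (ι γ • x)
    rw [← this]
    simp [funAction, LinearMap.funLeft]
  · intro h γ
    funext x
    change A.ρ (ι γ) (F ((ι γ)⁻¹ • x)) = F x
    rw [← h, smul_inv_smul]

lemma simplexDelta_mem_invCochains {ι : Γ →* G} {m : ℕ} {F : (Fin m → X) → A}
    (hF : F ∈ invCochains ι X A m) :
    simplexDelta (k := k) X A m F ∈ invCochains ι X A (m + 1) := by
  rw [mem_invCochains] at hF ⊢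
  intro γ x
  rw [simplexDelta_apply, simplexDelta_apply, map_sum]
  refine Finset.sum_congr rfl fun i _ => ?_
  rw [map_smul, ← hF]
  rfl

lemma cosimplexMap_mem_invCochains {ι : Γ →* G} {ι' : Γ' →* G'} {f : Γ →* Γ'} {e : X → X'}
    {φ : A' →ₗ[k] A} (he : ∀ γ x, e (ι γ • x) = ι' (f γ) • e x)
    (hφ : ∀ γ a, φ (A'.ρ (ι' (f γ)) a) = A.ρ (ι γ) (φ a)) {m : ℕ} {F : (Fin m → X') → A'}
    (hF : F ∈ invCochains ι' X' A' m) : cosimplexMap e φ m F ∈ invCochains ι X A m := by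
  rw [mem_invCochains] at hF ⊢
  intro γ x
  rw [cosimplexMap_apply, cosimplexMap_apply, ← hφ, ← hF]
  congr 2
  exact funext fun i => he γ (x i)

lemma coprismMap_mem_invCochains {ι : Γ →* G} {ι' : Γ' →* G'} {f : Γ →* Γ'} {e e' : X → X'}
    {φ : A' →ₗ[k] A} (he : ∀ γ x, e (ι γ • x) = ι' (f γ) • e x)
    (he' : ∀ γ x, e' (ι γ • x) = ι' (f γ) • e' x)
    (hφ : ∀ γ a, φ (A'.ρ (ι' (f γ)) a) = A.ρ (ι γ) (φ a)) {m : ℕ} {F : (Fin (m + 1) → X') → A'}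
    (hF : F ∈ invCochains ι' X' A' (m + 1)) : coprismMap e e' φ m F ∈ invCochains ι X A m := by
  rw [mem_invCochains] at hF ⊢
  intro γ x
  have h : prism (k := k) e e' (ι γ • x) =
      Finsupp.lmapDomain k k (ι' (f γ) • ·) (prism (k := k) e e' x) :=
    prism_equivariant (ι γ • ·) (ι' (f γ) • ·) (he γ) (he' γ) x
  rw [coprismMap_apply, coprismMap_apply, ← hφ, h, Finsupp.lmapDomain_apply,
    Finsupp.linearCombination_mapDomain, ← linearCombination_map (A'.ρ (ι' (f γ)))]
  congr 3
  exact funext fun y => hF (f γ) y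

/-- The cocycles of degree `q` in the complex of invariant cochains. -/
def invCocycles (ι : Γ →* G) (X : Type u) [MulAction G X] (A : Rep.{u} k G) (q : ℕ) :
    Submodule k ((Fin (q + 1) → X) → A) :=
  invCochains ι X A (q + 1) ⊓ LinearMap.ker (simplexDelta (k := k) X A (q + 1))

/-- The coboundaries of degree `q` in the unaugmented complex of invariant cochains. -/
def invCoboundaries (ι : Γ →* G) (X : Type u) [MulAction G X] (A : Rep.{u} k G) :
    ∀ q : ℕ, Submodule k ((Fin (q + 1) → X) → A)
  | 0 => ⊥
  | q + 1 => (invCochains ι X A (q + 1)).map (simplexDelta (k := k) X A (q + 1))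

lemma cosimplexMap_mem_invCocycles {ι : Γ →* G} {ι' : Γ' →* G'} {f : Γ →* Γ'} {e : X → X'}
    {φ : A' →ₗ[k] A} (he : ∀ γ x, e (ι γ • x) = ι' (f γ) • e x)
    (hφ : ∀ γ a, φ (A'.ρ (ι' (f γ)) a) = A.ρ (ι γ) (φ a)) {q : ℕ} {F : (Fin (q + 1) → X') → A'}
    (hF : F ∈ invCocycles ι' X' A' q) : cosimplexMap e φ (q + 1) F ∈ invCocycles ι X A q := by
  refine ⟨cosimplexMap_mem_invCochains he hφ hF.1, ?_⟩
  refine (simplexDelta_cosimplexMap e φ F).trans ?_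
  rw [show simplexDelta X' A' (q + 1) F = 0 from hF.2, map_zero]

lemma cosimplexMap_mem_invCoboundaries {ι : Γ →* G} {ι' : Γ' →* G'} {f : Γ →* Γ'} {e : X → X'}
    {φ : A' →ₗ[k] A} (he : ∀ γ x, e (ι γ • x) = ι' (f γ) • e x)
    (hφ : ∀ γ a, φ (A'.ρ (ι' (f γ)) a) = A.ρ (ι γ) (φ a)) {q : ℕ} {F : (Fin (q + 1) → X') → A'}
    (hF : F ∈ invCoboundaries ι' X' A' q) :
    cosimplexMap e φ (q + 1) F ∈ invCoboundaries ι X A q := by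
  cases q with
  | zero =>
    rw [show F = 0 from hF, map_zero]
    exact zero_mem _
  | succ q =>
    obtain ⟨E, hE, rfl⟩ := hF
    exact ⟨_, cosimplexMap_mem_invCochains he hφ hE, simplexDelta_cosimplexMap e φ E⟩

/-- Two equivariant maps of vertices induce maps on cocycles that differ by coboundaries. -/
lemma cosimplexMap_sub_mem_invCoboundaries {ι : Γ →* G} {ι' : Γ' →* G'} {f : Γ →* Γ'}
    {e e' : X → X'} {φ : A' →ₗ[k] A} (he : ∀ γ x, e (ι γ • x) = ι' (f γ) • e x)
    (he' : ∀ γ x, e' (ι γ • x) = ι' (f γ) • e' x)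
    (hφ : ∀ γ a, φ (A'.ρ (ι' (f γ)) a) = A.ρ (ι γ) (φ a)) {q : ℕ} {F : (Fin (q + 1) → X') → A'}
    (hF : F ∈ invCocycles ι' X' A' q) :
    cosimplexMap e' φ (q + 1) F - cosimplexMap e φ (q + 1) F ∈ invCoboundaries ι X A q := by
  have h := coprismMap_simplexDelta e e' φ F
  rw [show simplexDelta X' A' (q + 1) F = 0 from hF.2, map_zero] at h
  rw [sub_eq_zero.1 h.symm]
  cases q with
  | zero =>
    rw [coprismMap_zero, map_zero]
    exact zero_mem _
  | succ q => exact ⟨_, coprismMap_mem_invCochains he he' hφ hF.1, rfl⟩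

end SimplexCochains

/-! ### Homogeneous and inhomogeneous cochains -/

section Cobar
variable {k : Type u} [CommRing k] {Γ : Type u} [Group Γ] (B : Rep.{u} k Γ)

/-- The map from homogeneous to inhomogeneous cochains. -/
def toCobar (n : ℕ) : ((Fin (n + 1) → Γ) → B) →ₗ[k] ((Fin n → Γ) → B) :=
  LinearMap.funLeft k B Fin.partialProd

/-- The map from inhomogeneous to homogeneous cochains. -/
def ofCobar (n : ℕ) : ((Fin n → Γ) → B) →ₗ[k] ((Fin (n + 1) → Γ) → B) where
  toFun c x := B.ρ (x 0) (c (quotients x))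
  map_add' _ _ := funext fun _ => map_add _ _ _
  map_smul' _ _ := funext fun _ => map_smul _ _ _

variable {B}

lemma toCobar_apply {n : ℕ} (F : (Fin (n + 1) → Γ) → B) (g : Fin n → Γ) :
    toCobar B n F g = F (Fin.partialProd g) := rfl

lemma ofCobar_apply {n : ℕ} (c : (Fin n → Γ) → B) (x : Fin (n + 1) → Γ) :
    ofCobar B n c x = B.ρ (x 0) (c (quotients x)) := rfl

lemma toCobar_ofCobar {n : ℕ} (c : (Fin n → Γ) → B) : toCobar B n (ofCobar B n c) = c :=
  funext fun g => by
    rw [toCobar_apply, ofCobar_apply, quotients_partialProd, Fin.partialProd_zero, map_one]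
    rfl

/-- An invariant cochain is determined by its values on simplices whose first vertex is `1`. -/
lemma ofCobar_toCobar {n : ℕ} {F : (Fin (n + 1) → Γ) → B}
    (hF : F ∈ invCochains (MonoidHom.id Γ) Γ B (n + 1)) : ofCobar B n (toCobar B n F) = F :=
  funext fun x => by
    rw [ofCobar_apply, toCobar_apply]
    refine (mem_invCochains.1 hF (x 0) _).symm.trans ?_
    exact congr_arg F (Fin.partialProd_left_inv x)

lemma ofCobar_mem {n : ℕ} (c : (Fin n → Γ) → B) :
    ofCobar B n c ∈ invCochains (MonoidHom.id Γ) Γ B (n + 1) :=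
  mem_invCochains.2 fun γ x => by
    rw [ofCobar_apply, ofCobar_apply, MonoidHom.id_apply, quotients_smul, ← Module.End.mul_apply,
      ← map_mul]
    rfl

lemma toCobar_simplexDelta {n : ℕ} {F : (Fin (n + 1) → Γ) → B}
    (hF : F ∈ invCochains (MonoidHom.id Γ) Γ B (n + 1)) :
    toCobar B (n + 1) (simplexDelta (k := k) Γ B (n + 1) F) =
      (inhomogeneousCochains.d B n).hom (toCobar B n F) := by
  funext g
  rw [inhomogeneousCochains.d_hom_apply, toCobar_apply, simplexDelta_apply, Fin.sum_univ_succ]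
  congr 1
  · rw [Fin.val_zero, pow_zero, one_smul]
    refine Eq.trans ?_ (mem_invCochains.1 hF (g 0) _)
    congr 1
    funext i
    simp [Fin.partialProd_succ']
    rfl
  · refine Finset.sum_congr rfl fun j _ => ?_
    rw [toCobar_apply, Fin.partialProd_contractNth]
    rfl

lemma mem_cocycleSubmodule_iff {n : ℕ} {c : (groupCohomology.inhomogeneousCochains B).X n} :
    c ∈ cycleSubmodule (groupCohomology.inhomogeneousCochains B) n ↔
      (inhomogeneousCochains.d B n).hom c = 0 := by
  rw [mem_cycleSubmodule, ← groupCohomology.inhomogeneousCochains.d_def]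
  refine ⟨fun h => h _, fun h j => ?_⟩
  by_cases hj : n + 1 = j
  · subst hj; exact h
  · rw [HomologicalComplex.shape _ _ _ (by simpa using hj)]
    rfl

lemma toCobar_mem_cocycles {q : ℕ} {F : (Fin (q + 1) → Γ) → B}
    (hF : F ∈ invCocycles (MonoidHom.id Γ) Γ B q) :
    toCobar B q F ∈ cycleSubmodule (groupCohomology.inhomogeneousCochains B) q := by
  rw [mem_cocycleSubmodule_iff]
  refine (toCobar_simplexDelta hF.1).symm.trans ?_
  rw [show simplexDelta Γ B (q + 1) F = 0 from hF.2, map_zero]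

/-- The class in `H^q(Γ; B)` of a homogeneous cocycle. -/
def homogeneousClass (B : Rep.{u} k Γ) (q : ℕ) :
    invCocycles (MonoidHom.id Γ) Γ B q →ₗ[k] groupCohomology B q :=
  homologyClass (groupCohomology.inhomogeneousCochains B) q ∘ₗ
    (toCobar B q).restrict fun _ hF => toCobar_mem_cocycles hF

/-- With `homogeneousClass_surjective`, this identifies the cohomology of the invariant cochains on
`Γ` with `H^q(Γ; B)`. -/
lemma homogeneousClass_eq_zero_iff {q : ℕ} (F : invCocycles (MonoidHom.id Γ) Γ B q) :
    homogeneousClass B q F = 0 ↔ F.1 ∈ invCoboundaries (MonoidHom.id Γ) Γ B q := by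
  refine (homologyClass_eq_zero_iff _ _).trans ?_
  change (∃ j z, ((groupCohomology.inhomogeneousCochains B).d j q).hom z = toCobar B q F.1) ↔ _
  constructor
  · rintro ⟨j, c, hc⟩
    by_cases hj : j + 1 = q
    · subst hj
      have hc' : (inhomogeneousCochains.d B j).hom c = toCobar B (j + 1) F.1 :=
        congr($(groupCohomology.inhomogeneousCochains.d_def B j).hom c).symm.trans hc
      refine ⟨ofCobar B j c, ofCobar_mem _, ?_⟩
      have h1 := toCobar_simplexDelta (ofCobar_mem (B := B) c)
      rw [toCobar_ofCobar, hc'] at h1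
      rw [← ofCobar_toCobar F.2.1, ← h1,
        ofCobar_toCobar (simplexDelta_mem_invCochains (ofCobar_mem c))]
    · rw [HomologicalComplex.shape _ _ _ (by simpa using hj)] at hc
      have h0 : toCobar B q F.1 = 0 := hc.symm
      rw [← ofCobar_toCobar F.2.1, h0, map_zero]
      exact zero_mem _
  · cases q with
    | zero =>
      intro h
      refine ⟨0, 0, ?_⟩
      rw [show F.1 = 0 from h, map_zero, map_zero]
    | succ q =>
      rintro ⟨E, hE, h⟩
      refine ⟨q, toCobar B q E, ?_⟩
      rw [← h, toCobar_simplexDelta hE]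
      exact congr($(groupCohomology.inhomogeneousCochains.d_def B q).hom _)

lemma homogeneousClass_surjective (B : Rep.{u} k Γ) (q : ℕ) :
    Function.Surjective (homogeneousClass B q) := by
  intro y
  obtain ⟨⟨c, hc⟩, rfl⟩ := homologyClass_surjective q y
  refine ⟨⟨ofCobar B q c, ofCobar_mem _, ?_⟩, ?_⟩
  · change simplexDelta (k := k) Γ B (q + 1) (ofCobar B q c) = 0
    rw [← ofCobar_toCobar (simplexDelta_mem_invCochains (ofCobar_mem (B := B) c)),
      toCobar_simplexDelta (ofCobar_mem c), toCobar_ofCobar, mem_cocycleSubmodule_iff.1 hc,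
      map_zero]
  · refine congr_arg (homologyClass (groupCohomology.inhomogeneousCochains B) q) (Subtype.ext ?_)
    exact toCobar_ofCobar (B := B) c

end Cobar

/-! ### Group cohomology by simplices on a free set -/

section CobarComparison
variable {k : Type u} [CommRing k] {Γ Γ' G G' : Type u} [Group Γ] [Group Γ'] [Group G] [Group G']
  {A : Rep.{u} k G} {A' : Rep.{u} k G'} {X X' : Type u} [MulAction G X] [MulAction G' X']
  (ι : Γ →* G) {ι' : Γ' →* G'}

lemma orbit_equivariant (x₀ : X) (γ x : Γ) :
    ι (MonoidHom.id Γ γ • x) • x₀ = ι γ • ι x • x₀ := by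
  rw [← mul_smul, ← map_mul]
  rfl

/-- The class in `H^q(Γ; A)` of an invariant cocycle on a `Γ`-set with a base point. -/
def cobarClass (x₀ : X) (A : Rep.{u} k G) (q : ℕ) :
    invCocycles ι X A q →ₗ[k] groupCohomology (Rep.res ι A) q :=
  homogeneousClass (Rep.res ι A) q ∘ₗ
    (cosimplexMap (A := Rep.res ι A) (fun γ => ι γ • x₀) LinearMap.id (q + 1)).restrict
      fun _ hF => cosimplexMap_mem_invCocycles (ι := MonoidHom.id Γ) (ι' := ι)
        (f := MonoidHom.id Γ) (orbit_equivariant ι x₀) (fun _ _ => rfl) hF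

variable {ι}

lemma cobarClass_apply (x₀ : X) {q : ℕ} (F : invCocycles ι X A q) :
    cobarClass ι x₀ A q F = homogeneousClass (Rep.res ι A) q
      ⟨cosimplexMap (A := Rep.res ι A) (fun γ => ι γ • x₀) LinearMap.id (q + 1) F.1,
        cosimplexMap_mem_invCocycles (ι := MonoidHom.id Γ) (ι' := ι)
        (f := MonoidHom.id Γ) (orbit_equivariant ι x₀) (fun _ _ => rfl) F.2⟩ := rfl

/-- Naturality of the class in `H^q(Γ; A)`; it does not depend on the base points. -/
lemma map_cobarClass (x₀ : X) (x₀' : X') (f : Γ →* Γ')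
    (e : X → X') (he : ∀ γ x, e (ι γ • x) = ι' (f γ) • e x) (φ : A' →ₗ[k] A)
    (hφ : ∀ γ a, φ (A'.ρ (ι' (f γ)) a) = A.ρ (ι γ) (φ a))
    (ψ : Rep.res f (Rep.res ι' A') ⟶ Rep.res ι A) (hψ : ∀ a : A', ψ.hom a = φ a) {q : ℕ}
    (F : invCocycles ι' X' A' q) :
    (groupCohomology.map f ψ q).hom (cobarClass ι' x₀' A' q F) =
      cobarClass ι x₀ A q
        ⟨cosimplexMap e φ (q + 1) F.1, cosimplexMap_mem_invCocycles he hφ F.2⟩ := by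
  let F₁ : (Fin (q + 1) → Γ) → Rep.res ι A := cosimplexMap (A' := A') (A := Rep.res ι A)
    (fun γ => ι' (f γ) • x₀') φ (q + 1) F.1
  have hF₁ : F₁ ∈ invCocycles (MonoidHom.id Γ) Γ (Rep.res ι A) q :=
    cosimplexMap_mem_invCocycles (ι := MonoidHom.id Γ) (ι' := ι') (f := f)
      (fun γ x => by rw [← mul_smul, ← map_mul, ← map_mul]; rfl) hφ F.2
  have h1 : (groupCohomology.map f ψ q).hom (cobarClass ι' x₀' A' q F) =
      homogeneousClass (Rep.res ι A) q ⟨F₁, hF₁⟩ := by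
    refine (homologyMap_homologyClass _ _ _).trans ?_
    refine congr_arg (homologyClass (groupCohomology.inhomogeneousCochains (Rep.res ι A)) q)
      (Subtype.ext (funext fun g => ?_))
    refine (hψ _).trans ?_
    change φ (F.1 _) = φ (F.1 _)
    congr 2
    refine congr_arg F.1 (funext fun i => ?_)
    change ι' (Fin.partialProd (f ∘ g) i) • x₀' = ι' (f (Fin.partialProd g i)) • x₀'
    congr 2
    induction i using Fin.induction with
    | zero => simp
    | succ i hi => simp [Fin.partialProd_succ, hi]
  rw [h1, cobarClass_apply, ← sub_eq_zero, ← map_sub, homogeneousClass_eq_zero_iff]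
  exact cosimplexMap_sub_mem_invCoboundaries (ι := MonoidHom.id Γ) (ι' := ι') (f := f)
    (A := Rep.res ι A) (φ := φ) (e := fun γ => e (ι γ • x₀)) (e' := fun γ => ι' (f γ) • x₀')
    (fun γ x => by rw [← he, ← mul_smul, ← map_mul]; rfl)
    (fun γ x => by rw [← mul_smul, ← map_mul, ← map_mul]; rfl) hφ F.2

variable {ρ : X → Γ} (hρ : ∀ γ x, ρ (ι γ • x) = γ * ρ x)

include hρ in
/-- With `cobarClass_eq_zero_iff`, this identifies the cohomology of the invariant cochains of
simplices on `X` with `H^q(Γ; A)`, if `X` is a free `Γ`-set. -/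
lemma cobarClass_surjective (x₀ : X) (q : ℕ) : Function.Surjective (cobarClass ι x₀ A q) := by
  intro y
  obtain ⟨⟨F, hF⟩, rfl⟩ := homogeneousClass_surjective _ q y
  refine ⟨⟨cosimplexMap (A' := Rep.res ι A) ρ LinearMap.id (q + 1) F,
    cosimplexMap_mem_invCocycles (ι' := MonoidHom.id Γ) (f := MonoidHom.id Γ) hρ
      (fun _ _ => rfl) hF⟩, ?_⟩
  rw [cobarClass_apply, ← sub_eq_zero, ← map_sub, homogeneousClass_eq_zero_iff]
  have := cosimplexMap_sub_mem_invCoboundaries (ι := MonoidHom.id Γ) (ι' := MonoidHom.id Γ)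
    (f := MonoidHom.id Γ) (A := Rep.res ι A) (A' := Rep.res ι A) (φ := LinearMap.id) (e := id)
    (e' := fun γ => ρ (ι γ • x₀)) (fun _ _ => rfl)
    (fun γ x => by rw [hρ, hρ]; exact mul_assoc _ _ _) (fun _ _ => rfl) hF
  exact this

include hρ in
lemma cobarClass_eq_zero_iff (x₀ : X) {q : ℕ} (F : invCocycles ι X A q) :
    cobarClass ι x₀ A q F = 0 ↔ F.1 ∈ invCoboundaries ι X A q := by
  rw [cobarClass_apply, homogeneousClass_eq_zero_iff]
  constructor
  · intro h
    -- The map `x ↦ ι (ρ x) • x₀` is homotopic to the identity, and it factors through `Γ`.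
    have h1 := cosimplexMap_sub_mem_invCoboundaries (ι := ι) (ι' := ι)
      (f := MonoidHom.id Γ) (A := A) (A' := A) (φ := LinearMap.id)
      (e := fun x => ι (ρ x) • x₀) (e' := id)
      (fun γ x => by rw [hρ, map_mul, mul_smul]; rfl) (fun _ _ => rfl) (fun _ _ => rfl) F.2
    have h2 : cosimplexMap (A := A) (A' := A) (fun x => ι (ρ x) • x₀) LinearMap.id (q + 1) F.1 ∈
        invCoboundaries ι X A q :=
      cosimplexMap_mem_invCoboundaries (A := A) (A' := Rep.res ι A) (φ := LinearMap.id)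
        (ι' := MonoidHom.id Γ) (f := MonoidHom.id Γ) hρ (fun _ _ => rfl) h
    exact (sub_add_cancel F.1 _) ▸ add_mem h1 h2
  · obtain ⟨F, hF⟩ := F
    intro h
    have h3 : cosimplexMap (A := Rep.res ι A) (A' := A) (fun γ => ι γ • x₀) LinearMap.id (q + 1) F ∈
        invCoboundaries (MonoidHom.id Γ) Γ (Rep.res ι A) q :=
      cosimplexMap_mem_invCoboundaries (A := Rep.res ι A) (A' := A) (φ := LinearMap.id)
        (ι := MonoidHom.id Γ) (ι' := ι) (f := MonoidHom.id Γ) (orbit_equivariant ι x₀)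
        (fun _ _ => rfl) h
    exact h3

end CobarComparison

/-! ### Components of a total complex -/

/-- The numerical conditions on the shapes of a double complex, with differentials of degree
`σ = ±1`, and of its total complex. -/
class IsSumShape (σ : ℤ) (c : ComplexShape ℕ) [TotalComplexShape c c (ComplexShape.up' σ)] :
    Prop where
  mul_self : σ * σ = 1
  rel_iff (i j : ℕ) : c.Rel i j ↔ (i : ℤ) + σ = j
  π_eq (i j : ℕ) : ComplexShape.π c c (ComplexShape.up' σ) (i, j) = (i : ℤ) + j
  ε₁_eq (i j : ℕ) : ComplexShape.ε₁ c c (ComplexShape.up' σ) (i, j) = 1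

instance : IsSumShape (-1) (ComplexShape.down ℕ) where
  mul_self := by norm_num
  rel_iff i j := by
    rw [ComplexShape.down_Rel]
    omega
  π_eq _ _ := rfl
  ε₁_eq _ _ := rfl

instance : IsSumShape 1 (ComplexShape.up ℕ) where
  mul_self := by norm_num
  rel_iff i j := by
    rw [ComplexShape.up_Rel]
    omega
  π_eq _ _ := rfl
  ε₁_eq _ _ := rfl

lemma IsSumShape.eq_or (σ : ℤ) (c : ComplexShape ℕ) [TotalComplexShape c c (ComplexShape.up' σ)]
    [h : IsSumShape σ c] : σ = 1 ∨ σ = -1 :=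
  Int.isUnit_iff.1 (IsUnit.of_mul_eq_one _ h.mul_self)

section TotalComponents
variable {k : Type u} [CommRing k] {σ : ℤ} {c : ComplexShape ℕ}
  [TotalComplexShape c c (ComplexShape.up' σ)] [hs : IsSumShape σ c]
  (K L : HomologicalComplex₂ (ModuleCat.{u} k) c c)

/-- The inclusion of the component of bidegree `(i, j)` in the total complex. -/
def totalι (n : ℤ) (i j : ℕ) : (K.X i).X j →ₗ[k] (K.total (ComplexShape.up' σ)).X n :=
  (K.ιTotalOrZero (ComplexShape.up' σ) i j n).hom

open Classical in
/-- The projection of the total complex to the component of bidegree `(i, j)`. -/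
def totalπ (n : ℤ) (i j : ℕ) : (K.total (ComplexShape.up' σ)).X n →ₗ[k] (K.X i).X j :=
  (K.totalDesc (c₁₂ := ComplexShape.up' σ) fun i' j' _ =>
    if h : i' = i ∧ j' = j then (K.XXIsoOfEq _ _ _ h.1 h.2).hom else 0).hom

/-- The sign of the inner differential in bidegree `(i, j)`. -/
def totalSign (σ : ℤ) (c : ComplexShape ℕ) [TotalComplexShape c c (ComplexShape.up' σ)]
    (i j : ℕ) : ℤ := (ComplexShape.ε₂ c c (ComplexShape.up' σ) (i, j) : ℤˣ)

omit hs in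
lemma totalSign_smul_self {V : Type*} [AddCommGroup V] (i j : ℕ) (x : V) :
    totalSign σ c i j • totalSign σ c i j • x = x := by
  rw [smul_smul, totalSign, ← Units.val_mul, Int.units_mul_self, Units.val_one, one_smul]

omit hs in
lemma totalSign_smul_eq_zero {V : Type*} [AddCommGroup V] {i j : ℕ} {x : V} :
    totalSign σ c i j • x = 0 ↔ x = 0 :=
  ⟨fun h => by rw [← totalSign_smul_self (σ := σ) (c := c) i j x, h, smul_zero],
    fun h => by rw [h, smul_zero]⟩

variable {K L}

include hs in
lemma totalι_apply {n : ℤ} {i j : ℕ} (h : (i : ℤ) + j = n) (x : (K.X i).X j) :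
    totalι (σ := σ) K n i j x =
      (K.ιTotal (ComplexShape.up' σ) i j n ((hs.π_eq i j).trans h)).hom x := by
  rw [totalι, K.ιTotalOrZero_eq]

lemma totalι_eq_zero {n : ℤ} {i j : ℕ} (h : (i : ℤ) + j ≠ n) (x : (K.X i).X j) :
    totalι (σ := σ) K n i j x = 0 := by
  rw [totalι, K.ιTotalOrZero_eq_zero]
  · rfl
  · rwa [hs.π_eq]

lemma totalπ_totalι_self {n : ℤ} {i j : ℕ} (h : (i : ℤ) + j = n) (x : (K.X i).X j) :
    totalπ (σ := σ) K n i j (totalι (σ := σ) K n i j x) = x := by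
  classical
  rw [totalι_apply h, totalπ]
  refine (congr($(K.ι_totalDesc (c₁₂ := ComplexShape.up' σ) _ i j _).hom x)).trans ?_
  rw [dif_pos ⟨rfl, rfl⟩]
  simp

lemma totalπ_totalι_ne {n : ℤ} {i j i' j' : ℕ} (h : ¬ (i' = i ∧ j' = j)) (x : (K.X i').X j') :
    totalπ (σ := σ) K n i j (totalι (σ := σ) K n i' j' x) = 0 := by
  classical
  by_cases hn : (i' : ℤ) + j' = n
  · rw [totalι_apply hn, totalπ]
    refine (congr($(K.ι_totalDesc (c₁₂ := ComplexShape.up' σ) _ i' j' _).hom x)).trans ?_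
    rw [dif_neg h]
    rfl
  · rw [totalι_eq_zero hn, map_zero]

/-- Linear maps on the total complex are determined by their values on the components. -/
lemma total_hom_ext {n : ℤ} {V : Type u} [AddCommGroup V] [Module k V]
    {f g : (K.total (ComplexShape.up' σ)).X n →ₗ[k] V}
    (h : ∀ (i j : ℕ) (_ : (i : ℤ) + j = n) (x : (K.X i).X j),
      f (totalι (σ := σ) K n i j x) = g (totalι (σ := σ) K n i j x)) : f = g := by
  have : ModuleCat.ofHom f = ModuleCat.ofHom g := by
    refine HomologicalComplex₂.total.hom_ext _ fun i j hij => ?_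
    refine ModuleCat.hom_ext (LinearMap.ext fun x => ?_)
    have hij' := (hs.π_eq i j).symm.trans hij
    have := h i j hij' x
    rwa [totalι_apply hij'] at this
  exact congr_arg ModuleCat.Hom.hom this

lemma total_eq_sum {n : ℕ} (x : (K.total (ComplexShape.up' σ)).X n) :
    x = ∑ ij ∈ Finset.HasAntidiagonal.antidiagonal n, totalι (σ := σ) K n ij.1 ij.2
      (totalπ (σ := σ) K n ij.1 ij.2 x) := by
  have h : LinearMap.id = ∑ ij ∈ Finset.HasAntidiagonal.antidiagonal n,
      totalι (σ := σ) K n ij.1 ij.2 ∘ₗ totalπ (σ := σ) K n ij.1 ij.2 := by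
    refine total_hom_ext fun i j hij x => ?_
    rw [LinearMap.sum_apply, Finset.sum_eq_single (i, j)]
    · rw [LinearMap.comp_apply, totalπ_totalι_self hij]
      rfl
    · intro ij _ hne
      rw [LinearMap.comp_apply, totalπ_totalι_ne, map_zero]
      rintro ⟨rfl, rfl⟩
      exact hne rfl
    · intro hn
      exact (hn (Finset.HasAntidiagonal.mem_antidiagonal.2 (by exact_mod_cast hij))).elim
  have := congr($h x)
  rwa [LinearMap.sum_apply] at this

lemma total_subsingleton {n : ℤ} (hn : n < 0) (x : (K.total (ComplexShape.up' σ)).X n) : x = 0 := by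
  have : (LinearMap.id : (K.total (ComplexShape.up' σ)).X n →ₗ[k] _) = 0 :=
    total_hom_ext fun i j hij => by omega
  exact congr($this x)

/-- An element of the total complex is determined by its components. -/
lemma total_ext {n : ℤ} {x y : (K.total (ComplexShape.up' σ)).X n}
    (h : ∀ i j : ℕ, (i : ℤ) + j = n → totalπ (σ := σ) K n i j x = totalπ (σ := σ) K n i j y) :
    x = y := by
  by_cases hn : n < 0
  · rw [total_subsingleton hn x, total_subsingleton hn y]
  · obtain ⟨n, rfl⟩ := Int.eq_ofNat_of_zero_le (not_lt.1 hn)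
    rw [total_eq_sum x, total_eq_sum y]
    refine Finset.sum_congr rfl fun ij hij => ?_
    rw [h ij.1 ij.2 (by exact_mod_cast Finset.HasAntidiagonal.mem_antidiagonal.1 hij)]

/-- The differential of the total complex on a component. If `i` or `j` has no successor, then
`c.next` has the value `i` or `j` itself and the corresponding term vanishes, as the differential
in it does. -/
lemma total_d_totalι {n n' : ℤ} {i j : ℕ} (h : (i : ℤ) + j = n)
    (x : (K.X i).X j) :
    ((K.total (ComplexShape.up' σ)).d n n').hom (totalι (σ := σ) K n i j x) =
      totalι (σ := σ) K n' (c.next i) j (((K.d i (c.next i)).f j).hom x) +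
      totalSign σ c i j • totalι (σ := σ) K n' i (c.next j) (((K.X i).d j (c.next j)).hom x) := by
  rw [totalι_apply h, HomologicalComplex₂.total_d, ModuleCat.hom_add, LinearMap.add_apply]
  have h1 := congr($(K.ι_D₁ (ComplexShape.up' σ) n n' i j ((hs.π_eq i j).trans h)).hom x)
  have h2 := congr($(K.ι_D₂ (ComplexShape.up' σ) n n' i j ((hs.π_eq i j).trans h)).hom x)
  rw [ModuleCat.hom_comp, LinearMap.comp_apply] at h1 h2
  rw [h1, h2]
  congr 1
  by_cases hr : c.Rel i (c.next i)
  · rw [K.d₁_eq' _ hr, hs.ε₁_eq, one_smul]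
    rfl
  · rw [K.d₁_eq_zero _ _ _ _ hr, K.shape _ _ hr]
    simp

/-- The components of a differential in the total complex. As in `total_d_totalι`, terms for which
`c.prev` has no meaning vanish. -/
lemma totalπ_total_d {n n' : ℤ} (hn : n + σ = n') {i j : ℕ} (h : (i : ℤ) + j = n')
    (x : (K.total (ComplexShape.up' σ)).X n) :
    totalπ (σ := σ) K n' i j (((K.total (ComplexShape.up' σ)).d n n').hom x) =
      ((K.d (c.prev i) i).f j).hom (totalπ (σ := σ) K n (c.prev i) j x) +
      totalSign σ c i (c.prev j) •
        ((K.X i).d (c.prev j) j).hom (totalπ (σ := σ) K n i (c.prev j) x) := by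
  have hσ := hs.mul_self
  have key : totalπ (σ := σ) K n' i j ∘ₗ ((K.total (ComplexShape.up' σ)).d n n').hom =
      ((K.d (c.prev i) i).f j).hom ∘ₗ totalπ (σ := σ) K n (c.prev i) j +
      totalSign σ c i (c.prev j) •
        (((K.X i).d (c.prev j) j).hom ∘ₗ totalπ (σ := σ) K n i (c.prev j)) := by
    refine total_hom_ext fun i' j' hij x => ?_
    rw [LinearMap.comp_apply, total_d_totalι hij, map_add, map_zsmul, LinearMap.add_apply,
      LinearMap.smul_apply, LinearMap.comp_apply, LinearMap.comp_apply]
    congr 1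
    · by_cases hr : c.Rel i' i
      · have hj : j' = j := by have := (hs.rel_iff _ _).1 hr; omega
        obtain rfl := c.next_eq' hr
        obtain rfl := hj
        obtain hp : c.prev (c.next i') = i' := c.prev_eq' hr
        rw [hp, totalπ_totalι_self h, totalπ_totalι_self hij]
      · have h1 : totalπ (σ := σ) K n' i j (totalι (σ := σ) K n' (c.next i') j'
            (((K.d i' (c.next i')).f j').hom x)) = 0 := by
          by_cases hr' : c.Rel i' (c.next i')
          · rw [totalπ_totalι_ne]
            rintro ⟨rfl, rfl⟩
            exact hr hr'
          · rw [K.shape _ _ hr']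
            simp
        rw [h1]
        by_cases hp : i' = c.prev i ∧ j' = j
        · rw [K.shape (c.prev i) i fun h' => hr (hp.1 ▸ h')]
          rfl
        · rw [totalπ_totalι_ne hp, map_zero]
    · by_cases hr : c.Rel j' j
      · have hi : i' = i := by have := (hs.rel_iff _ _).1 hr; omega
        obtain rfl := c.next_eq' hr
        obtain rfl := hi
        obtain hp : c.prev (c.next j') = j' := c.prev_eq' hr
        rw [hp, totalπ_totalι_self h, totalπ_totalι_self hij]
      · have h1 : totalπ (σ := σ) K n' i j (totalι (σ := σ) K n' i' (c.next j')
            (((K.X i').d j' (c.next j')).hom x)) = 0 := by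
          by_cases hr' : c.Rel j' (c.next j')
          · rw [totalπ_totalι_ne]
            rintro ⟨rfl, rfl⟩
            exact hr hr'
          · rw [(K.X i').shape _ _ hr']
            simp
        rw [h1, smul_zero]
        by_cases hp : i' = i ∧ j' = c.prev j
        · rw [(K.X i).shape (c.prev j) j fun h' => hr (hp.2 ▸ h')]
          exact (smul_zero _).symm
        · rw [totalπ_totalι_ne hp, map_zero, smul_zero]
  have := congr($key x)
  rwa [LinearMap.add_apply, LinearMap.smul_apply] at this

/-- Membership in the filtration by the inner degree, in terms of components: for `σ = 1` those of
inner degree less than `p` vanish, and for `σ = -1` those of inner degree greater than `p`. -/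
lemma mem_innerFiltration_iff {p n : ℤ} {x : (K.total (ComplexShape.up' σ)).X n} :
    x ∈ innerFiltration K p n ↔
      ∀ i j : ℕ, (i : ℤ) + j = n → ¬ σ * p ≤ σ * j → totalπ (σ := σ) K n i j x = 0 := by
  constructor
  · intro hx i j _ hj
    revert x
    change innerFiltration K p n ≤ LinearMap.ker (totalπ (σ := σ) K n i j)
    refine innerFiltration_le fun i' j' h hj' x => ?_
    rw [LinearMap.mem_ker, ← totalι_apply ((hs.π_eq i' j').symm.trans h), totalπ_totalι_ne]
    rintro ⟨rfl, rfl⟩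
    exact hj hj'
  · intro h
    by_cases hn : n < 0
    · rw [total_subsingleton hn x]
      exact zero_mem _
    · obtain ⟨n, rfl⟩ := Int.eq_ofNat_of_zero_le (not_lt.1 hn)
      rw [total_eq_sum x]
      refine sum_mem fun ij hij => ?_
      have hij' : (ij.1 : ℤ) + ij.2 = n := by exact_mod_cast Finset.HasAntidiagonal.mem_antidiagonal.1 hij
      by_cases hj : σ * p ≤ σ * ij.2
      · exact ιOrZero_mem_innerFiltration K hj _
      · rw [h _ _ hij' hj, map_zero]
        exact zero_mem _

omit hs in
lemma totalι_mem_innerFiltration {p n : ℤ} {i j : ℕ} (hj : σ * p ≤ σ * j) (x : (K.X i).X j) :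
    totalι (σ := σ) K n i j x ∈ innerFiltration K p n :=
  ιOrZero_mem_innerFiltration K hj x

omit hs in
lemma totalMap_totalι (f : K ⟶ L) {n : ℤ} {i j : ℕ} (x : (K.X i).X j) :
    ((HomologicalComplex₂.total.map f (ComplexShape.up' σ)).f n).hom (totalι (σ := σ) K n i j x) =
      totalι (σ := σ) L n i j (((f.f i).f j).hom x) :=
  congr($(HomologicalComplex₂.ιTotalOrZero_map K L f (ComplexShape.up' σ) i j n).hom x)

lemma totalπ_totalMap (f : K ⟶ L) {n : ℤ} {i j : ℕ} (x : (K.total (ComplexShape.up' σ)).X n) :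
    totalπ (σ := σ) L n i j
      (((HomologicalComplex₂.total.map f (ComplexShape.up' σ)).f n).hom x) =
      ((f.f i).f j).hom (totalπ (σ := σ) K n i j x) := by
  have key : totalπ (σ := σ) L n i j ∘ₗ
      ((HomologicalComplex₂.total.map f (ComplexShape.up' σ)).f n).hom =
      ((f.f i).f j).hom ∘ₗ totalπ (σ := σ) K n i j := by
    refine total_hom_ext fun i' j' hij x => ?_
    rw [LinearMap.comp_apply, LinearMap.comp_apply, totalMap_totalι]
    by_cases h : i' = i ∧ j' = j
    · obtain ⟨rfl, rfl⟩ := h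
      rw [totalπ_totalι_self hij, totalπ_totalι_self hij]
    · rw [totalπ_totalι_ne h, totalπ_totalι_ne h, map_zero]
  exact congr($key x)

end TotalComponents

/-! ### The second page of the spectral sequence of a double complex -/

section RowHomology
variable {k : Type u} [CommRing k] {σ : ℤ} {c : ComplexShape ℕ}
  [TotalComplexShape c c (ComplexShape.up' σ)] [hs : IsSumShape σ c]
  {K K' : HomologicalComplex₂ (ModuleCat.{u} k) c c}

lemma totalπ_eq_zero_of_mem {p n : ℤ} {x : (K.total (ComplexShape.up' σ)).X n}
    (hx : x ∈ innerFiltration K p n) {i j : ℕ} (hj : ¬ σ * p ≤ σ * j) :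
    totalπ (σ := σ) K n i j x = 0 := by
  by_cases h : (i : ℤ) + j = n
  · exact mem_innerFiltration_iff.1 hx i j h hj
  · revert x
    change innerFiltration K p n ≤ LinearMap.ker (totalπ (σ := σ) K n i j)
    refine innerFiltration_le fun i' j' h' hj' x => ?_
    rw [LinearMap.mem_ker, ← totalι_apply ((hs.π_eq i' j').symm.trans h'), totalπ_totalι_ne]
    rintro ⟨rfl, rfl⟩
    exact hj hj'

variable (hc : ∀ i j, c.Rel i j → (i : ℤ) + σ = j)

/-- The submodule `Z^r` for the total complex of a double complex. -/
def totalZ (r p n : ℤ) : Submodule k ((K.total (ComplexShape.up' σ)).X n) :=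
  (totalFiltered K hc).Z r p n

/-- The submodule `B^r` for the total complex of a double complex. -/
def totalB (r p n : ℤ) : Submodule k ((K.total (ComplexShape.up' σ)).X n) :=
  (totalFiltered K hc).B r p n

omit hs in
variable {hc} in
lemma mem_totalZ {r p n : ℤ} {x : (K.total (ComplexShape.up' σ)).X n} :
    x ∈ totalZ hc r p n ↔ x ∈ innerFiltration K p n ∧
      ∀ j, ((K.total (ComplexShape.up' σ)).d n j).hom x ∈ innerFiltration K (p + σ * r) j :=
  FilteredComplex.mem_Z (C := totalFiltered K hc)

omit hs in
variable {hc} in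
lemma mem_totalB {r p n : ℤ} {x : (K.total (ComplexShape.up' σ)).X n} :
    x ∈ totalB hc r p n ↔ ∃ b ∈ totalZ hc (r - 1) (p + σ) n,
      ∃ z ∈ totalZ hc (r - 1) (p - σ * (r - 1)) (n - σ),
        b + ((K.total (ComplexShape.up' σ)).d (n - σ) n).hom z = x :=
  FilteredComplex.mem_B (C := totalFiltered K hc)

/-- A presentation `κ : C → L` of the homology at `q` of the outer differential of a double complex
`K`, where `i : C → K.X q` is the inclusion of the complex of cycles. -/
structure RowHomology (K : HomologicalComplex₂ (ModuleCat.{u} k) c c) (q : ℕ)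
    (L : HomologicalComplex (ModuleCat.{u} k) c) where
  C : HomologicalComplex (ModuleCat.{u} k) c
  i : C ⟶ K.X q
  κ : C ⟶ L
  injective (j : ℕ) : Function.Injective (i.f j).hom
  exact_i (j : ℕ) (x : (K.X q).X j) :
    (∃ y, (i.f j).hom y = x) ↔ ((K.d q (c.next q)).f j).hom x = 0
  surjective (j : ℕ) : Function.Surjective (κ.f j).hom
  exact_κ (j : ℕ) (y : C.X j) :
    (κ.f j).hom y = 0 ↔ ∃ b, ((K.d (c.prev q) q).f j).hom b = (i.f j).hom y

lemma hom_d_comm {C D : HomologicalComplex (ModuleCat.{u} k) c} (f : C ⟶ D) (i j : ℕ) (x : C.X i) :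
    (f.f j).hom ((C.d i j).hom x) = (D.d i j).hom ((f.f i).hom x) :=
  congr($(f.comm i j).hom x).symm

lemma mem_cycleSubmodule_next {C : HomologicalComplex (ModuleCat.{u} k) c} {i : ℕ} {x : C.X i} :
    x ∈ cycleSubmodule C i ↔ (C.d i (c.next i)).hom x = 0 := by
  rw [mem_cycleSubmodule]
  refine ⟨fun h => h _, fun h j => ?_⟩
  by_cases hj : c.Rel i j
  · obtain rfl := c.next_eq' hj
    exact h
  · rw [C.shape _ _ hj]
    rfl

namespace RowHomology

variable {q : ℕ} {L : HomologicalComplex (ModuleCat.{u} k) c} (R : RowHomology K q L)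

/-- Cycles of the outer differential as elements of `C`. -/
def lift (j : ℕ) : LinearMap.ker ((K.d q (c.next q)).f j).hom →ₗ[k] R.C.X j :=
  (LinearEquiv.ofInjective (R.i.f j).hom (R.injective j)).symm.toLinearMap ∘ₗ
    Submodule.inclusion fun x hx => (R.exact_i j x).2 hx

lemma i_lift {j : ℕ} (x : LinearMap.ker ((K.d q (c.next q)).f j).hom) :
    (R.i.f j).hom (R.lift j x) = x := by
  have := (LinearEquiv.ofInjective (R.i.f j).hom (R.injective j)).apply_symm_apply
    (Submodule.inclusion (fun x hx => (R.exact_i j x).2 hx) x)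
  exact congr_arg Subtype.val this

lemma d_i (j : ℕ) (y : R.C.X j) : ((K.d q (c.next q)).f j).hom ((R.i.f j).hom y) = 0 :=
  (R.exact_i j _).1 ⟨y, rfl⟩

variable {p : ℕ} {n : ℤ}

omit hs in
/-- For an element of the `p`th step of the filtration, the inner differential does not contribute
to the components of inner degree `p` of its boundary. -/
lemma d_prev_eq_zero [IsSumShape σ c] {x : (K.total (ComplexShape.up' σ)).X n}
    (hx : x ∈ innerFiltration K p n) (i : ℕ) :
    ((K.X i).d (c.prev p) p).hom (totalπ (σ := σ) K n i (c.prev p) x) = 0 := by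
  by_cases hr : c.Rel (c.prev p) p
  · rw [totalπ_eq_zero_of_mem hx, map_zero]
    have h := (IsSumShape.rel_iff (σ := σ) _ _).1 hr
    rcases IsSumShape.eq_or σ c with rfl | rfl <;> omega
  · rw [(K.X i).shape _ _ hr]
    rfl

/-- The component of bidegree `(q, p)` of an element of `Z^r` is a cycle of the outer differential,
since its boundary lies in a deeper step of the filtration. -/
lemma dOut_eq_zero (hn : (p : ℤ) + q = n) {r : ℤ} (hr : 1 ≤ r)
    {x : (K.total (ComplexShape.up' σ)).X n} (hx : x ∈ totalZ hc r p n) :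
    ((K.d q (c.next q)).f p).hom (totalπ (σ := σ) K n q p x) = 0 := by
  by_cases hq : c.Rel q (c.next q)
  · have h := (hs.rel_iff _ _).1 hq
    have h1 := (mem_totalZ.1 hx).2 (n + σ)
    have h2 : totalπ (σ := σ) K (n + σ) (c.next q) p
        (((K.total (ComplexShape.up' σ)).d n (n + σ)).hom x) = 0 := by
      refine totalπ_eq_zero_of_mem h1 ?_
      have := hs.mul_self
      rw [mul_add, ← mul_assoc, this]
      omega
    rw [totalπ_total_d rfl (by omega), c.prev_eq' hq,
      d_prev_eq_zero (mem_totalZ.1 hx).1, smul_zero, add_zero] at h2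
    exact h2
  · rw [K.shape _ _ hq]
    rfl

/-- The component of bidegree `(q, p)` of an element of `Z²`, as an element of `C`. -/
def top (hn : (p : ℤ) + q = n) : totalZ (K := K) hc 2 p n →ₗ[k] R.C.X p :=
  R.lift p ∘ₗ ((totalπ (σ := σ) K n q p).restrict fun _ hx =>
    dOut_eq_zero hc hn one_le_two hx)

lemma i_top (hn : (p : ℤ) + q = n) (x : totalZ (K := K) hc 2 p n) :
    (R.i.f p).hom (R.top hc hn x) = totalπ (σ := σ) K n q p x.1 := R.i_lift _

/-- The leading component of an element of `Z²` defines a cycle of `L`: its inner boundary is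
cancelled by the outer boundary of the next component. -/
lemma κ_top_mem (hn : (p : ℤ) + q = n) (x : totalZ (K := K) hc 2 p n) :
    (R.κ.f p).hom (R.top hc hn x) ∈ cycleSubmodule L p := by
  rw [mem_cycleSubmodule_next]
  by_cases hp : c.Rel p (c.next p)
  · have h := (hs.rel_iff _ _).1 hp
    have h1 := (mem_totalZ.1 x.2).2 (n + σ)
    have h2 : totalπ (σ := σ) K (n + σ) q (c.next p)
        (((K.total (ComplexShape.up' σ)).d n (n + σ)).hom x.1) = 0 := by
      refine totalπ_eq_zero_of_mem h1 ?_
      rcases IsSumShape.eq_or σ c with rfl | rfl <;> omega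
    rw [totalπ_total_d rfl (by omega), c.prev_eq' hp, ← R.i_top hc hn] at h2
    rw [← hom_d_comm, R.exact_κ]
    refine ⟨-(totalSign σ c q p • totalπ (σ := σ) K n (c.prev q) (c.next p) x.1), ?_⟩
    rw [map_neg, map_zsmul, eq_neg_of_add_eq_zero_left h2, smul_neg, totalSign_smul_self, neg_neg,
      hom_d_comm]
  · rw [L.shape _ _ hp]
    rfl

/-- The map `Z² → H_p(L)` that sends an element to the class of its component of bidegree `(q, p)`.
-/
def fromZ (hn : (p : ℤ) + q = n) :
    totalZ (K := K) hc 2 p n →ₗ[k] L.homology p :=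
  homologyClass L p ∘ₗ ((R.κ.f p).hom ∘ₗ R.top hc hn).codRestrict _ (R.κ_top_mem hc hn)

lemma fromZ_apply (hn : (p : ℤ) + q = n) (x : totalZ (K := K) hc 2 p n) :
    R.fromZ hc hn x = homologyClass L p ⟨(R.κ.f p).hom (R.top hc hn x), R.κ_top_mem hc hn x⟩ := rfl

/-- A cycle of `L` lifts to a zigzag of two components, the second of which cancels the inner
boundary of the first. -/
lemma fromZ_surjective (hn : (p : ℤ) + q = n) : Function.Surjective (R.fromZ hc hn) := by
  intro y
  obtain ⟨⟨l, hl⟩, rfl⟩ := homologyClass_surjective p y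
  obtain ⟨a, rfl⟩ := R.surjective p l
  rw [mem_cycleSubmodule_next, ← hom_d_comm, R.exact_κ] at hl
  obtain ⟨b, hb⟩ := hl
  have hσ := hs.mul_self
  have hqp : (q : ℤ) + p = n := by omega
  let x := totalι (σ := σ) K n q p ((R.i.f p).hom a) -
    totalSign σ c q p • totalι (σ := σ) K n (c.prev q) (c.next p) b
  -- If `q` has no predecessor or `p` has no successor, then `b` plays no role.
  by_cases hr : c.Rel (c.prev q) q ∧ c.Rel p (c.next p)
  · obtain ⟨hr1, hr2⟩ := hr
    have h1 := (hs.rel_iff _ _).1 hr1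
    have h2 := (hs.rel_iff _ _).1 hr2
    have hx : x ∈ totalZ (K := K) hc 2 p n := by
      rw [mem_totalZ]
      refine ⟨sub_mem (totalι_mem_innerFiltration le_rfl _) (zsmul_mem
        (totalι_mem_innerFiltration ?_ _) _), fun j => ?_⟩
      · rcases IsSumShape.eq_or σ c with rfl | rfl <;> omega
      · rw [map_sub, map_zsmul, total_d_totalι hqp, total_d_totalι (by omega), R.d_i, map_zero,
          zero_add, c.next_eq' hr1, hb, ← hom_d_comm, smul_add, add_comm, sub_add_eq_sub_sub]
        rw [sub_sub, add_comm, ← sub_sub, sub_self, zero_sub]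
        refine neg_mem (zsmul_mem (zsmul_mem ?_ _) _)
        by_cases hr3 : c.Rel (c.next p) (c.next (c.next p))
        · refine totalι_mem_innerFiltration ?_ _
          have h3 := (hs.rel_iff _ _).1 hr3
          rcases IsSumShape.eq_or σ c with rfl | rfl <;> omega
        · rw [(K.X _).shape _ _ hr3]
          simp
    refine ⟨⟨x, hx⟩, ?_⟩
    rw [fromZ_apply]
    congr 3
    apply R.injective
    rw [i_top]
    change totalπ (σ := σ) K n q p x = _
    rw [map_sub, map_zsmul, totalπ_totalι_self hqp, totalπ_totalι_ne, smul_zero, sub_zero]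
    rcases IsSumShape.eq_or σ c with rfl | rfl <;> omega
  · have hd : ((R.C.d p (c.next p)).hom a) = 0 := by
      rw [not_and_or] at hr
      rcases hr with hr | hr
      · apply R.injective
        rw [← hb, K.shape _ _ hr, map_zero]
        rfl
      · rw [R.C.shape _ _ hr]
        rfl
    have hx : totalι (σ := σ) K n q p ((R.i.f p).hom a) ∈
        totalZ (K := K) hc 2 p n := by
      rw [mem_totalZ]
      refine ⟨totalι_mem_innerFiltration le_rfl _, fun j => ?_⟩
      rw [total_d_totalι hqp, R.d_i, ← hom_d_comm, hd]
      simp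
    refine ⟨⟨_, hx⟩, ?_⟩
    rw [fromZ_apply]
    congr 3
    apply R.injective
    rw [i_top]
    exact totalπ_totalι_self hqp _

omit R in
/-- Modulo the next step of the filtration, only the outer differential contributes to the boundary
of an element of inner degree `p`. -/
lemma d_totalι_prev_sub_mem (hqp : (q : ℤ) + p = n) (b : (K.X (c.prev q)).X p) :
    ((K.total (ComplexShape.up' σ)).d (n - σ) n).hom (totalι (σ := σ) K (n - σ) (c.prev q) p b) -
      totalι (σ := σ) K n q p (((K.d (c.prev q) q).f p).hom b) ∈
      innerFiltration K ((p : ℤ) + σ) n := by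
  by_cases hr : c.Rel (c.prev q) q
  · have h := (hs.rel_iff _ _).1 hr
    rw [total_d_totalι (by omega), c.next_eq' hr, add_sub_cancel_left]
    refine zsmul_mem ?_ _
    by_cases hr' : c.Rel p (c.next p)
    · have h' := (hs.rel_iff _ _).1 hr'
      exact totalι_mem_innerFiltration (by rw [h']) _
    · rw [(K.X _).shape _ _ hr']
      simp
  · have h0 : c.prev q = q := dif_neg fun ⟨j, hj⟩ => hr (by rwa [c.prev_eq' hj])
    have hσ : σ ≠ 0 := by rcases IsSumShape.eq_or σ c with rfl | rfl <;> norm_num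
    rw [totalι_eq_zero (by rw [h0]; omega), K.shape _ _ hr]
    simp

/-- On cycles of the outer differential, the differential of the total complex is the inner
differential, up to sign. -/
lemma d_totalι_i (hqp : (q : ℤ) + p = n) (a : R.C.X (c.prev p)) :
    ((K.total (ComplexShape.up' σ)).d (n - σ) n).hom (totalSign σ c q (c.prev p) •
      totalι (σ := σ) K (n - σ) q (c.prev p) ((R.i.f (c.prev p)).hom a)) =
      totalι (σ := σ) K n q p ((R.i.f p).hom ((R.C.d (c.prev p) p).hom a)) := by
  by_cases hr : c.Rel (c.prev p) p
  · have h := (hs.rel_iff _ _).1 hr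
    rw [map_zsmul, total_d_totalι (by omega), R.d_i, map_zero, zero_add, totalSign_smul_self,
      c.next_eq' hr, hom_d_comm]
  · have h0 : c.prev p = p := dif_neg fun ⟨j, hj⟩ => hr (by rwa [c.prev_eq' hj])
    have hσ : σ ≠ 0 := by rcases IsSumShape.eq_or σ c with rfl | rfl <;> norm_num
    rw [totalι_eq_zero (by rw [h0]; omega), R.C.shape _ _ hr]
    simp

/-- The kernel of `fromZ` is `B²`: a leading component that is the sum of an outer boundary and of
the inner boundary of an outer cycle can be removed by the boundary of an element with two
components. -/
lemma fromZ_eq_zero_iff (hn : (p : ℤ) + q = n) (x : totalZ (K := K) hc 2 p n) :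
    R.fromZ hc hn x = 0 ↔ x.1 ∈ totalB (K := K) hc 2 p n := by
  have hσ := hs.mul_self
  have hqp : (q : ℤ) + p = n := by omega
  rw [fromZ_apply, homologyClass_eq_zero_iff, mem_totalB]
  constructor
  · rintro ⟨j, l, hl⟩
    obtain ⟨l, hl⟩ : ∃ l, (L.d (c.prev p) p).hom l = (R.κ.f p).hom (R.top hc hn x) := by
      by_cases hj : c.Rel j p
      · obtain rfl := c.prev_eq' hj
        exact ⟨l, hl⟩
      · rw [L.shape _ _ hj] at hl
        exact ⟨0, (map_zero _).trans hl⟩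
    obtain ⟨a, rfl⟩ := R.surjective _ l
    rw [← hom_d_comm, eq_comm, ← sub_eq_zero, ← map_sub, R.exact_κ] at hl
    obtain ⟨b, hb⟩ := hl
    rw [map_sub, i_top, eq_sub_iff_add_eq] at hb
    -- `b` bounds the leading component up to the inner boundary of the outer cycle `a`.
    let y := totalι (σ := σ) K (n - σ) (c.prev q) p b + totalSign σ c q (c.prev p) •
      totalι (σ := σ) K (n - σ) q (c.prev p) ((R.i.f (c.prev p)).hom a)
    have hy : ((K.total (ComplexShape.up' σ)).d (n - σ) n).hom y -
        totalι (σ := σ) K n q p (totalπ (σ := σ) K n q p x.1) ∈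
        innerFiltration K ((p : ℤ) + σ) n := by
      rw [map_add, R.d_totalι_i hqp, ← hb, map_add, add_sub_add_right_eq_sub]
      exact d_totalι_prev_sub_mem hqp b
    have hx := mem_totalZ.1 x.2
    have hx' : x.1 - totalι (σ := σ) K n q p (totalπ (σ := σ) K n q p x.1) ∈
        innerFiltration K ((p : ℤ) + σ) n := by
      rw [mem_innerFiltration_iff]
      intro i j hij hj
      rw [map_sub]
      by_cases hjp : j = p
      · obtain rfl : i = q := by omega
        subst hjp
        rw [totalπ_totalι_self hij, sub_self]
      · rw [totalπ_totalι_ne fun h => hjp h.2.symm, sub_zero]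
        refine totalπ_eq_zero_of_mem hx.1 ?_
        rcases IsSumShape.eq_or σ c with rfl | rfl <;> omega
    have hmem : x.1 - ((K.total (ComplexShape.up' σ)).d (n - σ) n).hom y ∈
        innerFiltration K ((p : ℤ) + σ) n := by
      have := sub_mem hx' hy
      rwa [sub_sub_sub_cancel_right] at this
    have hmono : innerFiltration K ((p : ℤ) + σ) n ≤ innerFiltration K (p : ℤ) n :=
      (totalFiltered K hc).F_le _ _
    refine ⟨_, mem_totalZ.2 ⟨hmem, fun j => ?_⟩, y, mem_totalZ.2 ⟨?_, fun j => ?_⟩,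
      sub_add_cancel _ _⟩
    · rw [map_sub]
      have h1 := (totalFiltered K hc).d_d (n - σ) n j y
      change ((K.total (ComplexShape.up' σ)).d n j).hom
        (((K.total (ComplexShape.up' σ)).d (n - σ) n).hom y) = 0 at h1
      rw [h1, sub_zero]
      convert hx.2 j using 2
      ring
    · refine add_mem (totalι_mem_innerFiltration ?_ _) ?_
      · rcases IsSumShape.eq_or σ c with rfl | rfl <;> omega
      · by_cases hr : c.Rel (c.prev p) p
        · have h := (hs.rel_iff _ _).1 hr
          refine zsmul_mem (totalι_mem_innerFiltration ?_ _) _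
          rcases IsSumShape.eq_or σ c with rfl | rfl <;> omega
        · have h0 : c.prev p = p := dif_neg fun ⟨j, hj⟩ => hr (by rwa [c.prev_eq' hj])
          have hσ : σ ≠ 0 := by rcases IsSumShape.eq_or σ c with rfl | rfl <;> norm_num
          rw [totalι_eq_zero (by rw [h0]; omega), smul_zero]
          exact zero_mem _
    · by_cases hj : n - σ + σ = j
      · obtain rfl : n = j := by omega
        have h1 : (p : ℤ) - σ * (2 - 1) + σ * (2 - 1) = p := by ring
        rw [h1]
        have h2 := sub_mem (mem_totalZ.1 x.2).1 (hmono hmem)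
        rwa [sub_sub_cancel] at h2
      · rw [(K.total (ComplexShape.up' σ)).shape _ _ hj]
        exact zero_mem _
  · rintro ⟨b, hb, z, hz, hx⟩
    have h0 : totalπ (σ := σ) K n q p b = 0 := by
      refine totalπ_eq_zero_of_mem (mem_totalZ.1 hb).1 ?_
      rcases IsSumShape.eq_or σ c with rfl | rfl <;> omega
    have h1 := R.i_top hc hn x
    rw [← hx, map_add, h0, zero_add, totalπ_total_d (sub_add_cancel n σ) hqp] at h1
    obtain ⟨a, ha⟩ : ∃ a, (R.i.f p).hom ((R.C.d (c.prev p) p).hom a) =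
        ((K.X q).d (c.prev p) p).hom (totalπ (σ := σ) K (n - σ) q (c.prev p) z) := by
      by_cases hr : c.Rel (c.prev p) p
      · have h := (hs.rel_iff _ _).1 hr
        have h2 := dOut_eq_zero (K := K) hc (p := c.prev p) (q := q) (n := n - σ) (r := 1)
          (by omega) le_rfl (x := z) (by
            rw [show (2 : ℤ) - 1 = 1 from rfl, mul_one] at hz
            convert hz using 2
            rw [← h]
            ring)
        obtain ⟨a, ha⟩ := (R.exact_i _ _).2 h2
        exact ⟨a, by rw [hom_d_comm, ha]⟩
      · rw [R.C.shape _ _ hr, (K.X q).shape _ _ hr]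
        exact ⟨0, by simp⟩
    refine ⟨c.prev p, totalSign σ c q (c.prev p) • (R.κ.f _).hom a, ?_⟩
    rw [map_zsmul, ← hom_d_comm]
    change _ = (R.κ.f p).hom (R.top hc hn x)
    rw [eq_comm, ← sub_eq_zero, ← map_zsmul, ← map_sub, R.exact_κ]
    refine ⟨totalπ (σ := σ) K (n - σ) (c.prev q) p z, ?_⟩
    rw [map_sub, map_zsmul, h1, ha, add_sub_cancel_right]

/-- The second page of the spectral sequence of the total complex is the homology of the complexes
formed by the homology of the outer differential. -/
def pageTwoIso (p : ℕ) : ((totalFiltered K hc).page 2).X ((p : ℤ), (q : ℤ)) ≅ L.homology p :=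
  ((Submodule.quotEquivOfEq _ _ (Submodule.ext fun x => (R.fromZ_eq_zero_iff hc rfl x).symm)).trans
    ((R.fromZ hc rfl).quotKerEquivOfSurjective (R.fromZ_surjective hc rfl))).toModuleIso

/-- Naturality of `fromZ`; the hypothesis on `g` says that it is induced by `f` on the homology of
the outer differential. -/
lemma fromZ_naturality {L' : HomologicalComplex (ModuleCat.{u} k) c} (R' : RowHomology K' q L')
    (f : K ⟶ K') (g : L ⟶ L')
    (hg : ∀ j y y', (R'.i.f j).hom y' = ((f.f q).f j).hom ((R.i.f j).hom y) →
      (R'.κ.f j).hom y' = (g.f j).hom ((R.κ.f j).hom y)) (hn : (p : ℤ) + q = n)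
    (x : totalZ (K := K) hc 2 p n) (x' : totalZ (K := K') hc 2 p n)
    (hx : x'.1 = ((HomologicalComplex₂.total.map f (ComplexShape.up' σ)).f n).hom x.1) :
    R'.fromZ hc hn x' = (HomologicalComplex.homologyMap g p).hom (R.fromZ hc hn x) := by
  rw [fromZ_apply, fromZ_apply, homologyMap_homologyClass]
  congr 2
  refine hg p _ _ ?_
  rw [i_top, i_top, hx, totalπ_totalMap]

lemma pageTwoIso_naturality {L' : HomologicalComplex (ModuleCat.{u} k) c} (R' : RowHomology K' q L')
    (f : K ⟶ K') (g : L ⟶ L')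
    (hg : ∀ j y y', (R'.i.f j).hom y' = ((f.f q).f j).hom ((R.i.f j).hom y) →
      (R'.κ.f j).hom y' = (g.f j).hom ((R.κ.f j).hom y)) (p : ℕ) :
    ((totalFilteredMap hc f).mapPage 2).f ((p : ℤ), (q : ℤ)) ≫ (R'.pageTwoIso hc p).hom =
      (R.pageTwoIso hc p).hom ≫ HomologicalComplex.homologyMap g p := by
  refine ModuleCat.hom_ext (LinearMap.ext fun x => ?_)
  obtain ⟨x, rfl⟩ := Submodule.Quotient.mk_surjective _ x
  let x' : totalZ (K := K') hc 2 p ((p : ℤ) + q) :=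
    ⟨((totalFilteredMap hc f).f.f _).hom x.1, (totalFilteredMap hc f).mem_Z_of_mem x.2⟩
  exact R.fromZ_naturality hc R' f g hg rfl x x' rfl

end RowHomology

end RowHomology

/-! ### Convergence of the spectral sequence of a first quadrant filtration -/

section Descend
variable {k : Type u} [CommRing k] {V W U : Type*} [AddCommGroup V] [Module k V] [AddCommGroup W]
  [Module k W] [AddCommGroup U] [Module k U]

/-- The linear map induced on the target of a surjection. -/
def descend (s : V →ₗ[k] W) (hs : Function.Surjective s) (t : V →ₗ[k] U)
    (h : LinearMap.ker s ≤ LinearMap.ker t) : W →ₗ[k] U :=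
  (LinearMap.ker s).liftQ t h ∘ₗ (s.quotKerEquivOfSurjective hs).symm.toLinearMap

@[simp]
lemma descend_apply (s : V →ₗ[k] W) (hs : Function.Surjective s) (t : V →ₗ[k] U)
    (h : LinearMap.ker s ≤ LinearMap.ker t) (v : V) : descend s hs t h (s v) = t v := by
  have : (s.quotKerEquivOfSurjective hs).symm (s v) = (LinearMap.ker s).mkQ v := by
    rw [LinearEquiv.symm_apply_eq]
    rfl
  rw [descend, LinearMap.comp_apply, LinearEquiv.coe_coe, this]
  rfl

end Descend

namespace FilteredComplex

variable {k : Type u} [CommRing k] {σ : ℤ}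

/-- The filtration is that of a double complex concentrated in the first quadrant. -/
structure FirstQuadrant (C : FilteredComplex k σ) : Prop where
  mul_self : σ * σ = 1
  top (p n : ℤ) (h : ∀ j : ℕ, (j : ℤ) ≤ n → σ * p ≤ σ * j) : C.F p n = ⊤
  bot (p n : ℤ) (h : ∀ j : ℕ, (j : ℤ) ≤ n → ¬ σ * p ≤ σ * j) : C.F p n = ⊥
  le (p n : ℤ) (h : p < 0 ∨ n - p < 0) : C.F p n ≤ C.F (p + σ) n

variable {C : FilteredComplex k σ} (hC : C.FirstQuadrant) {H : ℕ → ModuleCat.{u} k}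
  (Θ : ∀ n : ℕ, cycleSubmodule C.K n →ₗ[k] H n) (hs : ∀ n, Function.Surjective (Θ n))
  (hk : ∀ n x, Θ n x = 0 ↔ ∃ y : C.K.X (n - σ), (C.K.d (n - σ) n).hom y = x)

include hC in
lemma FirstQuadrant.eq_or : σ = 1 ∨ σ = -1 :=
  Int.isUnit_iff.1 (IsUnit.of_mul_eq_one _ hC.mul_self)

lemma mem_Z_of_cycle {r p n : ℤ} {x : C.K.X n} (hx : x ∈ cycleSubmodule C.K n) (h : x ∈ C.F p n) :
    x ∈ C.Z r p n :=
  mem_Z.2 ⟨h, fun j => by rw [mem_cycleSubmodule.1 hx]; exact zero_mem _⟩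

/-- The cycles in the `p`th step of the filtration. -/
def filteredCycles (C : FilteredComplex k σ) (p n : ℤ) : Submodule k (cycleSubmodule C.K n) :=
  (C.F p n).comap (cycleSubmodule C.K n).subtype

/-- The element of `E^r` represented by a cycle. -/
def cycleToPage (C : FilteredComplex k σ) (r p n : ℤ) : C.filteredCycles p n →ₗ[k] C.E r p n :=
  Submodule.mkQ _ ∘ₗ (((cycleSubmodule C.K n).subtype ∘ₗ
    (C.filteredCycles p n).subtype).codRestrict (C.Z r p n) fun x => mem_Z_of_cycle x.1.2 x.2)

lemma cycleToPage_apply {r p n : ℤ} (x : C.filteredCycles p n) :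
    C.cycleToPage r p n x =
      (Submodule.Quotient.mk ⟨x.1.1, mem_Z_of_cycle x.1.2 x.2⟩ : C.E r p n) := rfl

include hC in
/-- For `r ≥ p + q + 2` the differentials starting in bidegree `(p, q)` leave the quadrant, so that
all elements of `Z^r` are cycles. -/
lemma cycleToPage_surjective {p q : ℕ} {r : ℤ} (hr : (p : ℤ) + q + 2 ≤ r) :
    Function.Surjective (C.cycleToPage r p ((p + q : ℕ) : ℤ)) := by
  intro y
  obtain ⟨⟨x, hx⟩, rfl⟩ := Submodule.Quotient.mk_surjective _ y
  have hx' := mem_Z.1 hx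
  have hd : x ∈ cycleSubmodule C.K ((p + q : ℕ) : ℤ) := by
    refine mem_cycleSubmodule.2 fun j => ?_
    by_cases hj : ((p + q : ℕ) : ℤ) + σ = j
    · have := hx'.2 j
      rw [hC.bot] at this
      · exact this
      · intro i hi
        rcases hC.eq_or with rfl | rfl <;> push_cast at * <;> omega
    · rw [C.K.shape _ _ hj]
      rfl
  exact ⟨⟨⟨x, hd⟩, hx'.1⟩, rfl⟩

include hC hk in
/-- For `r ≥ p + q + 2` the differentials ending in bidegree `(p, q)` start outside the quadrant,
so that a cycle vanishes in `E^r` if and only if it is homologous to a cycle of the next step of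
the filtration. -/
lemma cycleToPage_eq_zero_iff {p q : ℕ} {r : ℤ} (hr : (p : ℤ) + q + 2 ≤ r)
    (x : C.filteredCycles p ((p + q : ℕ) : ℤ)) :
    C.cycleToPage r p ((p + q : ℕ) : ℤ) x = 0 ↔
      Θ (p + q) x.1 ∈ (C.filteredCycles (p + σ) ((p + q : ℕ) : ℤ)).map (Θ (p + q)) := by
  rw [cycleToPage_apply, mk_eq_zero_iff, mem_B]
  constructor
  · rintro ⟨b, hb, z, _, hz⟩
    have hbx : b = x.1.1 - (C.K.d (((p + q : ℕ) : ℤ) - σ) ((p + q : ℕ) : ℤ)).hom z :=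
      eq_sub_of_add_eq hz
    have hb' : b ∈ cycleSubmodule C.K ((p + q : ℕ) : ℤ) := by
      rw [hbx]
      exact sub_mem x.1.2 (d_mem_cycleSubmodule _ _ _ _)
    refine ⟨⟨b, hb'⟩, (mem_Z.1 hb).1, ?_⟩
    rw [eq_comm, ← sub_eq_zero, ← map_sub, hk]
    exact ⟨z, (sub_eq_of_eq_add' hz.symm).symm⟩
  · rintro ⟨b, hb, hbx⟩
    rw [eq_comm, ← sub_eq_zero, ← map_sub, hk] at hbx
    obtain ⟨z, hz⟩ := hbx
    have hz' : b.1 + (C.K.d (((p + q : ℕ) : ℤ) - σ) ((p + q : ℕ) : ℤ)).hom z = x.1.1 := by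
      rw [hz]
      exact add_sub_cancel _ _
    refine ⟨b.1, mem_Z_of_cycle b.2 hb, z, mem_Z.2 ⟨?_, fun j => ?_⟩, hz'⟩
    · rw [hC.top]
      · trivial
      · intro i hi
        rcases hC.eq_or with rfl | rfl <;> push_cast at * <;> omega
    · by_cases hj : ((p + q : ℕ) : ℤ) - σ + σ = j
      · obtain rfl : ((p + q : ℕ) : ℤ) = j := by omega
        rw [sub_add_cancel]
        rw [← eq_sub_iff_add_eq'] at hz'
        rw [hz']
        exact sub_mem x.2 (C.F_le _ _ hb)
      · rw [C.K.shape _ _ hj]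
        exact zero_mem _

/-- The spectral sequence of a first quadrant filtered complex converges to the homology, presented
by the surjections `Θ` from the cycles whose kernels are the boundaries. The filtration of the
limit consists of the images of the filtered cycles. -/
def convergence : Convergence C.spectralSequence H where
  isZero r hr p q hpq := by
    have : Subsingleton (C.E r p (p + q)) := by
      refine subsingleton_of_forall_eq 0 fun y => ?_
      obtain ⟨⟨x, hx⟩, rfl⟩ := Submodule.Quotient.mk_surjective _ y
      rw [mk_eq_zero_iff]
      refine Z_le_B (mem_Z.2 ⟨hC.le _ _ (by omega) (mem_Z.1 hx).1, fun j => ?_⟩)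
      convert (mem_Z.1 hx).2 j using 2
      ring
    exact ModuleCat.isZero_of_subsingleton (ModuleCat.of k (C.E r p (p + q)))
  fil p n := (C.filteredCycles p n).map (Θ n)
  fil_le p n := Submodule.map_mono (Submodule.comap_mono (C.F_le p n))
  fil_top p n h h' := by
    have : C.filteredCycles p n = ⊤ := by
      rw [filteredCycles, hC.top, Submodule.comap_top]
      intro j hj
      rcases hC.eq_or with rfl | rfl <;> omega
    rw [this, Submodule.map_top, LinearMap.range_eq_top.2 (hs n)]
  fil_bot p n h h' := by
    have : C.filteredCycles p n = ⊥ := by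
      rw [filteredCycles, hC.bot]
      · exact Submodule.ker_subtype _
      · intro j hj
        rcases hC.eq_or with rfl | rfl <;> omega
    rw [this, Submodule.map_bot]
  toPage p q r hr := descend ((Θ (p + q)).submoduleMap (C.filteredCycles p ((p + q : ℕ) : ℤ)))
    (LinearMap.submoduleMap_surjective _ _) (C.cycleToPage r p ((p + q : ℕ) : ℤ)) fun x hx => by
      refine (cycleToPage_eq_zero_iff hC Θ hk hr x).2 ?_
      rw [show Θ (p + q) x.1 = 0 from congr_arg Subtype.val hx]
      exact zero_mem _
  toPage_surjective p q r hr y := by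
    obtain ⟨x, rfl⟩ := cycleToPage_surjective hC hr y
    exact ⟨_, descend_apply _ _ _ _ x⟩
  toPage_eq_zero_iff p q r hr y := by
    obtain ⟨x, rfl⟩ := LinearMap.submoduleMap_surjective (Θ (p + q)) _ y
    refine (iff_of_eq (congr_arg (· = 0) (descend_apply ((Θ (p + q)).submoduleMap
      (C.filteredCycles p ((p + q : ℕ) : ℤ))) _ (C.cycleToPage r p _) _ x))).trans ?_
    exact cycleToPage_eq_zero_iff hC Θ hk hr x
  toPage_succ p q r hr y := by
    obtain ⟨x, rfl⟩ := LinearMap.submoduleMap_surjective (Θ (p + q)) _ y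
    have e1 := descend_apply ((Θ (p + q)).submoduleMap (C.filteredCycles p ((p + q : ℕ) : ℤ)))
      (LinearMap.submoduleMap_surjective _ _) (C.cycleToPage r p ((p + q : ℕ) : ℤ))
      (fun x hx => by
        refine (cycleToPage_eq_zero_iff hC Θ hk hr x).2 ?_
        rw [show Θ (p + q) x.1 = 0 from congr_arg Subtype.val hx]
        exact zero_mem _) x
    have e2 := descend_apply ((Θ (p + q)).submoduleMap (C.filteredCycles p ((p + q : ℕ) : ℤ)))
      (LinearMap.submoduleMap_surjective _ _) (C.cycleToPage (r + 1) p ((p + q : ℕ) : ℤ))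
      (fun x hx => by
        refine (cycleToPage_eq_zero_iff hC Θ hk (by omega) x).2 ?_
        rw [show Θ (p + q) x.1 = 0 from congr_arg Subtype.val hx]
        exact zero_mem _) x
    let z : C.Z (r + 1) p (p + q) := ⟨x.1.1, mem_Z_of_cycle x.1.2 x.2⟩
    refine ⟨((C.page r).liftCycles (C.fromZ r (r + 1) rfl ((p : ℤ), (q : ℤ))) _ rfl
      (C.fromZ_d r (r + 1) rfl ((p : ℤ), (q : ℤ)) _)).hom z,
      (C.iCycles_liftCycles_fromZ r (r + 1) rfl ((p : ℤ), (q : ℤ)) z).trans e1.symm, ?_⟩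
    have h1 := C.mk_pageIso_hom r (r + 1) rfl ((p : ℤ), (q : ℤ)) z
    have h2 := congr_arg (C.pageIso r (r + 1) rfl ((p : ℤ), (q : ℤ))).inv.hom h1
    refine (h2.symm.trans ?_).trans e2.symm
    exact congr($((C.pageIso r (r + 1) rfl ((p : ℤ), (q : ℤ))).hom_inv_id).hom _)

lemma convergence_toPage {p q : ℕ} {r : ℤ} (hr : (p : ℤ) + q + 2 ≤ r)
    (x : C.filteredCycles p ((p + q : ℕ) : ℤ)) (hx : Θ (p + q) x.1 ∈ (convergence hC Θ hs hk).fil p (p + q)) :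
    (convergence hC Θ hs hk).toPage p q r hr ⟨Θ (p + q) x.1, hx⟩ =
      C.cycleToPage r p ((p + q : ℕ) : ℤ) x :=
  descend_apply ((Θ (p + q)).submoduleMap (C.filteredCycles p ((p + q : ℕ) : ℤ))) _ _ _ x

variable {D : FilteredComplex k σ} (hD : D.FirstQuadrant) {H' : ℕ → ModuleCat.{u} k}
  (Θ' : ∀ n : ℕ, cycleSubmodule D.K n →ₗ[k] H' n) (hs' : ∀ n, Function.Surjective (Θ' n))
  (hk' : ∀ n x, Θ' n x = 0 ↔ ∃ y : D.K.X (n - σ), (D.K.d (n - σ) n).hom y = x)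

/-- A map of filtered complexes that induces `g` on the limits is compatible with convergence. -/
lemma convergence_compatible (φ : Hom C D) (g : ∀ n, H n ⟶ H' n)
    (h : ∀ (n : ℕ) (x : cycleSubmodule C.K n) (y : cycleSubmodule D.K n),
      y.1 = (φ.f.f n).hom x.1 → Θ' n y = (g n).hom (Θ n x)) :
    (convergence hC Θ hs hk).Compatible (convergence hD Θ' hs' hk') (mapSpectralSequence φ) g where
  mem p n x hx := by
    obtain ⟨x, hx, rfl⟩ := hx
    exact ⟨⟨(φ.f.f n).hom x.1, map_mem_cycleSubmodule φ.f x.2⟩, φ.mem _ _ _ hx, h n _ _ rfl⟩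
  toPage p q r hr x := by
    obtain ⟨_, ⟨x, hx, rfl⟩⟩ := x
    let y : D.filteredCycles p ((p + q : ℕ) : ℤ) :=
      ⟨⟨(φ.f.f _).hom x.1, map_mem_cycleSubmodule φ.f x.2⟩, φ.mem _ _ _ hx⟩
    have h1 := convergence_toPage hC Θ hs hk hr ⟨x, hx⟩ ⟨x, hx, rfl⟩
    have h2 := convergence_toPage hD Θ' hs' hk' hr y ⟨y.1, y.2, rfl⟩
    have h3 : (⟨Θ' (p + q) y.1, ⟨y.1, y.2, rfl⟩⟩ : (convergence hD Θ' hs' hk').fil p (p + q)) =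
        ⟨(g (p + q)).hom (Θ (p + q) x), h (p + q) x y.1 rfl ▸ ⟨y.1, y.2, rfl⟩⟩ :=
      Subtype.ext (h (p + q) x y.1 rfl)
    rw [h3] at h2
    refine Eq.trans ?_ h2.symm
    refine (congr_arg (φ.mapE r p ((p + q : ℕ) : ℤ)) h1).trans ?_
    rfl

end FilteredComplex

lemma totalFiltered_firstQuadrant {k : Type u} [CommRing k] {σ : ℤ} {c : ComplexShape ℕ}
    [TotalComplexShape c c (ComplexShape.up' σ)] [hs : IsSumShape σ c]
    (K : HomologicalComplex₂ (ModuleCat.{u} k) c c) (hc : ∀ i j, c.Rel i j → (i : ℤ) + σ = j) :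
    (totalFiltered K hc).FirstQuadrant where
  mul_self := hs.mul_self
  top p n h := by
    refine Submodule.eq_top_iff'.2 fun x => ?_
    exact mem_innerFiltration_iff.2 fun i j hij hj => (hj (h j (by omega))).elim
  bot p n h := by
    refine (Submodule.eq_bot_iff _).2 fun x hx => ?_
    refine total_ext fun i j hij => ?_
    exact (totalπ_eq_zero_of_mem hx (h j (by omega))).trans (map_zero _).symm
  le p n h x hx := by
    refine mem_innerFiltration_iff.2 fun i j hij hj => totalπ_eq_zero_of_mem hx ?_
    rcases IsSumShape.eq_or σ c with rfl | rfl <;> omega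

/-! ### Double complexes whose columns are resolutions -/

section Augmentation
variable {k : Type u} [CommRing k]

/-- The cycles of a sequence of modules `V` with differentials `δ`. -/
def seqCycles {V : ℕ → Type u} [∀ q, AddCommGroup (V q)] [∀ q, Module k (V q)]
    (δ : ∀ q, V (q + 1) →ₗ[k] V q) : ∀ q, Submodule k (V q)
  | 0 => ⊤
  | q + 1 => LinearMap.ker (δ q)

/-- A double complex in the first quadrant whose columns are resolutions of the modules `V q`. -/
structure ColumnAugmentation
    (K : HomologicalComplex₂ (ModuleCat.{u} k) (ComplexShape.down ℕ) (ComplexShape.down ℕ))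
    {V : ℕ → Type u} [∀ q, AddCommGroup (V q)] [∀ q, Module k (V q)]
    (δ : ∀ q, V (q + 1) →ₗ[k] V q) where
  ε (q : ℕ) : (K.X q).X 0 →ₗ[k] V q
  surjective (q : ℕ) : Function.Surjective (ε q)
  exact_ε (q : ℕ) (x : (K.X q).X 0) : ε q x = 0 ↔ ∃ b, ((K.X q).d 1 0).hom b = x
  exact (q j : ℕ) (x : (K.X q).X (j + 1)) (hx : ((K.X q).d (j + 1) j).hom x = 0) :
    ∃ b, ((K.X q).d (j + 2) (j + 1)).hom b = x
  comm (q : ℕ) (x : (K.X (q + 1)).X 0) : δ q (ε (q + 1) x) = ε q (((K.d (q + 1) q).f 0).hom x)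

namespace ColumnAugmentation

variable {K : HomologicalComplex₂ (ModuleCat.{u} k) (ComplexShape.down ℕ) (ComplexShape.down ℕ)}
  {V : ℕ → Type u} [∀ q, AddCommGroup (V q)] [∀ q, Module k (V q)]
  {δ : ∀ q, V (q + 1) →ₗ[k] V q} (R : ColumnAugmentation K δ)

/-- The edge map from the total complex. -/
def edge (n : ℕ) (m : ℤ) : (K.total (ComplexShape.up' (-1 : ℤ))).X m →ₗ[k] V n :=
  R.ε n ∘ₗ totalπ (σ := -1) K m n 0

/-- The edge map is a chain map. -/
lemma edge_d (n : ℕ) {m m' : ℤ} (hm : m = m' + 1) (hn : m' = n)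
    (w : (K.total (ComplexShape.up' (-1 : ℤ))).X m) :
    R.edge n m' (((K.total (ComplexShape.up' (-1 : ℤ))).d m m').hom w) =
      δ n (R.edge (n + 1) m w) := by
  subst hm hn
  rw [edge, LinearMap.comp_apply, totalπ_total_d (by omega) (by simp), map_add, map_zsmul]
  have h0 := (R.exact_ε n (((K.X n).d ((ComplexShape.down ℕ).prev 0) 0).hom
    (totalπ (σ := -1) K (n + 1) n ((ComplexShape.down ℕ).prev 0) w))).2
    (by rw [ChainComplex.prev]; exact ⟨_, rfl⟩)
  rw [h0, smul_zero, add_zero, edge, LinearMap.comp_apply, R.comm]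
  rw [ChainComplex.prev]

/-- A cycle of the total complex that the edge map kills is a boundary. This goes by induction on
`l`, where the components of the cycle in the columns from `l` on are assumed to vanish. That the
bounding element has no component of bidegree `(n + 1, 0)` makes it invisible to the edge map; this
is needed to lift cycles. -/
lemma exists_d_eq (n : ℕ) : ∀ (l : ℕ) (_ : l ≤ n + 1)
    (z : (K.total (ComplexShape.up' (-1 : ℤ))).X (n : ℤ))
    (_ : z ∈ cycleSubmodule (K.total (ComplexShape.up' (-1 : ℤ))) (n : ℤ))
    (_ : R.edge n n z = 0)
    (_ : ∀ i j : ℕ, (i : ℤ) + j = n → l ≤ i → totalπ (σ := -1) K n i j z = 0),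
    ∃ w, ((K.total (ComplexShape.up' (-1 : ℤ))).d ((n : ℤ) + 1) n).hom w = z ∧
      totalπ (σ := -1) K ((n : ℤ) + 1) (n + 1) 0 w = 0 := by
  intro l
  induction l with
  | zero =>
    intro _ z _ _ h
    refine ⟨0, ?_, map_zero _⟩
    rw [map_zero]
    exact total_ext fun i j hij => by rw [h i j hij (Nat.zero_le _), map_zero]
  | succ l ih =>
    intro hl z hz he h
    obtain ⟨j, rfl⟩ : ∃ j, n = l + j := ⟨n - l, by omega⟩
    obtain ⟨b, hb⟩ : ∃ b, ((K.X l).d (j + 1) j).hom b =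
        totalπ (σ := -1) K ((l + j : ℕ) : ℤ) l j z := by
      cases j with
      | zero => exact (R.exact_ε l _).1 he
      | succ j =>
        refine R.exact l j _ ?_
        have h1 := congr_arg (totalπ (σ := -1) K ((l + j : ℕ) : ℤ) l j)
          (mem_cycleSubmodule.1 hz ((l + j : ℕ) : ℤ))
        rw [totalπ_total_d (by push_cast; omega) (by push_cast; rfl), ChainComplex.prev, ChainComplex.prev,
          h _ _ (by push_cast; omega) (by omega), map_zero, zero_add, map_zero,
          totalSign_smul_eq_zero] at h1
        exact h1
    -- The last column in which `z` has a component is exact there, so that this component can be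
    -- removed by a boundary.
    let w := totalSign (-1) (ComplexShape.down ℕ) l (j + 1) •
      totalι (σ := -1) K (((l + j : ℕ) : ℤ) + 1) l (j + 1) b
    have hw : totalπ (σ := -1) K (((l + j : ℕ) : ℤ) + 1) (l + j + 1) 0 w = 0 := by
      rw [map_zsmul, totalπ_totalι_ne (by omega), smul_zero]
    have hd : ((K.total (ComplexShape.up' (-1 : ℤ))).d (((l + j : ℕ) : ℤ) + 1) ((l + j : ℕ) : ℤ)).hom w =
        totalSign (-1) (ComplexShape.down ℕ) l (j + 1) •
          totalι (σ := -1) K ((l + j : ℕ) : ℤ) ((ComplexShape.down ℕ).next l) (j + 1)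
            (((K.d l ((ComplexShape.down ℕ).next l)).f (j + 1)).hom b) +
        totalι (σ := -1) K ((l + j : ℕ) : ℤ) l j (totalπ (σ := -1) K ((l + j : ℕ) : ℤ) l j z) := by
      rw [map_zsmul, total_d_totalι (by push_cast; omega), smul_add, totalSign_smul_self, ← hb]
      rw [ChainComplex.next_nat_succ]
    obtain ⟨w', hw', hw''⟩ := ih (by omega)
      (z - ((K.total (ComplexShape.up' (-1 : ℤ))).d (((l + j : ℕ) : ℤ) + 1)
        ((l + j : ℕ) : ℤ)).hom w)
      (sub_mem hz (d_mem_cycleSubmodule _ _ _ _))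
      (by
        rw [map_sub, he, R.edge_d _ rfl rfl, zero_sub, neg_eq_zero]
        rw [edge, LinearMap.comp_apply]
        push_cast at hw ⊢
        rw [hw, map_zero, map_zero])
      (by
        intro i j' hij hi
        have e : totalπ (σ := -1) K ((l + j : ℕ) : ℤ) i j' (totalι (σ := -1) K ((l + j : ℕ) : ℤ) ((ComplexShape.down ℕ).next l) (j + 1)
            (((K.d l ((ComplexShape.down ℕ).next l)).f (j + 1)).hom b)) = 0 := by
          cases l with
          | zero =>
            rw [K.shape _ _ (by simp)]
            simp
          | succ l =>
            rw [totalπ_totalι_ne]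
            rw [ChainComplex.next_nat_succ]
            omega
        rw [hd, map_sub, map_add, map_zsmul, e, smul_zero, zero_add]
        by_cases hl' : i = l
        · obtain rfl : j' = j := by push_cast at hij; omega
          subst hl'
          rw [totalπ_totalι_self hij, sub_self]
        · rw [totalπ_totalι_ne (by omega), sub_zero]
          exact h _ _ hij (by omega))
    refine ⟨w + w', ?_, ?_⟩
    · rw [map_add, hw', add_sub_cancel]
    · rw [map_add, hw, hw'', add_zero]

lemma exists_d_eq_of_edge_eq_zero {n : ℕ} {z : (K.total (ComplexShape.up' (-1 : ℤ))).X (n : ℤ)}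
    (hz : z ∈ cycleSubmodule (K.total (ComplexShape.up' (-1 : ℤ))) (n : ℤ))
    (h : R.edge n n z = 0) :
    ∃ w, ((K.total (ComplexShape.up' (-1 : ℤ))).d ((n : ℤ) + 1) n).hom w = z ∧
      totalπ (σ := -1) K ((n : ℤ) + 1) (n + 1) 0 w = 0 :=
  R.exists_d_eq n (n + 1) le_rfl z hz h fun i j hij hi => by omega

lemma edge_mem_seqCycles (n : ℕ) {z : (K.total (ComplexShape.up' (-1 : ℤ))).X (n : ℤ)}
    (hz : z ∈ cycleSubmodule (K.total (ComplexShape.up' (-1 : ℤ))) (n : ℤ)) :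
    R.edge n n z ∈ seqCycles δ n := by
  cases n with
  | zero => trivial
  | succ n =>
    change δ n _ = 0
    rw [← R.edge_d n (m' := n) (by push_cast; rfl) rfl, mem_cycleSubmodule.1 hz, map_zero]

/-- The edge map from the cycles of the total complex. -/
def edgeCycles (n : ℕ) :
    cycleSubmodule (K.total (ComplexShape.up' (-1 : ℤ))) (n : ℤ) →ₗ[k] seqCycles δ n :=
  (R.edge n n).restrict fun _ hz => R.edge_mem_seqCycles n hz

/-- Together with `edge_mem_range_iff`, this says that the total complex has the homology of `V`.
-/
lemma edgeCycles_surjective (n : ℕ) : Function.Surjective (R.edgeCycles n) := by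
  rintro ⟨v, hv⟩
  obtain ⟨a, rfl⟩ := R.surjective n v
  cases n with
  | zero =>
    refine ⟨⟨totalι (σ := -1) K _ 0 0 a, mem_cycleSubmodule.2 fun j => ?_⟩, Subtype.ext ?_⟩
    · rw [total_d_totalι (by simp), K.shape _ _ (by simp), (K.X 0).shape _ _ (by simp)]
      simp
    · exact congr_arg (R.ε 0) (totalπ_totalι_self (by simp) a)
  | succ n =>
    let y := totalι (σ := -1) K ((n : ℤ) + 1) (n + 1) 0 a
    have hy : totalπ (σ := -1) K ((n : ℤ) + 1) (n + 1) 0 y = a :=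
      totalπ_totalι_self (by push_cast; omega) a
    -- The boundary of the lift `y` is killed by the edge map, hence it bounds an element `w` that
    -- the edge map kills, too.
    obtain ⟨w, hw, hw'⟩ := R.exists_d_eq_of_edge_eq_zero (n := n)
      (z := ((K.total (ComplexShape.up' (-1 : ℤ))).d ((n : ℤ) + 1) n).hom y)
      (d_mem_cycleSubmodule _ _ _ _)
      (by
        rw [R.edge_d n rfl rfl, edge, LinearMap.comp_apply, hy]
        exact hv)
    have hn : ((n + 1 : ℕ) : ℤ) = (n : ℤ) + 1 := by push_cast; rfl
    have hyw : y - w ∈ cycleSubmodule (K.total (ComplexShape.up' (-1 : ℤ))) ((n : ℤ) + 1) := by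
      refine mem_cycleSubmodule.2 fun j => ?_
      by_cases hj : (ComplexShape.up' (-1 : ℤ)).Rel ((n : ℤ) + 1) j
      · obtain rfl : j = n := by
          have : (n : ℤ) + 1 + -1 = j := hj
          omega
        rw [map_sub, hw, sub_self]
      · rw [HomologicalComplex.shape _ _ _ hj]
        rfl
    refine ⟨⟨y - w, hyw⟩, Subtype.ext ?_⟩
    refine congr_arg (R.ε (n + 1)) ?_
    refine (map_sub (totalπ (σ := -1) K ((n : ℤ) + 1) (n + 1) 0) y w).trans ?_
    rw [hw', hy, sub_zero]

/-- A cycle is a boundary iff its image under the edge map is. -/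
lemma edge_mem_range_iff (n : ℕ) {z : (K.total (ComplexShape.up' (-1 : ℤ))).X (n : ℤ)}
    (hz : z ∈ cycleSubmodule (K.total (ComplexShape.up' (-1 : ℤ))) (n : ℤ)) :
    (∃ v, δ n v = R.edge n n z) ↔
      ∃ w, ((K.total (ComplexShape.up' (-1 : ℤ))).d ((n : ℤ) + 1) n).hom w = z := by
  constructor
  · rintro ⟨v, hv⟩
    obtain ⟨b, rfl⟩ := R.surjective _ v
    let y := totalι (σ := -1) K ((n : ℤ) + 1) (n + 1) 0 b
    have hy : totalπ (σ := -1) K ((n : ℤ) + 1) (n + 1) 0 y = b :=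
      totalπ_totalι_self (by push_cast; omega) b
    obtain ⟨w, hw, -⟩ := R.exists_d_eq_of_edge_eq_zero (n := n)
      (sub_mem hz (d_mem_cycleSubmodule _ ((n : ℤ) + 1) (n : ℤ) y))
      (by rw [map_sub, R.edge_d n rfl rfl, ← hv, edge, LinearMap.comp_apply, hy, sub_self])
    exact ⟨y + w, by rw [map_add, hw, add_sub_cancel]⟩
  · rintro ⟨w, rfl⟩
    exact ⟨_, (R.edge_d n rfl rfl w).symm⟩

end ColumnAugmentation
end Augmentation

/-! ### Double complexes whose columns are coresolutions -/

section Coaugmentation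
variable {k : Type u} [CommRing k]

/-- A double complex in the first quadrant whose columns are coresolutions of the modules `V q`. -/
structure ColumnCoaugmentation
    (K : HomologicalComplex₂ (ModuleCat.{u} k) (ComplexShape.up ℕ) (ComplexShape.up ℕ))
    {V : ℕ → Type u} [∀ q, AddCommGroup (V q)] [∀ q, Module k (V q)]
    (δ : ∀ q, V q →ₗ[k] V (q + 1)) where
  η (q : ℕ) : V q →ₗ[k] (K.X q).X 0
  injective (q : ℕ) : Function.Injective (η q)
  exact_η (q : ℕ) (x : (K.X q).X 0) : (∃ v, η q v = x) ↔ ((K.X q).d 0 1).hom x = 0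
  exact (q j : ℕ) (x : (K.X q).X (j + 1)) (hx : ((K.X q).d (j + 1) (j + 2)).hom x = 0) :
    ∃ b, ((K.X q).d j (j + 1)).hom b = x
  comm (q : ℕ) (v : V q) : ((K.d q (q + 1)).f 0).hom (η q v) = η (q + 1) (δ q v)

namespace ColumnCoaugmentation

variable {K : HomologicalComplex₂ (ModuleCat.{u} k) (ComplexShape.up ℕ) (ComplexShape.up ℕ)}
  {V : ℕ → Type u} [∀ q, AddCommGroup (V q)] [∀ q, Module k (V q)]
  {δ : ∀ q, V q →ₗ[k] V (q + 1)} (R : ColumnCoaugmentation K δ)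

/-- The edge map to the total complex. -/
def edge (n : ℕ) (m : ℤ) : V n →ₗ[k] (K.total (ComplexShape.up' (1 : ℤ))).X m :=
  totalι (σ := 1) K m n 0 ∘ₗ R.η n

lemma edge_injective (n : ℕ) : Function.Injective (R.edge n n) := by
  intro v v' h
  apply R.injective
  have := congr_arg (totalπ (σ := 1) K n n 0) h
  rw [edge, LinearMap.comp_apply, LinearMap.comp_apply, totalπ_totalι_self (by simp),
    totalπ_totalι_self (by simp)] at this
  exact this

lemma d_edge (n : ℕ) {m m' : ℤ} (hn : m = n) (v : V n) :
    ((K.total (ComplexShape.up' (1 : ℤ))).d m m').hom (R.edge n m v) =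
      R.edge (n + 1) m' (δ n v) := by
  rw [edge, LinearMap.comp_apply, total_d_totalι (by simp [hn])]
  have h0 : ((K.X n).d 0 ((ComplexShape.up ℕ).next 0)).hom (R.η n v) = 0 := by
    rw [CochainComplex.next]
    exact (R.exact_η n _).1 ⟨v, rfl⟩
  rw [h0, map_zero, smul_zero, add_zero, CochainComplex.next, R.comm]
  rfl

/-- If an element has no components in the columns before `i`, and its boundary has no component of
bidegree `(i, j + 1)`, then its component of bidegree `(i, j)` is a cycle of the column. -/
lemma total_d_totalπ_eq_zero {n : ℤ} {i j : ℕ} (h : (i : ℤ) + j = n)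
    {z : (K.total (ComplexShape.up' (1 : ℤ))).X n}
    (hz : totalπ (σ := 1) K (n + 1) i (j + 1)
      (((K.total (ComplexShape.up' (1 : ℤ))).d n (n + 1)).hom z) = 0)
    (hi : ∀ i' j' : ℕ, (i' : ℤ) + j' = n → i' < i → totalπ (σ := 1) K n i' j' z = 0) :
    ((K.X i).d j (j + 1)).hom (totalπ (σ := 1) K n i j z) = 0 := by
  rw [totalπ_total_d rfl (by push_cast; omega)] at hz
  have h0 : ((K.d ((ComplexShape.up ℕ).prev i) i).f (j + 1)).hom
      (totalπ (σ := 1) K n ((ComplexShape.up ℕ).prev i) (j + 1) z) = 0 := by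
    cases i with
    | zero =>
      rw [K.shape _ _ (by simp)]
      rfl
    | succ i =>
      rw [hi, map_zero]
      · rw [CochainComplex.prev_nat_succ]
        push_cast at *
        omega
      · rw [CochainComplex.prev_nat_succ]
        omega
  rw [h0, zero_add, totalSign_smul_eq_zero, CochainComplex.prev_nat_succ] at hz
  exact hz

include R in
/-- Subtracting a boundary clears the components in the columns before `l`, by exactness of these
columns. -/
lemma exists_sub_d (n : ℕ) (z : (K.total (ComplexShape.up' (1 : ℤ))).X (n : ℤ))
    (hz : ∀ i j : ℕ, totalπ (σ := 1) K ((n : ℤ) + 1) i (j + 1)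
      (((K.total (ComplexShape.up' (1 : ℤ))).d n ((n : ℤ) + 1)).hom z) = 0) :
    ∀ (l : ℕ) (_ : l ≤ n), ∃ u, ∀ i j : ℕ, (i : ℤ) + j = n → i < l →
      totalπ (σ := 1) K n i j
        (z - ((K.total (ComplexShape.up' (1 : ℤ))).d ((n : ℤ) - 1) n).hom u) = 0 := by
  intro l
  induction l with
  | zero => exact fun _ => ⟨0, fun i j _ h => (Nat.not_lt_zero _ h).elim⟩
  | succ l ih =>
    intro hl
    obtain ⟨u, hu⟩ := ih (by omega)
    obtain ⟨j, rfl⟩ : ∃ j, n = l + (j + 1) := ⟨n - l - 1, by omega⟩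
    let z' := z - ((K.total (ComplexShape.up' (1 : ℤ))).d (((l + (j + 1) : ℕ) : ℤ) - 1)
      ((l + (j + 1) : ℕ) : ℤ)).hom u
    have hz' : ((K.total (ComplexShape.up' (1 : ℤ))).d ((l + (j + 1) : ℕ) : ℤ)
        (((l + (j + 1) : ℕ) : ℤ) + 1)).hom z' = ((K.total (ComplexShape.up' (1 : ℤ))).d
          ((l + (j + 1) : ℕ) : ℤ) (((l + (j + 1) : ℕ) : ℤ) + 1)).hom z := by
      rw [map_sub, mem_cycleSubmodule.1 (d_mem_cycleSubmodule _ _ _ _), sub_zero]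
    obtain ⟨b, hb⟩ := R.exact l j _ (total_d_totalπ_eq_zero (n := ((l + (j + 1) : ℕ) : ℤ))
      (by push_cast; omega) (z := z') (by rw [hz']; exact hz _ _) hu)
    let w := totalSign 1 (ComplexShape.up ℕ) l j •
      totalι (σ := 1) K (((l + (j + 1) : ℕ) : ℤ) - 1) l j b
    have hd : ((K.total (ComplexShape.up' (1 : ℤ))).d (((l + (j + 1) : ℕ) : ℤ) - 1)
        ((l + (j + 1) : ℕ) : ℤ)).hom w = totalSign 1 (ComplexShape.up ℕ) l j •
          totalι (σ := 1) K ((l + (j + 1) : ℕ) : ℤ) (l + 1) j (((K.d l (l + 1)).f j).hom b) +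
        totalι (σ := 1) K ((l + (j + 1) : ℕ) : ℤ) l (j + 1)
          (totalπ (σ := 1) K ((l + (j + 1) : ℕ) : ℤ) l (j + 1) z') := by
      rw [map_zsmul, total_d_totalι (by push_cast; omega), smul_add, totalSign_smul_self, ← hb,
        CochainComplex.next, CochainComplex.next]
    refine ⟨u + w, fun i j' hij hi => ?_⟩
    rw [map_add, ← sub_sub]
    change totalπ (σ := 1) K _ i j' (z' - _) = 0
    rw [hd, map_sub, map_add, map_zsmul, totalπ_totalι_ne (by omega), smul_zero, zero_add]
    by_cases hl' : i = l
    · subst hl'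
      obtain rfl : j' = j + 1 := by push_cast at hij; omega
      rw [totalπ_totalι_self hij, sub_self]
    · rw [totalπ_totalι_ne (by omega), sub_zero]
      exact hu _ _ hij (by omega)

/-- An element whose boundary lies in the bottom row comes from the edge map, up to a boundary. -/
lemma exists_eq_d_add_edge (n : ℕ) (z : (K.total (ComplexShape.up' (1 : ℤ))).X (n : ℤ))
    (hz : ∀ i j : ℕ, totalπ (σ := 1) K ((n : ℤ) + 1) i (j + 1)
      (((K.total (ComplexShape.up' (1 : ℤ))).d n ((n : ℤ) + 1)).hom z) = 0) :
    ∃ u v, z = ((K.total (ComplexShape.up' (1 : ℤ))).d ((n : ℤ) - 1) n).hom u + R.edge n n v := by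
  obtain ⟨u, hu⟩ := R.exists_sub_d n z hz n le_rfl
  have h := total_d_totalπ_eq_zero (n := (n : ℤ)) (i := n) (j := 0) (by simp)
    (z := z - ((K.total (ComplexShape.up' (1 : ℤ))).d ((n : ℤ) - 1) n).hom u)
    (by
      rw [map_sub, mem_cycleSubmodule.1 (d_mem_cycleSubmodule _ _ _ _), sub_zero]
      exact hz _ _) hu
  obtain ⟨v, hv⟩ := (R.exact_η n _).2 h
  refine ⟨u, v, ?_⟩
  rw [← sub_eq_iff_eq_add']
  refine total_ext fun i j hij => ?_
  rw [edge, LinearMap.comp_apply, hv]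
  by_cases hi : i = n
  · subst hi
    obtain rfl : j = 0 := by omega
    rw [totalπ_totalι_self hij]
  · rw [totalπ_totalι_ne (by omega)]
    exact hu _ _ hij (by omega)

/-- The cycle of the total complex given by a cycle of `V` and a cochain. -/
def toCycles (n : ℕ) : LinearMap.ker (δ n) × (K.total (ComplexShape.up' (1 : ℤ))).X ((n : ℤ) - 1)
    →ₗ[k] cycleSubmodule (K.total (ComplexShape.up' (1 : ℤ))) (n : ℤ) :=
  LinearMap.coprod
    ((R.edge n n).restrict fun v hv => mem_cycleSubmodule.2 fun j => by
      rw [R.d_edge n rfl, show δ n v = 0 from hv, map_zero])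
    (((K.total (ComplexShape.up' (1 : ℤ))).d ((n : ℤ) - 1) n).hom.codRestrict _ fun _ =>
      d_mem_cycleSubmodule _ _ _ _)

lemma toCycles_coe (n : ℕ) (v : LinearMap.ker (δ n))
    (w : (K.total (ComplexShape.up' (1 : ℤ))).X ((n : ℤ) - 1)) :
    (R.toCycles n (v, w)).1 =
      R.edge n n v + ((K.total (ComplexShape.up' (1 : ℤ))).d ((n : ℤ) - 1) n).hom w := by
  rw [toCycles, LinearMap.coprod_apply]
  rfl

/-- Every cycle of the total complex is homologous to one that comes from the edge map. -/
lemma toCycles_surjective (n : ℕ) : Function.Surjective (R.toCycles n) := by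
  rintro ⟨z, hz⟩
  obtain ⟨u, v, h⟩ := R.exists_eq_d_add_edge n z fun i j => by
    rw [mem_cycleSubmodule.1 hz, map_zero]
  have hv : δ n v = 0 := by
    have h1 := mem_cycleSubmodule.1 hz ((n + 1 : ℕ) : ℤ)
    rw [h, map_add, mem_cycleSubmodule.1 (d_mem_cycleSubmodule _ _ _ _), zero_add,
      R.d_edge n rfl] at h1
    exact R.edge_injective (n + 1) (h1.trans (map_zero _).symm)
  exact ⟨(⟨v, hv⟩, u), Subtype.ext ((R.toCycles_coe n _ _).trans ((add_comm _ _).trans h.symm))⟩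

/-- If the edge map sends a cycle to a boundary then it is a boundary. -/
lemma exists_δ_eq (n : ℕ) {v : V (n + 1)} {w : (K.total (ComplexShape.up' (1 : ℤ))).X (n : ℤ)}
    (h : ((K.total (ComplexShape.up' (1 : ℤ))).d (n : ℤ) (n + 1 : ℕ)).hom w =
      R.edge (n + 1) (n + 1 : ℕ) v) : ∃ v', δ n v' = v := by
  obtain ⟨u, v', hw⟩ := R.exists_eq_d_add_edge n w fun i j => by
    push_cast at h
    rw [h, edge, LinearMap.comp_apply, totalπ_totalι_ne (by omega)]
  refine ⟨v', ?_⟩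
  rw [hw, map_add, mem_cycleSubmodule.1 (d_mem_cycleSubmodule _ _ _ _), zero_add,
    R.d_edge n rfl] at h
  exact R.edge_injective (n + 1) h

/-- The map from the cycles of the total complex induced by a map from the cycles of `V` that
kills the boundaries. -/
def limitMap (n : ℕ) {U : Type u} [AddCommGroup U] [Module k U] (θ : LinearMap.ker (δ n) →ₗ[k] U)
    (hθ : ∀ v w, R.edge n n v.1 =
      ((K.total (ComplexShape.up' (1 : ℤ))).d ((n : ℤ) - 1) n).hom w → θ v = 0) :
    cycleSubmodule (K.total (ComplexShape.up' (1 : ℤ))) (n : ℤ) →ₗ[k] U :=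
  descend (R.toCycles n) (R.toCycles_surjective n) (θ ∘ₗ LinearMap.fst _ _ _) fun vw h => by
    obtain ⟨v, w⟩ := vw
    refine hθ v (-w) ?_
    have h' := congr_arg Subtype.val (show R.toCycles n (v, w) = 0 from h)
    rw [toCycles_coe] at h'
    rw [map_neg]
    exact eq_neg_of_add_eq_zero_left h'

variable (n : ℕ) {U : Type u} [AddCommGroup U] [Module k U] (θ : LinearMap.ker (δ n) →ₗ[k] U)
    (hθ : ∀ v w, R.edge n n v.1 =
      ((K.total (ComplexShape.up' (1 : ℤ))).d ((n : ℤ) - 1) n).hom w → θ v = 0)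

lemma limitMap_toCycles (v : LinearMap.ker (δ n))
    (w : (K.total (ComplexShape.up' (1 : ℤ))).X ((n : ℤ) - 1)) :
    R.limitMap n θ hθ (R.toCycles n (v, w)) = θ v :=
  descend_apply _ _ _ _ _

lemma limitMap_surjective (h : Function.Surjective θ) :
    Function.Surjective (R.limitMap n θ hθ) := by
  intro y
  obtain ⟨v, rfl⟩ := h y
  exact ⟨_, R.limitMap_toCycles n θ hθ v 0⟩

lemma limitMap_eq_zero_iff (h : ∀ v, θ v = 0 → ∃ w, ((K.total (ComplexShape.up' (1 : ℤ))).d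
      ((n : ℤ) - 1) n).hom w = R.edge n n v.1)
    (z : cycleSubmodule (K.total (ComplexShape.up' (1 : ℤ))) (n : ℤ)) :
    R.limitMap n θ hθ z = 0 ↔
      ∃ w, ((K.total (ComplexShape.up' (1 : ℤ))).d ((n : ℤ) - 1) n).hom w = z := by
  obtain ⟨⟨v, w⟩, rfl⟩ := R.toCycles_surjective n z
  rw [limitMap_toCycles, toCycles_coe]
  constructor
  · intro hv
    obtain ⟨w', hw'⟩ := h v hv
    exact ⟨w' + w, by rw [map_add, hw']⟩
  · rintro ⟨w', hw'⟩
    exact hθ v (w' - w) (by rw [map_sub, hw', add_sub_cancel_right])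

end ColumnCoaugmentation
end Coaugmentation

/-! ### Direct sums of convergent spectral sequences -/

section SumConvergence
variable {k : Type u} [CommRing k] {Λ : Type u}

lemma dsMap_surjective {M M' : Λ → ModuleCat.{u} k} (f : ∀ l, M l ⟶ M' l)
    (h : ∀ l, Function.Surjective (f l).hom) : Function.Surjective (dsMap f).hom := by
  intro y
  choose g hg using h
  obtain ⟨s, hs⟩ := ds_eq_sum M' y
  refine ⟨∑ l ∈ s, (dsι M l).hom (g l ((dsπ M' l).hom y)), ?_⟩
  refine (map_sum _ _ _).trans (Eq.trans (Finset.sum_congr rfl fun l _ => ?_) hs.symm)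
  refine congr($(dsι_map f l).hom _).trans ?_
  exact congr_arg (dsι M' l).hom (hg l _)

lemma dsπ_dsMap {M M' : Λ → ModuleCat.{u} k} (f : ∀ l, M l ⟶ M' l) (l : Λ) (x : ⨁ l, M l) :
    (dsπ M' l).hom ((dsMap f).hom x) = (f l).hom ((dsπ M l).hom x) :=
  congr($(dsMap_π f l).hom x)

lemma dsMap_injective {M M' : Λ → ModuleCat.{u} k} (f : ∀ l, M l ⟶ M' l)
    (h : ∀ l, Function.Injective (f l).hom) : Function.Injective (dsMap f).hom := by
  intro x y hxy
  refine ds_ext fun l => h l ?_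
  rw [← dsπ_dsMap, ← dsπ_dsMap, hxy]

/-- The direct sum of submodules. -/
def dsSub {M : Λ → ModuleCat.{u} k} (S : ∀ l, Submodule k (M l)) : Submodule k (⨁ l, M l) :=
  ⨅ l, (S l).comap (dsπ M l).hom

lemma mem_dsSub {M : Λ → ModuleCat.{u} k} {S : ∀ l, Submodule k (M l)} {x : ⨁ l, M l} :
    x ∈ dsSub S ↔ ∀ l, (dsπ M l).hom x ∈ S l := by
  simp [dsSub]

/-- The direct sum of the inclusions of submodules. -/
def dsIncl {M : Λ → ModuleCat.{u} k} (S : ∀ l, Submodule k (M l)) :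
    (⨁ l, S l) →ₗ[k] dsSub S :=
  (dsMap fun l => ModuleCat.ofHom (S l).subtype).hom.codRestrict _ fun x =>
    mem_dsSub.2 fun l => by
      rw [dsπ_dsMap]
      exact ((dsπ (fun l => ModuleCat.of k (S l)) l).hom x).2

lemma dsIncl_bijective {M : Λ → ModuleCat.{u} k} (S : ∀ l, Submodule k (M l)) :
    Function.Bijective (dsIncl S) := by
  refine ⟨fun x y h => dsMap_injective (fun l => ModuleCat.ofHom (S l).subtype)
    (fun l => Subtype.val_injective) (congr_arg Subtype.val h), fun y => ?_⟩
  obtain ⟨s, hs⟩ := ds_eq_sum M y.1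
  refine ⟨∑ l ∈ s, (dsι (fun l => ModuleCat.of k (S l)) l).hom
    ⟨(dsπ M l).hom y.1, mem_dsSub.1 y.2 l⟩, Subtype.ext ?_⟩
  refine (map_sum (dsMap fun l => ModuleCat.ofHom (S l).subtype).hom _ _).trans
    (Eq.trans (Finset.sum_congr rfl fun l _ => ?_) hs.symm)
  exact congr($(dsι_map (M' := M) (fun l => ModuleCat.ofHom (S l).subtype) l).hom
    ⟨(dsπ M l).hom y.1, mem_dsSub.1 y.2 l⟩)

/-- The map on the direct sum of submodules with given components. -/
def dsSubMap {M : Λ → ModuleCat.{u} k} (S : ∀ l, Submodule k (M l)) {M' : Λ → ModuleCat.{u} k}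
    (f : ∀ l, S l →ₗ[k] M' l) : dsSub S →ₗ[k] (⨁ l, M' l) :=
  (dsMap fun l => ModuleCat.ofHom (f l)).hom ∘ₗ
    (LinearEquiv.ofBijective (dsIncl S) (dsIncl_bijective S)).symm.toLinearMap

section
variable {M : Λ → ModuleCat.{u} k} (S : ∀ l, Submodule k (M l)) {M' : Λ → ModuleCat.{u} k}
  (f : ∀ l, S l →ₗ[k] M' l)

lemma dsSubMap_dsIncl (x : ⨁ l, S l) : dsSubMap S f (dsIncl S x) =
    (dsMap (M := fun l => ModuleCat.of k (S l)) fun l => ModuleCat.ofHom (f l)).hom x :=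
  congr_arg (dsMap fun l => ModuleCat.ofHom (f l)).hom
    ((LinearEquiv.ofBijective (dsIncl S) (dsIncl_bijective S)).symm_apply_apply x)

lemma dsπ_dsSubMap (x : dsSub S) (l : Λ) :
    (dsπ M' l).hom (dsSubMap S f x) = f l ⟨(dsπ M l).hom x.1, mem_dsSub.1 x.2 l⟩ := by
  obtain ⟨x, rfl⟩ := (dsIncl_bijective S).2 x
  rw [dsSubMap_dsIncl, dsπ_dsMap]
  refine congr_arg (f l) (Subtype.ext ?_)
  exact (dsπ_dsMap (fun l => ModuleCat.ofHom (S l).subtype) l x).symm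

lemma dsSubMap_surjective (h : ∀ l, Function.Surjective (f l)) :
    Function.Surjective (dsSubMap S f) := by
  intro y
  obtain ⟨x, rfl⟩ := dsMap_surjective (fun l => ModuleCat.ofHom (f l)) h y
  exact ⟨_, dsSubMap_dsIncl S f x⟩

end

/-- The identification of the homology of a page of the direct sum with the next page, in
components. -/
lemma dsSS_iso_hom_π {c : ComplexShape (ℤ × ℤ)}
    (X : Λ → HomologicalComplex (ModuleCat.{u} k) c) (pq : ℤ × ℤ) (l : Λ) (W : Λ → ModuleCat.{u} k)
    (w : ∀ l, (X l).homology pq ⟶ W l) (z : (dsComplex X).cycles pq) :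
    (dsπ W l).hom ((inv (dsHomologyMap X pq) ≫ dsMap w).hom (((dsComplex X).homologyπ pq).hom z)) =
      (w l).hom (((X l).homologyπ pq).hom
        ((HomologicalComplex.cyclesMap (dsComplexπ X l) pq).hom z)) := by
  have e : (inv (dsHomologyMap X pq) ≫ dsMap w) ≫ dsπ W l =
      HomologicalComplex.homologyMap (dsComplexπ X l) pq ≫ w l := by
    rw [Category.assoc, dsMap_π, IsIso.inv_comp_eq, ← Category.assoc, dsHomologyMap_π]
  refine (congr($(e).hom (((dsComplex X).homologyπ pq).hom z))).trans ?_
  exact congr_arg (w l).hom (congr($(HomologicalComplex.homologyπ_naturality (dsComplexπ X l) pq).hom z))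

/-- The passage from one page to the next can be checked componentwise in a direct sum. -/
lemma dsComplex_toPage_succ {c : ComplexShape (ℤ × ℤ)}
    (X : Λ → HomologicalComplex (ModuleCat.{u} k) c) (pq : ℤ × ℤ) (W : Λ → ModuleCat.{u} k)
    (w : ∀ l, (X l).homology pq ⟶ W l) (x : ⨁ l, (X l).X pq) (y : ⨁ l, W l)
    (h : ∀ l, ∃ z : (X l).cycles pq, ((X l).iCycles pq).hom z =
      (dsπ (fun l => (X l).X pq) l).hom x ∧
      (w l).hom (((X l).homologyπ pq).hom z) = (dsπ W l).hom y) :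
    ∃ z : (dsComplex X).cycles pq, ((dsComplex X).iCycles pq).hom z = x ∧
      (inv (dsHomologyMap X pq) ≫ dsMap w).hom (((dsComplex X).homologyπ pq).hom z) = y := by
  choose z hz hz' using h
  obtain ⟨z₀, hz₀⟩ := exists_cycles_of_d_eq_zero (dsComplex X) pq x fun j => by
    refine ds_ext fun l => ?_
    refine (dsπ_dsMap (fun l => (X l).d pq j) l x).trans ?_
    rw [← hz]
    exact (congr($((X l).iCycles_d pq j).hom (z l))).trans
      (map_zero (dsπ (fun l => (X l).X j) l).hom).symm
  refine ⟨z₀, hz₀, ds_ext fun l => ?_⟩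
  rw [dsSS_iso_hom_π, ← hz']
  congr 2
  apply (ModuleCat.mono_iff_injective ((X l).iCycles pq)).1 inferInstance
  rw [hz, ← hz₀]
  exact congr($(HomologicalComplex.cyclesMap_i (dsComplexπ X l) pq).hom z₀)

variable {σ : ℤ} {E : Λ → SpectralSequence (ModuleCat.{u} k) (FilteredComplex.pageShape σ) 2}
  {H : Λ → ℕ → ModuleCat.{u} k} (c : ∀ l, Convergence (E l) (H l))

/-- A direct sum of convergent spectral sequences converges to the direct sum of the limits. -/
def dsConvergence : Convergence (dsSS E) fun n => ModuleCat.of k (⨁ l, H l n) where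
  isZero r hr p q hpq := by
    have (l : Λ) : Subsingleton (((E l).page r hr).X (p, q)) :=
      ModuleCat.subsingleton_of_isZero ((c l).isZero r hr p q hpq)
    have : Subsingleton (⨁ l, ((E l).page r hr).X (p, q)) :=
      ⟨fun x y => ds_ext fun l => Subsingleton.elim _ _⟩
    exact ModuleCat.isZero_of_subsingleton (ModuleCat.of k (⨁ l, ((E l).page r hr).X (p, q)))
  fil p n := dsSub fun l => (c l).fil p n
  fil_le p n x hx := mem_dsSub.2 fun l => (c l).fil_le p n (mem_dsSub.1 hx l)
  fil_top p n h h' := by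
    refine Submodule.eq_top_iff'.2 fun x => mem_dsSub.2 fun l => ?_
    rw [(c l).fil_top p n h h']
    trivial
  fil_bot p n h h' := by
    refine (Submodule.eq_bot_iff _).2 fun x hx => ds_ext fun l => ?_
    have := mem_dsSub.1 hx l
    rw [(c l).fil_bot p n h h'] at this
    exact this.trans (map_zero _).symm
  toPage p q r hr := dsSubMap (fun l => (c l).fil p (p + q)) fun l => (c l).toPage p q r hr
  toPage_surjective p q r hr := dsSubMap_surjective _ _ fun l => (c l).toPage_surjective p q r hr
  toPage_eq_zero_iff p q r hr x := by
    rw [mem_dsSub]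
    have h (l : Λ) := dsπ_dsSubMap (fun l => (c l).fil p (p + q))
      (fun l => (c l).toPage p q r hr) x l
    refine Iff.trans ⟨fun h0 l => ?_, fun h0 => ds_ext fun l => ?_⟩
      (forall_congr' fun l => (c l).toPage_eq_zero_iff p q r hr ⟨_, mem_dsSub.1 x.2 l⟩)
    · exact (h l).symm.trans ((congr_arg (dsπ _ l).hom h0).trans (map_zero _))
    · exact ((h l).trans (h0 l)).trans (map_zero _).symm
  toPage_succ p q r hr x := by
    refine dsComplex_toPage_succ (fun l => (E l).page r (by omega)) ((p : ℤ), (q : ℤ))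
      (fun l => ((E l).page (r + 1) (by omega)).X ((p : ℤ), (q : ℤ)))
      (fun l => ((E l).iso r (r + 1) ((p : ℤ), (q : ℤ)) rfl (by omega)).hom) _ _ fun l => ?_
    obtain ⟨z, hz, hz'⟩ := (c l).toPage_succ p q r hr ⟨_, mem_dsSub.1 x.2 l⟩
    exact ⟨z, hz.trans (dsπ_dsSubMap (fun l => (c l).fil p (p + q))
      (fun l => (c l).toPage p q r hr) x l).symm,
      hz'.trans (dsπ_dsSubMap (fun l => (c l).fil p (p + q))
      (fun l => (c l).toPage p q (r + 1) (by omega)) x l).symm⟩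

lemma dsDesc_mem {M : Λ → ModuleCat.{u} k} {S : ∀ l, Submodule k (M l)} {P : ModuleCat.{u} k}
    {S' : Submodule k P} {f : ∀ l, M l ⟶ P} (h : ∀ l, ∀ x ∈ S l, (f l).hom x ∈ S') {x : ⨁ l, M l}
    (hx : x ∈ dsSub S) : (dsDesc f).hom x ∈ S' := by
  obtain ⟨s, hs⟩ := ds_eq_sum M x
  rw [hs, map_sum]
  refine sum_mem fun l _ => ?_
  have e : (dsDesc f).hom ((dsι M l).hom ((dsπ M l).hom x)) = (f l).hom ((dsπ M l).hom x) :=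
    congr($(dsι_desc f l).hom _)
  rw [e]
  exact h l _ (mem_dsSub.1 hx l)

lemma dsDesc_dsSubMap {M M' : Λ → ModuleCat.{u} k} {S : ∀ l, Submodule k (M l)}
    {P P' : ModuleCat.{u} k} {S' : Submodule k P} {f : ∀ l, M l ⟶ P}
    (h : ∀ l, ∀ x ∈ S l, (f l).hom x ∈ S') (t : ∀ l, S l →ₗ[k] M' l) (t' : S' →ₗ[k] P')
    (φ : ∀ l, M' l ⟶ P') (ht : ∀ l (x : S l), (φ l).hom (t l x) = t' ⟨(f l).hom x, h l x x.2⟩)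
    (x : dsSub S) :
    (dsDesc φ).hom (dsSubMap S t x) = t' ⟨(dsDesc f).hom x.1, dsDesc_mem h x.2⟩ := by
  obtain ⟨x, rfl⟩ := (dsIncl_bijective S).2 x
  rw [dsSubMap_dsIncl]
  have key : (dsMap (M := fun l => ModuleCat.of k (S l)) fun l => ModuleCat.ofHom (t l)) ≫
      dsDesc φ = ModuleCat.ofHom (t' ∘ₗ ((dsDesc f).hom.restrict fun _ hx => dsDesc_mem h hx) ∘ₗ
        dsIncl S) := by
    rw [dsMap_desc]
    refine ds_hom_ext fun l => ?_
    rw [dsι_desc]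
    refine ModuleCat.hom_ext (LinearMap.ext fun y => ?_)
    refine (ht l y).trans (congr_arg t' (Subtype.ext ?_))
    have e := dsι_desc (fun l => ModuleCat.ofHom (S l).subtype ≫ f l) l
    rw [← dsMap_desc] at e
    exact congr($(e.symm).hom y)
  exact congr($(key).hom x)

/-- The map out of a sum of spectral sequences with given components is compatible with the map on
limits with given components. -/
lemma dsConvergence_compatible
    {F : SpectralSequence (ModuleCat.{u} k) (FilteredComplex.pageShape σ) 2}
    {H' : ℕ → ModuleCat.{u} k} (c' : Convergence F H') (φ : ∀ l, E l ⟶ F)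
    (f : ∀ l n, H l n ⟶ H' n) (h : ∀ l, (c l).Compatible c' (φ l) (f l)) :
    (dsConvergence c).Compatible c' (dsSSDesc φ) fun n => dsDesc fun l => f l n where
  mem p n x hx := dsDesc_mem (fun l x hx => (h l).mem p n x hx) hx
  toPage p q r hr x := dsDesc_dsSubMap (fun l x hx => (h l).mem p (p + q) x hx)
    (fun l => (c l).toPage p q r hr) (c'.toPage p q r hr)
    (fun l => ((φ l).hom r (by omega)).f ((p : ℤ), (q : ℤ))) (fun l x => (h l).toPage p q r hr x) x

end SumConvergence

/-! ### Products of convergent spectral sequences -/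

section ProductConvergence
variable {k : Type u} [CommRing k] {Λ : Type u}

/-- The passage from one page to the next can be checked componentwise in a product. -/
lemma prComplex_toPage_succ {c : ComplexShape (ℤ × ℤ)}
    (X : Λ → HomologicalComplex (ModuleCat.{u} k) c) (pq : ℤ × ℤ) (W : Λ → ModuleCat.{u} k)
    (w : ∀ l, (X l).homology pq ⟶ W l) (x : ∀ l, (X l).X pq) (y : ∀ l, W l)
    (h : ∀ l, ∃ z : (X l).cycles pq, ((X l).iCycles pq).hom z = x l ∧
      (w l).hom (((X l).homologyπ pq).hom z) = y l) :
    ∃ z : (prComplex X).cycles pq, ((prComplex X).iCycles pq).hom z = x ∧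
      (prHomologyMap X pq ≫ prMap w).hom (((prComplex X).homologyπ pq).hom z) = y := by
  choose z hz hz' using h
  obtain ⟨z₀, hz₀⟩ := exists_cycles_of_d_eq_zero (prComplex X) pq x fun j => by
    refine funext fun l => ?_
    change ((X l).d pq j).hom (x l) = 0
    rw [← hz]
    exact congr($((X l).iCycles_d pq j).hom (z l))
  refine ⟨z₀, hz₀, funext fun l => ?_⟩
  change (w l).hom ((prHomologyMap X pq).hom (((prComplex X).homologyπ pq).hom z₀) l) = _
  rw [prHomologyMap_mk, ← hz']
  congr 2
  apply (ModuleCat.mono_iff_injective ((X l).iCycles pq)).1 inferInstance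
  rw [iCycles_cyclesMap_prComplexπ, hz, hz₀]

variable {σ : ℤ} {E : Λ → SpectralSequence (ModuleCat.{u} k) (FilteredComplex.pageShape σ) 2}
  {H : Λ → ℕ → ModuleCat.{u} k} (c : ∀ l, Convergence (E l) (H l))

/-- The filtration of a product of limits. -/
def prFil (p : ℤ) (n : ℕ) : Submodule k (∀ l, H l n) :=
  Submodule.pi Set.univ fun l => (c l).fil p n

lemma mem_prFil {p : ℤ} {n : ℕ} {x : ∀ l, H l n} : x ∈ prFil c p n ↔ ∀ l, x l ∈ (c l).fil p n := by
  simp [prFil, Submodule.mem_pi]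

/-- A product of convergent spectral sequences converges to the product of the limits. -/
def prConvergence : Convergence (prSS E) fun n => ModuleCat.of k (∀ l, H l n) where
  isZero r hr p q hpq := by
    have (l : Λ) : Subsingleton (((E l).page r hr).X (p, q)) :=
      ModuleCat.subsingleton_of_isZero ((c l).isZero r hr p q hpq)
    exact ModuleCat.isZero_of_subsingleton (ModuleCat.of k (∀ l, ((E l).page r hr).X (p, q)))
  fil p n := prFil c p n
  fil_le p n x hx := (mem_prFil c).2 fun l => (c l).fil_le p n ((mem_prFil c).1 hx l)
  fil_top p n h h' := by
    refine Submodule.eq_top_iff'.2 fun x => (mem_prFil c).2 fun l => ?_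
    rw [(c l).fil_top p n h h']
    trivial
  fil_bot p n h h' := by
    refine (Submodule.eq_bot_iff _).2 fun x hx => funext fun l => ?_
    have := (mem_prFil c).1 hx l
    rw [(c l).fil_bot p n h h'] at this
    exact this
  toPage p q r hr := LinearMap.pi fun l => (c l).toPage p q r hr ∘ₗ
    ((LinearMap.proj l).restrict fun x hx => (mem_prFil c).1 hx l)
  toPage_surjective p q r hr y := by
    choose g hg using fun l => (c l).toPage_surjective p q r hr (show _ from (y : ∀ l,
      ((E l).page r (by omega)).X ((p : ℤ), (q : ℤ))) l)
    exact ⟨⟨fun l => (g l).1, (mem_prFil c).2 fun l => (g l).2⟩, funext hg⟩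
  toPage_eq_zero_iff p q r hr x := by
    refine Iff.trans ?_ (mem_prFil c).symm
    refine Iff.trans ⟨fun h0 l => congr_fun h0 l, fun h0 => funext h0⟩
      (forall_congr' fun l => (c l).toPage_eq_zero_iff p q r hr ⟨_, (mem_prFil c).1 x.2 l⟩)
  toPage_succ p q r hr x := by
    exact prComplex_toPage_succ (fun l => (E l).page r (by omega)) ((p : ℤ), (q : ℤ))
      (fun l => ((E l).page (r + 1) (by omega)).X ((p : ℤ), (q : ℤ)))
      (fun l => ((E l).iso r (r + 1) ((p : ℤ), (q : ℤ)) rfl (by omega)).hom) _ _ fun l =>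
      (c l).toPage_succ p q r hr ⟨_, (mem_prFil c).1 x.2 l⟩

/-- The map into a product of spectral sequences with given components is compatible with the map
on limits with given components. -/
lemma prConvergence_compatible
    {F : SpectralSequence (ModuleCat.{u} k) (FilteredComplex.pageShape σ) 2}
    {H' : ℕ → ModuleCat.{u} k} (c' : Convergence F H') (φ : ∀ l, F ⟶ E l)
    (f : ∀ l n, H' n ⟶ H l n) (h : ∀ l, c'.Compatible (c l) (φ l) (f l)) :
    c'.Compatible (prConvergence c) (prSSLift φ) fun n => prLift fun l => f l n where
  mem p n x hx := (mem_prFil c).2 fun l => (h l).mem p n x hx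
  toPage p q r hr x := funext fun l => (h l).toPage p q r hr x

end ProductConvergence

/-! ### The second page of the homological Lyndon–Hochschild–Serre spectral sequence -/

/-- The bound on the index of the second page, as a constant that can be passed explicitly. -/
lemma int_two_le_two : (2 : ℤ) ≤ 2 := le_rfl

section FinsuppExact
variable {k : Type u} [CommRing k] {ι U V W : Type*} [AddCommGroup U] [Module k U]
  [AddCommGroup V] [Module k V] [AddCommGroup W] [Module k W]

/-- Finitely supported functions preserve exactness. -/
lemma finsupp_mapRange_exact {f : U →ₗ[k] V} {g : V →ₗ[k] W}
    (h : ∀ v, g v = 0 ↔ ∃ u, f u = v) (z : ι →₀ V) :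
    Finsupp.mapRange.linearMap g z = 0 ↔ ∃ w, Finsupp.mapRange.linearMap f w = z := by
  classical
  constructor
  · intro hz
    choose c hc using fun v hv => (h v).1 hv
    have h0 (i : ι) : g (z i) = 0 := DFunLike.congr_fun hz i
    refine ⟨z.sum fun i v => if hv : g v = 0 then Finsupp.single i (c v hv) else 0, ?_⟩
    rw [Finsupp.sum, map_sum]
    conv_rhs => rw [← Finsupp.sum_single z, Finsupp.sum]
    refine Finset.sum_congr rfl fun i _ => ?_
    rw [dif_pos (h0 i), Finsupp.mapRange.linearMap_apply, Finsupp.mapRange_single, hc]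
  · rintro ⟨w, rfl⟩
    refine Finsupp.ext fun i => ?_
    exact (h _).2 ⟨_, rfl⟩

lemma finsupp_mapRange_surjective {f : U →ₗ[k] V} (h : Function.Surjective f) :
    Function.Surjective (Finsupp.mapRange.linearMap f : (ι →₀ U) →ₗ[k] _) := by
  intro z
  induction z using Finsupp.induction_linear with
  | zero => exact ⟨0, map_zero _⟩
  | add x y hx hy =>
    obtain ⟨a, rfl⟩ := hx
    obtain ⟨b, rfl⟩ := hy
    exact ⟨a + b, map_add _ _ _⟩
  | single i v =>
    obtain ⟨u, rfl⟩ := h v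
    exact ⟨Finsupp.single i u, by simp⟩

end FinsuppExact

section LHSChains
variable {k : Type u} [CommRing k] {G : Type u} [Group G] (M : Subgroup G) [M.Normal]
  (A : Rep.{u} k G)

/-- The `G ⧸ M`-module `(k[G^{q+1}] ⊗ A)_M`. -/
abbrev lhsRep (q : ℕ) : Rep.{u} k (G ⧸ M) :=
  (finsuppRep (Fin (q + 1) → G) A).quotientToCoinvariants M

lemma smul_subtype_smul (g : G) (n : M) (x : G) :
    g • (M.subtype n • x) = M.subtype ((MulAut.conjNormal (H := M) g).toMonoidHom n) • g • x := by
  simp [MulAut.conjNormal_apply, mul_assoc]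

lemma rho_subtype_comm (g : G) (n : M) (a : A) :
    A.ρ g (A.ρ (M.subtype n) a) =
      A.ρ (M.subtype ((MulAut.conjNormal (H := M) g).toMonoidHom n)) (A.ρ g a) := by
  rw [← Module.End.mul_apply, ← Module.End.mul_apply, ← map_mul, ← map_mul]
  simp [MulAut.conjNormal_apply]

lemma lhsRep_ρ_mk (q : ℕ) (g : G) (b : coinvChains M.subtype G A (q + 1)) :
    (lhsRep M A q).ρ (g : G ⧸ M) b =
      coinvMap (f := (MulAut.conjNormal (H := M) g).toMonoidHom) (g • ·) (A.ρ g)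
        (smul_subtype_smul M g) (rho_subtype_comm M A g) (q + 1) b := by
  obtain ⟨z, rfl⟩ := coinvMk_surjective _ b
  rfl

lemma lhsRep_ρ_mem {q : ℕ} (g : G ⧸ M) {b : lhsRep M A q}
    (hb : b ∈ coinvCycles M.subtype G A q) :
    (lhsRep M A q).ρ g b ∈ coinvCycles M.subtype G A q := by
  induction g using QuotientGroup.induction_on with | H g => ?_
  rw [lhsRep_ρ_mk]
  exact coinvMap_mem_coinvCycles _ _ hb

/-- The `G ⧸ M`-module of cycles in `(k[G^{q+1}] ⊗ A)_M`. In degree `0` all elements are cycles. -/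
def lhsCyclesRep (q : ℕ) : Rep.{u} k (G ⧸ M) :=
  Rep.of (ρ := show Representation k (G ⧸ M) (coinvCycles M.subtype G A q) from
    { toFun := fun g => ((lhsRep M A q).ρ g).restrict fun _ hb => lhsRep_ρ_mem M A g hb
      map_one' := LinearMap.ext fun b => Subtype.ext (congr($((lhsRep M A q).ρ.map_one) b.1))
      map_mul' := fun g h =>
        LinearMap.ext fun b => Subtype.ext (congr($((lhsRep M A q).ρ.map_mul g h) b.1)) })

/-- The inclusion of the cycles. -/
def lhsCyclesIncl (q : ℕ) : lhsCyclesRep M A q ⟶ lhsRep M A q :=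
  Rep.ofHom
    { toLinearMap := (coinvCycles M.subtype G A q).subtype
      isIntertwining' := fun _ => rfl }

omit [M.Normal] in
/-- A choice of representatives of the right cosets makes `G` a free `M`-set. -/
lemma exists_toSubgroup : ∃ ρ : G → M, ∀ (n : M) (x : G), ρ (M.subtype n • x) = n * ρ x := by
  let r : Quotient (QuotientGroup.rightRel M) → G := Quotient.out
  have hr (x : G) : x * (r (Quotient.mk _ x))⁻¹ ∈ M := by
    have := Quotient.exact (Quotient.out_eq (Quotient.mk (QuotientGroup.rightRel M) x))
    exact QuotientGroup.rightRel_apply.1 this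
  refine ⟨fun x => ⟨x * (r (Quotient.mk _ x))⁻¹, hr x⟩, fun n x => Subtype.ext ?_⟩
  have h : Quotient.mk (QuotientGroup.rightRel M) (M.subtype n • x) = Quotient.mk _ x := by
    refine Quotient.sound (QuotientGroup.rightRel_apply.2 ?_)
    simp
  change (M.subtype n • x) * _ = (n : G) * (x * _)
  rw [h, smul_eq_mul, mul_assoc]
  rfl

/-- An `M`-equivariant map `G → M`. -/
def toSubgroup : G → M := (exists_toSubgroup M).choose

omit [M.Normal] in
lemma toSubgroup_smul (n : M) (x : G) : toSubgroup M (M.subtype n • x) = n * toSubgroup M x :=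
  (exists_toSubgroup M).choose_spec n x

/-- The projection from the cycles in `(k[G^{q+1}] ⊗ A)_M` to `H_q(M; A)`. -/
def lhsCyclesClass (q : ℕ) : lhsCyclesRep M A q ⟶ homologyRep M A q :=
  Rep.ofHom
    { toLinearMap := barClass (toSubgroup_smul M) q
      isIntertwining' := fun g => LinearMap.ext fun b => by
        induction g using QuotientGroup.induction_on with | H g => ?_
        refine Eq.trans ?_ (map_barClass (A := A) (A' := A) (ι := M.subtype) (ι' := M.subtype)
          (toSubgroup_smul M) (toSubgroup_smul M)
          (MulAut.conjNormal (H := M) g).toMonoidHom (g • ·) (smul_subtype_smul M g) (A.ρ g)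
          (rho_subtype_comm M A g) (conjHom M A g) (fun _ => rfl) b).symm
        exact congr_arg (barClass (toSubgroup_smul M) q) (Subtype.ext (lhsRep_ρ_mk M A q g b.1)) }

lemma lhsDoubleComplex_d_eq_sum (q p : ℕ) :
    (((lhsDoubleComplex M A).d (q + 1) q).f p).hom =
      ∑ i : Fin (q + 2), (-1 : ℤ) ^ (i : ℕ) • (((lhsSimplicial M A).δ i).f p).hom := by
  have hd : (lhsDoubleComplex M A).d (q + 1) q =
      AlgebraicTopology.AlternatingFaceMapComplex.objD (lhsSimplicial M A) q :=
    AlgebraicTopology.alternatingFaceMapComplex_obj_d _ q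
  refine congr($(hd).f p |>.hom).trans ?_
  change (HomologicalComplex.Hom.fAddMonoidHom p
    (∑ i : Fin (q + 2), (-1 : ℤ) ^ (i : ℕ) • (lhsSimplicial M A).δ i)).hom = _
  rw [map_sum, ModuleCat.hom_sum]
  rfl

/-- The outer differential of the double complex acts on the coefficients only. -/
lemma lhsDoubleComplex_d_f (q p : ℕ) :
    (((lhsDoubleComplex M A).d (q + 1) q).f p).hom =
      (Finsupp.mapRange.linearMap (coinvD M.subtype G A (q + 1)) :
        ((Fin p → G ⧸ M) →₀ lhsRep M A (q + 1)) →ₗ[k] ((Fin p → G ⧸ M) →₀ lhsRep M A q)) := by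
  rw [lhsDoubleComplex_d_eq_sum]
  refine Finsupp.lhom_ext' fun g => Representation.Coinvariants.hom_ext
    (Finsupp.lhom_ext fun x a => ?_)
  have h1 (i : Fin (q + 2)) : (((lhsSimplicial M A).δ i).f p).hom
      (Finsupp.single g (coinvMk M.subtype G A (q + 2) (Finsupp.single x a))) =
      (Finsupp.single g (coinvMk M.subtype G A (q + 1) (Finsupp.single (x ∘ i.succAbove) a)) :
        (Fin p → G ⧸ M) →₀ lhsRep M A q) := by
    refine (lhsChainsMap_single (N := M) (N' := M) (MonoidHom.id G) le_rfl _ (fun _ _ => rfl) (𝟙 A)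
      p g x a).trans ?_
    have : ⇑(QuotientGroup.map M M (MonoidHom.id G) le_rfl) ∘ g = g :=
      funext fun j => congr($(QuotientGroup.map_id M le_rfl) (g j))
    exact congr_arg (fun g => (Finsupp.single g (coinvMk M.subtype G A (q + 1)
      (Finsupp.single (x ∘ i.succAbove) a)) : (Fin p → G ⧸ M) →₀ lhsRep M A q)) this
  have h2 : (Finsupp.mapRange.linearMap (coinvD M.subtype G A (q + 1)))
      (Finsupp.single g (coinvMk M.subtype G A (q + 2) (Finsupp.single x a))) =
      ∑ i : Fin (q + 2), (-1 : ℤ) ^ (i : ℕ) • Finsupp.single g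
        (coinvMk M.subtype G A (q + 1) (Finsupp.single (x ∘ i.succAbove) a)) := by
    rw [Finsupp.mapRange.linearMap_apply, Finsupp.mapRange_single, coinvD_mk, simplexD_single,
      map_sum, ← Finsupp.singleAddHom_apply, map_sum]
    refine Finset.sum_congr rfl fun i _ => ?_
    rw [map_smul, Finsupp.singleAddHom_apply, ← Finsupp.smul_single, ← Int.cast_smul_eq_zsmul k]
    push_cast
    rfl
  refine Eq.trans ?_ h2.symm
  refine (LinearMap.sum_apply _ _ _).trans (Finset.sum_congr rfl fun i _ => ?_)
  exact congr_arg ((-1 : ℤ) ^ (i : ℕ) • ·) (h1 i)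

lemma chainsMap_id_f {Q : Type u} [Group Q] {B B' : Rep.{u} k Q} (u : B ⟶ B') (p : ℕ) :
    ((groupHomology.chainsMap (MonoidHom.id Q) u).f p).hom =
      (Finsupp.mapRange.linearMap u.hom.toLinearMap : ((Fin p → Q) →₀ B) →ₗ[k] _) :=
  groupHomology.chainsMap_id_f_hom_eq_mapRange p u

/-- The inclusion of the cycles of the outer differential in the double complex. -/
def lhsRowIncl (q : ℕ) : groupHomology.inhomogeneousChains (lhsCyclesRep M A q) ⟶
    (lhsDoubleComplex M A).X q :=
  groupHomology.chainsMap (MonoidHom.id _) (lhsCyclesIncl M A q)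

lemma lhsRowIncl_f (q p : ℕ) : ((lhsRowIncl M A q).f p).hom =
    (Finsupp.mapRange.linearMap (coinvCycles M.subtype G A q).subtype :
      ((Fin p → G ⧸ M) →₀ lhsCyclesRep M A q) →ₗ[k] ((Fin p → G ⧸ M) →₀ lhsRep M A q)) :=
  chainsMap_id_f (lhsCyclesIncl M A q) p

/-- The homology of the rows of the double complex: inhomogeneous chains of `G ⧸ M` with
coefficients in `H_q(M; A)`. -/
def lhsRowHomology (q : ℕ) : RowHomology (lhsDoubleComplex M A) q
    (groupHomology.inhomogeneousChains (homologyRep M A q)) where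
  C := groupHomology.inhomogeneousChains (lhsCyclesRep M A q)
  i := lhsRowIncl M A q
  κ := groupHomology.chainsMap (MonoidHom.id _) (lhsCyclesClass M A q)
  injective p := by
    rw [lhsRowIncl_f]
    exact Finsupp.mapRange_injective _ (map_zero (coinvCycles M.subtype G A q).subtype)
      Subtype.val_injective
  exact_i p x := by
    rw [lhsRowIncl_f]
    cases q with
    | zero =>
      rw [(lhsDoubleComplex M A).shape _ _ (by simp)]
      refine ⟨fun _ => rfl, fun _ => finsupp_mapRange_surjective (fun b => ⟨⟨b, trivial⟩, rfl⟩) x⟩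
    | succ q =>
      rw [ChainComplex.next_nat_succ, lhsDoubleComplex_d_f]
      exact (finsupp_mapRange_exact (fun b => ⟨fun h => ⟨⟨b, h⟩, rfl⟩, fun ⟨c, hc⟩ =>
        hc ▸ c.2⟩) x).symm
  surjective p := by
    rw [chainsMap_id_f]
    exact finsupp_mapRange_surjective (barClass_surjective (toSubgroup_smul M) q)
  exact_κ p y := by
    rw [chainsMap_id_f, lhsRowIncl_f, ChainComplex.prev, lhsDoubleComplex_d_f]
    have h := finsupp_mapRange_exact (ι := Fin p → G ⧸ M)
      (f := (coinvD M.subtype G A (q + 1)).codRestrict _ (coinvD_mem_coinvCycles q))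
      (g := barClass (A := A) (toSubgroup_smul M) q) (fun b => (barClass_eq_zero_iff _ b).trans
        (exists_congr fun _ => ⟨fun h => Subtype.ext h, fun h => congr_arg Subtype.val h⟩)) y
    refine h.trans (exists_congr fun w => ?_)
    refine ⟨fun e => ?_, fun e => ?_⟩
    · rw [← e]
      exact Finsupp.ext fun _ => rfl
    · exact Finsupp.ext fun g => Subtype.ext (DFunLike.congr_fun
        (show (_ : (Fin p → G ⧸ M) →₀ lhsRep M A q) = _ from e) g)

/-- The second page of the homological Lyndon–Hochschild–Serre spectral sequence. -/
def lhsPageTwoIso (p q : ℕ) : ((lhsSS M A).page 2 int_two_le_two).X ((p : ℤ), (q : ℤ)) ≅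
    groupHomology (homologyRep M A q) p :=
  (lhsRowHomology M A q).pageTwoIso _ p

variable {M A} {G' : Type u} [Group G'] {M' : Subgroup G'} [M'.Normal] {A' : Rep.{u} k G'}

/-- Functoriality of `lhsRep`. -/
def lhsRepMap (f : G →* G') (hM : M ≤ M'.comap f) (φ : A ⟶ Rep.res f A') (q : ℕ) :
    lhsRep M A q ⟶ Rep.res (QuotientGroup.map M M' f hM) (lhsRep M' A' q) :=
  coinvariantsMap M M' f hM
    (finsuppRepMap f (f ∘ ·) (fun _ _ => funext fun _ => map_mul f _ _) φ)

omit [M.Normal] [M'.Normal] in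
lemma map_subtype_smul (f : G →* G') (hM : M ≤ M'.comap f) (n : M) (x : G) :
    f (M.subtype n • x) = M'.subtype (subgroupHom f hM n) • f x := map_mul f (n : G) x

omit [M.Normal] [M'.Normal] in
lemma hom_rho_subtype (f : G →* G') (hM : M ≤ M'.comap f) (φ : A ⟶ Rep.res f A') (n : M) (a : A) :
    φ.hom.toLinearMap (A.ρ (M.subtype n) a) =
      A'.ρ (M'.subtype (subgroupHom f hM n)) (φ.hom.toLinearMap a) :=
  Rep.hom_comm_apply φ (n : G) a

lemma lhsRepMap_apply (f : G →* G') (hM : M ≤ M'.comap f) (φ : A ⟶ Rep.res f A') (q : ℕ)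
    (b : lhsRep M A q) :
    (lhsRepMap f hM φ q).hom b = coinvMap (X := G) (X' := G') (A := A) (A' := A') (ι := M.subtype)
      (ι' := M'.subtype) (f := subgroupHom f hM) f φ.hom.toLinearMap
      (map_subtype_smul f hM) (hom_rho_subtype f hM φ) (q + 1) b := by
  obtain ⟨z, rfl⟩ := coinvMk_surjective (ι := M.subtype) (X := G) (A := A) _ b
  rfl

/-- Functoriality of `lhsCyclesRep`. -/
def lhsCyclesRepMap (f : G →* G') (hM : M ≤ M'.comap f) (φ : A ⟶ Rep.res f A') (q : ℕ) :
    lhsCyclesRep M A q ⟶ Rep.res (QuotientGroup.map M M' f hM) (lhsCyclesRep M' A' q) :=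
  Rep.ofHom (σ := (lhsCyclesRep M' A' q).ρ.comp (QuotientGroup.map M M' f hM))
    { toLinearMap := (lhsRepMap f hM φ q).hom.toLinearMap.restrict fun b hb => by
        refine Eq.mpr (congr_arg (· ∈ _) (lhsRepMap_apply f hM φ q b)) ?_
        exact coinvMap_mem_coinvCycles _ _ hb
      isIntertwining' := fun g => LinearMap.ext fun b => Subtype.ext
        (Rep.hom_comm_apply (lhsRepMap f hM φ q) g b.1) }

lemma chainsMap_lhsCyclesIncl (f : G →* G') (hM : M ≤ M'.comap f) (φ : A ⟶ Rep.res f A') (q : ℕ) :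
    groupHomology.chainsMap (MonoidHom.id _) (lhsCyclesIncl M A q) ≫
      groupHomology.chainsMap (QuotientGroup.map M M' f hM) (lhsRepMap f hM φ q) =
    groupHomology.chainsMap (QuotientGroup.map M M' f hM) (lhsCyclesRepMap f hM φ q) ≫
      groupHomology.chainsMap (MonoidHom.id _) (lhsCyclesIncl M' A' q) := by
  rw [← groupHomology.chainsMap_comp, ← groupHomology.chainsMap_comp]
  exact groupHomology.chainsMap_congr rfl (LinearMap.ext fun _ => rfl)

lemma chainsMap_lhsCyclesClass (f : G →* G') (hM : M ≤ M'.comap f) (φ : A ⟶ Rep.res f A') (q : ℕ) :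
    groupHomology.chainsMap (MonoidHom.id _) (lhsCyclesClass M A q) ≫
      groupHomology.chainsMap (QuotientGroup.map M M' f hM) (homologyRepMap f hM φ q) =
    groupHomology.chainsMap (QuotientGroup.map M M' f hM) (lhsCyclesRepMap f hM φ q) ≫
      groupHomology.chainsMap (MonoidHom.id _) (lhsCyclesClass M' A' q) := by
  rw [← groupHomology.chainsMap_comp, ← groupHomology.chainsMap_comp]
  refine groupHomology.chainsMap_congr rfl (LinearMap.ext fun b => ?_)
  refine (map_barClass (A := A) (A' := A') (ι := M.subtype) (ι' := M'.subtype)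
    (toSubgroup_smul M) (toSubgroup_smul M') (subgroupHom f hM) f
    (map_subtype_smul f hM) φ.hom.toLinearMap (hom_rho_subtype f hM φ)
    (resHom f hM φ) (fun _ => rfl) b).trans ?_
  exact congr_arg (barClass (toSubgroup_smul M') q)
    (Subtype.ext (lhsRepMap_apply f hM φ q b.1).symm)

/-- On the second pages, the morphism of spectral sequences is the map induced on the homology of
the quotient with coefficients in the homology of the subgroup. -/
lemma lhsPageTwoIso_naturality (f : G →* G') (hM : M ≤ M'.comap f) (φ : A ⟶ Rep.res f A')
    (p q : ℕ) :
    ((lhsSSMap f hM φ).hom 2 int_two_le_two).f ((p : ℤ), (q : ℤ)) ≫ (lhsPageTwoIso M' A' p q).hom =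
      (lhsPageTwoIso M A p q).hom ≫
        groupHomology.map (QuotientGroup.map M M' f hM) (homologyRepMap f hM φ q) p := by
  refine (lhsRowHomology M A q).pageTwoIso_naturality _ (lhsRowHomology M' A' q)
    ((AlgebraicTopology.alternatingFaceMapComplex _).map (lhsSimplicialMap f hM φ))
    (groupHomology.chainsMap (QuotientGroup.map M M' f hM) (homologyRepMap f hM φ q))
    (fun j y y' hy => ?_) p
  have h1 := congr($(chainsMap_lhsCyclesIncl f hM φ q).f j |>.hom y)
  have h2 := congr($(chainsMap_lhsCyclesClass f hM φ q).f j |>.hom y)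
  refine Eq.trans ?_ h2.symm
  exact congr_arg ((lhsRowHomology M' A' q).κ.f j).hom
    ((lhsRowHomology M' A' q).injective j (hy.trans h1))

end LHSChains

/-! ### The limit of the homological Lyndon–Hochschild–Serre spectral sequence -/

section InducedAcyclic
variable {k : Type u} [CommRing k] {Q : Type u} [Group Q] {W : Rep.{u} k Q}

lemma contractNth_zero_cons {α : Type*} (op : α → α → α) {n : ℕ} (t : α) (g : Fin (n + 1) → α) :
    Fin.contractNth 0 op (Fin.cons t g : Fin (n + 2) → α) =
      Fin.cons (op t (g 0)) (fun i => g i.succ) := by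
  refine funext fun i => ?_
  cases i using Fin.cases with
  | zero => rw [Fin.contractNth_apply_of_eq _ _ _ _ rfl]; rfl
  | succ i =>
    rw [Fin.contractNth_apply_of_gt _ _ _ _ (by simp)]
    rfl

lemma contractNth_succ_cons {α : Type*} (op : α → α → α) {n : ℕ} (j : Fin (n + 1)) (t : α)
    (g : Fin (n + 1) → α) :
    Fin.contractNth j.succ op (Fin.cons t g : Fin (n + 2) → α) =
      Fin.cons t (Fin.contractNth j op g) := by
  refine funext fun i => ?_
  cases i using Fin.cases with
  | zero => rw [Fin.contractNth_apply_of_lt _ _ _ _ (by simp)]; rfl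
  | succ i =>
    rw [Fin.cons_succ]
    rcases lt_trichotomy (i : ℕ) (j : ℕ) with h | h | h
    · rw [Fin.contractNth_apply_of_lt _ _ _ _ (by simpa using h),
        Fin.contractNth_apply_of_lt _ _ _ _ h]
      rfl
    · rw [Fin.contractNth_apply_of_eq _ _ _ _ (by simpa using h),
        Fin.contractNth_apply_of_eq _ _ _ _ h]
      rfl
    · rw [Fin.contractNth_apply_of_gt _ _ _ _ (by simpa using h),
        Fin.contractNth_apply_of_gt _ _ _ _ h]
      rfl

/-- The candidate contracting homotopy of the inhomogeneous chains attached to a grading `σ` of the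
coefficients by group elements. -/
def chainHomotopy (σ : W →ₗ[k] (Q →₀ W)) (p : ℕ) :
    ((Fin p → Q) →₀ W) →ₗ[k] ((Fin (p + 1) → Q) →₀ W) :=
  Finsupp.lsum k fun g => Finsupp.lmapDomain W k (fun t => (Fin.cons t g : Fin (p + 1) → Q)) ∘ₗ σ

lemma chainHomotopy_single {σ : W →ₗ[k] (Q →₀ W)} {p : ℕ} (g : Fin p → Q) {w v : W} {t : Q}
    (h : σ w = Finsupp.single t v) :
    chainHomotopy σ p (Finsupp.single g w) = Finsupp.single (Fin.cons t g) v := by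
  simp [chainHomotopy, h]

/-- The homotopy identity for chains whose coefficient `w` is homogeneous, with `t⁻¹` as its
degree: the hypothesis says that the elements of the orbit of `w` are homogeneous of the
corresponding degrees. -/
lemma chainHomotopy_add {σ : W →ₗ[k] (Q →₀ W)} {p : ℕ} (g : Fin (p + 1) → Q) {w : W} {t : Q}
    (h : ∀ s, σ (W.ρ s⁻¹ w) = Finsupp.single (t * s) (W.ρ t w)) :
    ((groupHomology.inhomogeneousChains W).d (p + 2) (p + 1)).hom
        (chainHomotopy σ (p + 1) (Finsupp.single g w)) +
      chainHomotopy σ p (((groupHomology.inhomogeneousChains W).d (p + 1) p).hom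
        (Finsupp.single g w)) = Finsupp.single g w := by
  have h1 : σ w = Finsupp.single t (W.ρ t w) := by simpa using h 1
  rw [groupHomology.inhomogeneousChains.d_def, groupHomology.inhomogeneousChains.d_def]
  refine (congr_arg₂ (· + ·) ((congr_arg _ (chainHomotopy_single g h1)).trans
    (groupHomology.inhomogeneousChains.d_single _ _ _)) ((congr_arg (chainHomotopy σ p)
    (groupHomology.inhomogeneousChains.d_single _ _ _)).trans (map_add _ _ _))).trans ?_
  rw [Fin.sum_univ_succ, map_sum, chainHomotopy_single (g := fun i => g i.succ) (h (g 0))]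
  have e : ∀ j : Fin (p + 1), chainHomotopy σ p
      ((-1 : k) ^ ((j : ℕ) + 1) • Finsupp.single (Fin.contractNth j (· * ·) g) w) =
      - ((-1 : k) ^ ((j.succ : ℕ) + 1) • Finsupp.single
        (Fin.contractNth j.succ (· * ·) (Fin.cons t g : Fin (p + 2) → Q)) (W.ρ t w)) := by
    intro j
    rw [map_smul, chainHomotopy_single _ h1, contractNth_succ_cons, Fin.val_succ, ← neg_smul]
    congr 1
    rw [pow_succ _ ((j : ℕ) + 1)]
    simp
  rw [Finset.sum_congr rfl fun j _ => e j, Finset.sum_neg_distrib, contractNth_zero_cons]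
  have e0 : W.ρ ((Fin.cons t g : Fin (p + 2) → Q) 0)⁻¹ (W.ρ t w) = w := by
    rw [Fin.cons_zero]
    exact W.ρ.inv_self_apply t w
  rw [e0]
  simp only [Fin.cons_succ, Fin.val_zero, zero_add, pow_one, neg_smul, one_smul]
  abel

end InducedAcyclic

section LHSLimit
variable {k : Type u} [CommRing k] {G : Type u} [Group G] (M : Subgroup G) [M.Normal]
  (A : Rep.{u} k G)

/-- The grading of `(k[G^{q+1}] ⊗ A)_M` by `G ⧸ M` given by the first vertex of a simplex. The
component of degree `t⁻¹` is moved by `t` to degree `1`, so as to serve in `chainHomotopy`; it is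
recorded with the index `t`. -/
def lhsGrading (q : ℕ) : lhsRep M A q →ₗ[k] (G ⧸ M) →₀ lhsRep M A q :=
  coinvLift M.subtype
    (Finsupp.lsum k fun x : Fin (q + 1) → G =>
      Finsupp.lsingle (((x 0)⁻¹ : G) : G ⧸ M) ∘ₗ (lhsRep M A q).ρ (((x 0)⁻¹ : G) : G ⧸ M) ∘ₗ
        coinvMk M.subtype G A (q + 1) ∘ₗ Finsupp.lsingle x)
    (coinvKer_le_ker fun γ x a => (by
      have h1 : ((((M.subtype γ • x) 0)⁻¹ : G) : G ⧸ M) = (((x 0)⁻¹ : G) : G ⧸ M) := by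
        refine QuotientGroup.eq.2 ?_
        simpa using ‹M.Normal›.conj_mem _ (inv_mem γ.2) ((x 0)⁻¹)
      have h2 : coinvMk M.subtype G A (q + 1) (Finsupp.single (M.subtype γ • x)
          (A.ρ (M.subtype γ) a)) = coinvMk M.subtype G A (q + 1) (Finsupp.single x a) :=
        coinvMk_eq_iff.2 (single_sub_single_mem_coinvKer _ _ _ _)
      rw [Finsupp.lsum_single, Finsupp.lsum_single]
      simp only [LinearMap.comp_apply, Finsupp.lsingle_apply]
      rw [h2, h1]))

lemma lhsRep_ρ_single (q : ℕ) (g : G) (x : Fin (q + 1) → G) (a : A) :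
    (lhsRep M A q).ρ (g : G ⧸ M) (coinvMk M.subtype G A (q + 1) (Finsupp.single x a)) =
      coinvMk M.subtype G A (q + 1) (Finsupp.single (g • x) (A.ρ g a)) := by
  rw [lhsRep_ρ_mk, coinvMap_mk, simplexMap_single]
  rfl

lemma lhsGrading_single (q : ℕ) (x : Fin (q + 1) → G) (a : A) (s : G ⧸ M) :
    lhsGrading M A q ((lhsRep M A q).ρ s⁻¹ (coinvMk M.subtype G A (q + 1) (Finsupp.single x a))) =
      Finsupp.single ((((x 0)⁻¹ : G) : G ⧸ M) * s) ((lhsRep M A q).ρ (((x 0)⁻¹ : G) : G ⧸ M)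
        (coinvMk M.subtype G A (q + 1) (Finsupp.single x a))) := by
  induction s using QuotientGroup.induction_on with | H s => ?_
  rw [← QuotientGroup.mk_inv, lhsRep_ρ_single, lhsGrading, coinvLift_mk, Finsupp.lsum_single]
  simp only [LinearMap.comp_apply, Finsupp.lsingle_apply]
  rw [lhsRep_ρ_single, lhsRep_ρ_single, ← Module.End.mul_apply, ← map_mul, smul_smul]
  simp

lemma lhsRep_hom_ext {p q : ℕ} {V : Type*} [AddCommGroup V] [Module k V]
    {α β : ((Fin p → G ⧸ M) →₀ lhsRep M A q) →ₗ[k] V}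
    (h : ∀ g x a, α (Finsupp.single g (coinvMk M.subtype G A (q + 1) (Finsupp.single x a))) =
      β (Finsupp.single g (coinvMk M.subtype G A (q + 1) (Finsupp.single x a)))) : α = β :=
  Finsupp.lhom_ext' fun g => Representation.Coinvariants.hom_ext
    (Finsupp.lhom_ext fun x a => h g x a)

/-- The columns of the double complex are acyclic in positive degrees, since the coefficients are
induced from the trivial group. -/
lemma exists_inhomogeneousChains_lhsRep_d_eq (q j : ℕ)
    (x : (groupHomology.inhomogeneousChains (lhsRep M A q)).X (j + 1))
    (hx : ((groupHomology.inhomogeneousChains (lhsRep M A q)).d (j + 1) j).hom x = 0) :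
    ∃ b, ((groupHomology.inhomogeneousChains (lhsRep M A q)).d (j + 2) (j + 1)).hom b = x := by
  have h : ((groupHomology.inhomogeneousChains (lhsRep M A q)).d (j + 2) (j + 1)).hom ∘ₗ
        chainHomotopy (lhsGrading M A q) (j + 1) + chainHomotopy (lhsGrading M A q) j ∘ₗ
        ((groupHomology.inhomogeneousChains (lhsRep M A q)).d (j + 1) j).hom = LinearMap.id :=
    lhsRep_hom_ext M A fun g x a => chainHomotopy_add g (lhsGrading_single M A q x a)
  refine ⟨chainHomotopy (lhsGrading M A q) (j + 1) x, ?_⟩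
  refine Eq.trans ?_ (LinearMap.congr_fun h x)
  refine (add_zero _).symm.trans (congr_arg (_ + ·) ?_)
  exact ((congr_arg (chainHomotopy (lhsGrading M A q) j) hx).trans (map_zero _)).symm

/-- The projection `(k[G^{q+1}] ⊗ A)_M → (k[G^{q+1}] ⊗ A)_G`. -/
def coinvProj (q : ℕ) : lhsRep M A q →ₗ[k] coinvChains (MonoidHom.id G) G A (q + 1) :=
  coinvMap (X := G) (X' := G) (A := A) (A' := A) (ι := M.subtype) (ι' := MonoidHom.id G)
    (f := M.subtype) id LinearMap.id (fun _ _ => rfl) (fun _ _ => rfl) (q + 1)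

lemma coinvProj_single (q : ℕ) (x : Fin (q + 1) → G) (a : A) :
    coinvProj M A q (coinvMk M.subtype G A (q + 1) (Finsupp.single x a)) =
      coinvMk (MonoidHom.id G) G A (q + 1) (Finsupp.single x a) := by
  rw [coinvProj, coinvMap_mk, simplexMap_single]
  rfl

/-- The augmentation of the columns of the double complex. -/
def lhsEdge (q : ℕ) : ((Fin 0 → G ⧸ M) →₀ lhsRep M A q) →ₗ[k]
    coinvChains (MonoidHom.id G) G A (q + 1) :=
  Finsupp.lsum k fun _ => coinvProj M A q

lemma lhsEdge_single (q : ℕ) (g : Fin 0 → G ⧸ M) (w : lhsRep M A q) :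
    lhsEdge M A q (Finsupp.single g w) = coinvProj M A q w := by
  rw [lhsEdge, Finsupp.lsum_single]

lemma inhomogeneousChains_d_one_single {Q : Type u} [Group Q] (W : Rep.{u} k Q) (g : Fin 1 → Q)
    (w : W) : ((groupHomology.inhomogeneousChains W).d 1 0).hom (Finsupp.single g w) =
      (Finsupp.single Fin.elim0 (W.ρ (g 0)⁻¹ w - w) : (Fin 0 → Q) →₀ W) := by
  rw [groupHomology.inhomogeneousChains.d_def]
  refine (groupHomology.inhomogeneousChains.d_single _ _ _).trans ?_
  rw [Fin.sum_univ_one, Finsupp.single_sub, sub_eq_add_neg]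
  simp only [Fin.val_zero, zero_add, pow_one, neg_smul, one_smul]
  rw [Subsingleton.elim (fun i : Fin 0 => g i.succ) Fin.elim0,
    Subsingleton.elim (Fin.contractNth 0 (· * ·) g) Fin.elim0]

lemma lhsEdge_d (q : ℕ) (x : (groupHomology.inhomogeneousChains (lhsRep M A q)).X 1) :
    lhsEdge M A q (((groupHomology.inhomogeneousChains (lhsRep M A q)).d 1 0).hom x) = 0 := by
  have h : lhsEdge M A q ∘ₗ ((groupHomology.inhomogeneousChains (lhsRep M A q)).d 1 0).hom =
      (0 : ((Fin 1 → G ⧸ M) →₀ lhsRep M A q) →ₗ[k] _) := by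
    refine lhsRep_hom_ext M A fun g x a => ?_
    refine (congr_arg (lhsEdge M A q) (inhomogeneousChains_d_one_single _ _ _)).trans ?_
    rw [lhsEdge_single, map_sub, LinearMap.zero_apply, sub_eq_zero]
    generalize (g 0)⁻¹ = s
    induction s using QuotientGroup.induction_on with | H s => ?_
    rw [lhsRep_ρ_single, coinvProj_single, coinvProj_single]
    exact coinvMk_eq_iff.2 (single_sub_single_mem_coinvKer (MonoidHom.id G) s x a)
  exact LinearMap.congr_fun h x

/-- The relations of the `G`-coinvariants are images of `1`-chains of `G ⧸ M`, modulo those of the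
`M`-coinvariants. -/
lemma exists_d_eq_of_lhsEdge_eq_zero (q : ℕ)
    (x : (groupHomology.inhomogeneousChains (lhsRep M A q)).X 0) (hx : lhsEdge M A q x = 0) :
    ∃ b, ((groupHomology.inhomogeneousChains (lhsRep M A q)).d 1 0).hom b = x := by
  obtain ⟨w, rfl⟩ : ∃ w, Finsupp.single (Fin.elim0 : Fin 0 → G ⧸ M) w = x :=
    ⟨x Fin.elim0, (Finsupp.ext fun g => by
      rw [Subsingleton.elim g Fin.elim0]; exact Finsupp.single_eq_same)⟩
  rw [lhsEdge_single] at hx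
  obtain ⟨z, rfl⟩ := coinvMk_surjective (ι := M.subtype) (X := G) (A := A) _ w
  have hz : z ∈ coinvKer (MonoidHom.id G) G A (q + 1) := by
    refine coinvMk_eq_zero_iff.1 (Eq.trans ?_ hx)
    rw [coinvProj, coinvMap_mk]
    congr 1
    have : (simplexMap id LinearMap.id (q + 1) : ((Fin (q + 1) → G) →₀ A) →ₗ[k] _) =
        LinearMap.id := Finsupp.lhom_ext fun x a => by rw [simplexMap_single]; rfl
    rw [this, LinearMap.id_apply]
  refine coinvKer_le (S := (LinearMap.range
    ((groupHomology.inhomogeneousChains (lhsRep M A q)).d 1 0).hom).comap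
      ((Finsupp.lsingle (Fin.elim0 : Fin 0 → G ⧸ M) : lhsRep M A q →ₗ[k] _) ∘ₗ
        coinvMk M.subtype G A (q + 1))) ?_ hz
  intro γ x a
  refine ⟨Finsupp.single (fun _ => ((γ : G) : G ⧸ M)⁻¹)
    (coinvMk M.subtype G A (q + 1) (Finsupp.single x a)), ?_⟩
  refine (inhomogeneousChains_d_one_single _ _ _).trans ?_
  rw [inv_inv, lhsRep_ρ_single, ← map_sub]
  rfl

/-- The columns of the double complex of the Lyndon–Hochschild–Serre spectral sequence are
resolutions of the complex of coinvariants computing `H_n(G; A)`. -/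
def lhsColumnAugmentation : ColumnAugmentation (lhsDoubleComplex M A)
    (V := fun q => coinvChains (MonoidHom.id G) G A (q + 1))
    (fun q => coinvD (MonoidHom.id G) G A (q + 1)) where
  ε := lhsEdge M A
  surjective q v := by
    obtain ⟨z, rfl⟩ := coinvMk_surjective _ v
    refine ⟨Finsupp.single Fin.elim0 (coinvMk M.subtype G A (q + 1) z), ?_⟩
    refine (lhsEdge_single M A q _ _).trans ?_
    rw [coinvProj, coinvMap_mk]
    congr 1
    have : (simplexMap id LinearMap.id (q + 1) : ((Fin (q + 1) → G) →₀ A) →ₗ[k] _) =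
        LinearMap.id := Finsupp.lhom_ext fun x a => by rw [simplexMap_single]; rfl
    rw [this, LinearMap.id_apply]
  exact_ε q x := ⟨exists_d_eq_of_lhsEdge_eq_zero M A q x, fun ⟨b, hb⟩ =>
    hb ▸ lhsEdge_d M A q b⟩
  exact q j x hx := exists_inhomogeneousChains_lhsRep_d_eq M A q j x hx
  comm q x := by
    rw [lhsDoubleComplex_d_f]
    have h : coinvD (MonoidHom.id G) G A (q + 1) ∘ₗ lhsEdge M A (q + 1) = lhsEdge M A q ∘ₗ
        Finsupp.mapRange.linearMap (coinvD M.subtype G A (q + 1)) := by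
      refine lhsRep_hom_ext M A fun g x a => ?_
      rw [LinearMap.comp_apply, LinearMap.comp_apply, Finsupp.mapRange.linearMap_apply,
        Finsupp.mapRange_single, lhsEdge_single, lhsEdge_single]
      exact (coinvMap_coinvD _ _ _).symm
    exact LinearMap.congr_fun h x

lemma seqCycles_coinvD (n : ℕ) :
    seqCycles (V := fun q => coinvChains (MonoidHom.id G) G A (q + 1))
      (fun q => coinvD (MonoidHom.id G) G A (q + 1)) n = coinvCycles (MonoidHom.id G) G A n := by
  cases n <;> rfl

/-- The filtered complex of the homological Lyndon–Hochschild–Serre spectral sequence. -/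
abbrev lhsFiltered : FilteredComplex k (-1) :=
  totalFiltered (lhsDoubleComplex M A) fun i j (h : j + 1 = i) => by omega

/-- The map from the cycles of the total complex to the homology of `G`. -/
def lhsLimit (n : ℕ) :
    cycleSubmodule (lhsFiltered M A).K (n : ℤ) →ₗ[k] groupHomology A n :=
  (barClass (A := A) (ι := MonoidHom.id G) (X := G) (ρ := id) (fun _ _ => rfl) n) ∘ₗ
    (LinearEquiv.ofEq _ _ (seqCycles_coinvD A n)).toLinearMap ∘ₗ
      (lhsColumnAugmentation M A).edgeCycles n

lemma lhsLimit_surjective (n : ℕ) : Function.Surjective (lhsLimit M A n) :=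
  (barClass_surjective _ n).comp
    ((LinearEquiv.ofEq _ _ (seqCycles_coinvD A n)).surjective.comp
      ((lhsColumnAugmentation M A).edgeCycles_surjective n))

lemma lhsLimit_eq_zero_iff (n : ℕ) (x : cycleSubmodule (lhsFiltered M A).K (n : ℤ)) :
    lhsLimit M A n x = 0 ↔
      ∃ y, ((lhsFiltered M A).K.d
        ((n : ℤ) - (-1)) n).hom y = x := by
  refine (barClass_eq_zero_iff _ _).trans ?_
  refine ((lhsColumnAugmentation M A).edge_mem_range_iff n x.2).trans ?_
  rw [sub_neg_eq_add]
  rfl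

/-- The convergence of the homological Lyndon–Hochschild–Serre spectral sequence. -/
def lhsConvergence : Convergence (lhsSS M A) fun n => groupHomology A n :=
  FilteredComplex.convergence (totalFiltered_firstQuadrant _ _) (lhsLimit M A)
    (lhsLimit_surjective M A) (lhsLimit_eq_zero_iff M A)

variable {M A} {G' : Type u} [Group G'] {M' : Subgroup G'} [M'.Normal] {A' : Rep.{u} k G'}

lemma lhsEdge_map (f : G →* G') (hM : M ≤ M'.comap f) (φ : A ⟶ Rep.res f A') (q : ℕ)
    (x : (groupHomology.inhomogeneousChains (lhsRep M A q)).X 0) :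
    lhsEdge M' A' q (((groupHomology.chainsMap (QuotientGroup.map M M' f hM)
        (lhsRepMap f hM φ q)).f 0).hom x) =
      coinvMap (X := G) (X' := G') (A := A) (A' := A') (ι := MonoidHom.id G)
        (ι' := MonoidHom.id G') (f := f) f φ.hom.toLinearMap (map_mul f)
        (fun γ a => Rep.hom_comm_apply φ γ a) (q + 1) (lhsEdge M A q x) := by
  have h : lhsEdge M' A' q ∘ₗ ((groupHomology.chainsMap (QuotientGroup.map M M' f hM)
        (lhsRepMap f hM φ q)).f 0).hom = coinvMap (X := G) (X' := G') (A := A) (A' := A')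
        (ι := MonoidHom.id G) (ι' := MonoidHom.id G') (f := f) f φ.hom.toLinearMap (map_mul f)
        (fun γ a => Rep.hom_comm_apply φ γ a) (q + 1) ∘ₗ lhsEdge M A q := by
    refine lhsRep_hom_ext M A fun g x a => ?_
    refine (congr_arg (lhsEdge M' A' q) (lhsChainsMap_single f hM _ _ φ 0 g x a)).trans ?_
    refine (lhsEdge_single M' A' q _ _).trans ((coinvProj_single M' A' q _ _).trans ?_)
    rw [LinearMap.comp_apply, lhsEdge_single, coinvProj_single, coinvMap_mk, simplexMap_single]
    rfl
  exact LinearMap.congr_fun h x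

/-- On the limits, the morphism of spectral sequences is the map induced on group homology. -/
lemma lhsConvergence_compatible (f : G →* G') (hM : M ≤ M'.comap f) (φ : A ⟶ Rep.res f A') :
    (lhsConvergence M A).Compatible (lhsConvergence M' A') (lhsSSMap f hM φ)
      fun n => groupHomology.map f φ n := by
  refine FilteredComplex.convergence_compatible _ _ _ _ _ _ _ _
    (totalFilteredMap _ ((AlgebraicTopology.alternatingFaceMapComplex _).map
      (lhsSimplicialMap f hM φ))) _ fun n x y h => ?_
  refine Eq.trans ?_ (map_barClass (A := A) (A' := A') (ι := MonoidHom.id G)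
    (ι' := MonoidHom.id G') (X := G) (X' := G') (ρ := id) (ρ' := id) (fun _ _ => rfl)
    (fun _ _ => rfl) f f (map_mul f) φ.hom.toLinearMap (fun γ a => Rep.hom_comm_apply φ γ a) φ
    (fun _ => rfl) _).symm
  refine congr_arg (barClass (A := A') (ι := MonoidHom.id G') (X := G') (ρ := id)
    (fun _ _ => rfl) n) (Subtype.ext ?_)
  refine Eq.trans ?_ (lhsEdge_map f hM φ n _)
  refine congr_arg (lhsEdge M' A' n) ?_
  refine (congr_arg (totalπ (σ := -1) (lhsDoubleComplex M' A') n n 0) h).trans ?_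
  exact totalπ_totalMap _ _

end LHSLimit

/-! ### The second page of the cohomological Lyndon–Hochschild–Serre spectral sequence -/

section
variable {k : Type u} [CommRing k]
  {K K' : HomologicalComplex₂ (ModuleCat.{u} k) (ComplexShape.up ℕ) (ComplexShape.up ℕ)}
  {V V' : ℕ → Type u} [∀ q, AddCommGroup (V q)] [∀ q, Module k (V q)]
  [∀ q, AddCommGroup (V' q)] [∀ q, Module k (V' q)]
  {δ : ∀ q, V q →ₗ[k] V (q + 1)} {δ' : ∀ q, V' q →ₗ[k] V' (q + 1)}

lemma ColumnCoaugmentation.totalMap_toCycles (R : ColumnCoaugmentation K δ)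
    (R' : ColumnCoaugmentation K' δ') (f : K ⟶ K') {n : ℕ} (v : LinearMap.ker (δ n))
    (v' : LinearMap.ker (δ' n)) (h : ((f.f n).f 0).hom (R.η n v.1) = R'.η n v'.1)
    (w : (K.total (ComplexShape.up' (1 : ℤ))).X ((n : ℤ) - 1)) :
    ((HomologicalComplex₂.total.map f (ComplexShape.up' (1 : ℤ))).f n).hom
        (R.toCycles n (v, w)).1 =
      (R'.toCycles n (v', ((HomologicalComplex₂.total.map f (ComplexShape.up' (1 : ℤ))).f
        ((n : ℤ) - 1)).hom w)).1 := by
  rw [toCycles_coe, toCycles_coe, map_add]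
  refine congr_arg₂ (· + ·) ?_ ?_
  · exact (totalMap_totalι _ _).trans (congr_arg (totalι (σ := 1) K' n n 0) h)
  · exact congr($((HomologicalComplex₂.total.map f
      (ComplexShape.up' (1 : ℤ))).comm ((n : ℤ) - 1) n).hom w).symm

end

section LHSCochains
variable {k : Type u} [CommRing k] {G : Type u} [Group G] (M : Subgroup G) [M.Normal]
  (A : Rep.{u} k G)

/-- The `G ⧸ M`-module `Hom(k[G^{q+1}], A)^M`. -/
abbrev lhsCoRep (q : ℕ) : Rep.{u} k (G ⧸ M) :=
  (funRep (Fin (q + 1) → G) A).quotientToInvariants M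

lemma lhsCoRep_ρ_apply (q : ℕ) (g : G) (F : lhsCoRep M A q) (x : Fin (q + 1) → G) :
    ((lhsCoRep M A q).ρ (g : G ⧸ M) F).1 x = A.ρ g (F.1 (g⁻¹ • x)) := rfl

/-- The outer differential of the double complex, on the coefficients. -/
def lhsCoRepD (q : ℕ) : lhsCoRep M A q →ₗ[k] lhsCoRep M A (q + 1) :=
  (simplexDelta (k := k) G A (q + 1)).restrict
    (p := invCochains M.subtype G A (q + 1)) (q := invCochains M.subtype G A (q + 2))
    fun _ h => simplexDelta_mem_invCochains h

lemma lhsCoRepD_coe (q : ℕ) (F : lhsCoRep M A q) :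
    (lhsCoRepD M A q F).1 = simplexDelta (k := k) G A (q + 1) F.1 := rfl

lemma lhsCoRepD_ρ (q : ℕ) (g : G ⧸ M) (F : lhsCoRep M A q) :
    lhsCoRepD M A q ((lhsCoRep M A q).ρ g F) = (lhsCoRep M A (q + 1)).ρ g (lhsCoRepD M A q F) := by
  induction g using QuotientGroup.induction_on with | H g => ?_
  refine Subtype.ext (funext fun x => ?_)
  rw [lhsCoRep_ρ_apply, lhsCoRepD_coe, lhsCoRepD_coe, simplexDelta_apply, simplexDelta_apply,
    map_sum]
  exact Finset.sum_congr rfl fun i _ => by rw [map_smul, lhsCoRep_ρ_apply]; rfl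

/-- The `G ⧸ M`-module of cocycles in `Hom(k[G^{q+1}], A)^M`. -/
def lhsCocyclesRep (q : ℕ) : Rep.{u} k (G ⧸ M) :=
  Rep.of (ρ := show Representation k (G ⧸ M) (LinearMap.ker (lhsCoRepD M A q)) from
    { toFun := fun g => ((lhsCoRep M A q).ρ g).restrict fun F hF => by
        rw [LinearMap.mem_ker, lhsCoRepD_ρ, LinearMap.mem_ker.1 hF, map_zero]
      map_one' := LinearMap.ext fun b => Subtype.ext (congr($((lhsCoRep M A q).ρ.map_one) b.1))
      map_mul' := fun g h =>
        LinearMap.ext fun b => Subtype.ext (congr($((lhsCoRep M A q).ρ.map_mul g h) b.1)) })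

/-- The inclusion of the cocycles. -/
def lhsCocyclesIncl (q : ℕ) : lhsCocyclesRep M A q ⟶ lhsCoRep M A q :=
  Rep.ofHom
    { toLinearMap := (LinearMap.ker (lhsCoRepD M A q)).subtype
      isIntertwining' := fun _ => rfl }

/-- The cocycles, as functions on simplices. -/
def lhsCocyclesToInv (q : ℕ) :
    LinearMap.ker (lhsCoRepD M A q) →ₗ[k] invCocycles M.subtype G A q :=
  ((invCochains M.subtype G A (q + 1)).subtype ∘ₗ
    (LinearMap.ker (lhsCoRepD M A q)).subtype).codRestrict _ fun F =>
      ⟨F.1.2, congr_arg Subtype.val F.2⟩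

lemma conj_smul_subtype (g : G) (n : M) (x : G) :
    g⁻¹ • (M.subtype n • x) =
      M.subtype ((MulAut.conjNormal (H := M) g⁻¹).toMonoidHom n) • g⁻¹ • x :=
  smul_subtype_smul M g⁻¹ n x

lemma rho_conj_subtype (g : G) (n : M) (a : A) :
    A.ρ g (A.ρ (M.subtype ((MulAut.conjNormal (H := M) g⁻¹).toMonoidHom n)) a) =
      A.ρ (M.subtype n) (A.ρ g a) := by
  rw [← Module.End.mul_apply, ← Module.End.mul_apply, ← map_mul, ← map_mul]
  simp [mul_assoc]

/-- The projection from the cocycles in `Hom(k[G^{q+1}], A)^M` to `H^q(M; A)`. -/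
def lhsCocyclesClass (q : ℕ) : lhsCocyclesRep M A q ⟶ cohomologyRep M A q :=
  Rep.ofHom
    { toLinearMap := cobarClass M.subtype (1 : G) A q ∘ₗ lhsCocyclesToInv M A q
      isIntertwining' := fun g => LinearMap.ext fun F => by
        induction g using QuotientGroup.induction_on with | H g => ?_
        exact (map_cobarClass (A := A) (A' := A) (ι := M.subtype) (ι' := M.subtype)
          (1 : G) (1 : G) (MulAut.conjNormal (H := M) g⁻¹).toMonoidHom (g⁻¹ • ·)
          (conj_smul_subtype M g) (A.ρ g) (rho_conj_subtype M A g) (conjCoHom M A g)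
          (fun _ => rfl) (lhsCocyclesToInv M A q F)).symm }

lemma lhsCoDoubleComplex_d_eq_sum (q p : ℕ) :
    (((lhsCoDoubleComplex M A).d q (q + 1)).f p).hom =
      ∑ i : Fin (q + 2), (-1 : ℤ) ^ (i : ℕ) • (((lhsCosimplicial M A).δ i).f p).hom := by
  have hd : (lhsCoDoubleComplex M A).d q (q + 1) =
      AlgebraicTopology.AlternatingCofaceMapComplex.objD (lhsCosimplicial M A) q :=
    CochainComplex.of_d (fun n => (lhsCosimplicial M A).obj (SimplexCategory.mk n))
      (AlgebraicTopology.AlternatingCofaceMapComplex.objD (lhsCosimplicial M A)) q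
  refine congr($(hd).f p |>.hom).trans ?_
  change (HomologicalComplex.Hom.fAddMonoidHom p
    (∑ i : Fin (q + 2), (-1 : ℤ) ^ (i : ℕ) • (lhsCosimplicial M A).δ i)).hom = _
  rw [map_sum, ModuleCat.hom_sum]
  rfl

/-- The outer differential of the double complex acts on the coefficients only. -/
lemma lhsCoDoubleComplex_d_f (q p : ℕ) (F : (Fin p → G ⧸ M) → lhsCoRep M A q)
    (g : Fin p → G ⧸ M) :
    (((lhsCoDoubleComplex M A).d q (q + 1)).f p).hom F g = lhsCoRepD M A q (F g) := by
  rw [lhsCoDoubleComplex_d_eq_sum]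
  refine Subtype.ext (funext fun x => ?_)
  have h1 (i : Fin (q + 2)) : ((((lhsCosimplicial M A).δ i).f p).hom F g).1 x =
      (F g).1 (x ∘ i.succAbove) := by
    have : ⇑(QuotientGroup.map M M (MonoidHom.id G) le_rfl) ∘ g = g :=
      funext fun j => congr($(QuotientGroup.map_id M le_rfl) (g j))
    exact congr_arg (fun g => (F g).1 (x ∘ i.succAbove)) this
  have h2 : ∀ (s : Finset (Fin (q + 2))),
      (((∑ i ∈ s, (-1 : ℤ) ^ (i : ℕ) • (((lhsCosimplicial M A).δ i).f p).hom) F) g).1 x =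
      ∑ i ∈ s, (-1 : ℤ) ^ (i : ℕ) • (F g).1 (x ∘ i.succAbove) := by
    intro s
    induction s using Finset.cons_induction with
    | empty => rfl
    | cons i s hi ih =>
      rw [Finset.sum_cons, Finset.sum_cons, ← ih, ← h1]
      rfl
  refine (h2 _).trans ?_
  rw [lhsCoRepD_coe, simplexDelta_apply]
  refine Finset.sum_congr rfl fun i _ => ?_
  rw [← Int.cast_smul_eq_zsmul k]
  push_cast
  rfl

/-- The cohomology of the rows of the double complex: inhomogeneous cochains of `G ⧸ M` with
coefficients in `H^q(M; A)`. -/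
def lhsCoRowHomology (q : ℕ) : RowHomology (lhsCoDoubleComplex M A) q
    (groupCohomology.inhomogeneousCochains (cohomologyRep M A q)) where
  C := groupCohomology.inhomogeneousCochains (lhsCocyclesRep M A q)
  i := groupCohomology.cochainsMap (MonoidHom.id _) (lhsCocyclesIncl M A q)
  κ := groupCohomology.cochainsMap (MonoidHom.id _) (lhsCocyclesClass M A q)
  injective p y y' h := funext fun g => Subtype.ext (congr_fun h g)
  exact_i p x := by
    rw [CochainComplex.next]
    constructor
    · rintro ⟨y, rfl⟩
      exact funext fun g => (lhsCoDoubleComplex_d_f M A q p _ g).trans (y g).2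
    · intro h
      exact ⟨fun g => ⟨x g, (lhsCoDoubleComplex_d_f M A q p x g).symm.trans (congr_fun h g)⟩, rfl⟩
  surjective p y := by
    have h : Function.Surjective (cobarClass M.subtype (1 : G) A q ∘ₗ lhsCocyclesToInv M A q) :=
      (cobarClass_surjective (toSubgroup_smul M) (1 : G) q).comp
        fun F => ⟨⟨⟨F.1, F.2.1⟩, Subtype.ext F.2.2⟩, rfl⟩
    choose x hx using fun g => h (y g)
    exact ⟨x, funext hx⟩
  exact_κ p y := by
    have key : (∀ g, ((y g).1).1 ∈ invCoboundaries M.subtype G A q) ↔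
        ((groupCohomology.cochainsMap (MonoidHom.id _) (lhsCocyclesClass M A q)).f p).hom y = 0 := by
      refine ⟨fun h => funext fun g => ?_, fun h g => ?_⟩
      · exact (cobarClass_eq_zero_iff (toSubgroup_smul M) (1 : G)
          (lhsCocyclesToInv M A q (y g))).2 (h g)
      · exact (cobarClass_eq_zero_iff (toSubgroup_smul M) (1 : G)
          (lhsCocyclesToInv M A q (y g))).1 (congr_fun h g)
    rw [← key]
    cases q with
    | zero =>
      rw [(lhsCoDoubleComplex M A).shape _ _ (by simp)]
      constructor
      · exact fun h => ⟨0, funext fun g => Subtype.ext (h g).symm⟩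
      · rintro ⟨b, hb⟩ g
        exact (congr_arg Subtype.val (congr_fun hb g)).symm
    | succ q =>
      rw [CochainComplex.prev_nat_succ]
      constructor
      · intro h
        choose b hb hb' using h
        refine ⟨fun g => ⟨b g, hb g⟩, funext fun g => ?_⟩
        exact (lhsCoDoubleComplex_d_f M A q p _ g).trans (Subtype.ext (hb' g))
      · rintro ⟨b, hb⟩ g
        refine ⟨(b g).1, (b g).2, ?_⟩
        exact congr_arg Subtype.val ((lhsCoDoubleComplex_d_f M A q p b g).symm.trans
          (congr_fun hb g))

/-- The second page of the cohomological Lyndon–Hochschild–Serre spectral sequence. -/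
def lhsCoPageTwoIso (p q : ℕ) : ((lhsCoSS M A).page 2 int_two_le_two).X ((p : ℤ), (q : ℤ)) ≅
    groupCohomology (cohomologyRep M A q) p :=
  (lhsCoRowHomology M A q).pageTwoIso _ p

variable {M A} {G' : Type u} [Group G'] {M' : Subgroup G'} [M'.Normal] {A' : Rep.{u} k G'}

omit [M.Normal] [M'.Normal] in
lemma rho_subtype_hom (f : G →* G') (hM : M ≤ M'.comap f) (φ : Rep.res f A' ⟶ A) (n : M) (a : A') :
    φ.hom.toLinearMap (A'.ρ (M'.subtype (subgroupHom f hM n)) a) =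
      A.ρ (M.subtype n) (φ.hom.toLinearMap a) :=
  Rep.hom_comm_apply φ (n : G) a

/-- On the second pages, the morphism of spectral sequences is the map induced on the cohomology of
the quotient with coefficients in the cohomology of the subgroup. -/
lemma lhsCoPageTwoIso_naturality (f : G →* G') (hM : M ≤ M'.comap f) (φ : Rep.res f A' ⟶ A)
    (p q : ℕ) :
    ((lhsCoSSMap f hM φ).hom 2 int_two_le_two).f ((p : ℤ), (q : ℤ)) ≫ (lhsCoPageTwoIso M A p q).hom =
      (lhsCoPageTwoIso M' A' p q).hom ≫
        groupCohomology.map (QuotientGroup.map M M' f hM) (cohomologyRepMap f hM φ q) p := by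
  refine (lhsCoRowHomology M' A' q).pageTwoIso_naturality _ (lhsCoRowHomology M A q)
    ((AlgebraicTopology.alternatingCofaceMapComplex _).map (lhsCosimplicialMap f hM φ))
    (groupCohomology.cochainsMap (QuotientGroup.map M M' f hM) (cohomologyRepMap f hM φ q))
    (fun j y y' hy => funext fun g => ?_) p
  refine Eq.trans ?_ (map_cobarClass (A := A) (A' := A') (ι := M.subtype) (ι' := M'.subtype)
    (1 : G) (1 : G') (subgroupHom f hM) f
    (map_subtype_smul f hM) φ.hom.toLinearMap (rho_subtype_hom f hM φ)
    (resCoHom f hM φ) (fun _ => rfl) (lhsCocyclesToInv M' A' q (y (_ ∘ g)))).symm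
  refine congr_arg (cobarClass M.subtype (1 : G) A q) (Subtype.ext ?_)
  exact congr_arg (fun F : lhsCoRep M A q => F.1) (congr_fun hy g)

end LHSCochains

/-! ### The limit of the cohomological Lyndon–Hochschild–Serre spectral sequence -/

section LHSCoLimit
variable {k : Type u} [CommRing k] {G : Type u} [Group G] (M : Subgroup G) [M.Normal]
  (A : Rep.{u} k G)

lemma inhomogeneousCochains_d_apply {Q : Type u} [Group Q] (W : Rep.{u} k Q) (n : ℕ)
    (F : (Fin n → Q) → W) (g : Fin (n + 1) → Q) :
    ((groupCohomology.inhomogeneousCochains W).d n (n + 1)).hom F g =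
      W.ρ (g 0) (F fun i => g i.succ) +
        ∑ j : Fin (n + 1), (-1 : k) ^ ((j : ℕ) + 1) • F (Fin.contractNth j (· * ·) g) := by
  rw [groupCohomology.inhomogeneousCochains.d_def]
  exact inhomogeneousCochains.d_hom_apply _ _ _ _

/-- The contracting homotopy of the columns of the double complex: the new group element is the
inverse of the first vertex of the simplex on which the cochain is evaluated, and the value is
moved back to that vertex. -/
def cochainHomotopy (q p : ℕ) (F : (Fin (p + 1) → G ⧸ M) → lhsCoRep M A q)
    (g : Fin p → G ⧸ M) : lhsCoRep M A q :=
  ⟨fun x => ((lhsCoRep M A q).ρ (x 0 : G ⧸ M)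
    (F (Fin.cons ((x 0 : G) : G ⧸ M)⁻¹ g))).1 x, by
      refine mem_invCochains.2 fun n x => ?_
      have h : (((M.subtype n • x) 0 : G) : G ⧸ M) = (x 0 : G) := by
        refine (QuotientGroup.eq.2 ?_).symm
        simpa [mul_assoc] using ‹M.Normal›.conj_mem _ n.2 (x 0)⁻¹
      dsimp only
      rw [h]
      exact mem_invCochains.1 (((lhsCoRep M A q).ρ (x 0 : G ⧸ M)
        (F (Fin.cons ((x 0 : G) : G ⧸ M)⁻¹ g))).2) n x⟩

lemma cochainHomotopy_apply (q p : ℕ) (F : (Fin (p + 1) → G ⧸ M) → lhsCoRep M A q)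
    (g : Fin p → G ⧸ M) (x : Fin (q + 1) → G) :
    (cochainHomotopy M A q p F g).1 x = ((lhsCoRep M A q).ρ (x 0 : G ⧸ M)
      (F (Fin.cons ((x 0 : G) : G ⧸ M)⁻¹ g))).1 x := rfl

lemma lhsCoRep_ρ_cochainHomotopy (q p : ℕ) (F : (Fin (p + 1) → G ⧸ M) → lhsCoRep M A q)
    (g : Fin p → G ⧸ M) (s : G ⧸ M) (x : Fin (q + 1) → G) :
    ((lhsCoRep M A q).ρ s (cochainHomotopy M A q p F g)).1 x =
      ((lhsCoRep M A q).ρ (x 0 : G ⧸ M) (F (Fin.cons (((x 0 : G) : G ⧸ M)⁻¹ * s) g))).1 x := by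
  induction s using QuotientGroup.induction_on with | H s => ?_
  rw [lhsCoRep_ρ_apply, cochainHomotopy_apply, ← lhsCoRep_ρ_apply M A q s, ← Module.End.mul_apply,
    ← map_mul]
  have h : (s : G ⧸ M) * (((s⁻¹ • x) 0 : G) : G ⧸ M) = (x 0 : G) := by
    rw [← QuotientGroup.mk_mul]
    simp
  have h' : ((((s⁻¹ • x) 0 : G) : G ⧸ M))⁻¹ = ((x 0 : G) : G ⧸ M)⁻¹ * s := by
    rw [← h, mul_inv_rev, inv_mul_cancel_right]
  rw [h, h']

lemma lhsCoRep_coe_sum (q : ℕ) {ι : Type*} (s : Finset ι) (c : ι → k) (F : ι → lhsCoRep M A q)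
    (x : Fin (q + 1) → G) : (∑ i ∈ s, c i • F i).1 x = ∑ i ∈ s, c i • (F i).1 x := by
  induction s using Finset.cons_induction with
  | empty => rfl
  | cons i s hi ih =>
    rw [Finset.sum_cons, Finset.sum_cons, ← ih]
    rfl

/-- The columns of the double complex are acyclic in positive degrees, since the coefficients are
coinduced from the trivial group. -/
lemma exists_inhomogeneousCochains_lhsCoRep_d_eq (q j : ℕ)
    (F : (groupCohomology.inhomogeneousCochains (lhsCoRep M A q)).X (j + 1))
    (hF : ((groupCohomology.inhomogeneousCochains (lhsCoRep M A q)).d (j + 1) (j + 2)).hom F = 0) :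
    ∃ E, ((groupCohomology.inhomogeneousCochains (lhsCoRep M A q)).d j (j + 1)).hom E = F := by
  refine ⟨cochainHomotopy M A q j F, funext fun g => Subtype.ext (funext fun x => ?_)⟩
  refine (congr_arg (fun F : lhsCoRep M A q => F.1 x) (inhomogeneousCochains_d_apply _ _ _ g)).trans ?_
  have e : _ = (0 : lhsCoRep M A q) := (inhomogeneousCochains_d_apply (lhsCoRep M A q) _ F
    (Fin.cons ((x 0 : G) : G ⧸ M)⁻¹ g)).symm.trans (congr_fun hF _)
  have e' := congr_arg (fun F : lhsCoRep M A q => ((lhsCoRep M A q).ρ (x 0 : G ⧸ M) F).1 x) e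
  rw [Fin.sum_univ_succ, map_add, map_add, map_sum, map_zero, Fin.cons_zero,
    ← Module.End.mul_apply, ← map_mul, mul_inv_cancel, map_one, contractNth_zero_cons,
    Finset.sum_congr rfl fun j _ => by rw [map_smul, contractNth_succ_cons]] at e'
  simp only [Fin.cons_succ, Fin.val_zero, zero_add, pow_one, neg_smul, one_smul, map_neg] at e'
  have e2 : (F g).1 x + (-((lhsCoRep M A q).ρ (x 0 : G ⧸ M)
      (F (Fin.cons (((x 0 : G) : G ⧸ M)⁻¹ * g 0) fun i => g i.succ))).1 x +
      ∑ j : Fin (j + 1), (-1 : k) ^ ((j.succ : ℕ) + 1) • ((lhsCoRep M A q).ρ (x 0 : G ⧸ M)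
        (F (Fin.cons ((x 0 : G) : G ⧸ M)⁻¹ (Fin.contractNth j (· * ·) g)))).1 x) = 0 := by
    rw [← lhsCoRep_coe_sum]
    exact e'
  change ((lhsCoRep M A q).ρ (g 0) (cochainHomotopy M A q j F fun i => g i.succ)).1 x +
    (∑ i : Fin (j + 1), (-1 : k) ^ ((i : ℕ) + 1) •
      cochainHomotopy M A q j F (Fin.contractNth i (· * ·) g)).1 x = _
  rw [lhsCoRep_ρ_cochainHomotopy, lhsCoRep_coe_sum]
  simp only [cochainHomotopy_apply]
  have e3 : ∀ i : Fin (j + 1), (-1 : k) ^ ((i.succ : ℕ) + 1) = - (-1 : k) ^ ((i : ℕ) + 1) := by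
    intro i
    rw [Fin.val_succ, pow_succ _ ((i : ℕ) + 1)]
    simp
  simp only [e3, neg_smul, Finset.sum_neg_distrib] at e2
  rw [← neg_add, ← sub_eq_add_neg, sub_eq_zero] at e2
  exact e2.symm

/-- The inclusion `Hom(k[G^{q+1}], A)^G → Hom(k[G^{q+1}], A)^M`, as a coaugmentation of the columns
of the double complex. -/
def lhsCoEdge (q : ℕ) : invCochains (MonoidHom.id G) G A (q + 1) →ₗ[k]
    ((Fin 0 → G ⧸ M) → lhsCoRep M A q) :=
  LinearMap.pi fun _ => Submodule.inclusion
    (p' := invCochains M.subtype G A (q + 1)) fun _ hF => mem_invCochains.2 fun n x =>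
      mem_invCochains.1 hF (n : G) x

lemma inhomogeneousCochains_d_zero_apply {Q : Type u} [Group Q] (W : Rep.{u} k Q)
    (F : (Fin 0 → Q) → W) (g : Fin 1 → Q) :
    ((groupCohomology.inhomogeneousCochains W).d 0 1).hom F g =
      W.ρ (g 0) (F Fin.elim0) - F Fin.elim0 := by
  rw [inhomogeneousCochains_d_apply, Fin.sum_univ_one, sub_eq_add_neg]
  simp only [Fin.val_zero, zero_add, pow_one, neg_smul, one_smul]
  rw [Subsingleton.elim (fun i : Fin 0 => g i.succ) Fin.elim0,
    Subsingleton.elim (Fin.contractNth 0 (· * ·) g) Fin.elim0]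

/-- The columns of the double complex of the cohomological Lyndon–Hochschild–Serre spectral sequence
are coresolutions of the complex of invariants computing `H^n(G; A)`. -/
def lhsColumnCoaugmentation : ColumnCoaugmentation (lhsCoDoubleComplex M A)
    (V := fun q => invCochains (MonoidHom.id G) G A (q + 1))
    (fun q => (simplexDelta (k := k) G A (q + 1)).restrict
      fun _ hF => simplexDelta_mem_invCochains hF) where
  η := lhsCoEdge M A
  injective q F F' h := Subtype.ext
    (congr_arg (fun F : lhsCoRep M A q => F.1) (congr_fun h Fin.elim0))
  exact_η q x := by
    constructor
    · rintro ⟨F, rfl⟩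
      refine funext fun g => (inhomogeneousCochains_d_zero_apply _ _ g).trans (sub_eq_zero.2 ?_)
      generalize g 0 = s
      induction s using QuotientGroup.induction_on with | H s => ?_
      refine Subtype.ext (funext fun x => ?_)
      change A.ρ s (F.1 (s⁻¹ • x)) = F.1 x
      have := mem_invCochains.1 F.2 s (s⁻¹ • x)
      rw [MonoidHom.id_apply, smul_inv_smul] at this
      exact this.symm
    · intro h
      refine ⟨⟨(x Fin.elim0).1, mem_invCochains.2 fun s y => ?_⟩, funext fun g => Subtype.ext ?_⟩
      · have h1 := (inhomogeneousCochains_d_zero_apply _ x fun _ => (s : G ⧸ M)).symm.trans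
          (congr_fun h _)
        have h2 := congr_fun (congr_arg Subtype.val (sub_eq_zero.1 h1)) (s • y)
        rw [lhsCoRep_ρ_apply, inv_smul_smul] at h2
        exact h2.symm
      · exact congr_arg (fun g => (x g).1) (Subsingleton.elim Fin.elim0 g)
  exact q j x hx := exists_inhomogeneousCochains_lhsCoRep_d_eq M A q j x hx
  comm q F := funext fun g => lhsCoDoubleComplex_d_f M A q 0 _ g

/-- The filtered complex of the cohomological Lyndon–Hochschild–Serre spectral sequence. -/
abbrev lhsCoFiltered : FilteredComplex k 1 :=
  totalFiltered (lhsCoDoubleComplex M A) fun i j (h : i + 1 = j) => by omega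

/-- The class in the cohomology of `G` of a homogeneous cocycle. -/
def lhsCoKerClass (n : ℕ) : LinearMap.ker ((simplexDelta (k := k) G A (n + 1)).restrict
      (p := invCochains (MonoidHom.id G) G A (n + 1))
      (q := invCochains (MonoidHom.id G) G A (n + 2))
      fun _ hF => simplexDelta_mem_invCochains hF) →ₗ[k] groupCohomology A n :=
  cobarClass (MonoidHom.id G) (1 : G) A n ∘ₗ
    ((Submodule.subtype _ ∘ₗ Submodule.subtype _).codRestrict (invCocycles (MonoidHom.id G) G A n)
      fun F => ⟨F.1.2, congr_arg Subtype.val F.2⟩)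

lemma lhsCoKerClass_surjective (n : ℕ) : Function.Surjective (lhsCoKerClass A n) :=
  (cobarClass_surjective (ι := MonoidHom.id G) (ρ := id) (fun _ _ => rfl) (1 : G) n).comp
    fun F => ⟨⟨⟨F.1, F.2.1⟩, Subtype.ext F.2.2⟩, rfl⟩

lemma lhsCoKerClass_eq_zero_iff {n : ℕ} (F : LinearMap.ker ((simplexDelta (k := k) G A
      (n + 1)).restrict (p := invCochains (MonoidHom.id G) G A (n + 1))
      (q := invCochains (MonoidHom.id G) G A (n + 2))
      fun _ hF => simplexDelta_mem_invCochains hF)) :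
    lhsCoKerClass A n F = 0 ↔ F.1.1 ∈ invCoboundaries (MonoidHom.id G) G A n :=
  cobarClass_eq_zero_iff (ι := MonoidHom.id G) (ρ := id) (fun _ _ => rfl) (1 : G) _

lemma total_up_eq_zero_of_neg {K : HomologicalComplex₂ (ModuleCat.{u} k) (ComplexShape.up ℕ)
    (ComplexShape.up ℕ)} {n : ℤ} (hn : n < 0) (w : (K.total (ComplexShape.up' (1 : ℤ))).X n) :
    w = 0 :=
  total_ext fun i j hij => by omega

/-- A homogeneous cocycle has trivial class if and only if its image in the total complex is a
coboundary. -/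
lemma lhsCoKerClass_eq_zero_iff_edge {n : ℕ} (F : LinearMap.ker ((simplexDelta (k := k) G A
      (n + 1)).restrict (p := invCochains (MonoidHom.id G) G A (n + 1))
      (q := invCochains (MonoidHom.id G) G A (n + 2))
      fun _ hF => simplexDelta_mem_invCochains hF)) :
    lhsCoKerClass A n F = 0 ↔ ∃ w, ((lhsCoFiltered M A).K.d ((n : ℤ) - 1) n).hom w =
      (lhsColumnCoaugmentation M A).edge n n F.1 := by
  rw [lhsCoKerClass_eq_zero_iff]
  cases n with
  | zero =>
    constructor
    · intro h
      refine ⟨0, ?_⟩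
      rw [map_zero, show F.1 = 0 from Subtype.ext h, map_zero]
      rfl
    · rintro ⟨w, hw⟩
      have h0 := (congr_arg ((lhsCoFiltered M A).K.d (((0 : ℕ) : ℤ) - 1) (0 : ℕ)).hom
        (total_up_eq_zero_of_neg (by simp) w)).trans (map_zero _)
      have := (lhsColumnCoaugmentation M A).edge_injective 0
        ((hw.symm.trans h0).trans (map_zero _).symm)
      exact congr_arg Subtype.val this
  | succ n =>
    have hn : ((n + 1 : ℕ) : ℤ) - 1 = n := by push_cast; ring
    rw [hn]
    constructor
    · rintro ⟨E, hE, h⟩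
      refine ⟨(lhsColumnCoaugmentation M A).edge n n ⟨E, hE⟩, ?_⟩
      refine ((lhsColumnCoaugmentation M A).d_edge n rfl _).trans ?_
      exact congr_arg _ (Subtype.ext h)
    · rintro ⟨w, hw⟩
      obtain ⟨E, hE⟩ := (lhsColumnCoaugmentation M A).exists_δ_eq n hw
      exact ⟨E.1, E.2, congr_arg Subtype.val hE⟩

/-- The map from the cocycles of the total complex to the cohomology of `G`. -/
def lhsCoLimit (n : ℕ) :
    cycleSubmodule (lhsCoFiltered M A).K (n : ℤ) →ₗ[k] groupCohomology A n :=
  (lhsColumnCoaugmentation M A).limitMap n (lhsCoKerClass A n) fun F w h =>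
    (lhsCoKerClass_eq_zero_iff_edge M A F).2 ⟨w, h.symm⟩

lemma lhsCoLimit_toCycles (n : ℕ) (F : LinearMap.ker ((simplexDelta (k := k) G A
      (n + 1)).restrict (p := invCochains (MonoidHom.id G) G A (n + 1))
      (q := invCochains (MonoidHom.id G) G A (n + 2))
      fun _ hF => simplexDelta_mem_invCochains hF)) (w : (lhsCoFiltered M A).K.X ((n : ℤ) - 1)) :
    lhsCoLimit M A n ((lhsColumnCoaugmentation M A).toCycles n (F, w)) = lhsCoKerClass A n F :=
  (lhsColumnCoaugmentation M A).limitMap_toCycles n _ _ F w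

/-- The convergence of the cohomological Lyndon–Hochschild–Serre spectral sequence. -/
def lhsCoConvergence : Convergence (lhsCoSS M A) fun n => groupCohomology A n :=
  FilteredComplex.convergence (totalFiltered_firstQuadrant _ _) (lhsCoLimit M A)
    (fun n => (lhsColumnCoaugmentation M A).limitMap_surjective n _ _
      (lhsCoKerClass_surjective A n))
    (fun n => (lhsColumnCoaugmentation M A).limitMap_eq_zero_iff n _ _
      fun F h => (lhsCoKerClass_eq_zero_iff_edge M A F).1 h)

variable {M A} {G' : Type u} [Group G'] {M' : Subgroup G'} [M'.Normal] {A' : Rep.{u} k G'}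

/-- The restriction of an invariant cochain. -/
def lhsCoKerMap (f : G →* G') (φ : Rep.res f A' ⟶ A) {n : ℕ}
    (F : LinearMap.ker ((simplexDelta (k := k) G' A' (n + 1)).restrict
      (p := invCochains (MonoidHom.id G') G' A' (n + 1))
      (q := invCochains (MonoidHom.id G') G' A' (n + 2))
      fun _ hF => simplexDelta_mem_invCochains hF)) :
    LinearMap.ker ((simplexDelta (k := k) G A (n + 1)).restrict
      (p := invCochains (MonoidHom.id G) G A (n + 1))
      (q := invCochains (MonoidHom.id G) G A (n + 2))
      fun _ hF => simplexDelta_mem_invCochains hF) :=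
  have hF := cosimplexMap_mem_invCocycles (A := A) (A' := A') (ι := MonoidHom.id G)
    (ι' := MonoidHom.id G') (f := f) (e := f) (φ := φ.hom.toLinearMap) (map_mul f)
    (fun γ a => Rep.hom_comm_apply φ γ a) (F := F.1.1) ⟨F.1.2, congr_arg Subtype.val F.2⟩
  ⟨⟨_, hF.1⟩, Subtype.ext hF.2⟩

lemma lhsCoKerClass_lhsCoKerMap (f : G →* G') (φ : Rep.res f A' ⟶ A) {n : ℕ}
    (F : LinearMap.ker ((simplexDelta (k := k) G' A' (n + 1)).restrict
      (p := invCochains (MonoidHom.id G') G' A' (n + 1))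
      (q := invCochains (MonoidHom.id G') G' A' (n + 2))
      fun _ hF => simplexDelta_mem_invCochains hF)) :
    lhsCoKerClass A n (lhsCoKerMap f φ F) =
      (groupCohomology.map f φ n).hom (lhsCoKerClass A' n F) :=
  (map_cobarClass (A := A) (A' := A') (ι := MonoidHom.id G) (ι' := MonoidHom.id G')
    (1 : G) (1 : G') f f (map_mul f) φ.hom.toLinearMap (fun γ a => Rep.hom_comm_apply φ γ a) φ
    (fun _ => rfl) ⟨F.1.1, F.1.2, congr_arg Subtype.val F.2⟩).symm

lemma lhsCoLimit_naturality (f : G →* G') (hM : M ≤ M'.comap f) (φ : Rep.res f A' ⟶ A) {n : ℕ}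
    (x : cycleSubmodule (lhsCoFiltered M' A').K (n : ℤ))
    (y : cycleSubmodule (lhsCoFiltered M A).K (n : ℤ))
    (h : y.1 = ((HomologicalComplex₂.total.map ((AlgebraicTopology.alternatingCofaceMapComplex _).map
      (lhsCosimplicialMap f hM φ)) (ComplexShape.up' (1 : ℤ))).f n).hom x.1) :
    lhsCoLimit M A n y = (groupCohomology.map f φ n).hom (lhsCoLimit M' A' n x) := by
  obtain ⟨⟨F, w⟩, rfl⟩ := (lhsColumnCoaugmentation M' A').toCycles_surjective n x
  have h1 := ColumnCoaugmentation.totalMap_toCycles (lhsColumnCoaugmentation M' A')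
    (lhsColumnCoaugmentation M A) ((AlgebraicTopology.alternatingCofaceMapComplex _).map
      (lhsCosimplicialMap f hM φ)) F (lhsCoKerMap f φ F) rfl w
  have hy := Subtype.ext (h.trans h1)
  refine (congr_arg (lhsCoLimit M A n) hy).trans ((lhsCoLimit_toCycles M A n _ _).trans ?_)
  refine (lhsCoKerClass_lhsCoKerMap f φ F).trans ?_
  exact congr_arg (groupCohomology.map f φ n).hom (lhsCoLimit_toCycles M' A' n F w).symm

/-- On the limits, the morphism of spectral sequences is the map induced on group cohomology. -/
lemma lhsCoConvergence_compatible (f : G →* G') (hM : M ≤ M'.comap f) (φ : Rep.res f A' ⟶ A) :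
    (lhsCoConvergence M' A').Compatible (lhsCoConvergence M A) (lhsCoSSMap f hM φ)
      fun n => groupCohomology.map f φ n := by
  refine FilteredComplex.convergence_compatible _ _ _ _ _ _ _ _
    (totalFilteredMap _ ((AlgebraicTopology.alternatingCofaceMapComplex _).map
      (lhsCosimplicialMap f hM φ))) _ fun n x y h => ?_
  exact lhsCoLimit_naturality f hM φ x y h

end LHSCoLimit

/-! ### Internal direct sums and products -/

section InternalSum
variable {k : Type*} [CommRing k] {I : Type*} {V : I → Type*} [∀ i, AddCommGroup (V i)]
  [∀ i, Module k (V i)] {W : Type*} [AddCommGroup W] [Module k W]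

/-- The maps `f i : V i → W` exhibit `W` as the direct sum of the modules `V i`. -/
def IsInternalSum (f : ∀ i, V i →ₗ[k] W) : Prop :=
  (∀ w, ∃ (s : Finset I) (x : ∀ i, V i), ∑ i ∈ s, f i (x i) = w) ∧
    ∀ (s : Finset I) (x : ∀ i, V i), ∑ i ∈ s, f i (x i) = 0 → ∀ i ∈ s, x i = 0

/-- The maps `f i : W → V i` exhibit `W` as the product of the modules `V i`. -/
def IsInternalProd (f : ∀ i, W →ₗ[k] V i) : Prop :=
  (∀ w, (∀ i, f i w = 0) → w = 0) ∧ ∀ x : ∀ i, V i, ∃ w, ∀ i, f i w = x i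

variable {f : ∀ i, V i →ₗ[k] W}

lemma IsInternalSum.induction (hf : IsInternalSum f) {p : W → Prop} (h0 : p 0)
    (hadd : ∀ w w', p w → p w' → p (w + w')) (h : ∀ i x, p (f i x)) (w : W) : p w := by
  obtain ⟨s, x, rfl⟩ := hf.1 w
  exact Finset.sum_induction _ p hadd h0 fun i _ => h i _

lemma IsInternalSum.bijective [DecidableEq I] (hf : IsInternalSum f) :
    Function.Bijective (DirectSum.toModule k I W f) := by
  classical
  constructor
  · refine (injective_iff_map_eq_zero _).2 fun x hx => ?_
    have h1 : ∑ i ∈ DFinsupp.support x, f i (x i) = 0 := by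
      rw [← hx]
      conv_rhs => rw [← DirectSum.sum_support_of x, map_sum]
      exact Finset.sum_congr rfl fun i _ => (DirectSum.toModule_lof k (φ := f) i (x i)).symm
    refine DFinsupp.ext fun i => ?_
    by_cases hi : i ∈ DFinsupp.support x
    · exact hf.2 _ (fun i => x i) h1 i hi
    · simpa using hi
  · intro w
    obtain ⟨s, x, rfl⟩ := hf.1 w
    refine ⟨∑ i ∈ s, DirectSum.lof k I V i (x i), ?_⟩
    rw [map_sum]
    exact Finset.sum_congr rfl fun i _ => DirectSum.toModule_lof k i (x i)

/-- The universal property of a direct sum. -/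
lemma IsInternalSum.exists_desc (hf : IsInternalSum f) {U : Type*} [AddCommGroup U] [Module k U]
    (v : ∀ i, V i →ₗ[k] U) : ∃ u : W →ₗ[k] U, ∀ i x, u (f i x) = v i x := by
  classical
  let e := LinearEquiv.ofBijective _ hf.bijective
  refine ⟨DirectSum.toModule k I U v ∘ₗ e.symm.toLinearMap, fun i x => ?_⟩
  have h : e.symm (f i x) = DirectSum.lof k I V i x :=
    e.symm_apply_eq.2 (DirectSum.toModule_lof k i x).symm
  rw [LinearMap.comp_apply, LinearEquiv.coe_coe, h, DirectSum.toModule_lof]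

end InternalSum

/-! ### Derivations on free products -/

section Gluing
variable {I : Type*} {Γ : I → Type*} [∀ i, Group (Γ i)] {G : Type*} [Group G] {ι : ∀ i, Γ i →* G}
  (hι : Function.Bijective (Monoid.CoprodI.lift ι))

include hι in
lemma coprodI_induction {p : G → Prop} (one : p 1) (of : ∀ i γ, p (ι i γ))
    (mul : ∀ x y, p x → p y → p (x * y)) (g : G) : p g := by
  obtain ⟨w, rfl⟩ := hι.2 g
  induction w using Monoid.CoprodI.induction_on with
  | one => rwa [map_one]
  | of i γ => rw [Monoid.CoprodI.lift_of]; exact of i γ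
  | mul x y hx hy => rw [map_mul]; exact mul _ _ hx hy

variable {k : Type*} [CommRing k] {V : Type*} [AddCommGroup V] [Module k V]
  (ρ : Representation k G V)

/-- The affine permutation `w ↦ g w + v`. A derivation `d` is the same as a homomorphism to the
affine permutations of the form `g ↦ affinePerm ρ g (d g)`. -/
def affinePerm (g : G) (v : V) : Equiv.Perm V where
  toFun w := ρ g w + v
  invFun w := ρ g⁻¹ (w - v)
  left_inv w := by
    change ρ g⁻¹ (ρ g w + v - v) = w
    rw [add_sub_cancel_right, ρ.inv_self_apply]
  right_inv w := by
    change ρ g (ρ g⁻¹ (w - v)) + v = w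
    rw [ρ.self_inv_apply, sub_add_cancel]

include hι in
/-- Derivations on the factors of a free product extend to the free product: they are homomorphisms
to a group of affine permutations. -/
lemma exists_derivation (d : ∀ i, Γ i → V)
    (hd : ∀ i γ γ', d i (γ * γ') = d i γ + ρ (ι i γ) (d i γ')) :
    ∃ D : G → V, (∀ x y, D (x * y) = D x + ρ x (D y)) ∧ ∀ i γ, D (ι i γ) = d i γ := by
  let Φ : Monoid.CoprodI Γ →* Equiv.Perm V := Monoid.CoprodI.lift fun i =>
    MonoidHom.mk' (fun γ => affinePerm ρ (ι i γ) (d i γ)) fun γ γ' => Equiv.ext fun v => by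
      change ρ (ι i (γ * γ')) v + d i (γ * γ') =
        ρ (ι i γ) (ρ (ι i γ') v + d i γ') + d i γ
      rw [hd, map_mul, map_mul, map_add, Module.End.mul_apply, add_assoc, add_comm (d i γ)]
  have hΦ : ∀ i γ v, Φ (Monoid.CoprodI.of γ) v = ρ (ι i γ) v + d i γ := fun i γ v => by
    rw [Monoid.CoprodI.lift_of]
    rfl
  have h0 : ∀ i, d i 1 = 0 := fun i => by simpa using hd i 1 1
  have key : ∀ w v, Φ w v = ρ (Monoid.CoprodI.lift ι w) v + Φ w 0 := by
    intro w
    induction w using Monoid.CoprodI.induction_on with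
    | one => intro v; simp
    | of i γ => intro v; rw [hΦ, hΦ, map_zero, zero_add, Monoid.CoprodI.lift_of]
    | mul x y hx hy =>
      intro v
      rw [map_mul, Equiv.Perm.mul_apply, Equiv.Perm.mul_apply, hx, hy v, hx (Φ y 0), map_mul,
        map_mul, map_add, Module.End.mul_apply, add_assoc]
  let e := MulEquiv.ofBijective _ hι
  refine ⟨fun x => Φ (e.symm x) 0, fun x y => ?_, fun i γ => ?_⟩
  · change Φ (e.symm (x * y)) 0 = Φ (e.symm x) 0 + ρ x (Φ (e.symm y) 0)
    rw [map_mul, map_mul, Equiv.Perm.mul_apply, key, add_comm]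
    congr 2
    exact congr_arg ρ (e.apply_symm_apply x)
  · have : e.symm (ι i γ) = Monoid.CoprodI.of γ :=
      e.symm_apply_eq.2 (Monoid.CoprodI.lift_of ι γ).symm
    change Φ (e.symm (ι i γ)) 0 = d i γ
    rw [this, hΦ, map_zero, zero_add]

/-- A group is a free set for every group that embeds in it. -/
lemma exists_equivariant_of_injective {Γ G : Type*} [Group Γ] [Group G] {ι : Γ →* G}
    (h : Function.Injective ι) : ∃ ρ : G → Γ, ∀ γ x, ρ (ι γ • x) = γ * ρ x := by
  let e := MonoidHom.ofInjective h
  refine ⟨fun x => e.symm (toSubgroup ι.range x), fun γ x => ?_⟩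
  have := toSubgroup_smul ι.range (e γ) x
  change toSubgroup ι.range (ι γ • x) = _ at this
  change e.symm (toSubgroup ι.range (ι γ • x)) = γ * e.symm (toSubgroup ι.range x)
  rw [this, map_mul, e.symm_apply_apply]

include hι in
lemma coprodI_injective (i : I) : Function.Injective (ι i) := fun γ γ' h =>
  Monoid.CoprodI.of_injective i (hι.1 (by
    rw [Monoid.CoprodI.lift_of, Monoid.CoprodI.lift_of, h]))

end Gluing

/-! ### Homology of free products -/

section FreeProductHomology
variable {I k G : Type u} {Γ : I → Type u} [∀ i, Group (Γ i)] [Group G] [CommRing k]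
  {ι : ∀ i, Γ i →* G} (hι : Function.Bijective (Monoid.CoprodI.lift ι)) (A : Rep.{u} k G)

include hι in
/-- The relations of the coinvariants under a free product are generated by the relations of the
factors. -/
lemma coinvKer_id_le_iSup (m : ℕ) :
    coinvKer (MonoidHom.id G) G A m ≤ ⨆ i, coinvKer (ι i) G A m := by
  have h : ∀ g z, finsuppAction (Fin m → G) A g z - z ∈ ⨆ i, coinvKer (ι i) G A m := by
    refine coprodI_induction hι (fun z => ?_) (fun i γ z => ?_) fun x y hx hy z => ?_
    · rw [map_one, Module.End.one_apply, sub_self]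
      exact zero_mem _
    · exact Submodule.mem_iSup_of_mem i (Representation.Coinvariants.mem_ker_of_eq
        (ρ := (finsuppAction (Fin m → G) A).comp (ι i)) γ z _ rfl)
    · rw [map_mul, Module.End.mul_apply, ← sub_add_sub_cancel _ (finsuppAction (Fin m → G) A y z)]
      exact add_mem (hx _) (hy _)
  refine coinvKer_le fun g x a => ?_
  have := h g (Finsupp.single x a)
  rwa [finsuppAction_single] at this

/-- The module of endomorphisms of `V`, with the action of `G` on the source. -/
def endRep {G k V : Type*} [Group G] [CommRing k] [AddCommGroup V] [Module k V]
    (σ : Representation k G V) : Representation k G (V →ₗ[k] V) where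
  toFun g := LinearMap.lcomp k V (σ g⁻¹)
  map_one' := LinearMap.ext fun φ => LinearMap.ext fun v => by simp
  map_mul' g h := LinearMap.ext fun φ => LinearMap.ext fun v => by simp

lemma endRep_apply {G k V : Type*} [Group G] [CommRing k] [AddCommGroup V] [Module k V]
    (σ : Representation k G V) (g : G) (φ : V →ₗ[k] V) (v : V) :
    endRep σ g φ v = φ (σ g⁻¹ v) := rfl

include hι in
/-- For chains of positive length, the relations `γ z - z` with `γ` in one factor of a free product
split off from those of the other factors. -/
lemma exists_coinvKer_projection (m : ℕ) (j : I) :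
    ∃ T : ((Fin (m + 1) → G) →₀ A) →ₗ[k] ((Fin (m + 1) → G) →₀ A),
      (∀ y ∈ coinvKer (ι j) G A (m + 1), T y = y) ∧
      ∀ i, i ≠ j → ∀ y ∈ coinvKer (ι i) G A (m + 1), T y = 0 := by
  classical
  let σ := finsuppAction (Fin (m + 1) → G) A
  -- The derivation is inner on the factor `j`, given by the identity, and zero on the other
  -- factors.
  obtain ⟨D, hD, hDι⟩ := exists_derivation hι (endRep σ)
    (fun i γ => if i = j then endRep σ (ι i γ) LinearMap.id - LinearMap.id else 0)
    (fun i γ γ' => by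
      by_cases h : i = j
      · rw [if_pos h, if_pos h, if_pos h, map_mul, map_mul, map_sub, Module.End.mul_apply]
        abel
      · rw [if_neg h, if_neg h, if_neg h, map_zero, add_zero])
  -- Every simplex is the translate by its first vertex of a simplex with first vertex `1`; this
  -- turns the derivation into an operator that measures the effect of translations.
  let T : ((Fin (m + 1) → G) →₀ A) →ₗ[k] ((Fin (m + 1) → G) →₀ A) :=
    Finsupp.lsum k fun y => D (y 0)⁻¹ ∘ₗ σ (y 0)⁻¹ ∘ₗ Finsupp.lsingle y
  have hT : ∀ x y a, T (Finsupp.single (x • y) (A.ρ x a)) =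
      T (Finsupp.single y a) + D x⁻¹ (Finsupp.single y a) := by
    intro x y a
    have h1 : (x • y) 0 = x * y 0 := rfl
    rw [Finsupp.lsum_single, Finsupp.lsum_single]
    simp only [LinearMap.comp_apply, Finsupp.lsingle_apply]
    rw [h1, mul_inv_rev, hD, LinearMap.add_apply, endRep_apply, inv_inv, map_mul,
      Module.End.mul_apply, ← finsuppAction_single, σ.inv_self_apply, σ.self_inv_apply]
  have hx : ∀ i γ z, D (ι i γ)⁻¹ z = if i = j then σ (ι i γ) z - z else 0 := by
    intro i γ z
    rw [← map_inv, hDι]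
    split_ifs with h
    · rw [LinearMap.sub_apply, endRep_apply, ← map_inv (ι i), inv_inv]
      rfl
    · rfl
  refine ⟨T, fun y hy => ?_, fun i hi y hy => ?_⟩
  · refine coinvKer_le (S := LinearMap.eqLocus T LinearMap.id) (fun γ x a => ?_) hy
    rw [LinearMap.mem_eqLocus, map_sub, hT, add_sub_cancel_left, hx, if_pos rfl, LinearMap.id_apply]
    exact congr_arg (· - _) (finsuppAction_single _ _ _)
  · refine LinearMap.mem_ker.1 (coinvKer_le_ker (T := T) (fun γ x a => ?_) hy)
    rw [hT, hx, if_neg hi, add_zero]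

include hι in
/-- For chains of positive length, the relations of the factors of a free product are linearly
independent. -/
lemma eq_zero_of_sum_coinvKer (m : ℕ) {s : Finset I} {y : I → ((Fin (m + 1) → G) →₀ A)}
    (hy : ∀ i, y i ∈ coinvKer (ι i) G A (m + 1)) (h : ∑ i ∈ s, y i = 0) : ∀ i ∈ s, y i = 0 := by
  intro j hj
  obtain ⟨T, hT, hT'⟩ := exists_coinvKer_projection hι A m j
  have := congr_arg T h
  rwa [map_sum, map_zero, Finset.sum_eq_single_of_mem j hj fun i _ hi => hT' i hi _ (hy i),
    hT _ (hy j)] at this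

lemma exists_finset_sum_of_mem_iSup {I R M : Type*} [Ring R] [AddCommGroup M] [Module R M]
    {S : I → Submodule R M} {z : M} (hz : z ∈ ⨆ i, S i) :
    ∃ (s : Finset I) (y : I → M), (∀ i, y i ∈ S i) ∧ (∀ i ∉ s, y i = 0) ∧ ∑ i ∈ s, y i = z := by
  obtain ⟨f, hf, rfl⟩ := (Submodule.mem_iSup_iff_exists_finsupp _ _).1 hz
  exact ⟨f.support, f, hf, fun i hi => Finsupp.notMem_support_iff.1 hi, rfl⟩

variable {A}

/-- In the augmented degree there are no relations if the action on the coefficients is trivial. -/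
lemma coinvKer_eq_zero_of_trivial {Γ G X : Type u} [Group Γ] [Group G] [MulAction G X]
    {A : Rep.{u} k G} {ι : Γ →* G} (hA : ∀ g, A.ρ g = 1) {y : (Fin 0 → X) →₀ A}
    (hy : y ∈ coinvKer ι X A 0) : y = 0 := by
  refine (Submodule.mem_bot k).1 (coinvKer_le (S := ⊥) (fun γ x a => ?_) hy)
  rw [hA, Subsingleton.elim (ι γ • x) x]
  exact (Submodule.mem_bot k).2 (sub_self _)

/-- The map on homology induced by one factor, on the classes of cycles. -/
lemma map_factor_barClass {Γ : Type u} [Group Γ] {ι : Γ →* G} {ρ : G → Γ}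
    (hρ : ∀ γ x, ρ (ι γ • x) = γ * ρ x) {q : ℕ} {z : (Fin (q + 2) → G) →₀ A}
    (hz : simplexD (k := k) G A (q + 1) z ∈ coinvKer ι G A (q + 1))
    (hz' : simplexD (k := k) G A (q + 1) z ∈ coinvKer (MonoidHom.id G) G A (q + 1)) :
    (groupHomology.map ι (𝟙 (Rep.res ι A)) (q + 1)).hom
        (barClass hρ (q + 1) ⟨coinvMk ι G A (q + 2) z, coinvMk_mem_coinvCycles_succ.2 hz⟩) =
      barClass (A := A) (ι := MonoidHom.id G) (X := G) (ρ := id) (fun _ _ => rfl) (q + 1)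
        ⟨coinvMk (MonoidHom.id G) G A (q + 2) z, coinvMk_mem_coinvCycles_succ.2 hz'⟩ := by
  refine (map_barClass (A := A) (A' := A) (ι := ι) (ι' := MonoidHom.id G) (ρ' := id) hρ (fun _ _ => rfl) ι id
    (fun _ _ => rfl) LinearMap.id (fun _ _ => rfl) (𝟙 (Rep.res ι A)) (fun _ => rfl) _).trans ?_
  refine congr_arg _ (Subtype.ext ?_)
  refine congr_arg (coinvMk (MonoidHom.id G) G A (q + 2)) ?_
  have : (simplexMap id LinearMap.id (q + 2) : ((Fin (q + 2) → G) →₀ A) →ₗ[k] _) =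
    LinearMap.id := Finsupp.lhom_ext fun x a => by rw [simplexMap_single]; rfl
  exact congr($this z)

lemma exists_barClass_succ {Γ X : Type u} [Group Γ] [MulAction G X] [Nonempty X] {ι : Γ →* G}
    {ρ : X → Γ} (hρ : ∀ γ x, ρ (ι γ • x) = γ * ρ x) {q : ℕ}
    (v : groupHomology (Rep.res ι A) (q + 1)) :
    ∃ (z : (Fin (q + 2) → X) →₀ A)
      (hz : simplexD (k := k) X A (q + 1) z ∈ coinvKer ι X A (q + 1)),
      barClass hρ (q + 1) ⟨coinvMk ι X A (q + 2) z, coinvMk_mem_coinvCycles_succ.2 hz⟩ = v := by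
  obtain ⟨⟨b, hb⟩, rfl⟩ := barClass_surjective hρ (q + 1) v
  obtain ⟨z, rfl⟩ := coinvMk_surjective _ b
  exact ⟨z, coinvMk_mem_coinvCycles_succ.1 hb, rfl⟩

lemma barClass_mk_eq_zero_iff {Γ X : Type u} [Group Γ] [MulAction G X] [Nonempty X] {ι : Γ →* G}
    {ρ : X → Γ} (hρ : ∀ γ x, ρ (ι γ • x) = γ * ρ x) {q : ℕ} {z : (Fin (q + 2) → X) →₀ A}
    (hz : simplexD (k := k) X A (q + 1) z ∈ coinvKer ι X A (q + 1)) :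
    barClass hρ (q + 1) ⟨coinvMk ι X A (q + 2) z, coinvMk_mem_coinvCycles_succ.2 hz⟩ = 0 ↔
      ∃ w, z - simplexD (k := k) X A (q + 2) w ∈ coinvKer ι X A (q + 2) := by
  rw [barClass_eq_zero_iff]
  constructor
  · rintro ⟨w, hw⟩
    obtain ⟨w, rfl⟩ := coinvMk_surjective _ w
    exact ⟨w, coinvMk_eq_iff.1 hw.symm⟩
  · rintro ⟨w, hw⟩
    exact ⟨coinvMk ι X A (q + 3) w, (coinvMk_eq_iff.2 hw).symm⟩

lemma coinvKer_le_id {Γ X : Type u} [Group Γ] [MulAction G X] (ι : Γ →* G) (m : ℕ) :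
    coinvKer ι X A m ≤ coinvKer (MonoidHom.id G) X A m :=
  coinvKer_le fun γ x a => single_sub_single_mem_coinvKer (MonoidHom.id G) (ι γ) x a

include hι in
/-- The homology of a free product in degree `q + 1` is the direct sum of the homologies of the
factors, if `q + 1 > 1` or if the action on the coefficients is trivial. -/
lemma isInternalSum_homology_freeProduct (q : ℕ) (hq : 1 ≤ q ∨ ∀ g, A.ρ g = 1) :
    IsInternalSum fun i =>
      (groupHomology.map (ι i) (𝟙 (Rep.res (ι i) A)) (q + 1)).hom := by
  classical
  choose ρ hρ using fun i => exists_equivariant_of_injective (coprodI_injective hι i)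
  have hρ₀ : ∀ γ x : G, (id : G → G) (MonoidHom.id G γ • x) = γ * x := fun _ _ => rfl
  constructor
  · intro v
    obtain ⟨z, hz, rfl⟩ := exists_barClass_succ (ι := MonoidHom.id G) hρ₀ v
    -- The boundary of `z` is a relation, hence a sum of relations `y i` of the factors. These are
    -- cycles by independence, and chains `z i` with boundary `y i` represent classes of the
    -- factors. The sum of the `z i` differs from `z` by a boundary.
    obtain ⟨s, y, hy, -, hsum⟩ := exists_finset_sum_of_mem_iSup (coinvKer_id_le_iSup hι A _ hz)
    have hdy : ∀ i ∈ s, simplexD (k := k) G A q (y i) = 0 := by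
      have h0 : ∑ i ∈ s, simplexD (k := k) G A q (y i) = 0 := by
        rw [← map_sum, hsum, simplexD_simplexD]
      have h1 : ∀ i, simplexD (k := k) G A q (y i) ∈ coinvKer (ι i) G A q :=
        fun i => simplexD_mem_coinvKer (hy i)
      cases q with
      | zero =>
        exact fun i _ => coinvKer_eq_zero_of_trivial (hq.resolve_left (by simp)) (h1 i)
      | succ q => exact eq_zero_of_sum_coinvKer hι A q h1 h0
    choose! z' hz' using fun i (hi : i ∈ s) => exists_simplexD_eq _ (hdy i hi)
    let z'' : I → ((Fin (q + 2) → G) →₀ A) := fun i => if i ∈ s then z' i else 0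
    have hz'' : ∀ i ∈ s, simplexD (k := k) G A (q + 1) (z'' i) = y i := fun i hi => by
      simp only [z'', if_pos hi]
      exact hz' i hi
    have hz₁ : ∀ i, simplexD (k := k) G A (q + 1) (z'' i) ∈ coinvKer (ι i) G A (q + 1) := by
      intro i
      by_cases hi : i ∈ s
      · rw [hz'' i hi]
        exact hy i
      · simp only [z'', if_neg hi, map_zero]
        exact zero_mem _
    refine ⟨s, fun i => barClass (hρ i) (q + 1)
      ⟨coinvMk (ι i) G A (q + 2) (z'' i), coinvMk_mem_coinvCycles_succ.2 (hz₁ i)⟩, ?_⟩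
    rw [Finset.sum_congr rfl fun i _ => map_factor_barClass (hρ i) (hz₁ i)
      (coinvKer_le_id _ _ (hz₁ i)), ← map_sum, ← sub_eq_zero, ← map_sub]
    have hd : simplexD (k := k) G A (q + 1) (∑ i ∈ s, z'' i - z) = 0 := by
      rw [map_sub, map_sum, Finset.sum_congr rfl hz'', hsum, sub_self]
    obtain ⟨w, hw⟩ := exists_simplexD_eq _ hd
    refine (barClass_eq_zero_iff _ _).2 ⟨coinvMk _ G A (q + 3) w, ?_⟩
    refine (congr_arg (coinvMk (MonoidHom.id G) G A (q + 2)) hw).trans ?_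
    rw [map_sub, map_sum, Submodule.coe_sub, Submodule.coe_sum]
  · intro s x h
    choose z hz hx using fun i => exists_barClass_succ (hρ i) (x i)
    have h1 : ∑ i ∈ s, (groupHomology.map (ι i) (𝟙 (Rep.res (ι i) A)) (q + 1)).hom (x i) =
        barClass (A := A) hρ₀ (q + 1)
          (∑ i ∈ s, ⟨coinvMk _ G A (q + 2) (z i), coinvMk_mem_coinvCycles_succ.2
            (coinvKer_le_id _ _ (hz i))⟩) := by
      rw [map_sum]
      exact Finset.sum_congr rfl fun i _ => by
        rw [← hx, map_factor_barClass (hρ i) (hz i) (coinvKer_le_id _ _ (hz i))]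
    obtain ⟨w, hw⟩ := (barClass_eq_zero_iff _ _).1 (h1.symm.trans h)
    obtain ⟨w, rfl⟩ := coinvMk_surjective _ w
    rw [coinvD_mk, Submodule.coe_sum, ← map_sum, coinvMk_eq_iff] at hw
    -- The sum of the cycles `z i` is a boundary up to relations `y i` of the factors. Then the
    -- chains `z i + y i` have boundaries that sum to zero, so that each is a boundary by
    -- independence and exactness.
    obtain ⟨s', y, hy, hy0, hsum⟩ := exists_finset_sum_of_mem_iSup (coinvKer_id_le_iSup hι A _ hw)
    let z' : I → ((Fin (q + 2) → G) →₀ A) := fun i => if i ∈ s then z i else 0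
    have hz' : ∀ i, simplexD (k := k) G A (q + 1) (z' i + y i) ∈ coinvKer (ι i) G A (q + 1) := by
      intro i
      rw [map_add]
      refine add_mem ?_ (simplexD_mem_coinvKer (hy i))
      by_cases hi : i ∈ s
      · simp only [z', if_pos hi]
        exact hz i
      · simp only [z', if_neg hi, map_zero]
        exact zero_mem _
    have h2 : ∑ i ∈ s ∪ s', simplexD (k := k) G A (q + 1) (z' i + y i) = 0 := by
      rw [← map_sum, Finset.sum_add_distrib,
        ← Finset.sum_subset Finset.subset_union_right (fun i _ hi => hy0 i hi), hsum,
        ← Finset.sum_subset (s₁ := s) Finset.subset_union_left (fun i _ hi => if_neg hi),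
        Finset.sum_congr rfl (fun i hi => (if_pos hi : z' i = z i)), add_sub_cancel,
        simplexD_simplexD]
    intro i hi
    have h3 := eq_zero_of_sum_coinvKer hι A q hz' h2 i (Finset.mem_union_left _ hi)
    obtain ⟨u, hu⟩ := exists_simplexD_eq _ h3
    rw [← hx i, barClass_mk_eq_zero_iff (hρ i) (hz i)]
    refine ⟨u, ?_⟩
    rw [hu, show z' i = z i from if_pos hi, sub_add_cancel_left]
    exact neg_mem (hy i)

end FreeProductHomology

/-! ### Cohomology of free products -/

section FreeProductCohomology
variable {I k G : Type u} {Γ : I → Type u} [∀ i, Group (Γ i)] [Group G] [CommRing k]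
  {ι : ∀ i, Γ i →* G} (hι : Function.Bijective (Monoid.CoprodI.lift ι)) {A : Rep.{u} k G}

lemma mem_invCochains_iff_funAction {Γ X : Type u} [Group Γ] [MulAction G X] {ι : Γ →* G} {m : ℕ}
    {F : (Fin m → X) → A} :
    F ∈ invCochains ι X A m ↔ ∀ γ, funAction (Fin m → X) A (ι γ) F - F = 0 :=
  ⟨fun h γ => sub_eq_zero.2 (h γ), fun h γ => sub_eq_zero.1 (h γ)⟩

lemma simplexDelta_funAction {X : Type u} [MulAction G X] {m : ℕ} (g : G) (F : (Fin m → X) → A) :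
    simplexDelta (k := k) X A m (funAction (Fin m → X) A g F) =
      funAction (Fin (m + 1) → X) A g (simplexDelta (k := k) X A m F) :=
  simplexDelta_cosimplexMap (g⁻¹ • ·) (A.ρ g) F

/-- A derivation with values in the cochains of positive length, which form a coinduced module, is
inner. -/
lemma exists_inner_derivation (m : ℕ) {D : G → (Fin (m + 1) → G) → A}
    (hD : ∀ x y, D (x * y) = D x + funAction (Fin (m + 1) → G) A x (D y)) :
    ∃ b, ∀ x, D x = funAction (Fin (m + 1) → G) A x b - b := by
  refine ⟨fun y => -D (y 0) y, fun x => funext fun y => ?_⟩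
  have h := congr_fun (hD x (x⁻¹ * y 0)) y
  rw [mul_inv_cancel_left] at h
  change D (y 0) y = D x y + A.ρ x (D (x⁻¹ * y 0) (x⁻¹ • y)) at h
  change D x y = A.ρ x (-D (x⁻¹ * y 0) (x⁻¹ • y)) - -D (y 0) y
  rw [h, map_neg]
  abel

include hι in
/-- Cochains `b i`, given for each factor of a free product, can be replaced by a single cochain
that differs from `b i` by a cochain invariant under the factor `i`. Moreover, it is invariant
modulo a submodule `M` if each `b i` is so under the factor `i`. -/
lemma exists_forall_sub_mem_invCochains {m : ℕ} (hm : 1 ≤ m ∨ ∀ g, A.ρ g = 1)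
    (b : I → (Fin m → G) → A) :
    ∃ b', (∀ i, b' - b i ∈ invCochains (ι i) G A m) ∧
      ∀ {M : Submodule k ((Fin m → G) → A)} (_ : ∀ g, ∀ z ∈ M, funAction (Fin m → G) A g z ∈ M)
        (_ : ∀ i γ, funAction (Fin m → G) A (ι i γ) (b i) - b i ∈ M) (g : G),
        funAction (Fin m → G) A g b' - b' ∈ M := by
  cases m with
  | zero =>
    have hA := hm.resolve_left (by simp)
    have h0 : ∀ g F, funAction (Fin 0 → G) A g F = F := fun g F => funext fun y => by
      change A.ρ g (F (g⁻¹ • y)) = F y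
      rw [hA, Subsingleton.elim (g⁻¹ • y) y]
      rfl
    refine ⟨0, fun i => ?_, fun _ _ g => ?_⟩
    · exact mem_invCochains_iff_funAction.2 fun γ => by rw [h0, sub_self]
    · rw [map_zero, sub_zero]
      exact zero_mem _
  | succ m =>
    let σ := funAction (Fin (m + 1) → G) A
    -- The coboundaries `γ ↦ γ (b i) - b i` extend to a derivation on the free product.
    obtain ⟨D, hD, hDι⟩ := exists_derivation hι σ (fun i γ => σ (ι i γ) (b i) - b i)
      (fun i γ γ' => by rw [map_mul, map_mul, map_sub, Module.End.mul_apply]; abel)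
    obtain ⟨b', hb'⟩ := exists_inner_derivation m hD
    refine ⟨b', fun i => mem_invCochains_iff_funAction.2 fun γ => ?_, fun {M} hM hb g => ?_⟩
    · rw [map_sub, sub_sub_sub_comm, ← hb', hDι, sub_self]
    · rw [← hb']
      refine coprodI_induction hι (p := fun g => D g ∈ M) ?_ (fun i γ => ?_)
        (fun x y hx hy => ?_) g
      · rw [hb', map_one, Module.End.one_apply, sub_self]
        exact zero_mem _
      · rw [hDι]
        exact hb i γ
      · rw [hD]
        exact add_mem hx (hM _ _ hy)

/-- The restriction to one factor, on the classes of cocycles. -/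
lemma map_factor_cobarClass {Γ : Type u} [Group Γ] (ι : Γ →* G) {q : ℕ} {F : (Fin (q + 1) → G) → A}
    (hF : F ∈ invCocycles (MonoidHom.id G) G A q) (hF' : F ∈ invCocycles ι G A q) :
    (groupCohomology.map ι (𝟙 (Rep.res ι A)) q).hom
        (cobarClass (MonoidHom.id G) (1 : G) A q ⟨F, hF⟩) =
      cobarClass ι (1 : G) A q ⟨F, hF'⟩ :=
  map_cobarClass (A := A) (A' := A) (ι := ι) (ι' := MonoidHom.id G) (1 : G) (1 : G) ι id
    (fun _ _ => rfl) LinearMap.id (fun _ _ => rfl) (𝟙 (Rep.res ι A)) (fun _ => rfl) ⟨F, hF⟩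

lemma invCocycles_id_le {Γ : Type u} [Group Γ] (ι : Γ →* G) {q : ℕ} :
    invCocycles (MonoidHom.id G) G A q ≤ invCocycles ι G A q := fun _ h =>
  ⟨fun γ => h.1 (ι γ), h.2⟩

include hι in
/-- The cohomology of a free product in degree `q + 1` is the product of the cohomologies of the
factors, if `q + 1 > 1` or if the action on the coefficients is trivial. -/
lemma isInternalProd_cohomology_freeProduct (q : ℕ) (hq : 1 ≤ q ∨ ∀ g, A.ρ g = 1) :
    IsInternalProd fun i =>
      (groupCohomology.map (ι i) (𝟙 (Rep.res (ι i) A)) (q + 1)).hom := by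
  choose ρ hρ using fun i => exists_equivariant_of_injective (coprodI_injective hι i)
  have hρ₀ : ∀ γ x : G, (id : G → G) (MonoidHom.id G γ • x) = γ * x := fun _ _ => rfl
  constructor
  · intro v hv
    obtain ⟨⟨c, hc⟩, rfl⟩ := cobarClass_surjective (ι := MonoidHom.id G) hρ₀ (1 : G) (q + 1) v
    have h1 : ∀ i, c ∈ invCoboundaries (ι i) G A (q + 1) := fun i => by
      rw [← cobarClass_eq_zero_iff (hρ i) (1 : G) ⟨c, invCocycles_id_le (ι i) hc⟩]
      exact (map_factor_cobarClass (ι i) hc _).symm.trans (hv i)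
    choose b hb hbc using h1
    -- The cocycle `c` is the coboundary of some `b₀`, and of an invariant cochain `b i` for each
    -- factor. The differences `b i - b₀` are coboundaries, and gluing them makes `b₀` invariant
    -- under all factors.
    obtain ⟨b₀, hb₀⟩ := exists_simplexDelta_eq c hc.2
    choose u hu using fun i => exists_simplexDelta_eq (b i - b₀) (by rw [map_sub, hbc, hb₀, sub_self])
    obtain ⟨u', hu', -⟩ := exists_forall_sub_mem_invCochains hι hq u
    refine (cobarClass_eq_zero_iff (ι := MonoidHom.id G) hρ₀ (1 : G) _).2
      ⟨b₀ + simplexDelta (k := k) G A q u', ?_, ?_⟩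
    · have h2 : ∀ i, b₀ + simplexDelta (k := k) G A q u' ∈ invCochains (ι i) G A (q + 1) := by
        intro i
        have : b₀ + simplexDelta (k := k) G A q u' =
            b i + simplexDelta (k := k) G A q (u' - u i) := by
          rw [map_sub, hu]
          abel
        rw [this]
        exact add_mem (hb i) (simplexDelta_mem_invCochains (hu' i))
      refine coprodI_induction hι ?_ (fun i γ => h2 i γ) fun x y hx hy => ?_
      · rw [map_one]
        rfl
      · rw [map_mul, Module.End.mul_apply, hy, hx]
    · rw [map_add, simplexDelta_simplexDelta, add_zero, hb₀]
  · intro x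
    choose c hx using fun i => cobarClass_surjective (hρ i) (1 : G) (q + 1) (x i)
    choose b hb using fun i => exists_simplexDelta_eq (c i).1 (c i).2.2
    -- The cocycles `c i` are coboundaries of cochains `b i`. Gluing these gives a cochain that is
    -- invariant modulo cocycles, so its coboundary is invariant.
    obtain ⟨b', hb', hM⟩ := exists_forall_sub_mem_invCochains hι (Or.inl (Nat.succ_pos q)) b
    have hF : simplexDelta (k := k) G A (q + 1) b' ∈ invCocycles (MonoidHom.id G) G A (q + 1) := by
      refine ⟨mem_invCochains_iff_funAction.2 fun g => ?_, simplexDelta_simplexDelta b'⟩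
      have := hM (M := LinearMap.ker (simplexDelta (k := k) G A (q + 1)))
        (fun g z hz => by rw [LinearMap.mem_ker, simplexDelta_funAction, LinearMap.mem_ker.1 hz,
          map_zero])
        (fun i γ => by
          rw [LinearMap.mem_ker, map_sub, simplexDelta_funAction, hb]
          exact mem_invCochains_iff_funAction.1 (c i).2.1 γ) g
      rw [LinearMap.mem_ker, map_sub, simplexDelta_funAction] at this
      exact this
    refine ⟨cobarClass (MonoidHom.id G) (1 : G) A (q + 1) ⟨_, hF⟩, fun i => ?_⟩
    refine (map_factor_cobarClass (ι i) hF (invCocycles_id_le (ι i) hF)).trans ?_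
    rw [← hx, ← sub_eq_zero, ← map_sub]
    refine (cobarClass_eq_zero_iff (hρ i) (1 : G) _).2 ⟨b' - b i, hb' i, ?_⟩
    rw [map_sub, hb]
    rfl

end FreeProductCohomology

/-! ### Malnormality of free factors -/

section Malnormal
variable {I : Type*} {Γ : I → Type*} [∀ i, Group (Γ i)]

/-- The factors of a free product are malnormal: an element that conjugates a nontrivial element of
a factor into that factor lies in it. -/
lemma coprodI_exists_eq_of {i : I} {a c : Γ i} (ha : a ≠ 1) {w : Monoid.CoprodI Γ}
    (h : w * Monoid.CoprodI.of a * w⁻¹ = Monoid.CoprodI.of c) :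
    ∃ b : Γ i, w = Monoid.CoprodI.of b := by
  classical
  -- Write `w⁻¹` as the product of a head in the factor `i` and a tail that does not start with a
  -- letter of this factor.
  obtain ⟨p, hp⟩ : ∃ p : Monoid.CoprodI.Word.Pair Γ i,
      Monoid.CoprodI.of p.head * p.tail.prod = w⁻¹ := by
    refine ⟨Monoid.CoprodI.Word.equivPair i (Monoid.CoprodI.Word.equiv w⁻¹), ?_⟩
    rw [← Monoid.CoprodI.Word.prod_rcons, ← Monoid.CoprodI.Word.equivPair_symm,
      Equiv.symm_apply_apply]
    exact Monoid.CoprodI.Word.equiv.symm_apply_apply w⁻¹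
  by_cases ht : p.tail = Monoid.CoprodI.Word.empty
  · refine ⟨p.head⁻¹, ?_⟩
    rw [ht, Monoid.CoprodI.Word.prod_empty, mul_one] at hp
    rw [map_inv, hp, inv_inv]
  · exfalso
    obtain ⟨j, l, v, hv⟩ := Monoid.CoprodI.NeWord.of_word p.tail ht
    have hji : j ≠ i := by
      have := p.fstIdx_ne
      rw [← hv] at this
      intro hji
      refine this ?_
      change v.toList.head?.map Sigma.fst = some i
      rw [Monoid.CoprodI.NeWord.toList_head?, Option.map_some]
      exact congr_arg some hji
    have hvp : v.prod = p.tail.prod := by rw [← hv]; rfl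
    have hb : p.head⁻¹ * a * p.head ≠ 1 := fun hb => ha (by
      have := congr_arg (fun y => p.head * y * p.head⁻¹) hb
      simpa [mul_assoc] using this)
    have hw : w = (Monoid.CoprodI.of p.head * v.prod)⁻¹ := by rw [hvp, hp, inv_inv]
    -- With a nontrivial tail `v`, the conjugate is a reduced word of at least three letters, of
    -- the form `v⁻¹ b v`, and cannot be equal to a single letter.
    let W := Monoid.CoprodI.NeWord.append (Monoid.CoprodI.NeWord.append v.inv hji
      (Monoid.CoprodI.NeWord.singleton _ hb)) hji.symm v
    have hW : W.prod = Monoid.CoprodI.of c := by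
      rw [← h, hw, Monoid.CoprodI.NeWord.append_prod, Monoid.CoprodI.NeWord.append_prod,
        Monoid.CoprodI.NeWord.inv_prod, Monoid.CoprodI.NeWord.prod_singleton, map_mul, map_mul,
        map_inv]
      group
    have hc : c ≠ 1 := fun hc => ha (by
      rw [hc, map_one, mul_inv_eq_one, mul_eq_left] at h
      exact Monoid.CoprodI.of_injective i (h.trans (map_one _).symm))
    have hWw : W.toWord = (Monoid.CoprodI.NeWord.singleton c hc).toWord :=
      Monoid.CoprodI.Word.equiv.symm.injective
        (hW.trans (Monoid.CoprodI.NeWord.prod_singleton c hc).symm)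
    have hl := congr_arg (fun u : Monoid.CoprodI.Word Γ => u.toList.length) hWw
    change ((v.inv.toList ++ [_]) ++ v.toList).length = 1 at hl
    have := List.length_pos_iff.2 v.toList_ne_nil
    have := List.length_pos_iff.2 v.inv.toList_ne_nil
    simp only [List.length_append, List.length_cons, List.length_nil] at hl
    omega

end Malnormal

/-! ### Cohen–Lyndon triples -/

section Triple
variable {G Λ : Type u} [Group G] (H : Λ → Subgroup G) (N : ∀ l, Subgroup (H l))

/-- The homomorphism `N l → ⟪N⟫` given by conjugation by `t`. -/
def conjToKernel (l : Λ) (t : G) : N l →* tripleKernel H N :=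
  (MulAut.conjNormal (H := tripleKernel H N) t).toMonoidHom.comp
    (subgroupHom (H l).subtype (le_comap_tripleKernel H N l))

variable {H N}

/-- In a Cohen–Lyndon triple, `⟪N⟫` is the free product of the groups `N l`, one copy for each
element of the transversal, mapped to `⟪N⟫` by conjugation. -/
lemma IsCohenLyndonTriple.exists_transversal (hCL : IsCohenLyndonTriple H N) :
    ∃ T : Λ → Set G,
      (∀ l (g : G), ∃ t ∈ T l, ∃ h : H l, ∃ m ∈ tripleKernel H N, t * h * m = g) ∧
      Function.Bijective (Monoid.CoprodI.lift fun i : Σ l, T l =>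
        conjToKernel H N i.1 (i.2 : G)) := by
  obtain ⟨T, hT, hinj, hrange⟩ := hCL
  refine ⟨T, fun l g => ?_, ?_⟩
  · obtain ⟨⟨t, x⟩, hx, -⟩ := (hT l).existsUnique g
    obtain ⟨h, hh, m, hm, e⟩ := Subgroup.mem_sup_of_normal_right.1 x.2
    refine ⟨t, t.2, ⟨h, hh⟩, m, hm, ?_⟩
    rw [← hx, ← e, ← mul_assoc]
  -- By definition, `⟪N⟫` is the free product of its subgroups `t (N l) t⁻¹`; conjugation by `t`
  -- identifies them with the groups `N l`.
  · let conj : (Σ l, T l) → Subgroup G := fun i =>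
      (subgroupOfG H N i.1).map (MulAut.conj (i.2 : G)).toMonoidHom
    let toG : Monoid.CoprodI (fun i => conj i) →* G :=
      Monoid.CoprodI.lift fun i => (conj i).subtype
    change Function.Injective toG at hinj
    change toG.range = _ at hrange
    let c : ∀ i : Σ l, T l, N i.1 →* conj i := fun i =>
      { toFun := fun n => ⟨i.2 * n * (i.2 : G)⁻¹, n, ⟨n, n.2, rfl⟩, rfl⟩
        map_one' := Subtype.ext (by simp)
        map_mul' := fun x y => Subtype.ext (by simp [mul_assoc]) }
    have hc : ∀ i, Function.Bijective (c i) := fun i => by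
      refine ⟨fun x y h => Subtype.ext (Subtype.ext ?_), ?_⟩
      · have h' : (i.2 : G) * x * (i.2 : G)⁻¹ = i.2 * y * (i.2 : G)⁻¹ := congr_arg Subtype.val h
        simpa using h'
      · rintro ⟨_, _, ⟨n, hn, rfl⟩, rfl⟩
        exact ⟨⟨n, hn⟩, rfl⟩
    let C := Monoid.CoprodI.lift fun i => (Monoid.CoprodI.of (M := fun i => conj i)).comp (c i)
    let D := Monoid.CoprodI.lift fun i => (Monoid.CoprodI.of (M := fun i : Σ l, T l => N i.1)
      (i := i)).comp (MulEquiv.ofBijective (c i) (hc i)).symm.toMonoidHom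
    have hDC : D.comp C = MonoidHom.id _ := Monoid.CoprodI.ext_hom _ _ fun i =>
      MonoidHom.ext fun n => by
        change D (C (Monoid.CoprodI.of (M := fun i : Σ l, T l => N i.1) (i := i) n)) = _
        rw [Monoid.CoprodI.lift_of]
        change D (Monoid.CoprodI.of (c i n)) = _
        rw [Monoid.CoprodI.lift_of]
        exact congr_arg (Monoid.CoprodI.of (M := fun i : Σ l, T l => N i.1) (i := i))
          ((MulEquiv.ofBijective (c i) (hc i)).symm_apply_apply n)
    have hCD : C.comp D = MonoidHom.id _ := Monoid.CoprodI.ext_hom _ _ fun i =>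
      MonoidHom.ext fun n => by
        change C (D (Monoid.CoprodI.of (M := fun i => conj i) n)) = _
        rw [Monoid.CoprodI.lift_of]
        change C (Monoid.CoprodI.of ((MulEquiv.ofBijective (c i) (hc i)).symm n)) = _
        rw [Monoid.CoprodI.lift_of]
        exact congr_arg (Monoid.CoprodI.of (M := fun i => conj i))
          ((MulEquiv.ofBijective (c i) (hc i)).apply_symm_apply n)
    have hL : (tripleKernel H N).subtype.comp (Monoid.CoprodI.lift fun i : Σ l, T l =>
        conjToKernel H N i.1 (i.2 : G)) = toG.comp C := Monoid.CoprodI.ext_hom _ _ fun i =>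
      MonoidHom.ext fun n => by
        change ((Monoid.CoprodI.lift (fun i : Σ l, T l => conjToKernel H N i.1 (i.2 : G))
          (Monoid.CoprodI.of n) : tripleKernel H N) : G) = toG (C (Monoid.CoprodI.of n))
        rw [Monoid.CoprodI.lift_of, Monoid.CoprodI.lift_of]
        change _ = toG (Monoid.CoprodI.of (c i n))
        rw [Monoid.CoprodI.lift_of]
        rfl
    constructor
    · intro x y hxy
      have h1 : toG (C x) = toG (C y) := by
        have := congr_arg (tripleKernel H N).subtype hxy
        exact (DFunLike.congr_fun hL x).symm.trans (this.trans (DFunLike.congr_fun hL y))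
      have h2 := congr_arg D (hinj h1)
      exact (DFunLike.congr_fun hDC x).symm.trans (h2.trans (DFunLike.congr_fun hDC y))
    · intro m
      obtain ⟨w, hw⟩ : (m : G) ∈ toG.range := by rw [hrange]; exact m.2
      refine ⟨D w, Subtype.ext ?_⟩
      refine (DFunLike.congr_fun hL (D w)).trans (Eq.trans ?_ hw)
      exact congr_arg toG (DFunLike.congr_fun hCD w)

variable [∀ l, (N l).Normal]

/-- Malnormality of the free factors of `⟪N⟫` forces `H l ∩ ⟪N⟫ = N l` unless `N l` is trivial. -/
lemma IsCohenLyndonTriple.injective_or_subsingleton (hCL : IsCohenLyndonTriple H N) (l : Λ) :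
    Function.Injective (tripleQuotientMap H N l) ∨ Subsingleton (N l) := by
  obtain ⟨T, hT, hb⟩ := hCL.exists_transversal
  by_cases hN : ∃ n : N l, n ≠ 1
  · left
    obtain ⟨n, hn⟩ := hN
    refine (injective_iff_map_eq_one _).2 fun h hh => ?_
    induction h using QuotientGroup.induction_on with | H h => ?_
    have hM : (h : G) ∈ tripleKernel H N := (QuotientGroup.eq_one_iff _).1 hh
    refine (QuotientGroup.eq_one_iff _).2 ?_
    -- The coset of `1` is represented by some `t = m⁻¹ h'⁻¹`. The element `m⁻¹ h m` of `⟪N⟫`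
    -- normalizes the free factor `t (N l) t⁻¹`, and it lies in this factor by malnormality.
    obtain ⟨t, ht, h', m, hm, e⟩ := hT l 1
    have et : t = m⁻¹ * (h' : G)⁻¹ := by
      rw [mul_assoc, mul_eq_one_iff_eq_inv] at e
      rw [e, mul_inv_rev]
    let i : Σ l, T l := ⟨l, t, ht⟩
    let w : tripleKernel H N := ⟨m⁻¹ * h * m, mul_mem (mul_mem (inv_mem hm) hM) hm⟩
    obtain ⟨x, hx⟩ := hb.2 w
    have hc : h' * h * h'⁻¹ * n * (h' * h * h'⁻¹)⁻¹ ∈ N l :=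
      Subgroup.Normal.conj_mem inferInstance _ n.2 _
    obtain ⟨b, hb'⟩ := coprodI_exists_eq_of (Γ := fun i : Σ l, T l => N i.1) (i := i) (w := x)
      (a := n) (c := ⟨_, hc⟩) hn (hb.1 (by
        rw [map_mul, map_mul, map_inv, hx, Monoid.CoprodI.lift_of, Monoid.CoprodI.lift_of]
        refine Subtype.ext ?_
        change m⁻¹ * h * m * (t * n * t⁻¹) * (m⁻¹ * h * m)⁻¹ =
          t * (h' * h * (h' : G)⁻¹ * n * (h' * h * (h' : G)⁻¹)⁻¹) * t⁻¹
        rw [et]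
        group))
    have hw : m⁻¹ * h * m = t * b * t⁻¹ := by
      rw [hb', Monoid.CoprodI.lift_of] at hx
      exact (congr_arg Subtype.val hx).symm
    have : h = h'⁻¹ * b * h'⁻¹⁻¹ := Subtype.ext (by
      change (h : G) = (h' : G)⁻¹ * b * (h' : G)⁻¹⁻¹
      have := congr_arg (fun y => m * y * m⁻¹) hw
      rw [et] at this
      simpa [mul_assoc] using this)
    rw [this]
    exact Subgroup.Normal.conj_mem inferInstance _ b.2 _
  · right
    push Not at hN
    exact ⟨fun x y => (hN x).trans (hN y).symm⟩

end Triple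

section InternalSum
variable {k : Type*} [CommRing k] {I : Type*} {V V' : I → Type*} [∀ i, AddCommGroup (V i)]
  [∀ i, Module k (V i)] [∀ i, AddCommGroup (V' i)] [∀ i, Module k (V' i)]
  {W : Type*} [AddCommGroup W] [Module k W]

lemma IsInternalSum.comp_bijective {f : ∀ i, V i →ₗ[k] W} (hf : IsInternalSum f)
    (e : ∀ i, V' i →ₗ[k] V i) (he : ∀ i, Function.Bijective (e i)) :
    IsInternalSum fun i => f i ∘ₗ e i := by
  constructor
  · intro w
    obtain ⟨s, x, rfl⟩ := hf.1 w
    choose y hy using fun i => (he i).2 (x i)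
    exact ⟨s, y, Finset.sum_congr rfl fun i _ => congr_arg (f i) (hy i)⟩
  · intro s x hx i hi
    exact (he i).1 ((hf.2 s (fun i => e i (x i)) hx i hi).trans (map_zero _).symm)

lemma IsInternalProd.comp_bijective {f : ∀ i, W →ₗ[k] V i} (hf : IsInternalProd f)
    (e : ∀ i, V i →ₗ[k] V' i) (he : ∀ i, Function.Bijective (e i)) :
    IsInternalProd fun i => e i ∘ₗ f i := by
  constructor
  · exact fun w hw => hf.1 w fun i => (he i).1 ((hw i).trans (map_zero _).symm)
  · intro x
    choose y hy using fun i => (he i).2 (x i)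
    obtain ⟨w, hw⟩ := hf.2 y
    exact ⟨w, fun i => (congr_arg (e i) (hw i)).trans (hy i)⟩

end InternalSum

/-! ### Homology and cohomology of the kernel of a Cohen–Lyndon triple -/

section Triple
variable {k : Type u} [CommRing k] {G Λ : Type u} [Group G] (H : Λ → Subgroup G)
  (N : ∀ l, Subgroup (H l)) (A : Rep.{u} k G)

/-- The action of `t` on `A`, as an isomorphism from `A` to its restriction along
`conjToKernel H N l t`. -/
def conjCoeffIso (l : Λ) (t : G) : Rep.res (N l).subtype (Rep.res (H l).subtype A) ≅
    Rep.res (conjToKernel H N l t) (Rep.res (tripleKernel H N).subtype A) where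
  hom := Rep.ofHom (ρ := (A.ρ.comp (H l).subtype).comp (N l).subtype)
    (σ := (A.ρ.comp (tripleKernel H N).subtype).comp (conjToKernel H N l t))
    { toLinearMap := A.ρ t
      isIntertwining' := fun n => by
        change A.ρ t * A.ρ n = A.ρ (t * n * t⁻¹) * A.ρ t
        rw [← map_mul, ← map_mul, inv_mul_cancel_right] }
  inv := Rep.ofHom (σ := (A.ρ.comp (H l).subtype).comp (N l).subtype)
    (ρ := (A.ρ.comp (tripleKernel H N).subtype).comp (conjToKernel H N l t))
    { toLinearMap := A.ρ t⁻¹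
      isIntertwining' := fun n => by
        change A.ρ t⁻¹ * A.ρ (t * n * t⁻¹) = A.ρ n * A.ρ t⁻¹
        rw [← map_mul, ← map_mul, mul_assoc t, inv_mul_cancel_left] }
  hom_inv_id := Rep.hom_ext (Representation.IntertwiningMap.ext (LinearMap.ext fun a => A.ρ.inv_self_apply t a))
  inv_hom_id := Rep.hom_ext (Representation.IntertwiningMap.ext (LinearMap.ext fun a => A.ρ.self_inv_apply t a))

variable [∀ l, (N l).Normal]

lemma homologyRep_ρ_mk (M : Subgroup G) [M.Normal] (q : ℕ) (g : G) :
    (homologyRep M A q).ρ (g : G ⧸ M) =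
      (groupHomology.map (MulAut.conjNormal (H := M) g).toMonoidHom (conjHom M A g) q).hom := rfl

lemma cohomologyRep_ρ_mk (M : Subgroup G) [M.Normal] (q : ℕ) (g : G) :
    (cohomologyRep M A q).ρ (g : G ⧸ M) = (groupCohomology.map
      (MulAut.conjNormal (H := M) g⁻¹).toMonoidHom (conjCoHom M A g) q).hom := rfl

lemma tripleHomologyMap_toLinearMap (l : Λ) (q : ℕ) :
    (tripleHomologyMap H N A l q).hom.toLinearMap = (groupHomology.map
      (subgroupHom (H l).subtype (le_comap_tripleKernel H N l))
      (resHom (H l).subtype (le_comap_tripleKernel H N l) (𝟙 (Rep.res (H l).subtype A))) q).hom :=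
  rfl

lemma tripleCohomologyMap_toLinearMap (l : Λ) (q : ℕ) :
    (tripleCohomologyMap H N A l q).hom.toLinearMap = (groupCohomology.map
      (subgroupHom (H l).subtype (le_comap_tripleKernel H N l))
      (resCoHom (H l).subtype (le_comap_tripleKernel H N l) (𝟙 (Rep.res (H l).subtype A))) q).hom :=
  rfl

/-- The translate by `t` of the map `H_q(N l; A) → H_q(⟪N⟫; A)` is induced by the conjugation `N l
→ ⟪N⟫` by `t`, up to the isomorphism given by the action of `t` on the coefficients. -/
lemma tripleHomologyMap_conj (l : Λ) (t : G) (q : ℕ) :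
    (homologyRep (tripleKernel H N) A q).ρ (t : G ⧸ tripleKernel H N) ∘ₗ
      (tripleHomologyMap H N A l q).hom.toLinearMap =
    (groupHomology.map (conjToKernel H N l t) (𝟙 (Rep.res (conjToKernel H N l t)
      (Rep.res (tripleKernel H N).subtype A))) q).hom ∘ₗ
      (groupHomology.map (MonoidHom.id (N l)) (conjCoeffIso H N A l t).hom q).hom := by
  have key : groupHomology.map (subgroupHom (H l).subtype (le_comap_tripleKernel H N l))
      (resHom (H l).subtype (le_comap_tripleKernel H N l) (𝟙 (Rep.res (H l).subtype A))) q ≫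
      groupHomology.map (MulAut.conjNormal (H := tripleKernel H N) t).toMonoidHom
        (conjHom (tripleKernel H N) A t) q =
      groupHomology.map (MonoidHom.id (N l)) (conjCoeffIso H N A l t).hom q ≫
      groupHomology.map (conjToKernel H N l t) (𝟙 (Rep.res (conjToKernel H N l t)
        (Rep.res (tripleKernel H N).subtype A))) q := by
    refine homologyMap_sq q ?_
    rw [← groupHomology.chainsMap_comp, ← groupHomology.chainsMap_comp]
    exact groupHomology.chainsMap_congr (MonoidHom.ext fun n => Subtype.ext rfl)
      (LinearMap.ext fun a => rfl)
  rw [homologyRep_ρ_mk, tripleHomologyMap_toLinearMap]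
  exact congr_arg ModuleCat.Hom.hom key

/-- The translate by `t` of the map `H^q(⟪N⟫; A) → H^q(N l; A)` is induced by the conjugation `N l
→ ⟪N⟫` by `t`, up to the isomorphism given by the action of `t` on the coefficients. -/
lemma tripleCohomologyMap_conj (l : Λ) (t : G) (q : ℕ) :
    (tripleCohomologyMap H N A l q).hom.toLinearMap ∘ₗ
      (cohomologyRep (tripleKernel H N) A q).ρ (t : G ⧸ tripleKernel H N)⁻¹ =
    (groupCohomology.map (MonoidHom.id (N l)) (conjCoeffIso H N A l t).inv q).hom ∘ₗ
    (groupCohomology.map (conjToKernel H N l t) (𝟙 (Rep.res (conjToKernel H N l t)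
      (Rep.res (tripleKernel H N).subtype A))) q).hom := by
  have key : groupCohomology.map (MulAut.conjNormal (H := tripleKernel H N) t⁻¹⁻¹).toMonoidHom
        (conjCoHom (tripleKernel H N) A t⁻¹) q ≫
      groupCohomology.map (subgroupHom (H l).subtype (le_comap_tripleKernel H N l))
        (resCoHom (H l).subtype (le_comap_tripleKernel H N l) (𝟙 (Rep.res (H l).subtype A))) q =
      groupCohomology.map (conjToKernel H N l t) (𝟙 (Rep.res (conjToKernel H N l t)
        (Rep.res (tripleKernel H N).subtype A))) q ≫
      groupCohomology.map (MonoidHom.id (N l)) (conjCoeffIso H N A l t).inv q := by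
    refine homologyMap_sq q ?_
    rw [← groupCohomology.cochainsMap_comp, ← groupCohomology.cochainsMap_comp]
    exact groupCohomology.cochainsMap_congr (MonoidHom.ext fun n => Subtype.ext
      (by change (t⁻¹)⁻¹ * n * (t⁻¹)⁻¹⁻¹ = t * n * t⁻¹; rw [inv_inv]))
      (LinearMap.ext fun a => rfl)
  rw [← QuotientGroup.mk_inv, cohomologyRep_ρ_mk, tripleCohomologyMap_toLinearMap]
  exact congr_arg ModuleCat.Hom.hom key

lemma bijective_groupHomology_map_of_isIso {Γ : Type u} [Group Γ] {B B' : Rep.{u} k Γ}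
    (φ : B ⟶ B') [IsIso φ] (q : ℕ) :
    Function.Bijective (groupHomology.map (MonoidHom.id Γ) φ q).hom :=
  ConcreteCategory.bijective_of_isIso ((groupHomology.functor k Γ q).map φ)

lemma bijective_groupCohomology_map_of_isIso {Γ : Type u} [Group Γ] {B B' : Rep.{u} k Γ}
    (φ : B ⟶ B') [IsIso φ] (q : ℕ) :
    Function.Bijective (groupCohomology.map (MonoidHom.id Γ) φ q).hom :=
  ConcreteCategory.bijective_of_isIso ((groupCohomology.functor k Γ q).map φ)

variable {H N} {T : Λ → Set G}

/-- `H_q(⟪N⟫; A)` is the direct sum of the translates of the images of the modules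
`H_q(N l; A)`. -/
lemma isInternalSum_tripleHomology (hT : Function.Bijective (Monoid.CoprodI.lift
      fun i : Σ l, T l => conjToKernel H N i.1 (i.2 : G))) (q : ℕ)
    (hq : 1 ≤ q ∨ ∀ g ∈ tripleKernel H N, A.ρ g = 1) :
    IsInternalSum fun i : Σ l, T l =>
      (homologyRep (tripleKernel H N) A (q + 1)).ρ ((i.2 : G) : G ⧸ tripleKernel H N) ∘ₗ
        (tripleHomologyMap H N A i.1 (q + 1)).hom.toLinearMap := by
  have h := isInternalSum_homology_freeProduct (A := Rep.res (tripleKernel H N).subtype A) hT q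
    (hq.imp_right fun h g => h g g.2)
  have h' := h.comp_bijective (fun i => (groupHomology.map (MonoidHom.id (N i.1))
    (conjCoeffIso H N A i.1 (i.2 : G)).hom (q + 1)).hom) fun i =>
      bijective_groupHomology_map_of_isIso (conjCoeffIso H N A i.1 (i.2 : G)).hom (q + 1)
  have e : ∀ i : Σ l, T l, _ = _ := fun i => tripleHomologyMap_conj H N A i.1 (i.2 : G) (q + 1)
  simp only [← e] at h'
  exact h'

/-- `H^q(⟪N⟫; A)` is the product of the modules `H^q(N l; A)`, one copy for each element of the
transversal. -/
lemma isInternalProd_tripleCohomology (hT : Function.Bijective (Monoid.CoprodI.lift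
      fun i : Σ l, T l => conjToKernel H N i.1 (i.2 : G))) (q : ℕ)
    (hq : 1 ≤ q ∨ ∀ g ∈ tripleKernel H N, A.ρ g = 1) :
    IsInternalProd fun i : Σ l, T l =>
      (tripleCohomologyMap H N A i.1 (q + 1)).hom.toLinearMap ∘ₗ
      (cohomologyRep (tripleKernel H N) A (q + 1)).ρ ((i.2 : G) : G ⧸ tripleKernel H N)⁻¹ := by
  have h := isInternalProd_cohomology_freeProduct (A := Rep.res (tripleKernel H N).subtype A) hT q
    (hq.imp_right fun h g => h g g.2)
  have h' := h.comp_bijective (fun i => (groupCohomology.map (MonoidHom.id (N i.1))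
    (conjCoeffIso H N A i.1 (i.2 : G)).inv (q + 1)).hom) fun i =>
      bijective_groupCohomology_map_of_isIso (conjCoeffIso H N A i.1 (i.2 : G)).inv (q + 1)
  have e : ∀ i : Σ l, T l, _ = _ := fun i => tripleCohomologyMap_conj H N A i.1 (i.2 : G) (q + 1)
  simp only [← e] at h'
  exact h'

end Triple

/-! ### Sums of induced and products of coinduced modules -/

section Induced
variable {k Q Λ : Type u} [CommRing k] [Group Q] {Γ : Λ → Type u} [∀ l, Group (Γ l)]
  {π : ∀ l, Γ l →* Q} {V : Rep.{u} k Q} {W : ∀ l, Rep.{u} k (Γ l)} {S : Λ → Type u}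

/-- The morphisms `j l` exhibit `V` as the direct sum of the modules induced from the `W l` along
the homomorphisms `π l`: for elements `s l t` that meet all left cosets of the image of `π l`, the
module `V` is the direct sum of the translates by `s l t` of the images of the `j l`. -/
structure IsInducedSum (j : ∀ l, W l ⟶ Rep.res (π l) V) (s : ∀ l, S l → Q) : Prop where
  exists_mul : ∀ l g, ∃ t h, s l t * π l h = g
  isInternalSum : IsInternalSum fun i : Σ l, S l => V.ρ (s i.1 i.2) ∘ₗ (j i.1).hom.toLinearMap

/-- The morphisms `j l` exhibit `V` as the product of the modules coinduced from the `W l` along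
the homomorphisms `π l`: for elements `s l t` that meet all left cosets of the image of `π l`, an
element `v` of `V` is given by the arbitrary values of the `j l` on its translates by the inverses
of the `s l t`. -/
structure IsInducedProd (j : ∀ l, Rep.res (π l) V ⟶ W l) (s : ∀ l, S l → Q) : Prop where
  exists_mul : ∀ l g, ∃ t h, s l t * π l h = g
  isInternalProd : IsInternalProd fun i : Σ l, S l =>
    (j i.1).hom.toLinearMap ∘ₗ V.ρ (s i.1 i.2)⁻¹

section Sum
variable {j : ∀ l, W l ⟶ Rep.res (π l) V} {s : ∀ l, S l → Q}

lemma IsInducedSum.induction (hj : IsInducedSum j s) {p : V → Prop} (h0 : p 0)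
    (hadd : ∀ v w, p v → p w → p (v + w)) (h : ∀ l g x, p (V.ρ g ((j l).hom x))) (v : V) : p v :=
  hj.isInternalSum.induction h0 hadd (fun i x => h i.1 (s i.1 i.2) x) v

lemma ρ_mul_hom (l : Λ) (g : Q) (γ : Γ l) (x : W l) :
    V.ρ (g * π l γ) ((j l).hom x) = V.ρ g ((j l).hom ((W l).ρ γ x)) := by
  rw [map_mul, Module.End.mul_apply]
  exact congr_arg (V.ρ g) (Rep.hom_comm_apply (j l) γ x).symm

/-- Linear maps on `V` are given by families of linear maps on the modules `W l`, indexed by `Q`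
and compatible with the action of the `Γ l`. -/
lemma IsInducedSum.exists_desc (hj : IsInducedSum j s) {U : Type*} [AddCommGroup U] [Module k U]
    (u : ∀ l, Q → W l →ₗ[k] U) (hu : ∀ l g γ x, u l (g * π l γ) x = u l g ((W l).ρ γ x)) :
    ∃ v : V →ₗ[k] U, ∀ l g x, v (V.ρ g ((j l).hom x)) = u l g x := by
  obtain ⟨v, hv⟩ := hj.isInternalSum.exists_desc fun i => u i.1 (s i.1 i.2)
  refine ⟨v, fun l g x => ?_⟩
  obtain ⟨t, h, rfl⟩ := hj.exists_mul l g
  rw [ρ_mul_hom, hu]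
  exact hv ⟨l, t⟩ _

/-- The universal property of a sum of induced modules. -/
lemma IsInducedSum.exists_hom (hj : IsInducedSum j s) (B : Rep.{u} k Q)
    (u : ∀ l, W l ⟶ Rep.res (π l) B) : ∃ v : V ⟶ B, ∀ l x, v.hom ((j l).hom x) = (u l).hom x := by
  obtain ⟨v, hv⟩ := hj.exists_desc (fun l g => B.ρ g ∘ₗ (u l).hom.toLinearMap)
    fun l g γ x => ρ_mul_hom l g γ x
  refine ⟨Rep.ofHom (ρ := V.ρ) (σ := B.ρ) ⟨v, fun g => LinearMap.ext fun a => ?_⟩, fun l x => ?_⟩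
  · change v (V.ρ g a) = B.ρ g (v a)
    induction a using hj.induction with
    | h0 => simp only [map_zero]
    | hadd a b ha hb => simp only [map_add, ha, hb]
    | h l g' x =>
      rw [← Module.End.mul_apply, ← map_mul, hv, hv]
      exact congr($(map_mul B.ρ g g') ((u l).hom x))
  · have := hv l 1 x
    rw [map_one, map_one] at this
    exact this

lemma IsInducedSum.hom_ext (hj : IsInducedSum j s) {B : Rep.{u} k Q} {v v' : V ⟶ B}
    (h : ∀ l x, v.hom ((j l).hom x) = v'.hom ((j l).hom x)) : v = v' := by
  refine Rep.hom_ext (Representation.IntertwiningMap.ext (LinearMap.ext fun a => ?_))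
  change v.hom a = v'.hom a
  induction a using hj.induction with
  | h0 => simp only [map_zero]
  | hadd a b ha hb => simp only [map_add, ha, hb]
  | h l g x => rw [Rep.hom_comm_apply, Rep.hom_comm_apply, h]

/-- The map from the sum of the induced modules is an isomorphism. -/
lemma IsInducedSum.isIso_desc (hj : IsInducedSum j s) :
    IsIso (Sigma.desc fun l => (Rep.indResHomEquiv.{u} (π l) (W l) V).symm (j l)) := by
  have key : ∀ (B : Rep.{u} k Q) (v : V ⟶ B) l x, (((Rep.indResHomEquiv.{u} (π l) (W l) B)
      ((Rep.indResHomEquiv.{u} (π l) (W l) V).symm (j l) ≫ v)).hom x) = v.hom ((j l).hom x) :=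
    fun B v l x => congr_arg v.hom
      congr(($((Rep.indResHomEquiv.{u} (π l) (W l) V).apply_symm_apply (j l))).hom x)
  refine (isIso_iff_coyoneda_map_bijective _).2 fun B => ⟨fun v v' h => ?_, fun w => ?_⟩
  · refine hj.hom_ext fun l x => ?_
    have h' := congr_arg (fun y => Sigma.ι _ l ≫ y) h
    simp only [colimit.ι_desc_assoc, Cofan.mk_ι_app] at h'
    rw [← key, ← key]
    exact congr(((Rep.indResHomEquiv.{u} (π l) (W l) B) $h').hom x)
  · obtain ⟨v, hv⟩ := hj.exists_hom B fun l =>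
      (Rep.indResHomEquiv.{u} (π l) (W l) B)
        (Sigma.ι (fun l => Rep.ind (π l) (W l)) l ≫ w)
    refine ⟨v, Sigma.hom_ext _ _ fun l => ?_⟩
    refine (Category.assoc _ _ _).symm.trans ?_
    rw [colimit.ι_desc, Cofan.mk_ι_app]
    refine (Rep.indResHomEquiv.{u} (π l) (W l) B).injective (Rep.hom_ext
      (Representation.IntertwiningMap.ext (LinearMap.ext fun x => ?_)))
    exact (key B v l x).trans (hv l x)

end Sum

section Prod
variable {j : ∀ l, Rep.res (π l) V ⟶ W l} {s : ∀ l, S l → Q}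

lemma hom_ρ_mul (l : Λ) (g : Q) (γ : Γ l) (v : V) :
    (j l).hom (V.ρ (π l γ * g) v) = (W l).ρ γ ((j l).hom (V.ρ g v)) := by
  rw [map_mul, Module.End.mul_apply]
  exact Rep.hom_comm_apply (j l) γ (V.ρ g v)

lemma IsInducedProd.eq_zero (hj : IsInducedProd j s) {v : V}
    (h : ∀ l g, (j l).hom (V.ρ g v) = 0) : v = 0 :=
  hj.isInternalProd.1 v fun i => h i.1 (s i.1 i.2)⁻¹

/-- Elements of `V` are given by equivariant functions from `Q` to the modules `W l`. -/
lemma IsInducedProd.exists_eq (hj : IsInducedProd j s) (u : ∀ l, Q → W l)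
    (hu : ∀ l g γ, u l (π l γ * g) = (W l).ρ γ (u l g)) :
    ∃ v : V, ∀ l g, (j l).hom (V.ρ g v) = u l g := by
  obtain ⟨v, hv⟩ := hj.isInternalProd.2 fun i => u i.1 (s i.1 i.2)⁻¹
  refine ⟨v, fun l g => ?_⟩
  obtain ⟨t, h, e⟩ := hj.exists_mul l g⁻¹
  obtain rfl : g = π l h⁻¹ * (s l t)⁻¹ := by rw [map_inv, ← mul_inv_rev, e, inv_inv]
  rw [hom_ρ_mul, hu]
  exact congr_arg _ (hv ⟨l, t⟩)

/-- The universal property of a product of coinduced modules. -/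
lemma IsInducedProd.exists_hom (hj : IsInducedProd j s) (B : Rep.{u} k Q)
    (u : ∀ l, Rep.res (π l) B ⟶ W l) : ∃ v : B ⟶ V, ∀ l x, (j l).hom (v.hom x) = (u l).hom x := by
  choose v hv using fun b : B => hj.exists_eq (fun l g => (u l).hom (B.ρ g b))
    fun l g γ => hom_ρ_mul l g γ b
  have hext : ∀ a b : V, (∀ l g, (j l).hom (V.ρ g a) = (j l).hom (V.ρ g b)) → a = b :=
    fun a b h => sub_eq_zero.1 (hj.eq_zero fun l g => by
      rw [map_sub]
      exact (map_sub (j l).hom _ _).trans (sub_eq_zero.2 (h l g)))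
  let v' : B →ₗ[k] V :=
    { toFun := v
      map_add' := fun a b => hext _ _ fun l g => by
        rw [hv, map_add, map_add, map_add (V.ρ g)]
        exact (congr_arg₂ _ (hv a l g).symm (hv b l g).symm).trans (map_add (j l).hom _ _).symm
      map_smul' := fun r b => hext _ _ fun l g => by
        rw [hv, map_smul, map_smul, map_smul (V.ρ g)]
        exact (congr_arg _ (hv b l g).symm).trans (map_smul (j l).hom r _).symm }
  refine ⟨Rep.ofHom (ρ := B.ρ) (σ := V.ρ) ⟨v', fun g => LinearMap.ext fun b =>
    hext _ _ fun l g' => ?_⟩, fun l b => ?_⟩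
  · change (j l).hom (V.ρ g' (v (B.ρ g b))) = (j l).hom (V.ρ g' (V.ρ g (v b)))
    rw [hv, ← Module.End.mul_apply, ← Module.End.mul_apply, ← map_mul, ← map_mul, hv]
  · have := hv b l 1
    rw [map_one, map_one] at this
    exact this

lemma IsInducedProd.hom_ext (hj : IsInducedProd j s) {B : Rep.{u} k Q} {v v' : B ⟶ V}
    (h : ∀ l x, (j l).hom (v.hom x) = (j l).hom (v'.hom x)) : v = v' := by
  refine Rep.hom_ext (Representation.IntertwiningMap.ext (LinearMap.ext fun a => ?_))
  change v.hom a = v'.hom a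
  refine sub_eq_zero.1 (hj.eq_zero fun l g => ?_)
  rw [map_sub, ← Rep.hom_comm_apply, ← Rep.hom_comm_apply]
  exact (map_sub (j l).hom _ _).trans (sub_eq_zero.2 (h l _))

/-- The map to the product of the coinduced modules is an isomorphism. -/
lemma IsInducedProd.isIso_lift (hj : IsInducedProd j s) :
    IsIso (Pi.lift fun l => Rep.resCoindHomEquiv.{u} (π l) V (W l) (j l)) := by
  have key : ∀ (B : Rep.{u} k Q) (v : B ⟶ V) l x, ((Rep.resCoindHomEquiv.{u} (π l) B (W l)).symm
      (v ≫ Rep.resCoindHomEquiv.{u} (π l) V (W l) (j l))).hom x = (j l).hom (v.hom x) :=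
    fun B v l x =>
      congr(($((Rep.resCoindHomEquiv.{u} (π l) V (W l)).symm_apply_apply (j l))).hom (v.hom x))
  refine (isIso_iff_yoneda_map_bijective _).2 fun B => ⟨fun v v' h => ?_, fun w => ?_⟩
  · refine hj.hom_ext fun l x => ?_
    have h' := congr_arg (fun y => y ≫ Pi.π _ l) h
    simp only [Category.assoc, limit.lift_π, Fan.mk_π_app] at h'
    rw [← key, ← key]
    exact congr(((Rep.resCoindHomEquiv.{u} (π l) B (W l)).symm $h').hom x)
  · obtain ⟨v, hv⟩ := hj.exists_hom B fun l =>
      (Rep.resCoindHomEquiv.{u} (π l) B (W l)).symm (w ≫ Pi.π _ l)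
    refine ⟨v, Pi.hom_ext _ _ fun l => ?_⟩
    refine (Category.assoc _ _ _).trans ?_
    rw [limit.lift_π, Fan.mk_π_app]
    refine (Rep.resCoindHomEquiv.{u} (π l) B (W l)).symm.injective (Rep.hom_ext
      (Representation.IntertwiningMap.ext (LinearMap.ext fun x => ?_)))
    exact (key B v l x).trans (hv l x)

end Prod
end Induced

section InternalSum
variable {k I W : Type*} [CommRing k] {V : I → Type*} [∀ i, AddCommGroup (V i)]
  [∀ i, Module k (V i)] [AddCommGroup W] [Module k W] {f : ∀ i, V i →ₗ[k] W}

/-- A map to the direct sum that is a retraction on each summand gives independence of the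
summands. -/
lemma IsInternalSum.of_retraction [DecidableEq I] (h : ∀ w, w ∈ ⨆ i, LinearMap.range (f i))
    (r : W →ₗ[k] ⨁ i, V i) (hr : ∀ i x, r (f i x) = DirectSum.lof k I V i x) :
    IsInternalSum f := by
  constructor
  · intro w
    obtain ⟨s, y, hy, -, hw⟩ := exists_finset_sum_of_mem_iSup (h w)
    choose x hx using hy
    exact ⟨s, x, (Finset.sum_congr rfl fun i _ => hx i).trans hw⟩
  · intro s x hx i hi
    have h1 := congr_arg (fun w => DirectSum.component k I V i (r w)) hx
    simp only [map_sum, map_zero, hr] at h1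
    rw [Finset.sum_eq_single_of_mem i hi fun l _ hl => by
      rw [DirectSum.component.of, dif_neg hl]] at h1
    rwa [DirectSum.component.lof_self] at h1

lemma IsInternalSum.exists_sum_eq (hf : IsInternalSum f) (w : W) :
    ∃ (s : Finset I) (x : ∀ i, V i), (∀ i ∉ s, x i = 0) ∧ ∑ i ∈ s, f i (x i) = w := by
  classical
  obtain ⟨s, x, hx⟩ := hf.1 w
  refine ⟨s, fun i => if i ∈ s then x i else 0, fun i hi => if_neg hi, ?_⟩
  exact (Finset.sum_congr rfl fun i hi => congr_arg (f i) (if_pos hi)).trans hx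

end InternalSum

/-! ### Coinvariants and invariants of induced modules -/

section Chains
variable {k Q Λ X : Type u} [CommRing k] [Group Q] {Γ : Λ → Type u} [∀ l, Group (Γ l)]
  {π : ∀ l, Γ l →* Q} {V : Rep.{u} k Q} {W : ∀ l, Rep.{u} k (Γ l)} {S : Λ → Type u}
  {s : ∀ l, S l → Q} [MulAction Q X] [∀ l, MulAction (Γ l) X]
  (hX : ∀ l (γ : Γ l) (x : X), γ • x = π l γ • x)

/-- The map of coinvariants induced by a morphism `W l ⟶ Rep.res (π l) V`. -/
abbrev inducedCoinvMap (j : ∀ l, W l ⟶ Rep.res (π l) V) (m : ℕ) (l : Λ) :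
    coinvChains (MonoidHom.id (Γ l)) X (W l) m →ₗ[k] coinvChains (MonoidHom.id Q) X V m :=
  coinvMap (ι := MonoidHom.id (Γ l)) (ι' := MonoidHom.id Q) (f := π l) id (j l).hom.toLinearMap
    (hX l) (Rep.hom_comm_apply (j l)) m

include hX in
lemma smul_pi_eq (m : ℕ) (l : Λ) (γ : Γ l) (y : Fin m → X) : γ • y = π l γ • y :=
  funext fun i => hX l γ (y i)

/-- Coinvariants of chains commute with induction. This is the chain-level form of Shapiro's
lemma. -/
lemma IsInducedSum.isInternalSum_coinvMap {j : ∀ l, W l ⟶ Rep.res (π l) V}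
    (hj : IsInducedSum j s) (m : ℕ) :
    IsInternalSum fun l => inducedCoinvMap hX j m l := by
  classical
  let C : Λ → Type u := fun l => coinvChains (MonoidHom.id (Γ l)) X (W l) m
  have hmk : ∀ (g : Q) (y : Fin m → X) (v : V), coinvMk (MonoidHom.id Q) X V m
      (Finsupp.single (g • y) (V.ρ g v)) = coinvMk (MonoidHom.id Q) X V m (Finsupp.single y v) :=
    fun g y v => coinvMk_eq_iff.2 (single_sub_single_mem_coinvKer (MonoidHom.id Q) g y v)
  have hmk' : ∀ l (γ : Γ l) (y : Fin m → X) (v : W l), coinvMk (MonoidHom.id (Γ l)) X (W l) m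
      (Finsupp.single (π l γ • y) ((W l).ρ γ v)) =
      coinvMk (MonoidHom.id (Γ l)) X (W l) m (Finsupp.single y v) := fun l γ y v => by
    rw [← smul_pi_eq hX]
    exact coinvMk_eq_iff.2 (single_sub_single_mem_coinvKer (MonoidHom.id (Γ l)) γ y v)
  have hd : ∀ y : Fin m → X, ∃ u : V →ₗ[k] ⨁ l, C l, ∀ l g x, u (V.ρ g ((j l).hom x)) =
      DirectSum.lof k Λ C l (coinvMk (MonoidHom.id (Γ l)) X (W l) m
        (Finsupp.single (g⁻¹ • y) x)) := fun y => by
    refine hj.exists_desc (fun l g => DirectSum.lof k Λ C l ∘ₗ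
      coinvMk (MonoidHom.id (Γ l)) X (W l) m ∘ₗ Finsupp.lsingle (g⁻¹ • y)) fun l g γ x => ?_
    refine congr_arg (DirectSum.lof k Λ C l) ?_
    change coinvMk _ X (W l) m (Finsupp.single ((g * π l γ)⁻¹ • y) x) =
      coinvMk _ X (W l) m (Finsupp.single (g⁻¹ • y) ((W l).ρ γ x))
    rw [← hmk' l γ, mul_inv_rev, mul_smul, smul_inv_smul]
  choose u hu using hd
  -- The inverse sends the class of a simplex `y` with coefficient `g (j l x)` to the class of the
  -- simplex `g⁻¹ y` with coefficient `x`, in the summand `l`.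
  obtain ⟨r, hr⟩ : ∃ r : coinvChains (MonoidHom.id Q) X V m →ₗ[k] ⨁ l, C l,
      ∀ z, r (coinvMk (MonoidHom.id Q) X V m z) = Finsupp.lsum k u z := by
    refine ⟨coinvLift (MonoidHom.id Q) (Finsupp.lsum k u) (coinvKer_le_ker fun g y v => ?_),
      fun z => rfl⟩
    change Finsupp.lsum k u (Finsupp.single (g • y) (V.ρ g v)) =
      Finsupp.lsum k u (Finsupp.single y v)
    rw [Finsupp.lsum_single, Finsupp.lsum_single]
    induction v using hj.induction with
    | h0 => simp only [map_zero]
    | hadd v v' h h' => simp only [map_add, h, h']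
    | h l g' x =>
      rw [← Module.End.mul_apply, ← map_mul, hu, hu, mul_inv_rev, mul_smul, inv_smul_smul]
  refine IsInternalSum.of_retraction (fun w => ?_) r fun l c => ?_
  · obtain ⟨z, rfl⟩ := coinvMk_surjective _ w
    induction z using Finsupp.induction_linear with
    | zero => rw [map_zero]; exact zero_mem _
    | add z z' h h' => rw [map_add]; exact add_mem h h'
    | single y v =>
      induction v using hj.induction with
      | h0 => rw [Finsupp.single_zero, map_zero]; exact zero_mem _
      | hadd v v' h h' => rw [Finsupp.single_add, map_add]; exact add_mem h h'
      | h l g x =>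
        refine Submodule.mem_iSup_of_mem l
          ⟨coinvMk _ X (W l) m (Finsupp.single (g⁻¹ • y) x), ?_⟩
        rw [coinvMap_mk, simplexMap_single]
        refine (hmk g _ _).symm.trans ?_
        congr 2
        exact smul_inv_smul g y
  · obtain ⟨z, rfl⟩ := coinvMk_surjective _ c
    refine (hr _).trans ?_
    clear hr
    induction z using Finsupp.induction_linear with
    | zero => simp only [map_zero]
    | add z z' h h' => rw [map_add, map_add, h, h', map_add, map_add]
    | single y x =>
      rw [simplexMap_single, Finsupp.lsum_single]
      have := hu y l 1 x
      rw [map_one, inv_one, one_smul] at this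
      exact this

include hX in
/-- Invariant cochains commute with coinduction: invariant cochains with coefficients in the `W l`
come from one with coefficients in `V`, which is unique by `IsInducedProd.invCochains_eq_zero`. -/
lemma IsInducedProd.exists_invCochains {j : ∀ l, Rep.res (π l) V ⟶ W l}
    (hj : IsInducedProd j s) {m : ℕ} (F : ∀ l, (Fin m → X) → W l)
    (hF : ∀ l, F l ∈ invCochains (MonoidHom.id (Γ l)) X (W l) m) :
    ∃ F' ∈ invCochains (MonoidHom.id Q) X V m,
      ∀ l, cosimplexMap id (j l).hom.toLinearMap m F' = F l := by
  have hF' : ∀ l (γ : Γ l) (y : Fin m → X), F l (π l γ • y) = (W l).ρ γ (F l y) := fun l γ y => by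
    rw [← smul_pi_eq hX]
    exact mem_invCochains.1 (hF l) γ y
  choose F' hF₁ using fun y => hj.exists_eq (fun l g => F l (g • y)) fun l g γ => by
    rw [mul_smul, hF']
  refine ⟨F', mem_invCochains.2 fun g y => ?_, fun l => funext fun y => ?_⟩
  · refine sub_eq_zero.1 (hj.eq_zero fun l g' => ?_)
    rw [map_sub]
    refine (map_sub (j l).hom _ _).trans (sub_eq_zero.2 ?_)
    rw [hF₁, ← Module.End.mul_apply, ← map_mul]
    exact (congr_arg (F l) (mul_smul g' g y).symm).trans (hF₁ y l (g' * g)).symm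
  · have := hF₁ y l 1
    rw [map_one, one_smul] at this
    exact this

omit [∀ l, MulAction (Γ l) X] in
lemma IsInducedProd.invCochains_eq_zero {j : ∀ l, Rep.res (π l) V ⟶ W l}
    (hj : IsInducedProd j s) {m : ℕ} {F : (Fin m → X) → V}
    (hF : F ∈ invCochains (MonoidHom.id Q) X V m)
    (h : ∀ l, cosimplexMap id (j l).hom.toLinearMap m F = 0) : F = 0 := by
  refine funext fun y => hj.eq_zero fun l g => ?_
  have := mem_invCochains.1 hF g y
  exact (congr_arg (j l).hom this.symm).trans (congr_fun (h l) (g • y))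

end Chains

/-! ### Shapiro's lemma -/

section Shapiro
variable {k Q Λ : Type u} [CommRing k] [Group Q] {Γ : Λ → Type u} [∀ l, Group (Γ l)]
  {π : ∀ l, Γ l →* Q} {V : Rep.{u} k Q} {W : ∀ l, Rep.{u} k (Γ l)} {S : Λ → Type u}
  {s : ∀ l, S l → Q}

lemma subsingleton_groupHomology {Γ : Type u} [Group Γ] (W : Rep.{u} k Γ) [Subsingleton W]
    (p : ℕ) : Subsingleton (groupHomology W p) := by
  refine ⟨fun x y => ?_⟩
  obtain ⟨⟨z, hz⟩, rfl⟩ := homologyClass_surjective p x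
  obtain ⟨⟨z', hz'⟩, rfl⟩ := homologyClass_surjective p y
  have : Subsingleton ((Fin p → Γ) →₀ W) := inferInstance
  have h : z = z' := this.elim z z'
  subst h
  rfl

lemma subsingleton_groupCohomology {Γ : Type u} [Group Γ] (W : Rep.{u} k Γ) [Subsingleton W]
    (p : ℕ) : Subsingleton (groupCohomology W p) := by
  refine ⟨fun x y => ?_⟩
  obtain ⟨⟨z, hz⟩, rfl⟩ := homologyClass_surjective p x
  obtain ⟨⟨z', hz'⟩, rfl⟩ := homologyClass_surjective p y
  have : Subsingleton ((Fin p → Γ) → W) := inferInstance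
  have h : z = z' := this.elim z z'
  subst h
  rfl

variable [∀ l, MulAction (Γ l) Q] (hX : ∀ l (γ : Γ l) (x : Q), γ • x = π l γ • x)

/-- A presentation `κ` of the homology of `Γ l` by simplices with vertices in `Q`, compatible with
that of `Q`. If `π l` is injective then `Q` is a free `Γ l`-set; otherwise all modules involved are
zero. -/
lemma exists_homologyClass_map (j : ∀ l, W l ⟶ Rep.res (π l) V) (l : Λ)
    (h : Function.Injective (π l) ∨ Subsingleton (W l)) (p : ℕ) :
    ∃ κ : coinvCycles (MonoidHom.id (Γ l)) Q (W l) p →ₗ[k] groupHomology (W l) p,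
      Function.Surjective κ ∧
      (∀ b, κ b = 0 ↔ ∃ w, coinvD (MonoidHom.id (Γ l)) Q (W l) (p + 1) w = b) ∧
      ∀ b, (groupHomology.map (π l) (j l) p).hom (κ b) =
        barClass (A := V) (ι := MonoidHom.id Q) (X := Q) (ρ := id) (fun _ _ => rfl) p
          ⟨inducedCoinvMap hX j (p + 1) l b.1,
            coinvMap_mem_coinvCycles (hX l) (Rep.hom_comm_apply (j l)) b.2⟩ := by
  rcases h with h | h
  · obtain ⟨ρ, hρ⟩ := exists_equivariant_of_injective h
    have hρ' : ∀ (γ : Γ l) (x : Q), ρ (MonoidHom.id (Γ l) γ • x) = γ * ρ x := fun γ x => by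
      rw [MonoidHom.id_apply, hX, hρ]
    refine ⟨barClass (A := W l) hρ' p, barClass_surjective hρ' p,
      fun b => barClass_eq_zero_iff hρ' b, fun b => ?_⟩
    exact map_barClass (A := W l) (A' := V) (ι := MonoidHom.id (Γ l)) (ι' := MonoidHom.id Q)
      (ρ' := id) hρ' (fun _ _ => rfl) (π l) id (hX l) (j l).hom.toLinearMap
      (Rep.hom_comm_apply (j l)) (j l) (fun _ => rfl) b
  · have h1 := subsingleton_groupHomology (W l) p
    have h2 : ∀ m (b : coinvChains (MonoidHom.id (Γ l)) Q (W l) m), b = 0 := fun m b => by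
      obtain ⟨z, rfl⟩ := coinvMk_surjective _ b
      rw [Subsingleton.elim z 0, map_zero]
    refine ⟨0, fun y => ⟨0, Subsingleton.elim _ _⟩,
      fun b => iff_of_true rfl ⟨0, (map_zero _).trans (h2 _ b.1).symm⟩, fun b => ?_⟩
    rw [LinearMap.zero_apply, map_zero]
    refine ((congr_arg _ (Subtype.ext ?_)).trans (map_zero _)).symm
    change inducedCoinvMap hX j (p + 1) l b.1 = 0
    rw [h2 _ b.1, map_zero]

include hX in
/-- Shapiro's lemma for a sum of induced modules. The complex of coinvariants that computes the
homology of `Q` is the direct sum of the complexes that compute the homology of the `Γ l`. -/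
lemma IsInducedSum.isInternalSum_groupHomology {j : ∀ l, W l ⟶ Rep.res (π l) V}
    (hj : IsInducedSum j s) (h : ∀ l, Function.Injective (π l) ∨ Subsingleton (W l)) (p : ℕ) :
    IsInternalSum fun l => (groupHomology.map (π l) (j l) p).hom := by
  classical
  choose κ hκ hκ₀ hκ₁ using fun l => exists_homologyClass_map hX j l (h l) p
  have hΦ := fun m => hj.isInternalSum_coinvMap hX m
  have hD : ∀ m l b, inducedCoinvMap hX j m l (coinvD (MonoidHom.id (Γ l)) Q (W l) m b) =
      coinvD (MonoidHom.id Q) Q V m (inducedCoinvMap hX j (m + 1) l b) := fun m l b =>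
    coinvMap_coinvD (hX l) (Rep.hom_comm_apply (j l)) b
  constructor
  · intro v
    obtain ⟨⟨b, hb⟩, rfl⟩ := barClass_surjective (A := V) (ι := MonoidHom.id Q) (X := Q)
      (ρ := id) (fun _ _ => rfl) p v
    obtain ⟨t, c, hct, rfl⟩ := (hΦ (p + 1)).exists_sum_eq b
    have hc : ∀ l, c l ∈ coinvCycles (MonoidHom.id (Γ l)) Q (W l) p := by
      cases p with
      | zero => exact fun l => trivial
      | succ p =>
        intro l
        change coinvD _ _ _ _ (c l) = 0
        by_cases hl : l ∈ t
        · refine (hΦ (p + 1)).2 t (fun l => coinvD (MonoidHom.id (Γ l)) Q (W l) (p + 1) (c l)) ?_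
            l hl
          rw [Finset.sum_congr rfl fun l _ => hD (p + 1) l (c l), ← map_sum]
          exact hb
        · rw [hct l hl, map_zero]
    refine ⟨t, fun l => κ l ⟨c l, hc l⟩, ?_⟩
    rw [Finset.sum_congr rfl fun l _ => hκ₁ l ⟨c l, hc l⟩, ← map_sum]
    exact congr_arg _ (Subtype.ext (AddSubmonoidClass.coe_finsetSum _ _))
  · intro t x hx l hl
    choose c hc using fun l => hκ l (x l)
    have h1 : ∑ l ∈ t, barClass (A := V) (ι := MonoidHom.id Q) (X := Q) (ρ := id)
        (fun _ _ => rfl) p ⟨inducedCoinvMap hX j (p + 1) l (c l).1,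
          coinvMap_mem_coinvCycles (hX l) (Rep.hom_comm_apply (j l)) (c l).2⟩ = 0 := by
      rw [← hx]
      refine Finset.sum_congr rfl fun l _ => ?_
      rw [← hκ₁, hc]
    rw [← map_sum, barClass_eq_zero_iff] at h1
    obtain ⟨w, hw⟩ := h1
    obtain ⟨t', d, hdt, rfl⟩ := (hΦ (p + 2)).exists_sum_eq w
    rw [AddSubmonoidClass.coe_finsetSum, map_sum] at hw
    have h2 : ∑ i ∈ t ∪ t', inducedCoinvMap hX j (p + 1) i
        ((if i ∈ t then (c i).1 else 0) - coinvD (MonoidHom.id (Γ i)) Q (W i) (p + 1) (d i)) = 0 := by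
      simp only [map_sub, Finset.sum_sub_distrib]
      rw [sub_eq_zero, ← Finset.sum_subset Finset.subset_union_left,
        ← Finset.sum_subset (Finset.subset_union_right (s₁ := t))]
      · rw [Finset.sum_congr rfl fun i _ => hD (p + 1) i (d i)]
        refine Eq.trans ?_ hw.symm
        exact Finset.sum_congr rfl fun i hi => by rw [if_pos hi]
      · intro i _ hi
        rw [hdt i hi, map_zero, map_zero]
      · intro i _ hi
        rw [if_neg hi, map_zero]
    have h3 := (hΦ (p + 1)).2 _ _ h2 l (Finset.mem_union_left _ hl)
    rw [if_pos hl, sub_eq_zero] at h3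
    rw [← hc, hκ₀]
    exact ⟨d l, h3.symm⟩

/-- A presentation `κ` of the cohomology of `Γ l` by simplices with vertices in `Q`, compatible
with that of `Q`. If `π l` is injective then `Q` is a free `Γ l`-set; otherwise all modules
involved are zero. -/
lemma exists_cohomologyClass_map (j : ∀ l, Rep.res (π l) V ⟶ W l) (l : Λ)
    (h : Function.Injective (π l) ∨ Subsingleton (W l)) (p : ℕ) :
    ∃ κ : invCocycles (MonoidHom.id (Γ l)) Q (W l) p →ₗ[k] groupCohomology (W l) p,
      Function.Surjective κ ∧
      (∀ F, κ F = 0 ↔ F.1 ∈ invCoboundaries (MonoidHom.id (Γ l)) Q (W l) p) ∧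
      ∀ F, (groupCohomology.map (π l) (j l) p).hom (cobarClass (MonoidHom.id Q) (1 : Q) V p F) =
        κ ⟨cosimplexMap id (j l).hom.toLinearMap (p + 1) F.1,
          cosimplexMap_mem_invCocycles (f := π l) (ι := MonoidHom.id (Γ l))
            (ι' := MonoidHom.id Q) (hX l) (Rep.hom_comm_apply (j l)) F.2⟩ := by
  rcases h with h | h
  · obtain ⟨ρ, hρ⟩ := exists_equivariant_of_injective h
    have hρ' : ∀ (γ : Γ l) (x : Q), ρ (MonoidHom.id (Γ l) γ • x) = γ * ρ x := fun γ x => by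
      rw [MonoidHom.id_apply, hX, hρ]
    refine ⟨cobarClass (MonoidHom.id (Γ l)) (1 : Q) (W l) p, cobarClass_surjective hρ' 1 p,
      fun F => cobarClass_eq_zero_iff hρ' 1 F, fun F => ?_⟩
    exact map_cobarClass (A := W l) (A' := V) (ι := MonoidHom.id (Γ l)) (ι' := MonoidHom.id Q)
      (1 : Q) (1 : Q) (π l) id (hX l) (j l).hom.toLinearMap
      (Rep.hom_comm_apply (j l)) (j l) (fun _ => rfl) F
  · have h1 := subsingleton_groupCohomology (W l) p
    refine ⟨0, fun y => ⟨0, Subsingleton.elim _ _⟩, fun F => iff_of_true rfl ?_,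
      fun F => Subsingleton.elim _ _⟩
    rw [Subsingleton.elim F.1 0]
    exact zero_mem _

include hX in
/-- Shapiro's lemma for a product of coinduced modules. The complex of invariants that computes the
cohomology of `Q` is the product of the complexes that compute the cohomology of the `Γ l`. -/
lemma IsInducedProd.isInternalProd_groupCohomology {j : ∀ l, Rep.res (π l) V ⟶ W l}
    (hj : IsInducedProd j s) (h : ∀ l, Function.Injective (π l) ∨ Subsingleton (W l)) (p : ℕ) :
    IsInternalProd fun l => (groupCohomology.map (π l) (j l) p).hom := by
  choose κ hκ hκ₀ hκ₁ using fun l => exists_cohomologyClass_map hX j l (h l) p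
  have hδ : ∀ m l (F : (Fin m → Q) → V), simplexDelta (k := k) Q (W l) m
      (cosimplexMap id (j l).hom.toLinearMap m F) =
      cosimplexMap id (j l).hom.toLinearMap (m + 1) (simplexDelta (k := k) Q V m F) :=
    fun m l F => simplexDelta_cosimplexMap id _ F
  constructor
  · intro v hv
    obtain ⟨⟨F, hF⟩, rfl⟩ := cobarClass_surjective (A := V) (ι := MonoidHom.id Q) (X := Q)
      (ρ := id) (fun _ _ => rfl) 1 p v
    have h1 : ∀ l, cosimplexMap id (j l).hom.toLinearMap (p + 1) F ∈
        invCoboundaries (MonoidHom.id (Γ l)) Q (W l) p := fun l =>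
      (hκ₀ l _).1 ((hκ₁ l _).symm.trans (hv l))
    rw [cobarClass_eq_zero_iff (ρ := id) fun _ _ => rfl]
    change F ∈ _
    cases p with
    | zero => exact hj.invCochains_eq_zero hF.1 h1
    | succ p =>
      choose B hB hBF using h1
      obtain ⟨B', hB', hB₁⟩ := hj.exists_invCochains hX B hB
      refine ⟨B', hB', ?_⟩
      refine (sub_eq_zero.1 (hj.invCochains_eq_zero
        (sub_mem hF.1 (simplexDelta_mem_invCochains hB')) fun l => ?_)).symm
      rw [map_sub, ← hδ, hB₁, hBF, sub_self]
  · intro x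
    choose F hF using fun l => hκ l (x l)
    obtain ⟨F', hF', hF₁⟩ := hj.exists_invCochains hX (fun l => (F l).1) fun l => (F l).2.1
    have hδF : simplexDelta (k := k) Q V (p + 1) F' = 0 :=
      hj.invCochains_eq_zero (simplexDelta_mem_invCochains hF') fun l => by
        rw [← hδ, hF₁]
        exact (F l).2.2
    refine ⟨cobarClass (MonoidHom.id Q) (1 : Q) V p ⟨F', hF', hδF⟩, fun l => ?_⟩
    refine (hκ₁ l _).trans (Eq.trans ?_ (hF l))
    exact congr_arg (κ l) (Subtype.ext (hF₁ l))

end Shapiro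

/-! ### Morphisms from sums and to products of spectral sequences -/

section SumMorphisms
variable {k : Type u} [CommRing k] {Λ : Type u} {κ : Type*} {c' : ℤ → ComplexShape κ} {r₀ : ℤ}
  {E E' : Λ → SpectralSequence (ModuleCat.{u} k) c' r₀}
  {F : SpectralSequence (ModuleCat.{u} k) c' r₀}

lemma dsSSι_desc (f : ∀ l, E l ⟶ F) (l : Λ) : dsSSι E l ≫ dsSSDesc f = f l :=
  SpectralSequence.hom_ext fun r hr =>
    dsComplexι_desc (K := fun l => (E l).page r hr) (fun l => (f l).hom r hr) l

lemma dsSS_hom_ext {f g : dsSS E ⟶ F} (h : ∀ l, dsSSι E l ≫ f = dsSSι E l ≫ g) : f = g :=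
  SpectralSequence.hom_ext fun r hr => HomologicalComplex.hom_ext _ _ fun i =>
    ds_hom_ext fun l => congr(($(h l).hom r hr).f i)

lemma dsSSι_map (f : ∀ l, E l ⟶ E' l) (l : Λ) : dsSSι E l ≫ dsSSMap f = f l ≫ dsSSι E' l :=
  dsSSι_desc _ l

lemma prSSLift_π (f : ∀ l, F ⟶ E l) (l : Λ) : prSSLift f ≫ prSSπ E l = f l := rfl

lemma prSS_hom_ext {f g : F ⟶ prSS E} (h : ∀ l, f ≫ prSSπ E l = g ≫ prSSπ E l) : f = g :=
  SpectralSequence.hom_ext fun r hr => HomologicalComplex.hom_ext _ _ fun i =>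
    pr_hom_ext fun l => congr(($(h l).hom r hr).f i)

lemma prSSMap_π (f : ∀ l, E l ⟶ E' l) (l : Λ) : prSSMap f ≫ prSSπ E' l = prSSπ E l ≫ f l := rfl

end SumMorphisms

lemma FilteredComplex.mapSpectralSequence_comp {k : Type u} [CommRing k] {σ : ℤ}
    {C D E : FilteredComplex k σ} (φ : Hom C D) (ψ : Hom D E) (χ : Hom C E)
    (h : φ.f ≫ ψ.f = χ.f) :
    mapSpectralSequence φ ≫ mapSpectralSequence ψ = mapSpectralSequence χ := by
  refine SpectralSequence.hom_ext fun r hr => HomologicalComplex.hom_ext _ _ fun pq =>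
    ModuleCat.hom_ext (LinearMap.ext fun x => ?_)
  obtain ⟨x, rfl⟩ := Submodule.Quotient.mk_surjective _ x
  change Submodule.Quotient.mk _ = Submodule.Quotient.mk _
  exact congr_arg _ (Subtype.ext congr($(h).f _ |>.hom x.1))

/-! ### Functoriality of the Lyndon–Hochschild–Serre spectral sequences -/

section LHSFunctoriality
variable {k : Type u} [CommRing k] {G G' G'' : Type u} [Group G] [Group G'] [Group G'']
  {N : Subgroup G} [N.Normal] {N' : Subgroup G'} [N'.Normal] {N'' : Subgroup G''} [N''.Normal]
  {A : Rep.{u} k G} {A' : Rep.{u} k G'} {A'' : Rep.{u} k G''}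

lemma lhsSSMap_comp (f : G →* G') (hN : N ≤ N'.comap f) (φ : A ⟶ Rep.res f A')
    (f' : G' →* G'') (hN' : N' ≤ N''.comap f') (φ' : A' ⟶ Rep.res f' A'')
    (f'' : G →* G'') (hN'' : N ≤ N''.comap f'') (φ'' : A ⟶ Rep.res f'' A'')
    (hf : f'.comp f = f'') (hφ : ∀ a, φ'.hom (φ.hom a) = φ''.hom a) :
    lhsSSMap f hN φ ≫ lhsSSMap f' hN' φ' = lhsSSMap f'' hN'' φ'' := by
  refine FilteredComplex.mapSpectralSequence_comp _ _ _ ?_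
  refine (HomologicalComplex₂.total.map_comp _ _ _).symm.trans ?_
  refine congr_arg (fun y => HomologicalComplex₂.total.map y _) ?_
  refine (Functor.map_comp _ _ _).symm.trans (congr_arg _ ?_)
  exact NatTrans.ext (funext fun n => lhsChainsMap_comp _ _ _ _ _ _ _ _ _ _ _ _ _ _ _ hf
    (funext fun x => funext fun i => congr($hf (x i))) hφ)

lemma lhsCoSSMap_comp (f : G →* G') (hN : N ≤ N'.comap f) (φ : Rep.res f A' ⟶ A)
    (f' : G' →* G'') (hN' : N' ≤ N''.comap f') (φ' : Rep.res f' A'' ⟶ A')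
    (f'' : G →* G'') (hN'' : N ≤ N''.comap f'') (φ'' : Rep.res f'' A'' ⟶ A)
    (hf : f'.comp f = f'') (hφ : ∀ a, φ.hom (φ'.hom a) = φ''.hom a) :
    lhsCoSSMap f' hN' φ' ≫ lhsCoSSMap f hN φ = lhsCoSSMap f'' hN'' φ'' := by
  refine FilteredComplex.mapSpectralSequence_comp _ _ _ ?_
  refine (HomologicalComplex₂.total.map_comp _ _ _).symm.trans ?_
  refine congr_arg (fun y => HomologicalComplex₂.total.map y _) ?_
  refine (Functor.map_comp _ _ _).symm.trans (congr_arg _ ?_)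
  exact NatTrans.ext (funext fun n => lhsCochainsMap_comp _ _ _ _ _ _ _ _ _ _ _ _ _ _ _ hf
    (funext fun x => funext fun i => congr($hf (x i))) hφ)

end LHSFunctoriality

/-! ### The second pages for a Cohen–Lyndon triple -/

section Triple
variable {k : Type u} [CommRing k] {G Λ : Type u} [Group G] {H : Λ → Subgroup G}
  {N : ∀ l, Subgroup (H l)} [∀ l, (N l).Normal] (A : Rep.{u} k G)

/-- Naturality of the morphism of homological spectral sequences in the coefficients. -/
lemma sumSSMap_comp_tripleSSMap {A B : Rep.{u} k G} (v : A ⟶ B) :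
    sumSSMap H N v ≫ tripleSSMap H N B =
      tripleSSMap H N A ≫ lhsSSCoeffMap (tripleKernel H N) v := by
  refine dsSS_hom_ext fun l => ?_
  rw [sumSSMap, ← Category.assoc, dsSSι_map, Category.assoc, tripleSSMap, dsSSι_desc, tripleSSMap,
    ← Category.assoc, dsSSι_desc]
  let φ : Rep.res (H l).subtype A ⟶ Rep.res (H l).subtype B := (Rep.resFunctor (H l).subtype).map v
  exact (lhsSSMap_comp (A := Rep.res (H l).subtype A) (A' := Rep.res (H l).subtype B)
      (MonoidHom.id (H l)) _ φ (H l).subtype (le_comap_tripleKernel H N l) (𝟙 _) (H l).subtype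
      (le_comap_tripleKernel H N l) φ rfl fun _ => rfl).trans
    (lhsSSMap_comp (A' := A) (A'' := B) (H l).subtype (le_comap_tripleKernel H N l) (𝟙 _)
      (MonoidHom.id G) _ v (H l).subtype (le_comap_tripleKernel H N l) φ rfl fun _ => rfl).symm

/-- Naturality of the morphism of cohomological spectral sequences in the coefficients. -/
lemma tripleCoSSMap_comp_prodSSMap {A B : Rep.{u} k G} (v : A ⟶ B) :
    tripleCoSSMap H N A ≫ prodSSMap H N v =
      lhsCoSSCoeffMap (tripleKernel H N) v ≫ tripleCoSSMap H N B := by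
  refine prSS_hom_ext fun l => ?_
  rw [prodSSMap, Category.assoc, prSSMap_π, ← Category.assoc, tripleCoSSMap, prSSLift_π,
    tripleCoSSMap, Category.assoc, prSSLift_π]
  let φ : Rep.res (H l).subtype A ⟶ Rep.res (H l).subtype B := (Rep.resFunctor (H l).subtype).map v
  exact (lhsCoSSMap_comp (A := Rep.res (H l).subtype B) (A' := Rep.res (H l).subtype A) (A'' := A)
      (MonoidHom.id (H l)) _ φ (H l).subtype (le_comap_tripleKernel H N l) (𝟙 _) (H l).subtype
      (le_comap_tripleKernel H N l) φ rfl fun _ => rfl).trans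
    (lhsCoSSMap_comp (A' := B) (A'' := A) (H l).subtype (le_comap_tripleKernel H N l) (𝟙 _)
      (MonoidHom.id G) _ v (H l).subtype (le_comap_tripleKernel H N l) φ rfl fun _ => rfl).symm

variable {A}

/-- The sum of the groups `H_p(H l ⧸ N l; H_q(N l; A))`, as the second page of `sumSS`. -/
def sumPageTwoIso (p q : ℕ) : ((sumSS H N A).page 2 int_two_le_two).X ((p : ℤ), (q : ℤ)) ≅
    ModuleCat.of k (⨁ l, groupHomology (homologyRep (N l) (Rep.res (H l).subtype A) q) p) :=
  dsMapIso fun l => lhsPageTwoIso (N l) (Rep.res (H l).subtype A) p q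

lemma sumPageTwoIso_naturality (p q : ℕ) :
    ((tripleSSMap H N A).hom 2 int_two_le_two).f ((p : ℤ), (q : ℤ)) ≫
        (lhsPageTwoIso (tripleKernel H N) A p q).hom =
      (sumPageTwoIso p q).hom ≫ dsDesc fun l =>
        groupHomology.map (tripleQuotientMap H N l) (tripleHomologyMap H N A l q) p :=
  dsDesc_comm _ _ _ _ fun l => lhsPageTwoIso_naturality (H l).subtype
    (le_comap_tripleKernel H N l) (𝟙 (Rep.res (H l).subtype A)) p q

/-- The product of the groups `H^p(H l ⧸ N l; H^q(N l; A))`, as the second page of `prodSS`. -/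
def prodPageTwoIso (p q : ℕ) : ((prodSS H N A).page 2 int_two_le_two).X ((p : ℤ), (q : ℤ)) ≅
    ModuleCat.of k (∀ l, groupCohomology (cohomologyRep (N l) (Rep.res (H l).subtype A) q) p) :=
  prMapIso fun l => lhsCoPageTwoIso (N l) (Rep.res (H l).subtype A) p q

lemma prodPageTwoIso_naturality (p q : ℕ) :
    ((tripleCoSSMap H N A).hom 2 int_two_le_two).f ((p : ℤ), (q : ℤ)) ≫ (prodPageTwoIso p q).hom =
      (lhsCoPageTwoIso (tripleKernel H N) A p q).hom ≫ prLift fun l =>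
        groupCohomology.map (tripleQuotientMap H N l) (tripleCohomologyMap H N A l q) p :=
  prLift_comm _ _ _ _ fun l => lhsCoPageTwoIso_naturality (H l).subtype
    (le_comap_tripleKernel H N l) (𝟙 (Rep.res (H l).subtype A)) p q

/-- The classes of a transversal of `H l ⬝ ⟪N⟫` meet all cosets of the image of `H l ⧸ N l`. -/
lemma exists_mk_mul_tripleQuotientMap {T : Λ → Set G}
    (hT : ∀ l (g : G), ∃ t ∈ T l, ∃ h : H l, ∃ m ∈ tripleKernel H N, t * h * m = g) (l : Λ)
    (g : G ⧸ tripleKernel H N) : ∃ (t : T l) (h : H l ⧸ N l),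
      ((t : G) : G ⧸ tripleKernel H N) * tripleQuotientMap H N l h = g := by
  induction g using QuotientGroup.induction_on with | H g => ?_
  obtain ⟨t, ht, h, m, hm, rfl⟩ := hT l g
  refine ⟨⟨t, ht⟩, (h : H l ⧸ N l), ?_⟩
  rw [QuotientGroup.mk_mul, (QuotientGroup.eq_one_iff m).2 hm, mul_one]
  rfl

variable (hCL : IsCohenLyndonTriple H N) {q : ℕ}
  (hq : 1 < q ∨ (q = 1 ∧ ∀ g ∈ tripleKernel H N, A.ρ g = 1))

include hCL hq in
/-- The homology of `⟪N⟫` is the direct sum of the modules induced from the homology of the groups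
`N l`; the classes of the transversals serve as coset representatives. -/
lemma IsCohenLyndonTriple.isInducedSum : ∃ (S : Λ → Type u)
    (s : ∀ l, S l → G ⧸ tripleKernel H N),
    IsInducedSum (π := tripleQuotientMap H N) (fun l => tripleHomologyMap H N A l q) s := by
  obtain ⟨T, hT, hb⟩ := hCL.exists_transversal
  obtain ⟨q, rfl⟩ : ∃ n, q = n + 1 := ⟨q - 1, by omega⟩
  refine ⟨fun l => T l, fun l t => ((t : G) : G ⧸ tripleKernel H N),
    exists_mk_mul_tripleQuotientMap hT, ?_⟩
  exact isInternalSum_tripleHomology A hb q (hq.imp (fun h => by omega) fun h => h.2)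

include hCL hq in
/-- The cohomology of `⟪N⟫` is the product of the modules coinduced from the cohomology of the
groups `N l`. -/
lemma IsCohenLyndonTriple.isInducedProd : ∃ (S : Λ → Type u)
    (s : ∀ l, S l → G ⧸ tripleKernel H N),
    IsInducedProd (π := tripleQuotientMap H N) (fun l => tripleCohomologyMap H N A l q) s := by
  obtain ⟨T, hT, hb⟩ := hCL.exists_transversal
  obtain ⟨q, rfl⟩ : ∃ n, q = n + 1 := ⟨q - 1, by omega⟩
  refine ⟨fun l => T l, fun l t => ((t : G) : G ⧸ tripleKernel H N),
    exists_mk_mul_tripleQuotientMap hT, ?_⟩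
  exact isInternalProd_tripleCohomology A hb q (hq.imp (fun h => by omega) fun h => h.2)

include hCL hq in
/-- The map on the second pages in homology is an isomorphism, by Shapiro's lemma. Where `H l ⧸ N l
→ G ⧸ ⟪N⟫` is not known to be injective, `N l` is trivial and has no homology in degree `q > 0`. -/
lemma IsCohenLyndonTriple.isIso_dsDesc (p : ℕ) : IsIso (dsDesc fun l =>
    groupHomology.map (tripleQuotientMap H N l) (tripleHomologyMap H N A l q) p) := by
  classical
  obtain ⟨S, s, hs⟩ := hCL.isInducedSum hq
  let _ := fun l => MulAction.compHom (G ⧸ tripleKernel H N) (tripleQuotientMap H N l)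
  have hsub : ∀ l, Subsingleton (N l) →
      Subsingleton (groupHomology (Rep.res (N l).subtype (Rep.res (H l).subtype A)) q) := fun l hN => by
    obtain ⟨q, rfl⟩ : ∃ n, q = n + 1 := ⟨q - 1, by omega⟩
    exact ModuleCat.subsingleton_of_isZero (isZero_groupHomology_succ_of_subsingleton _ q)
  have h := hs.isInternalSum_groupHomology (fun _ _ _ => rfl) (fun l =>
    (hCL.injective_or_subsingleton l).imp_right (hsub l)) p
  exact (ConcreteCategory.isIso_iff_bijective _).2 h.bijective

include hCL hq in
/-- The map on the second pages in cohomology is an isomorphism, by Shapiro's lemma; trivial groups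
`N l` have no cohomology in degree `q > 0`. -/
lemma IsCohenLyndonTriple.isIso_prLift (p : ℕ) : IsIso (prLift fun l =>
    groupCohomology.map (tripleQuotientMap H N l) (tripleCohomologyMap H N A l q) p) := by
  obtain ⟨S, s, hs⟩ := hCL.isInducedProd hq
  let _ := fun l => MulAction.compHom (G ⧸ tripleKernel H N) (tripleQuotientMap H N l)
  have hsub : ∀ l, Subsingleton (N l) →
      Subsingleton (groupCohomology (Rep.res (N l).subtype (Rep.res (H l).subtype A)) q) := fun l hN => by
    obtain ⟨q, rfl⟩ : ∃ n, q = n + 1 := ⟨q - 1, by omega⟩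
    exact ModuleCat.subsingleton_of_isZero (isZero_groupCohomology_succ_of_subsingleton _ q)
  have h := hs.isInternalProd_groupCohomology (fun _ _ _ => rfl) (fun l =>
    (hCL.injective_or_subsingleton l).imp_right (hsub l)) p
  refine (ConcreteCategory.isIso_iff_bijective _).2
    ⟨(injective_iff_map_eq_zero (prLift _).hom).2 fun x hx => h.1 x fun l => congr_fun hx l,
      fun x => ?_⟩
  obtain ⟨w, hw⟩ := h.2 x
  exact ⟨w, funext hw⟩

end Triple

/-! ### Convergence and comparison of the spectral sequences -/

section TriplePages
variable {k : Type u} [CommRing k] {G Λ : Type u} [Group G] {H : Λ → Subgroup G}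
  {N : ∀ l, Subgroup (H l)} [∀ l, (N l).Normal] {A : Rep.{u} k G}

lemma isIso_of_isZero_of_isZero {M M' : ModuleCat.{u} k} (hM : IsZero M) (hM' : IsZero M')
    (f : M ⟶ M') : IsIso f :=
  ⟨0, hM.eq_of_src _ _, hM'.eq_of_src _ _⟩

variable (H N A) in
/-- Convergence of `sumSS` to the sum of the homology modules of the groups `H l`. -/
def sumConvergence : Convergence (sumSS H N A) fun n =>
    ModuleCat.of k (⨁ l, groupHomology (Rep.res (H l).subtype A) n) :=
  dsConvergence fun l => lhsConvergence (N l) (Rep.res (H l).subtype A)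

variable (H N A) in
/-- Convergence of `prodSS` to the product of the cohomology modules of the groups `H l`. -/
def prodConvergence : Convergence (prodSS H N A) fun n =>
    ModuleCat.of k (∀ l, groupCohomology (Rep.res (H l).subtype A) n) :=
  prConvergence fun l => lhsCoConvergence (N l) (Rep.res (H l).subtype A)

lemma IsCohenLyndonTriple.isIso_tripleSSMap (hCL : IsCohenLyndonTriple H N) (p q : ℤ)
    (hq : 1 < q ∨ (q = 1 ∧ ∀ g ∈ tripleKernel H N, A.ρ g = 1)) :
    IsIso (((tripleSSMap H N A).hom 2 int_two_le_two).f (p, q)) := by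
  obtain ⟨q, rfl⟩ := Int.eq_ofNat_of_zero_le (show 0 ≤ q by omega)
  rcases lt_or_ge p 0 with hp | hp
  · exact isIso_of_isZero_of_isZero ((sumConvergence H N A).isZero 2 le_rfl p q (Or.inl hp))
      ((lhsConvergence (tripleKernel H N) A).isZero 2 le_rfl p q (Or.inl hp)) _
  · obtain ⟨p, rfl⟩ := Int.eq_ofNat_of_zero_le hp
    have := hCL.isIso_dsDesc (A := A) (q := q)
      (hq.imp (fun h => by omega) fun h => ⟨by omega, h.2⟩) p
    rw [(Iso.eq_comp_inv _).2 (sumPageTwoIso_naturality (H := H) (N := N) (A := A) p q)]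
    infer_instance

lemma IsCohenLyndonTriple.isIso_tripleCoSSMap (hCL : IsCohenLyndonTriple H N) (p q : ℤ)
    (hq : 1 < q ∨ (q = 1 ∧ ∀ g ∈ tripleKernel H N, A.ρ g = 1)) :
    IsIso (((tripleCoSSMap H N A).hom 2 int_two_le_two).f (p, q)) := by
  obtain ⟨q, rfl⟩ := Int.eq_ofNat_of_zero_le (show 0 ≤ q by omega)
  rcases lt_or_ge p 0 with hp | hp
  · exact isIso_of_isZero_of_isZero
      ((lhsCoConvergence (tripleKernel H N) A).isZero 2 le_rfl p q (Or.inl hp))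
      ((prodConvergence H N A).isZero 2 le_rfl p q (Or.inl hp)) _
  · obtain ⟨p, rfl⟩ := Int.eq_ofNat_of_zero_le hp
    have := hCL.isIso_prLift (A := A) (q := q)
      (hq.imp (fun h => by omega) fun h => ⟨by omega, h.2⟩) p
    rw [(Iso.eq_comp_inv _).2 (prodPageTwoIso_naturality (H := H) (N := N) (A := A) p q)]
    infer_instance

end TriplePages

theorem mainTheorem2 {k : Type u} [CommRing k] {G Λ : Type u} [Group G] (H : Λ → Subgroup G)
    (N : ∀ l, Subgroup (H l)) [∀ l, (N l).Normal] (hCL : IsCohenLyndonTriple H N)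
    (A : Rep.{u} k G) :
    -- the isomorphisms on the (co)homology of `⟪N⟫`
    (∀ q : ℕ, (1 < q ∨ (q = 1 ∧ ∀ g ∈ tripleKernel H N, A.ρ g = 1)) →
      IsIso (tripleIndMap H N A q) ∧ IsIso (tripleCoindMap H N A q)) ∧
    -- the second pages of the homological spectral sequences, and the morphism on them
    (∃ (eE : ∀ p q : ℕ, ((sumSS H N A).page 2).X ((p : ℤ), (q : ℤ)) ≅
          ModuleCat.of k (⨁ l, groupHomology
            (homologyRep (N l) (Rep.res (H l).subtype A) q) p))
        (eF : ∀ p q : ℕ, ((lhsSS (tripleKernel H N) A).page 2).X ((p : ℤ), (q : ℤ)) ≅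
          groupHomology (homologyRep (tripleKernel H N) A q) p),
      ∀ p q : ℕ, ((tripleSSMap H N A).hom 2).f ((p : ℤ), (q : ℤ)) ≫ (eF p q).hom =
        (eE p q).hom ≫ dsDesc fun l =>
          groupHomology.map (tripleQuotientMap H N l) (tripleHomologyMap H N A l q) p) ∧
    -- their limits, and the morphism on them
    (∃ (cE : Convergence (sumSS H N A) fun n =>
          ModuleCat.of k (⨁ l, groupHomology (Rep.res (H l).subtype A) n))
        (cF : Convergence (lhsSS (tripleKernel H N) A) fun n => groupHomology A n),
      cE.Compatible cF (tripleSSMap H N A) fun n => dsDesc fun l =>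
        groupHomology.map (H l).subtype (𝟙 (Rep.res (H l).subtype A)) n) ∧
    -- the isomorphism on the second pages
    (∀ p q : ℤ, (1 < q ∨ (q = 1 ∧ ∀ g ∈ tripleKernel H N, A.ρ g = 1)) →
      IsIso (((tripleSSMap H N A).hom 2).f (p, q))) ∧
    -- naturality in the coefficients
    (∀ (B : Rep.{u} k G) (v : A ⟶ B), sumSSMap H N v ≫ tripleSSMap H N B =
      tripleSSMap H N A ≫ lhsSSCoeffMap (tripleKernel H N) v) ∧
    -- the same for cohomology
    (∃ (eE : ∀ p q : ℕ, ((prodSS H N A).page 2).X ((p : ℤ), (q : ℤ)) ≅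
          ModuleCat.of k (∀ l, groupCohomology
            (cohomologyRep (N l) (Rep.res (H l).subtype A) q) p))
        (eF : ∀ p q : ℕ, ((lhsCoSS (tripleKernel H N) A).page 2).X ((p : ℤ), (q : ℤ)) ≅
          groupCohomology (cohomologyRep (tripleKernel H N) A q) p),
      ∀ p q : ℕ, ((tripleCoSSMap H N A).hom 2).f ((p : ℤ), (q : ℤ)) ≫ (eE p q).hom =
        (eF p q).hom ≫ prLift fun l =>
          groupCohomology.map (tripleQuotientMap H N l) (tripleCohomologyMap H N A l q) p) ∧
    (∃ (cE : Convergence (prodSS H N A) fun n =>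
          ModuleCat.of k (∀ l, groupCohomology (Rep.res (H l).subtype A) n))
        (cF : Convergence (lhsCoSS (tripleKernel H N) A) fun n => groupCohomology A n),
      cF.Compatible cE (tripleCoSSMap H N A) fun n => prLift fun l =>
        groupCohomology.map (H l).subtype (𝟙 (Rep.res (H l).subtype A)) n) ∧
    (∀ p q : ℤ, (1 < q ∨ (q = 1 ∧ ∀ g ∈ tripleKernel H N, A.ρ g = 1)) →
      IsIso (((tripleCoSSMap H N A).hom 2).f (p, q))) ∧
    (∀ (B : Rep.{u} k G) (v : A ⟶ B), tripleCoSSMap H N A ≫ prodSSMap H N v =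
      lhsCoSSCoeffMap (tripleKernel H N) v ≫ tripleCoSSMap H N B) := by
  refine ⟨fun q hq => ⟨?_, ?_⟩, ⟨sumPageTwoIso, lhsPageTwoIso (tripleKernel H N) A,
      sumPageTwoIso_naturality⟩,
    ⟨sumConvergence H N A, lhsConvergence (tripleKernel H N) A,
      dsConvergence_compatible _ _ _ _ fun l => lhsConvergence_compatible (H l).subtype
        (le_comap_tripleKernel H N l) (𝟙 (Rep.res (H l).subtype A))⟩,
    hCL.isIso_tripleSSMap, fun B v => sumSSMap_comp_tripleSSMap v,
    ⟨prodPageTwoIso, lhsCoPageTwoIso (tripleKernel H N) A, prodPageTwoIso_naturality⟩,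
    ⟨prodConvergence H N A, lhsCoConvergence (tripleKernel H N) A,
      prConvergence_compatible _ _ _ _ fun l => lhsCoConvergence_compatible (H l).subtype
        (le_comap_tripleKernel H N l) (𝟙 (Rep.res (H l).subtype A))⟩,
    hCL.isIso_tripleCoSSMap, fun B v => tripleCoSSMap_comp_prodSSMap v⟩
  · obtain ⟨S, s, hs⟩ := hCL.isInducedSum hq
    exact hs.isIso_desc
  · obtain ⟨S, s, hs⟩ := hCL.isInducedProd hq
    exact hs.isIso_lift

end
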